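/- Let $m\ge 1$, $n\ge 0$, let $V\subset\mathbb R^m$ and $W\subset\mathbb R^n$ be open (for instance balls centred at the origin), and let $Z(x,t)=x+i\phi(x,t)$, where $\phi:\mathbb R^m\times W\to\mathbb R^m$ is smooth, vanishes for $x$ outside a fixed compact set, and satisfies $|\phi(x,t)-\phi(x',t)|\le\mu|x-x'|$ for all $x,x'\in\mathbb R^m$, $t\in W$, with some constant $\mu<1$. For $z,w\in\mathbb C^m$ write $z\cdot w=\sum_j z_jw_j$, $\langle z\rangle^2=z\cdot z$, and $\langle\zeta\rangle=(\langle\zeta\rangle^2)^{1/2}$ (main branch) when $|\Im\zeta|<|\Re\zeta|$. For $t\in W$ let $$\mathbb R\mathrm T'_{\mathfrak W_t}=\{(Z(x,t),\zeta): x\in\mathbb R^m,\ \zeta={}^tZ_x(x,t)^{-1}\xi,\ \xi\in\mathbb R^m\}$$ be the real structure bundle, and assume that there is $c>0$ such that $$\Im\Big\{\zeta\cdot(Z(x,t)-Z(x',t))+\tfrac i2\langle\zeta\rangle\langle Z(x,t)-Z(x',t)\rangle^2\Big\}\ge c\,|\zeta|\,|Z(x,t)-Z(x',t)|^2$$ for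 all $x,x'\in V$, $t\in W$ and all $\zeta$ in the fibre of $\mathbb R\mathrm T'_{\mathfrak W_t}$ over $Z(x,t)$ or over $Z(x',t)$. For $u\in C^\infty(W;\mathcal E'(V))$ define the FBI transform, the integral being understood as a duality bracket in $x'$, by $$\mathfrak F[u](t;z,\zeta)=\int_V e^{i\zeta\cdot(z-Z(x',t))-\langle\zeta\rangle\langle z-Z(x',t)\rangle^2}\,u(x',t)\,\Delta(z-Z(x',t),\zeta)\,\det Z_x(x',t)\,dx',$$ where $\Delta(z,\zeta)=\det\big(\mathrm{Id}+i(z_j\zeta_k)_{j,k}/\langle\zeta\rangle\big)$. Then for every $\epsilon>0$ the integral $$u_\epsilon(x,t)=\frac1{(2\pi^3)^{m/2}}\iint_{\mathbb R\mathrm T'_{\mathfrak W_t}}e^{i\zeta\cdot(Z(x,t)-z')-\langle\zeta\rangle\langle Z(x,t)-z'\rangle^2-\epsilon\langle\zeta\rangle^2}\,\mathfrak F[u](t;z',\zeta)\,\langle\zeta\rangle^{m/2}\,dz'\wedge d\zeta$$ (where $\mathbb R\mathrm T'_{\mathfrak W_t}$ is parametrized by $(x',\xi)\in\mathbb R^m\times\mathbb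 R^m$ through $z'=Z(x',t)$, $\zeta={}^tZ_x(x',t)^{-1}\xi$, so that $dz'\wedge d\zeta$ becomes $\det Z_x(x',t)\det({}^tZ_x(x',t)^{-1})\,dx'\,d\xi$) converges absolutely for all $(x,t)\in V\times W$, is continuous on $V\times W$ and defines an element of $C^\infty(W;\mathcal D'(V))$, and $$u_\epsilon\longrightarrow u\quad\text{in } C^\infty(W;\mathcal D'(V))\quad\text{as }\epsilon\to0^+ .$$ -/

import Mathlib

open Set Filter Topology MeasureTheory TopologicalSpace
open scoped ContDiff Matrix Distributions

noncomputable section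

namespace FBI

/-- The Euclidean space `ℝᵏ`. -/
abbrev RSpace (k : ℕ) : Type := EuclideanSpace ℝ (Fin k)

/-- The Hermitian space `ℂᵏ`. -/
abbrev CSpace (k : ℕ) : Type := EuclideanSpace ℂ (Fin k)

/-! ### The space `𝓔'(V)` of compactly supported distributions -/

/-- `C^∞(V)`. Functions are total; only their values on the open set `V` matter, because the
functionals below are bounded by derivatives at points of `V`. -/
def smoothFunctions {m : ℕ} (V : Opens (RSpace m)) : Submodule ℂ (RSpace m → ℂ) where
  carrier := {f | ContDiffOn ℝ ∞ f V}
  add_mem' hf hg := ContDiffOn.add hf hg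
  zero_mem' := contDiffOn_const
  smul_mem' c _ hf := ContDiffOn.const_smul c hf

/-- `𝓔'(V)`: the linear functionals on `C^∞(V)` that are continuous for the topology of uniform
convergence of all derivatives on the compact subsets of `V`. -/
structure CompactDistribution {m : ℕ} (V : Opens (RSpace m)) where
  toLinearMap : smoothFunctions V →ₗ[ℂ] ℂ
  bound : ∃ K : Set (RSpace m), IsCompact K ∧ K ⊆ V ∧ ∃ (q : ℕ) (C : ℝ),
    ∀ (f : smoothFunctions V) (M : ℝ), 0 ≤ M →
      (∀ j ≤ q, ∀ x ∈ K, ‖iteratedFDeriv ℝ j (f : RSpace m → ℂ) x‖ ≤ M) →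
        ‖toLinearMap f‖ ≤ C * M

namespace CompactDistribution

variable {m : ℕ} {V : Opens (RSpace m)}

open scoped Classical in
/-- The duality bracket `⟨u, f⟩` for `f ∈ C^∞(V)` (and `0` for functions `f` that are not smooth
on `V`). -/
def pair (u : CompactDistribution V) (f : RSpace m → ℂ) : ℂ :=
  if h : ContDiffOn ℝ ∞ f V then u.toLinearMap ⟨f, h⟩ else 0

lemma pair_of_smooth (u : CompactDistribution V) {f : RSpace m → ℂ} (h : ContDiffOn ℝ ∞ f V) :
    u.pair f = u.toLinearMap ⟨f, h⟩ := dif_pos h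

lemma contDiff_ofReal_test (χ : 𝓓(V, ℝ)) : ContDiff ℝ ∞ (fun x => (χ x : ℂ)) :=
  Complex.ofRealCLM.contDiff.comp χ.contDiff

/-- The inclusion `𝓔'(V) ⊆ 𝓓'(V)`: restriction of a functional to the test functions. -/
def toDistribution (u : CompactDistribution V) : 𝓓'(V, ℂ) :=
  ContinuousLinearMap.toUniformConvergenceCLM (RingHom.id ℝ) ℂ {S | IsCompact S}
    (TestFunction.mkCLM ℝ (fun χ : 𝓓(V, ℝ) => u.pair (fun x => (χ x : ℂ)))
      (fun f g => by
        rw [pair_of_smooth u (contDiff_ofReal_test f).contDiffOn,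
          pair_of_smooth u (contDiff_ofReal_test g).contDiffOn,
          pair_of_smooth u (contDiff_ofReal_test (f + g)).contDiffOn, ← map_add]
        congr 1
        ext x
        simp)
      (fun c f => by
        rw [pair_of_smooth u (contDiff_ofReal_test f).contDiffOn,
          pair_of_smooth u (contDiff_ofReal_test (c • f)).contDiffOn,
          ← Complex.coe_smul, ← map_smul]
        congr 1
        ext x
        simp)
      (fun K hK => by
        refine (ContDiffMapSupportedIn.mkCLMtoNormedSpace (𝕜 := ℝ) (K := K) (n := ⊤)
          (fun f => u.pair (fun x => ((TestFunction.ofSupportedIn hK f x : ℝ) : ℂ))) ?_ ?_ ?_).continuous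
        · intro f g
          rw [pair_of_smooth u (contDiff_ofReal_test _).contDiffOn,
            pair_of_smooth u (contDiff_ofReal_test _).contDiffOn,
            pair_of_smooth u (contDiff_ofReal_test _).contDiffOn, ← map_add]
          congr 1
          ext x
          simp
        · intro c f
          rw [pair_of_smooth u (contDiff_ofReal_test _).contDiffOn,
            pair_of_smooth u (contDiff_ofReal_test _).contDiffOn,
            ← Complex.coe_smul, ← map_smul]
          congr 1
          ext x
          simp
        · obtain ⟨L, -, -, q, C, hC⟩ := u.bound
          refine ⟨Finset.range (q + 1), |C|, abs_nonneg _, fun f => ?_⟩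
          rw [pair_of_smooth u (contDiff_ofReal_test _).contDiffOn]
          refine (hC _ _ (apply_nonneg _ f) fun j hj x _ => ?_).trans
            (mul_le_mul_of_nonneg_right (le_abs_self C) (apply_nonneg _ f))
          have h1 : ‖iteratedFDeriv ℝ j (fun x => (f x : ℂ)) x‖ = ‖iteratedFDeriv ℝ j f x‖ :=
            Complex.ofRealLI.norm_iteratedFDeriv_comp_left (n := ∞) (i := j)
              f.contDiff.contDiffAt (by exact_mod_cast le_top)
          refine h1.le.trans ((ContDiffMapSupportedIn.norm_iteratedFDeriv_apply_le_seminorm_top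
            ℝ).trans ?_)
          exact (Finset.le_sup (f := fun i => ContDiffMapSupportedIn.seminorm ℝ (RSpace m) ℝ ⊤ K i)
            (Finset.mem_range.2 (Nat.lt_succ_of_le hj))) f))

end CompactDistribution

/-- The distribution `χ ↦ ∫ χ(x) f(x) dx` on `V` defined by a function `f` that is locally
integrable on `V`. -/
def regularDistribution {m : ℕ} (V : Opens (RSpace m)) (f : RSpace m → ℂ) : 𝓓'(V, ℂ) :=
  ContinuousLinearMap.toUniformConvergenceCLM (RingHom.id ℝ) ℂ {S | IsCompact S}
    (TestFunction.integralAgainstBilinCLM (ContinuousLinearMap.lsmul ℝ ℝ : ℝ →L[ℝ] ℂ →L[ℝ] ℂ)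
      volume f)

/-! ### Smooth families of distributions -/

/-- `u ∈ C^∞(W; 𝓔'(V))`: all the functions `t ↦ ⟨u(t), f⟩`, `f ∈ C^∞(V)`, are smooth on `W`.
(For the strong dual topology one gets the same families, as `C^∞(V)` is a Fréchet-Montel
space.) -/
def IsSmoothCompactFamily {m n : ℕ} {V : Opens (RSpace m)} (W : Opens (RSpace n))
    (u : RSpace n → CompactDistribution V) : Prop :=
  ∀ f : smoothFunctions V, ContDiffOn ℝ ∞ (fun t => (u t).toLinearMap f) W

/-- `T ∈ C^∞(W; 𝓓'(V))`: all the functions `t ↦ ⟨T(t), χ⟩`, `χ ∈ C_c^∞(V)`, are smooth on `W`. -/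
def IsSmoothFamily {m n : ℕ} {V : Opens (RSpace m)} (W : Opens (RSpace n))
    (T : RSpace n → 𝓓'(V, ℂ)) : Prop :=
  ∀ χ : 𝓓(V, ℝ), ContDiffOn ℝ ∞ (fun t => T t χ) W

/-- Convergence `T_ε → T` in `C^∞(W; 𝓓'(V))` along a filter: every `t`-derivative converges,
uniformly for `t` in compact subsets of `W`, for the topology of `𝓓'(V)`, which is that of uniform
convergence on the compact sets (equivalently, as `C_c^∞(V)` is a Montel space, on the bounded sets)
of test functions. -/
def TendstoInSmoothFamilies {m n : ℕ} {V : Opens (RSpace m)} (W : Opens (RSpace n))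
    (T : ℝ → RSpace n → 𝓓'(V, ℂ)) (l : Filter ℝ) (T₀ : RSpace n → 𝓓'(V, ℂ)) : Prop :=
  ∀ (k : ℕ) (K : Set (RSpace n)), IsCompact K → K ⊆ W →
    ∀ B : Set 𝓓(V, ℝ), IsCompact B →
      TendstoUniformlyOn
        (fun (ε : ℝ) (p : RSpace n × 𝓓(V, ℝ)) => iteratedFDeriv ℝ k (fun t => T ε t p.2) p.1)
        (fun p => iteratedFDeriv ℝ k (fun t => T₀ t p.2) p.1) l (K ×ˢ B)

/-! ### Complex quadratic form, the map `Z`, and the real structure bundle -/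

/-- The bilinear product `z · w = z₁ w₁ + ⋯ + z_m w_m` on `ℂᵐ` (no conjugation). -/
def cdot {m : ℕ} (z w : CSpace m) : ℂ := ∑ j, z j * w j

/-- `⟨ζ⟩ = (ζ · ζ)^{1/2}`, with the main branch of the square root. -/
def bracket {m : ℕ} (ζ : CSpace m) : ℂ := (cdot ζ ζ) ^ (1 / 2 : ℂ)

section

variable {m n : ℕ} (φ : RSpace m → RSpace n → RSpace m)

/-- `Z(x,t) = x + i φ(x,t)`. -/
def Z (x : RSpace m) (t : RSpace n) : CSpace m :=
  WithLp.toLp 2 fun j => (x j : ℂ) + Complex.I * (φ x t j : ℂ)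

/-- The Jacobian matrix `Z_x(x,t) = (∂Z_j/∂x_k)_{j,k}`. -/
def Zx (x : RSpace m) (t : RSpace n) : Matrix (Fin m) (Fin m) ℂ :=
  Matrix.of fun j k => fderiv ℝ (fun y => Z φ y t j) x (EuclideanSpace.single k 1)

/-- The covector `ζ = ᵗZ_x(x,t)⁻¹ ξ`. -/
def covector (t : RSpace n) (x ξ : RSpace m) : CSpace m :=
  WithLp.toLp 2 (((Zx φ x t)ᵀ)⁻¹ *ᵥ fun j => (ξ j : ℂ))

/-- The fibre over `Z(x,t)` of the real structure bundle of the manifold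
`{Z(x,t) : x ∈ ℝᵐ}`, for fixed `t`. -/
def fibre (t : RSpace n) (x : RSpace m) : Set (CSpace m) := range (covector φ t x)

/-- The standing assumptions on `Z = x + iφ`: `φ` is smooth on `ℝᵐ × W`, vanishes for `x` outside
a compact set, is Lipschitz in `x` with a constant less than one, and the manifolds
`{Z(x,t) : x ∈ V}`, `t ∈ W`, are well positioned. -/
structure IsAdmissible (V : Opens (RSpace m)) (W : Opens (RSpace n)) : Prop where
  smooth : ContDiffOn ℝ ∞ (fun p : RSpace m × RSpace n => φ p.1 p.2) (univ ×ˢ (W : Set (RSpace n)))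
  compact_support : ∃ K : Set (RSpace m), IsCompact K ∧ ∀ x ∉ K, ∀ t ∈ W, φ x t = 0
  lipschitz : ∃ μ : ℝ, μ < 1 ∧ ∀ t ∈ W, ∀ x x' : RSpace m, ‖φ x t - φ x' t‖ ≤ μ * ‖x - x'‖
  well_positioned : ∃ c : ℝ, 0 < c ∧ ∀ t ∈ W, ∀ x ∈ V, ∀ x' ∈ V,
    ∀ ζ ∈ fibre φ t x ∪ fibre φ t x',
      c * ‖ζ‖ * ‖Z φ x t - Z φ x' t‖ ^ 2 ≤
        (cdot ζ (Z φ x t - Z φ x' t) + Complex.I * (1 / 2) * bracket ζ *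
          cdot (Z φ x t - Z φ x' t) (Z φ x t - Z φ x' t)).im

/-! ### The FBI transform and the inversion integral -/

/-- `Δ(z,ζ) = det(Id + i (z ⊙ ζ)/⟨ζ⟩)`, where `z ⊙ ζ = (z_i ζ_j)_{i,j}`. -/
def fbiDelta (z ζ : CSpace m) : ℂ :=
  (1 + (Complex.I / bracket ζ) • Matrix.vecMulVec z ζ : Matrix (Fin m) (Fin m) ℂ).det

/-- The FBI transform: `u(·,t)` applied to
`x' ↦ e^{iζ·(z - Z(x',t)) - ⟨ζ⟩⟨z - Z(x',t)⟩²} Δ(z - Z(x',t), ζ) det Z_x(x',t)`; the last factor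
comes from `dZ₁ ∧ ⋯ ∧ dZ_m = det Z_x dx`. -/
def fbi {V : Opens (RSpace m)} (u : RSpace n → CompactDistribution V) (t : RSpace n)
    (z ζ : CSpace m) : ℂ :=
  (u t).pair fun x' =>
    Complex.exp (Complex.I * cdot ζ (z - Z φ x' t)
      - bracket ζ * cdot (z - Z φ x' t) (z - Z φ x' t))
      * fbiDelta (z - Z φ x' t) ζ * (Zx φ x' t).det

/-- The integrand of the inversion formula at a point `(z',ζ)` of `ℂᵐ × ℂᵐ`. -/
def inversionKernel {V : Opens (RSpace m)} (u : RSpace n → CompactDistribution V) (ε : ℝ)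
    (x : RSpace m) (t : RSpace n) (z' ζ : CSpace m) : ℂ :=
  Complex.exp (Complex.I * cdot ζ (Z φ x t - z')
      - bracket ζ * cdot (Z φ x t - z') (Z φ x t - z') - ε * cdot ζ ζ)
    * fbi φ u t z' ζ * bracket ζ ^ ((m : ℂ) / 2)

/-- The pull-back of the form `(integrand) dz' ∧ dζ` under the parametrization
`(x',ξ) ↦ (Z(x',t), ᵗZ_x(x',t)⁻¹ ξ)` of the real structure bundle by `ℝᵐ × ℝᵐ`. As `z'` does not
depend on `ξ`, the form `dz' ∧ dζ` becomes `det(Z_x) det(ᵗZ_x⁻¹) dx' dξ`. -/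
def inversionIntegrand {V : Opens (RSpace m)} (u : RSpace n → CompactDistribution V) (ε : ℝ)
    (x : RSpace m) (t : RSpace n) (p : RSpace m × RSpace m) : ℂ :=
  inversionKernel φ u ε x t (Z φ p.1 t) (covector φ t p.1 p.2)
    * ((Zx φ p.1 t).det * (((Zx φ p.1 t)ᵀ)⁻¹).det)

/-- The regularized inversion integral: `(2π³)^{-m/2}` times the integral over the real structure
bundle. -/
def inversionIntegral {V : Opens (RSpace m)} (u : RSpace n → CompactDistribution V) (ε : ℝ)
    (x : RSpace m) (t : RSpace n) : ℂ :=
  (((2 * Real.pi ^ 3) ^ ((m : ℝ) / 2) : ℝ) : ℂ)⁻¹ * ∫ p, inversionIntegrand φ u ε x t p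

end

end FBI

end

noncomputable section

namespace FBI

/-! ### Holomorphic functions of several variables -/

section Holomorphic

variable {E F : Type*} [NormedAddCommGroup E] [NormedSpace ℂ E] [NormedAddCommGroup F]
  [NormedSpace ℂ F]

/-! Reduction to a kernel. Put a = Z(x,t) and b = Z(y,t). Once the outer factors are moved inside
the bracket, u_ε(x,t) is u(t), acting in y, applied to an integral over the real structure bundle of
a function that is entire in b. The bracket and the integral may be exchanged
(`CompactDistribution.pair_integral`). On each fibre ζ is deformed to real ξ, which produces the
factor det Z_x. Completing the square shows that z' enters only through z' − (a+b)/2, so the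
z'-integral is a Gaussian integral over a totally real manifold: the term of Δ linear in z' −
(a+b)/2 drops out and the power of |ξ| is cancelled. What remains is `kern` at a − b
(`IsAdmissible.integral_invKernel`), so that u_ε(x,t) is the bracket of u(t) with k_ε(Z(x,t) −
Z(y,t)) det Z_x(y,t) (`IsAdmissible.inversionIntegral_eq`).

Approximate identity. The factor 1 + iξ·w/(2|ξ|) left over from Δ is exactly the one for which
integration by parts in the direction w turns the integral k_ε(w) into ε/(w·w) times a convergent
integral. The Gaussian kernel has the same representation without the term w·w|ξ|/2 in the exponent.
Close to the diagonal, a contour on which e^{iζ·w} decays like e^{−κ|p||r|}, with r = Re w, bounds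
the difference of the two kernels by ε^{1/4}|r|^{1/2−m}, which is locally integrable. Away from the
diagonal the contour is a fibre of the bundle, where the positivity hypothesis gives exponential
decay and the bound O(ε). The Gaussian has integral one against dZ and first moment O(√ε). Hence the
integral of a(x) k_ε(Z(x,t) − Z(y,t)) dx tends to a(y)/det Z_x(y,t) with rate ε^{1/4}
(`IsAdmissible.exists_norm_integral_kern_sub_le`).

Derivatives. Estimating derivatives of k_ε directly would lose powers of ε. Instead, since k_ε is
holomorphic and the vectors ∂Z/∂x_j span ℂᵐ, a derivative in (y,t) of k_ε(Z(x,t) − Z(y,t)) is a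
combination of x-derivatives, and integration by parts moves these to the coefficient. The integrals
with smooth coefficients thus form a class closed under differentiation, and for such a class
uniform convergence of every member already implies convergence of all derivatives
(`tendstoUniformlyOn_iteratedFDeriv_of_class`).

Pairing with u. A smooth family of compactly supported distributions is locally of uniformly bounded
order and support, by a uniform boundedness principle. This justifies the product rule for brackets
⟨u(t), f(·,t)⟩, and the same abstract theorem then gives convergence of all t-derivatives of the
brackets. Uniformity over a compact set of test functions follows from a common support and common
bounds for each derivative. -/

lemma norm_fderiv_le_of_norm_le {f : E → F} {c : E} {R M : ℝ} (hR : 0 < R)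
    (hf : DifferentiableOn ℂ f (Metric.ball c R)) (hM : ∀ x ∈ Metric.ball c R, ‖f x‖ ≤ M) :
    ‖fderiv ℂ f c‖ ≤ 2 * M / R := by
  have hM0 : 0 ≤ M := (norm_nonneg _).trans (hM c (Metric.mem_ball_self hR))
  refine ContinuousLinearMap.opNorm_le_bound _ (by positivity) fun v => ?_
  rcases eq_or_ne v 0 with rfl | hv
  · simp
  have hv' : 0 < ‖v‖ := norm_pos_iff.2 hv
  -- Half of the largest radius for which the complex line stays in the ball, so that the closed
  -- disc does too; Cauchy's estimate with this radius gives the factor 2.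
  set ρ : ℝ := R / (2 * ‖v‖) with hρ
  have hρ0 : 0 < ρ := by positivity
  have hmem : ∀ s ∈ Metric.closedBall (0 : ℂ) ρ, c + s • v ∈ Metric.ball c R := by
    intro s hs
    rw [mem_closedBall_zero_iff] at hs
    rw [Metric.mem_ball, dist_eq_norm, add_sub_cancel_left, norm_smul]
    calc ‖s‖ * ‖v‖ ≤ ρ * ‖v‖ := by gcongr
      _ = R / 2 := by rw [hρ]; field_simp
      _ < R := by linarith
  have hd : DifferentiableAt ℂ f c :=
    hf.differentiableAt (Metric.ball_mem_nhds c hR)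
  have hline : HasDerivAt (fun s : ℂ => c + s • v) v 0 := by
    simpa using ((hasDerivAt_id (0 : ℂ)).smul_const v).const_add c
  have hder : HasDerivAt (fun s : ℂ => f (c + s • v)) (fderiv ℂ f c v) 0 := by
    have h0 : HasFDerivAt f (fderiv ℂ f c) (c + (0 : ℂ) • v) := by simpa using hd.hasFDerivAt
    exact h0.comp_hasDerivAt 0 hline
  have hdiff : DifferentiableOn ℂ (fun s : ℂ => f (c + s • v)) (Metric.closedBall 0 ρ) := by
    intro s hs
    have h1 : DifferentiableAt ℂ f (c + s • v) :=
      hf.differentiableAt (Metric.isOpen_ball.mem_nhds (hmem s hs))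
    exact (h1.comp s (by fun_prop)).differentiableWithinAt
  have hcl : DiffContOnCl ℂ (fun s : ℂ => f (c + s • v)) (Metric.ball 0 ρ) :=
    (hdiff.mono (closure_ball (0 : ℂ) hρ0.ne').subset).diffContOnCl
  have key := Complex.norm_deriv_le_of_forall_mem_sphere_norm_le hρ0 hcl
    (fun s hs => hM _ (hmem s (Metric.sphere_subset_closedBall hs)))
  rw [hder.deriv] at key
  refine key.trans (le_of_eq ?_)
  rw [hρ]; field_simp

/-- In each direction the derivative is an almost everywhere limit of difference quotients along a
fixed sequence of steps, and in finite dimension the full derivative is a finite combination of its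
values on a basis. Joint measurability is not needed. -/
lemma aestronglyMeasurable_fderiv_param [FiniteDimensional ℂ E] {α : Type*} [MeasurableSpace α]
    {μ : Measure α} {h : E → α → F} {x₀ : E} {R : ℝ} (hR : 0 < R)
    (hm : ∀ x ∈ Metric.ball x₀ R, AEStronglyMeasurable (h x) μ)
    (hd : ∀ᵐ a ∂μ, DifferentiableAt ℂ (fun x => h x a) x₀) :
    AEStronglyMeasurable (fun a => fderiv ℂ (fun x => h x a) x₀) μ := by
  let b := Module.finBasis ℂ E
  have hcoord : ∀ v : E, AEStronglyMeasurable (fun a => fderiv ℂ (fun x => h x a) x₀ v) μ := by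
    intro v
    set δ : ℝ := R / (‖v‖ + 1) with hδ
    have hδ0 : 0 < δ := by positivity
    let s : ℕ → ℂ := fun n => ((δ / (n + 1) : ℝ) : ℂ)
    have hspos : ∀ n : ℕ, 0 < δ / ((n : ℝ) + 1) := fun n => by positivity
    have hs0 : Tendsto s atTop (𝓝[≠] 0) := by
      refine tendsto_nhdsWithin_iff.2 ⟨?_, Eventually.of_forall fun n => ?_⟩
      · have : Tendsto (fun n : ℕ => δ / ((n : ℝ) + 1)) atTop (𝓝 0) :=
          by simpa using (tendsto_one_div_add_atTop_nhds_zero_nat (𝕜 := ℝ)).const_mul δ |>.congr fun n => by ring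
        have h2 := (Complex.continuous_ofReal.tendsto 0).comp this
        rw [Complex.ofReal_zero] at h2
        exact h2
      · simp only [s, mem_compl_iff, mem_singleton_iff, Complex.ofReal_eq_zero]
        exact (hspos n).ne'
    refine aestronglyMeasurable_of_tendsto_ae (u := atTop)
      (f := fun (n : ℕ) a => (s n)⁻¹ • (h (x₀ + s n • v) a - h x₀ a)) (fun n => ?_) ?_
    · refine ((hm _ ?_).sub (hm _ (Metric.mem_ball_self hR))).const_smul _
      rw [Metric.mem_ball, dist_eq_norm, add_sub_cancel_left, norm_smul]
      have h1 : ‖s n‖ ≤ δ := by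
        simp only [s, Complex.norm_real, Real.norm_eq_abs, abs_of_pos (hspos n)]
        exact div_le_self hδ0.le (by have : (0 : ℝ) ≤ n := n.cast_nonneg
                                     linarith)
      calc ‖s n‖ * ‖v‖ ≤ δ * ‖v‖ := by gcongr
        _ < δ * (‖v‖ + 1) := by gcongr; linarith
        _ = R := by rw [hδ]; field_simp
    · filter_upwards [hd] with a ha
      have hder : HasDerivAt (fun t : ℂ => h (x₀ + t • v) a) (fderiv ℂ (fun x => h x a) x₀ v) 0 := by
        have h0 : HasFDerivAt (fun x => h x a) (fderiv ℂ (fun x => h x a) x₀) (x₀ + (0 : ℂ) • v) := by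
          simpa using ha.hasFDerivAt
        have hline : HasDerivAt (fun t : ℂ => x₀ + t • v) v 0 := by
          simpa using ((hasDerivAt_id (0 : ℂ)).smul_const v).const_add x₀
        exact h0.comp_hasDerivAt 0 hline
      have := (hasDerivAt_iff_tendsto_slope_zero.1 hder).comp hs0
      simpa [Function.comp_def] using this
  have heq : ∀ L : E →L[ℂ] F, L = ∑ i, ContinuousLinearMap.smulRightL ℂ E F
      (LinearMap.toContinuousLinearMap (b.coord i)) (L (b i)) := by
    intro L
    ext x
    conv_lhs => rw [← b.sum_repr x]
    rw [map_sum]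
    simp
  have : (fun a => fderiv ℂ (fun x => h x a) x₀) = fun a => ∑ i,
      ContinuousLinearMap.smulRightL ℂ E F (LinearMap.toContinuousLinearMap (b.coord i))
        (fderiv ℂ (fun x => h x a) x₀ (b i)) := by
    funext a; exact heq _
  rw [this]
  exact Finset.aestronglyMeasurable_fun_sum _ fun i _ =>
    (ContinuousLinearMap.continuous _).comp_aestronglyMeasurable (hcoord _)

/-- Integrals of dominated families of holomorphic functions are holomorphic. -/
lemma differentiableOn_integral_of_dominated [FiniteDimensional ℂ E] [NormedSpace ℝ F] {α : Type*}
    [MeasurableSpace α] {μ : Measure α} {h : E → α → F} {D : Set E} (hD : IsOpen D)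
    (hm : ∀ x ∈ D, AEStronglyMeasurable (h x) μ)
    (hd : ∀ᵐ a ∂μ, DifferentiableOn ℂ (fun x => h x a) D)
    (hb : ∀ x ∈ D, ∃ U ∈ 𝓝 x, ∃ bound : α → ℝ, Integrable bound μ ∧
      ∀ᵐ a ∂μ, ∀ y ∈ U, ‖h y a‖ ≤ bound a) :
    DifferentiableOn ℂ (fun x => ∫ a, h x a ∂μ) D := by
  intro x₀ hx₀
  obtain ⟨U, hU, bound, hbi, hbd⟩ := hb x₀ hx₀
  obtain ⟨R, hR, hRU⟩ := Metric.mem_nhds_iff.1 (inter_mem hU (hD.mem_nhds hx₀))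
  have hhalf : ∀ x ∈ Metric.ball x₀ (R / 2), Metric.ball x (R / 2) ⊆ Metric.ball x₀ R := by
    intro x hx
    refine Metric.ball_subset_ball' ?_
    rw [Metric.mem_ball] at hx
    linarith
  -- Cauchy's estimate on balls of radius R/2 turns a local majorant of the functions into one of
  -- their derivatives, so no bound on derivatives has to be assumed.
  refine (hasFDerivAt_integral_of_dominated_of_fderiv_le (𝕜 := ℂ)
    (F' := fun x a => fderiv ℂ (fun x => h x a) x) (bound := fun a => 2 * bound a / (R / 2))
    (Metric.ball_mem_nhds x₀ (half_pos hR)) ?_ ?_ ?_ ?_ ?_ ?_).differentiableAt.differentiableWithinAt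
  · filter_upwards [hD.mem_nhds hx₀] with x hx using hm x hx
  · refine hbi.mono' (hm x₀ hx₀) ?_
    filter_upwards [hbd] with a ha using ha x₀ (mem_of_mem_nhds hU)
  · refine aestronglyMeasurable_fderiv_param hR (fun x hx => hm x (hRU hx).2) ?_
    filter_upwards [hd] with a ha using ha.differentiableAt (hD.mem_nhds hx₀)
  · filter_upwards [hd, hbd] with a ha hba x hx
    refine norm_fderiv_le_of_norm_le (half_pos hR)
      (ha.mono fun y hy => (hRU (hhalf x hx hy)).2) fun y hy => hba y (hRU (hhalf x hx hy)).1
  · exact (hbi.const_mul 2).div_const _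
  · filter_upwards [hd] with a ha x hx
    exact (ha.differentiableAt (hD.mem_nhds
      (hRU (hhalf x hx (Metric.mem_ball_self (half_pos hR)))).2)).hasFDerivAt


lemma differentiable_integral_of_dominated [FiniteDimensional ℂ E] [NormedSpace ℝ F] {α : Type*}
    [MeasurableSpace α] {μ : Measure α} {h : E → α → F}
    (hm : ∀ x, AEStronglyMeasurable (h x) μ)
    (hd : ∀ᵐ a ∂μ, Differentiable ℂ (fun x => h x a))
    (hb : ∀ x, ∃ U ∈ 𝓝 x, ∃ bound : α → ℝ, Integrable bound μ ∧
      ∀ᵐ a ∂μ, ∀ y ∈ U, ‖h y a‖ ≤ bound a) :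
    Differentiable ℂ (fun x => ∫ a, h x a ∂μ) := by
  rw [← differentiableOn_univ]
  exact differentiableOn_integral_of_dominated isOpen_univ (fun x _ => hm x)
    (hd.mono fun a ha => ha.differentiableOn) fun x _ => hb x

/-- Cauchy's formula on the complex line through b writes the directional derivative as a circle
integral of translates of f, which is again an integral of a dominated family of entire functions of
b. -/
lemma differentiable_fderiv_apply [FiniteDimensional ℂ E] [CompleteSpace F] {f : E → F}
    (hf : Differentiable ℂ f) (v : E) : Differentiable ℂ (fun b => fderiv ℂ f b v) := by
  have hform : ∀ b, fderiv ℂ f b v = (2 * Real.pi * Complex.I : ℂ)⁻¹ •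
      ∮ s in C(0, 1), (1 / s ^ 2 : ℂ) • f (b + s • v) := by
    intro b
    have hline : HasDerivAt (fun t : ℂ => b + t • v) v 0 := by
      simpa using ((hasDerivAt_id (0 : ℂ)).smul_const v).const_add b
    have h0 : HasFDerivAt f (fderiv ℂ f b) (b + (0 : ℂ) • v) := by
      simpa using (hf b).hasFDerivAt
    rw [← (h0.comp_hasDerivAt 0 hline).deriv]
    have hdc : DiffContOnCl ℂ (fun s : ℂ => f (b + s • v)) (Metric.ball 0 1) :=
      (hf.comp (by fun_prop : Differentiable ℂ (fun s : ℂ => b + s • v))).diffContOnCl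
    have := hdc.deriv_eq_smul_circleIntegral (c := 0) one_pos
    rw [show (fun t : ℂ => f (b + t • v)) = f ∘ fun t => b + t • v from rfl] at this
    rw [eq_inv_smul_iff₀ (by simp [Real.pi_ne_zero]), ← this]
    simp
  rw [funext hform]
  refine Differentiable.const_smul ?_ _
  simp only [circleIntegral, intervalIntegral.integral_of_le Real.two_pi_pos.le]
  have hcont : ∀ b : E, Continuous fun θ : ℝ => deriv (circleMap 0 1) θ •
      (1 / circleMap 0 1 θ ^ 2 : ℂ) • f (b + circleMap 0 1 θ • v) := by
    intro b
    have := hf.continuous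
    have h1 : ∀ θ : ℝ, circleMap 0 1 θ ^ 2 ≠ 0 := fun θ => by
      simp [circleMap]
    have h2 : Continuous fun θ : ℝ => deriv (circleMap 0 1) θ := by
      simp only [deriv_circleMap]; fun_prop
    have h3 : Continuous fun θ : ℝ => (1 / circleMap 0 1 θ ^ 2 : ℂ) :=
      continuous_const.div (by fun_prop) h1
    fun_prop
  refine differentiable_integral_of_dominated (fun b => (hcont b).aestronglyMeasurable)
    (Eventually.of_forall fun θ => ?_) fun b => ?_
  · fun_prop
  · obtain ⟨C, hC⟩ := (isCompact_closedBall b (1 + ‖v‖)).exists_bound_of_continuousOn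
      hf.continuous.continuousOn
    refine ⟨_, Metric.ball_mem_nhds b one_pos, fun _ => C, ?_, Eventually.of_forall fun θ y hy => ?_⟩
    · exact integrable_const C
    · have h1 : ‖circleMap 0 1 θ‖ = 1 := by simp
      rw [norm_smul, norm_smul, deriv_circleMap, norm_mul, norm_div, norm_pow, h1]
      simp only [norm_one, Complex.norm_I, one_pow, div_one, mul_one, one_mul]
      refine hC _ ?_
      rw [Metric.mem_closedBall, dist_eq_norm]
      rw [Metric.mem_ball, dist_eq_norm] at hy
      calc ‖y + circleMap 0 1 θ • v - b‖ = ‖(y - b) + circleMap 0 1 θ • v‖ := by congr 1; abel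
        _ ≤ ‖y - b‖ + ‖circleMap 0 1 θ • v‖ := norm_add_le _ _
        _ ≤ 1 + ‖v‖ := by rw [norm_smul, h1, one_mul]; gcongr

/-- Entire functions of several variables are smooth. -/
lemma _root_.Differentiable.contDiff_of_finiteDimensional [FiniteDimensional ℂ E] [CompleteSpace F]
    {f : E → F} (hf : Differentiable ℂ f) : ContDiff ℂ ∞ f := by
  have : ∀ n : ℕ, ∀ f : E → F, Differentiable ℂ f → ContDiff ℂ n f := by
    intro n
    induction n with
    | zero => intro f hf; exact contDiff_zero.2 hf.continuous
    | succ n ih =>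
      intro f hf
      rw [Nat.cast_succ, contDiff_succ_iff_fderiv_apply]
      refine ⟨hf, by simp, fun v => ih _ (differentiable_fderiv_apply hf v)⟩
  exact contDiff_infty.2 fun n => this n f hf

end Holomorphic

/-- Cauchy estimates for the iterated real derivatives of an entire function. -/
lemma norm_iteratedFDeriv_le_of_norm_le {E : Type} [NormedAddCommGroup E] [NormedSpace ℂ E]
    [FiniteDimensional ℂ E] (j : ℕ) :
    ∀ {F : Type} [NormedAddCommGroup F] [NormedSpace ℂ F] [CompleteSpace F] {f : E → F} {c : E}
      {M : ℝ}, Differentiable ℂ f → (∀ x ∈ Metric.ball c (j + 1), ‖f x‖ ≤ M) →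
    ‖iteratedFDeriv ℝ j f c‖ ≤ 2 ^ j * M := by
  induction j with
  | zero =>
    intro F _ _ _ f c M hf hM
    rw [norm_iteratedFDeriv_zero, pow_zero, one_mul]
    exact hM c (Metric.mem_ball_self (by positivity))
  | succ j ih =>
    intro F _ _ _ f c M hf hM
    have hd : ContDiff ℂ ∞ (fderiv ℂ f) :=
      hf.contDiff_of_finiteDimensional.fderiv_right (by simp)
    have h1 : fderiv ℝ f = (ContinuousLinearMap.restrictScalarsIsometry ℂ E F ℝ ℝ) ∘ fderiv ℂ f := by
      funext x
      exact ((hf x).hasFDerivAt.restrictScalars ℝ).fderiv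
    -- Each differentiation costs one unit of radius and a factor 2. The induction runs on the
    -- complex derivative; restriction of scalars is isometric and hence does not change the norms.
    have h2 : ∀ x ∈ Metric.ball c (j + 1), ‖fderiv ℂ f x‖ ≤ 2 * M := by
      intro x hx
      have := norm_fderiv_le_of_norm_le (M := M) one_pos (hf.differentiableOn (s := Metric.ball x 1))
        fun y hy => hM y (Metric.ball_subset_ball' (by
          rw [Metric.mem_ball] at hx; push_cast; linarith) hy)
      simpa using this
    have h3 := ih (hd.differentiable (by simp)) h2
    rw [← norm_iteratedFDeriv_fderiv, h1]
    have h4 : ContDiff ℝ ∞ (fderiv ℂ f) := hd.restrict_scalars ℝ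
    rw [LinearIsometry.norm_iteratedFDeriv_comp_left _ (n := ∞) h4.contDiffAt (by exact_mod_cast le_top)]
    refine h3.trans (le_of_eq ?_)
    ring

end FBI
end

noncomputable section

namespace FBI

/-! ### Deformation of contours in `ℂᵐ` -/

section Contour

variable {m : ℕ}

/-- The inclusion `ℝᵐ ⊆ ℂᵐ`. -/
def toC : RSpace m →ₗᵢ[ℝ] CSpace m where
  toFun x := WithLp.toLp 2 fun j => (x j : ℂ)
  map_add' x y := by ext j; simp
  map_smul' c x := by ext j; simp
  norm_map' x := by simp [EuclideanSpace.norm_eq]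

@[simp] lemma toC_apply (x : RSpace m) (j : Fin m) : toC x j = x j := rfl

/-- The Jacobian matrix of `g`, as a complex matrix. -/
def jacC (g : RSpace m → RSpace m) (p : RSpace m) : Matrix (Fin m) (Fin m) ℂ :=
  Matrix.of fun j k => ((fderiv ℝ g p (EuclideanSpace.single k 1) j : ℝ) : ℂ)

lemma norm_jacC_le {g : RSpace m → RSpace m} {K : NNReal} (hg : LipschitzWith K g) (p : RSpace m)
    (j k : Fin m) : ‖jacC g p j k‖ ≤ K := by
  simp only [jacC, Matrix.of_apply, Complex.norm_real]
  calc ‖fderiv ℝ g p (EuclideanSpace.single k 1) j‖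
      ≤ ‖fderiv ℝ g p (EuclideanSpace.single k 1)‖ := PiLp.norm_apply_le _ _
    _ ≤ ‖fderiv ℝ g p‖ * ‖EuclideanSpace.single k (1 : ℝ)‖ := ContinuousLinearMap.le_opNorm _ _
    _ ≤ K * 1 := by
        gcongr
        · exact norm_fderiv_le_of_lipschitz ℝ hg
        · simp
    _ = K := mul_one _

/-- Continuity on a compact set of pairs (τ, N). The constant depends only on the size of the
entries, so the Jacobian factors of all the contours below are bounded uniformly. -/
lemma exists_norm_det_le (m : ℕ) (R K : ℝ) : ∃ C : ℝ, 0 ≤ C ∧ ∀ τ : ℂ, ‖τ‖ ≤ R →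
    ∀ N : Matrix (Fin m) (Fin m) ℂ, (∀ j k, ‖N j k‖ ≤ K) → ‖(1 + τ • N).det‖ ≤ C := by
  have hc : IsCompact ((Metric.closedBall (0 : ℂ) R) ×ˢ
      (Set.univ.pi fun _ => Set.univ.pi fun _ => Metric.closedBall (0 : ℂ) K :
        Set (Fin m → Fin m → ℂ))) :=
    (isCompact_closedBall _ _).prod
      (isCompact_univ_pi fun _ => isCompact_univ_pi fun _ => isCompact_closedBall _ _)
  have hcont : Continuous fun q : ℂ × (Fin m → Fin m → ℂ) =>
      (1 + q.1 • (Matrix.of q.2 : Matrix (Fin m) (Fin m) ℂ)).det := by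
    refine Continuous.matrix_det ?_
    exact continuous_const.add (continuous_fst.smul continuous_snd)
  obtain ⟨C, hC⟩ := hc.exists_bound_of_continuousOn hcont.continuousOn
  refine ⟨max C 0, le_max_right _ _, fun τ hτ N hN => (hC (τ, N) ⟨?_, ?_⟩).trans (le_max_left _ _)⟩
  · simpa using hτ
  · intro j _ k _
    simpa using hN j k

lemma det_id_add_smul (L : RSpace m →L[ℝ] RSpace m) (τ : ℝ) :
    (((ContinuousLinearMap.id ℝ (RSpace m) + τ • L).det : ℝ) : ℂ) =
      (1 + (τ : ℂ) • (Matrix.of fun j k => ((L (EuclideanSpace.single k 1) j : ℝ) : ℂ) :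
        Matrix (Fin m) (Fin m) ℂ)).det := by
  let b := (EuclideanSpace.basisFun (Fin m) ℝ).toBasis
  have h1 : (ContinuousLinearMap.id ℝ (RSpace m) + τ • L).det =
      (1 + τ • (Matrix.of fun j k => L (EuclideanSpace.single k 1) j)).det := by
    rw [ContinuousLinearMap.det, ← LinearMap.det_toMatrix b]
    congr 1
    ext j k
    simp [LinearMap.toMatrix_apply, b, Matrix.one_apply]
  rw [h1]
  have h2 := RingHom.map_det Complex.ofRealHom
    (1 + τ • (Matrix.of fun j k => L (EuclideanSpace.single k 1) j) : Matrix (Fin m) (Fin m) ℝ)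
  rw [Complex.ofRealHom_eq_coe] at h2
  rw [h2]
  congr 1
  ext j k
  simp [Matrix.one_apply]
  split_ifs <;> simp

/-- The determinant is continuous and equals 1 at the identity. Positivity removes the absolute
value in the change of variables, which would otherwise spoil holomorphy in τ. -/
lemma exists_det_pos (m : ℕ) (K : ℝ) : ∃ δ : ℝ, 0 < δ ∧ ∀ τ : ℝ, |τ| < δ →
    ∀ L : RSpace m →L[ℝ] RSpace m, ‖L‖ ≤ K →
      0 < (ContinuousLinearMap.id ℝ (RSpace m) + τ • L).det := by
  have hcont : Continuous fun L : RSpace m →L[ℝ] RSpace m =>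
      (ContinuousLinearMap.id ℝ (RSpace m) + L).det :=
    ContinuousLinearMap.continuous_det.comp (continuous_const.add continuous_id)
  have h0 : 0 < (ContinuousLinearMap.id ℝ (RSpace m) + 0).det := by
    simp [ContinuousLinearMap.det]
  obtain ⟨δ, hδ, h⟩ := Metric.eventually_nhds_iff_ball.1 (hcont.continuousAt.eventually (lt_mem_nhds h0))
  refine ⟨δ / (|K| + 1), by positivity, fun τ hτ L hL => h _ ?_⟩
  rw [mem_ball_zero_iff, norm_smul, Real.norm_eq_abs]
  calc |τ| * ‖L‖ ≤ |τ| * |K| := by gcongr; exact hL.trans (le_abs_self K)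
    _ ≤ |τ| * (|K| + 1) := by gcongr; linarith
    _ < δ / (|K| + 1) * (|K| + 1) := by gcongr
    _ = δ := by field_simp

/-- A small Lipschitz perturbation of the identity: solving p + τ g(p) = y is a fixed point problem
for the contraction p ↦ y − τ g(p). -/
lemma bijective_add_smul {g : RSpace m → RSpace m} {K : NNReal} (hg : LipschitzWith K g) {τ : ℝ}
    (hτ : |τ| * K < 1) : Function.Bijective fun p => p + τ • g p := by
  have hL : LipschitzWith (‖τ‖₊ * K) (fun p => τ • g p) := by
    exact (lipschitzWith_smul τ).comp hg
  have hlt : ‖τ‖₊ * K < 1 := by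
    rw [← NNReal.coe_lt_coe]; simpa using hτ
  constructor
  · intro p q hpq
    have h1 : ‖p - q‖ ≤ (|τ| * K) * ‖p - q‖ := by
      have h2 := hL.dist_le_mul q p
      rw [dist_eq_norm, dist_eq_norm] at h2
      have h3 : τ • g q - τ • g p = p - q := by
        have : p + τ • g p = q + τ • g q := hpq
        rw [sub_eq_sub_iff_add_eq_add, add_comm, ← this, add_comm]
      rw [h3, norm_sub_rev q p] at h2
      simpa using h2
    by_contra hne
    have : 0 < ‖p - q‖ := norm_pos_iff.2 (sub_ne_zero.2 hne)
    nlinarith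
  · intro y
    have hL' : LipschitzWith (‖τ‖₊ * K) (fun p => y - τ • g p) := by
      refine LipschitzWith.of_dist_le_mul fun p q => ?_
      rw [dist_sub_left]
      exact hL.dist_le_mul p q
    have hc : ContractingWith (‖τ‖₊ * K) (fun p => y - τ • g p) := ⟨hlt, hL'⟩
    refine ⟨hc.fixedPoint, ?_⟩
    have := hc.fixedPoint_isFixedPt
    have h2 : y - τ • g hc.fixedPoint = hc.fixedPoint := this
    change hc.fixedPoint + τ • g hc.fixedPoint = y
    rw [← eq_sub_iff_add_eq]; exact h2.symm

/-- Deformation of the contour `ℝᵐ` into `{p + i g(p)}`. -/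
theorem integral_contour_shift (hm : 0 < m) {g : RSpace m → RSpace m} {K : NNReal} (hg : LipschitzWith K g)
    {s : Set (RSpace m)} (hs : sᶜ.Countable) (hgd : ∀ p ∈ s, DifferentiableAt ℝ g p)
    {F : CSpace m → ℂ} {U : Set (CSpace m)} (hF : DifferentiableOn ℂ F U)
    {D : Set ℂ} (hD : IsOpen D) (hDc : IsPreconnected D) (h0 : 0 ∈ D) (hI : Complex.I ∈ D)
    {R : ℝ} (hDR : ∀ τ ∈ D, ‖τ‖ ≤ R)
    (hmem : ∀ τ ∈ D, ∀ p ∈ s, toC p + τ • toC (g p) ∈ U)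
    {bound : RSpace m → ℝ} (hbi : Integrable bound)
    (hb : ∀ τ ∈ D, ∀ p ∈ s, ‖F (toC p + τ • toC (g p))‖ ≤ bound p) :
    ∫ p, F (toC p + Complex.I • toC (g p)) * (1 + Complex.I • jacC g p).det = ∫ p, F (toC p) := by
  have hsm : MeasurableSet s := by simpa using hs.measurableSet.compl
  have : Nonempty (Fin m) := ⟨⟨0, hm⟩⟩
  have hsn : ∀ᵐ p ∂(volume : Measure (RSpace m)), p ∈ s := hs.measure_zero _
  obtain ⟨C, hC0, hC⟩ := exists_norm_det_le m R K
  -- The integral over the contour {p + τ g(p)}, parametrized by p, is holomorphic in τ. For small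
  -- real τ it is the integral over ℝᵐ after a change of variables, hence constant; the identity
  -- theorem carries this constancy to τ = i.
  let h : ℂ → RSpace m → ℂ := fun τ p =>
    F (toC p + τ • toC (g p)) * (1 + τ • jacC g p).det
  have hjm : Measurable fun p => (fun j k => jacC g p j k : Fin m → Fin m → ℂ) := by
    have h1 : Measurable (fderiv ℝ g) := measurable_fderiv ℝ g
    refine measurable_pi_lambda _ fun j => measurable_pi_lambda _ fun k => ?_
    have hL : Continuous fun L : RSpace m →L[ℝ] RSpace m => L (EuclideanSpace.single k 1) j :=
      (EuclideanSpace.proj j : RSpace m →L[ℝ] ℝ).continuous.comp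
        (ContinuousLinearMap.apply ℝ (RSpace m) (EuclideanSpace.single k (1 : ℝ))).continuous
    exact (Complex.continuous_ofReal.comp hL).measurable.comp h1
  have hmeas : ∀ τ ∈ D, AEStronglyMeasurable (h τ) (volume.restrict s) := by
    intro τ hτ
    refine AEStronglyMeasurable.mul ?_ ?_
    · refine ContinuousOn.aestronglyMeasurable ?_ hsm
      refine hF.continuousOn.comp (Continuous.continuousOn ?_) fun p hp => hmem τ hτ p hp
      have := hg.continuous
      exact toC.continuous.add ((toC.continuous.comp this).const_smul τ)
    · have hdet : Continuous fun N : Fin m → Fin m → ℂ =>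
          (1 + τ • (Matrix.of N : Matrix (Fin m) (Fin m) ℂ)).det :=
        Continuous.matrix_det (continuous_const.add (continuous_id.const_smul τ))
      exact (hdet.measurable.comp hjm).aestronglyMeasurable
  have hbd : ∀ τ ∈ D, ∀ p ∈ s, ‖h τ p‖ ≤ bound p * C := by
    intro τ hτ p hp
    rw [norm_mul]
    exact mul_le_mul (hb τ hτ p hp) (hC τ (hDR τ hτ) _ fun j k => norm_jacC_le hg p j k)
      (norm_nonneg _) ((norm_nonneg _).trans (hb τ hτ p hp))
  have hhol : DifferentiableOn ℂ (fun τ => ∫ p in s, h τ p) D := by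
    refine differentiableOn_integral_of_dominated hD hmeas ?_ fun τ hτ =>
      ⟨D, hD.mem_nhds hτ, fun p => bound p * C, (hbi.mul_const C).restrict, ?_⟩
    · refine (ae_restrict_iff' hsm).2 (Eventually.of_forall fun p hp => ?_)
      refine DifferentiableOn.mul ?_ ?_
      · exact hF.comp (by fun_prop) fun τ hτ => hmem τ hτ p hp
      · simp only [Matrix.det_apply, Matrix.add_apply, Matrix.smul_apply]
        fun_prop
    · exact (ae_restrict_iff' hsm).2 (Eventually.of_forall fun p hp τ hτ => hbd τ hτ p hp)
  obtain ⟨δ, hδ, hdet⟩ := exists_det_pos m K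
  obtain ⟨r, hr, hrD⟩ := Metric.isOpen_iff.1 hD 0 h0
  have hreal : ∀ τ : ℝ, |τ| < δ → |τ| < r → |τ| * K < 1 →
      ∫ p in s, h τ p = ∫ p, F (toC p) := by
    intro τ h1 h2 h3
    have hbij := bijective_add_smul hg h3
    -- The map is a bijection, so the complement of the image is the image of the countable
    -- exceptional set.
    have himg : volume ((fun p => p + τ • g p) '' s)ᶜ = 0 := by
      rw [← image_compl_eq hbij]
      exact (hs.image _).measure_zero _
    have hfd : ∀ p ∈ s, HasFDerivWithinAt (fun p => p + τ • g p)
        (ContinuousLinearMap.id ℝ (RSpace m) + τ • fderiv ℝ g p) s p := fun p hp =>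
      ((hasFDerivAt_id p).add ((hgd p hp).hasFDerivAt.const_smul τ)).hasFDerivWithinAt
    have hcv := integral_image_eq_integral_abs_det_fderiv_smul volume hsm hfd hbij.1.injOn
      (fun q => F (toC q))
    rw [Measure.restrict_eq_self_of_ae_mem (s := (fun p => p + τ • g p) '' s) himg] at hcv
    rw [hcv]
    refine setIntegral_congr_fun hsm fun p hp => ?_
    have hpos := hdet τ h1 (fderiv ℝ g p) (norm_fderiv_le_of_lipschitz ℝ hg)
    simp only [h]
    rw [abs_of_pos hpos, map_add, map_smul, Complex.real_smul, det_id_add_smul, mul_comm]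
    rfl
  have hfreq : ∃ᶠ τ in 𝓝[≠] (0 : ℂ), ∫ p in s, h τ p = ∫ p, F (toC p) := by
    have hlim : Tendsto (fun n : ℕ => ((1 / ((n : ℝ) + 1) : ℝ) : ℂ)) atTop (𝓝[≠] 0) := by
      refine tendsto_nhdsWithin_iff.2 ⟨?_, Eventually.of_forall fun n => ?_⟩
      · have h2 := (Complex.continuous_ofReal.tendsto 0).comp
          (tendsto_one_div_add_atTop_nhds_zero_nat (𝕜 := ℝ))
        rw [Complex.ofReal_zero] at h2
        exact h2
      · have : (0 : ℝ) < 1 / ((n : ℝ) + 1) := by positivity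
        simp only [mem_compl_iff, mem_singleton_iff, Complex.ofReal_eq_zero]
        exact this.ne'
    refine hlim.frequently (Eventually.frequently ?_)
    have ht := tendsto_one_div_add_atTop_nhds_zero_nat (𝕜 := ℝ)
    have htK : Tendsto (fun n : ℕ => |1 / ((n : ℝ) + 1)| * K) atTop (𝓝 0) := by
      simpa using ht.abs.mul_const (K : ℝ)
    have hta : Tendsto (fun n : ℕ => |1 / ((n : ℝ) + 1)|) atTop (𝓝 0) := by simpa using ht.abs
    filter_upwards [hta.eventually (gt_mem_nhds hδ), hta.eventually (gt_mem_nhds hr),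
      htK.eventually (gt_mem_nhds one_pos)] with n hn1 hn2 hn3
    exact hreal _ hn1 hn2 hn3
  have heq := (hhol.analyticOnNhd hD).eqOn_of_preconnected_of_frequently_eq
    (analyticOnNhd_const (v := ∫ p, F (toC p))) hDc h0 hfreq hI
  have hsI : ∫ p in s, h Complex.I p = ∫ p, h Complex.I p := by
    rw [Measure.restrict_eq_self_of_ae_mem hsn]
  exact hsI.symm.trans heq

end Contour

end FBI
end

noncomputable section

namespace FBI

/-! ### The bilinear form, the square root `⟨ζ⟩` and the cone `|Im ζ| < |Re ζ|` -/

section Cone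

variable {m : ℕ}

lemma cdot_comm (z w : CSpace m) : cdot z w = cdot w z := by
  simp only [cdot, mul_comm]

lemma cdot_add_left (z z' w : CSpace m) : cdot (z + z') w = cdot z w + cdot z' w := by
  simp [cdot, add_mul, Finset.sum_add_distrib]

lemma cdot_smul_left (c : ℂ) (z w : CSpace m) : cdot (c • z) w = c * cdot z w := by
  simp [cdot, Finset.mul_sum, mul_assoc]

lemma cdot_add_right (z w w' : CSpace m) : cdot z (w + w') = cdot z w + cdot z w' := by
  rw [cdot_comm, cdot_add_left, cdot_comm w, cdot_comm w']

lemma cdot_smul_right (c : ℂ) (z w : CSpace m) : cdot z (c • w) = c * cdot z w := by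
  rw [cdot_comm, cdot_smul_left, cdot_comm]

lemma cdot_neg_right (z w : CSpace m) : cdot z (-w) = -cdot z w := by
  simpa using cdot_smul_right (-1) z w

lemma cdot_neg_left (z w : CSpace m) : cdot (-z) w = -cdot z w := by
  simpa using cdot_smul_left (-1) z w

lemma cdot_sub_right (z w w' : CSpace m) : cdot z (w - w') = cdot z w - cdot z w' := by
  rw [sub_eq_add_neg, cdot_add_right, cdot_neg_right, sub_eq_add_neg]

lemma cdot_sub_left (z z' w : CSpace m) : cdot (z - z') w = cdot z w - cdot z' w := by
  rw [sub_eq_add_neg, cdot_add_left, cdot_neg_left, sub_eq_add_neg]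

lemma cdot_toC (p q : RSpace m) : cdot (toC p) (toC q) = ((inner ℝ p q : ℝ) : ℂ) := by
  simp [cdot, PiLp.inner_apply, mul_comm]

lemma norm_cdot_le (z w : CSpace m) : ‖cdot z w‖ ≤ ‖z‖ * ‖w‖ := by
  have h1 : cdot z w = inner ℂ (WithLp.toLp 2 fun j => (starRingEnd ℂ) (z j) : CSpace m) w := by
    simp [cdot, PiLp.inner_apply, mul_comm]
  rw [h1]
  refine (norm_inner_le_norm _ _).trans (le_of_eq ?_)
  congr 1
  simp [EuclideanSpace.norm_eq]

lemma cdot_self_add_I (p q : RSpace m) : cdot (toC p + Complex.I • toC q) (toC p + Complex.I • toC q)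
    = ((‖p‖ ^ 2 - ‖q‖ ^ 2 : ℝ) : ℂ) + Complex.I * ((2 * inner ℝ p q : ℝ) : ℂ) := by
  simp only [cdot_add_left, cdot_add_right, cdot_smul_left, cdot_smul_right, cdot_toC,
    real_inner_self_eq_norm_sq, real_inner_comm p q]
  push_cast
  linear_combination (‖q‖ : ℂ) ^ 2 * Complex.I_mul_I

lemma norm_sq_add_I (p q : RSpace m) : ‖toC p + Complex.I • toC q‖ ^ 2 = ‖p‖ ^ 2 + ‖q‖ ^ 2 := by
  simp only [EuclideanSpace.norm_sq_eq, ← Finset.sum_add_distrib]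
  refine Finset.sum_congr rfl fun j _ => ?_
  simp only [PiLp.add_apply, PiLp.smul_apply, toC_apply, smul_eq_mul, Real.norm_eq_abs, sq_abs]
  rw [← Complex.normSq_eq_norm_sq, mul_comm, Complex.normSq_add_mul_I]

lemma exists_eq_add_I (z : CSpace m) : ∃ p q : RSpace m, z = toC p + Complex.I • toC q := by
  refine ⟨WithLp.toLp 2 fun j => (z j).re, WithLp.toLp 2 fun j => (z j).im, ?_⟩
  ext j
  simp only [PiLp.add_apply, PiLp.smul_apply, toC_apply, smul_eq_mul]
  rw [mul_comm, Complex.re_add_im]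

lemma norm_le_norm_add_I (p q : RSpace m) : ‖p‖ ≤ ‖toC p + Complex.I • toC q‖ := by
  have := norm_sq_add_I p q
  nlinarith [norm_nonneg p, norm_nonneg q, norm_nonneg (toC p + Complex.I • toC q)]

lemma norm_add_I_le {p q : RSpace m} {ρ : ℝ} (hq : ‖q‖ ≤ ρ * ‖p‖) (hρ1 : ρ < 1) :
    ‖toC p + Complex.I • toC q‖ ≤ 2 * ‖p‖ := by
  refine (norm_add_le _ _).trans ?_
  rw [norm_smul, Complex.norm_I, one_mul, toC.norm_map, toC.norm_map]
  nlinarith [norm_nonneg p]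

lemma re_cdot_self_add_I (p q : RSpace m) :
    (cdot (toC p + Complex.I • toC q) (toC p + Complex.I • toC q)).re = ‖p‖ ^ 2 - ‖q‖ ^ 2 := by
  rw [cdot_self_add_I, Complex.add_re, Complex.ofReal_re, Complex.mul_re]
  simp

lemma re_cdot_self_ge {p q : RSpace m} {ρ : ℝ} (hq : ‖q‖ ≤ ρ * ‖p‖) :
    (1 - ρ ^ 2) * ‖p‖ ^ 2 ≤
      (cdot (toC p + Complex.I • toC q) (toC p + Complex.I • toC q)).re := by
  rw [re_cdot_self_add_I]
  nlinarith [norm_nonneg q, pow_le_pow_left₀ (norm_nonneg q) hq 2]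

lemma _root_.DifferentiableAt.cdot {E : Type*} [NormedAddCommGroup E] [NormedSpace ℂ E]
    {f g : E → CSpace m} {x : E} (hf : DifferentiableAt ℂ f x) (hg : DifferentiableAt ℂ g x) :
    DifferentiableAt ℂ (fun x => FBI.cdot (f x) (g x)) x := by
  simp only [FBI.cdot]
  fun_prop

lemma _root_.ContinuousAt.cdot {E : Type*} [TopologicalSpace E]
    {f g : E → CSpace m} {x : E} (hf : ContinuousAt f x) (hg : ContinuousAt g x) :
    ContinuousAt (fun x => FBI.cdot (f x) (g x)) x := by
  simp only [FBI.cdot]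
  fun_prop

lemma _root_.Continuous.cdot {E : Type*} [TopologicalSpace E]
    {f g : E → CSpace m} (hf : Continuous f) (hg : Continuous g) :
    Continuous (fun x => FBI.cdot (f x) (g x)) :=
  continuous_iff_continuousAt.2 fun _ => hf.continuousAt.cdot hg.continuousAt

variable (m) in
/-- The cone `|Im ζ| < |Re ζ|`. -/
def cone : Set (CSpace m) := {ζ | 0 < (cdot ζ ζ).re}

lemma isOpen_cone : IsOpen (cone m) :=
  isOpen_lt continuous_const (Complex.continuous_re.comp (continuous_id.cdot continuous_id))

lemma mem_cone_of_norm_le {p q : RSpace m} {ρ : ℝ} (hρ0 : 0 ≤ ρ) (hρ : ρ < 1) (hp : p ≠ 0)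
    (hq : ‖q‖ ≤ ρ * ‖p‖) : toC p + Complex.I • toC q ∈ cone m := by
  refine lt_of_lt_of_le ?_ (re_cdot_self_ge hq)
  have : 0 < ‖p‖ := norm_pos_iff.2 hp
  have : 0 < 1 - ρ ^ 2 := by nlinarith
  positivity

lemma toC_mem_cone {p : RSpace m} (hp : p ≠ 0) : toC p ∈ cone m := by
  have := mem_cone_of_norm_le (q := 0) le_rfl one_pos hp (by simp)
  simpa using this

lemma slitPlane_of_mem_cone {ζ : CSpace m} (h : ζ ∈ cone m) : cdot ζ ζ ∈ Complex.slitPlane :=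
  Or.inl h

lemma bracket_sq (ζ : CSpace m) : bracket ζ ^ 2 = cdot ζ ζ := by
  have := Complex.cpow_nat_inv_pow (cdot ζ ζ) two_ne_zero
  simp only [Nat.cast_ofNat] at this
  rw [bracket, one_div, this]

lemma bracket_ne_zero {ζ : CSpace m} (h : ζ ∈ cone m) : bracket ζ ≠ 0 := by
  intro h0
  have := bracket_sq ζ
  rw [h0] at this
  have h2 : 0 < (cdot ζ ζ).re := h
  rw [← this] at h2
  simp at h2

lemma norm_bracket_le (ζ : CSpace m) : ‖bracket ζ‖ ≤ ‖ζ‖ := by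
  have h1 : ‖bracket ζ‖ ^ 2 ≤ ‖ζ‖ ^ 2 := by
    rw [← norm_pow, bracket_sq, sq]
    exact norm_cdot_le ζ ζ
  exact (pow_le_pow_iff_left₀ (norm_nonneg _) (norm_nonneg _) two_ne_zero).1 h1

lemma norm_bracket_ge {ζ : CSpace m} {a : ℝ} (ha : 0 ≤ a) (h : a ^ 2 ≤ (cdot ζ ζ).re) :
    a ≤ ‖bracket ζ‖ := by
  have h1 : a ^ 2 ≤ ‖bracket ζ‖ ^ 2 := by
    rw [← norm_pow, bracket_sq]
    exact h.trans (Complex.re_le_norm _)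
  exact (pow_le_pow_iff_left₀ ha (norm_nonneg _) two_ne_zero).1 h1

lemma bracket_toC (p : RSpace m) : bracket (toC p) = (‖p‖ : ℂ) := by
  rw [bracket, cdot_toC, real_inner_self_eq_norm_sq]
  have : (1 / 2 : ℂ) = ((1 / 2 : ℝ) : ℂ) := by push_cast; rfl
  rw [this, ← Complex.ofReal_cpow (sq_nonneg _), ← Real.sqrt_eq_rpow, Real.sqrt_sq (norm_nonneg _)]

lemma differentiableOn_bracket : DifferentiableOn ℂ bracket (cone m) := by
  intro ζ hζ
  refine DifferentiableAt.differentiableWithinAt ?_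
  exact (differentiableAt_id.cdot differentiableAt_id).cpow_const (slitPlane_of_mem_cone hζ)

lemma continuousOn_bracket : ContinuousOn bracket (cone m) := differentiableOn_bracket.continuousOn

/-- The matrix is a rank one perturbation of the identity. Only this affine form in z is used later.
-/
lemma fbiDelta_eq (z ζ : CSpace m) : fbiDelta z ζ = 1 + Complex.I / bracket ζ * cdot z ζ := by
  rw [fbiDelta, ← Matrix.smul_vecMulVec, Matrix.vecMulVec_eq Unit, Matrix.det_one_add_mul_comm]
  simp [Matrix.det_unique, Matrix.add_apply, Matrix.mul_apply, cdot, Finset.mul_sum]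
  exact Finset.sum_congr rfl fun j _ => by ring

end Cone

/-! ### The map `Z` and the real structure bundle -/

section Geometry

variable {m n : ℕ}

/-- The complex matrix of a real linear map. -/
def matC (L : RSpace m →L[ℝ] RSpace m) : Matrix (Fin m) (Fin m) ℂ :=
  Matrix.of fun j k => ((L (EuclideanSpace.single k 1) j : ℝ) : ℂ)

lemma jacC_eq (g : RSpace m → RSpace m) (p : RSpace m) : jacC g p = matC (fderiv ℝ g p) := rfl

lemma matC_mulVec (L : RSpace m →L[ℝ] RSpace m) (p : RSpace m) (j : Fin m) :
    (matC L *ᵥ fun k => (p k : ℂ)) j = (L p j : ℂ) := by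
  have h : p = ∑ k, p k • EuclideanSpace.single k (1 : ℝ) := by
    ext j
    simp [Finset.sum_apply, Pi.single_apply]
  conv_rhs => rw [h]
  simp [Matrix.mulVec, dotProduct, matC, map_sum, mul_comm]

lemma matC_adjoint (L : RSpace m →L[ℝ] RSpace m) :
    matC (ContinuousLinearMap.adjoint L) = (matC L)ᵀ := by
  ext j k
  simp only [matC, Matrix.of_apply, Matrix.transpose_apply]
  have h1 : ∀ x : RSpace m, ∀ i, x i = inner ℝ (EuclideanSpace.single i (1 : ℝ)) x := by
    intro x i; simp [EuclideanSpace.inner_single_left]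
  rw [h1, ContinuousLinearMap.adjoint_inner_right, real_inner_comm, ← h1]

lemma matC_neg (L : RSpace m →L[ℝ] RSpace m) : matC (-L) = -matC L := by
  ext j k; simp [matC]

lemma toLp_mulVec_add_I (L : RSpace m →L[ℝ] RSpace m) (p q : RSpace m) (j : Fin m) :
    ((1 + Complex.I • matC L) *ᵥ (toC p + Complex.I • toC q).ofLp) j =
      (toC (p - L q) + Complex.I • toC (q + L p)) j := by
  have h1 : (toC p + Complex.I • toC q).ofLp = (fun k => (p k : ℂ)) + Complex.I • fun k => (q k : ℂ) := rfl
  rw [h1, Matrix.mulVec_add, Matrix.mulVec_smul, Matrix.add_mulVec, Matrix.add_mulVec,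
    Matrix.smul_mulVec, Matrix.smul_mulVec, Matrix.one_mulVec, Matrix.one_mulVec]
  simp only [Pi.add_apply, Pi.smul_apply, matC_mulVec, PiLp.add_apply, PiLp.smul_apply, toC_apply,
    smul_eq_mul, PiLp.sub_apply]
  push_cast
  linear_combination (L q j : ℂ) * Complex.I_mul_I

/-- A kernel vector p + iq would satisfy p = Lq and q = −Lp, which a strict contraction L allows
only for p = q = 0. -/
lemma det_one_add_ne_zero {L : RSpace m →L[ℝ] RSpace m} (hL : ‖L‖ < 1) :
    (1 + Complex.I • matC L).det ≠ 0 := by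
  intro h0
  obtain ⟨v, hv, hv0⟩ := Matrix.exists_mulVec_eq_zero_iff.2 h0
  obtain ⟨p, q, hpq⟩ := exists_eq_add_I (WithLp.toLp 2 v : CSpace m)
  have hv' : v = (toC p + Complex.I • toC q).ofLp := by rw [← hpq]
  have h2 : toC (p - L q) + Complex.I • toC (q + L p) = 0 := by
    ext j
    rw [← toLp_mulVec_add_I, ← hv', hv0]; rfl
  have h3 := norm_sq_add_I (p - L q) (q + L p)
  rw [h2, norm_zero] at h3
  have h4 : p - L q = 0 := by
    rw [← norm_eq_zero]; nlinarith [norm_nonneg (p - L q), sq_nonneg ‖q + L p‖]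
  have h5 : q + L p = 0 := by
    rw [← norm_eq_zero]; nlinarith [norm_nonneg (q + L p), sq_nonneg ‖p - L q‖]
  have hp : ‖p‖ ≤ ‖L‖ * ‖q‖ := by rw [sub_eq_zero.1 h4]; exact L.le_opNorm q
  have hq : ‖q‖ ≤ ‖L‖ * ‖p‖ := by
    rw [eq_neg_of_add_eq_zero_left h5, norm_neg]; exact L.le_opNorm p
  have hp0 : ‖p‖ = 0 := by
    nlinarith [norm_nonneg p, norm_nonneg q, norm_nonneg L, mul_nonneg (norm_nonneg L) (norm_nonneg q),
      mul_nonneg (norm_nonneg L) (norm_nonneg p), mul_nonneg (norm_nonneg L) (sub_nonneg.2 hq)]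
  have hq0 : ‖q‖ = 0 := by rw [hp0, mul_zero] at hq; exact le_antisymm hq (norm_nonneg _)
  apply hv
  rw [hv', norm_eq_zero.1 hp0, norm_eq_zero.1 hq0]
  ext j; simp

lemma Z_eq (φ : RSpace m → RSpace n → RSpace m) (x : RSpace m) (t : RSpace n) :
    Z φ x t = toC x + Complex.I • toC (φ x t) := rfl

lemma Z_sub (φ : RSpace m → RSpace n → RSpace m) (x y : RSpace m) (t : RSpace n) :
    Z φ x t - Z φ y t = toC (x - y) + Complex.I • toC (φ x t - φ y t) := by
  rw [Z_eq, Z_eq, map_sub, map_sub, smul_sub]; abel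

lemma Zx_eq {φ : RSpace m → RSpace n → RSpace m} {x : RSpace m} {t : RSpace n}
    (h : DifferentiableAt ℝ (fun y => φ y t) x) :
    Zx φ x t = 1 + Complex.I • matC (fderiv ℝ (fun y => φ y t) x) := by
  ext j k
  have h1 : HasFDerivAt (fun y => Z φ y t j)
      (Complex.ofRealCLM.comp (EuclideanSpace.proj j : RSpace m →L[ℝ] ℝ) + Complex.I •
        Complex.ofRealCLM.comp ((EuclideanSpace.proj j : RSpace m →L[ℝ] ℝ).comp
          (fderiv ℝ (fun y => φ y t) x))) x := by
    have ha : HasFDerivAt (fun y : RSpace m => (y j : ℂ))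
        (Complex.ofRealCLM.comp (EuclideanSpace.proj j : RSpace m →L[ℝ] ℝ)) x :=
      (Complex.ofRealCLM.comp (EuclideanSpace.proj j : RSpace m →L[ℝ] ℝ)).hasFDerivAt
    have hb : HasFDerivAt (fun y : RSpace m => (φ y t j : ℂ))
        (Complex.ofRealCLM.comp ((EuclideanSpace.proj j : RSpace m →L[ℝ] ℝ).comp
          (fderiv ℝ (fun y => φ y t) x))) x :=
      ((Complex.ofRealCLM.comp (EuclideanSpace.proj j : RSpace m →L[ℝ] ℝ)).hasFDerivAt).comp x
        h.hasFDerivAt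
    exact ha.add (hb.const_smul Complex.I)
  simp only [Zx, Matrix.of_apply, h1.fderiv]
  by_cases hjk : j = k <;> simp [matC, hjk]

namespace IsAdmissible

variable {φ : RSpace m → RSpace n → RSpace m} {V : Opens (RSpace m)} {W : Opens (RSpace n)}

lemma exists_lipschitz (hφ : IsAdmissible φ V W) :
    ∃ K : NNReal, K < 1 ∧ ∀ t ∈ W, LipschitzWith K (fun x => φ x t) := by
  obtain ⟨μ, hμ, h⟩ := hφ.lipschitz
  refine ⟨Real.toNNReal μ, by simpa using hμ, fun t ht => LipschitzWith.of_dist_le_mul fun x x' => ?_⟩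
  rw [dist_eq_norm, dist_eq_norm]
  exact (h t ht x x').trans (by gcongr; exact Real.le_coe_toNNReal μ)

lemma contDiff (hφ : IsAdmissible φ V W) {t : RSpace n} (ht : t ∈ W) :
    ContDiff ℝ ∞ (fun x => φ x t) := by
  rw [← contDiffOn_univ]
  exact hφ.smooth.comp (f := fun x : RSpace m => (x, t)) (by fun_prop) fun x _ => ⟨mem_univ _, ht⟩

lemma differentiableAt (hφ : IsAdmissible φ V W) {t : RSpace n} (ht : t ∈ W) (x : RSpace m) :
    DifferentiableAt ℝ (fun x => φ x t) x :=
  (hφ.contDiff ht).contDiffAt.differentiableAt (by simp)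

lemma Zx_eq (hφ : IsAdmissible φ V W) {t : RSpace n} (ht : t ∈ W) (x : RSpace m) :
    Zx φ x t = 1 + Complex.I • matC (fderiv ℝ (fun y => φ y t) x) :=
  FBI.Zx_eq (hφ.differentiableAt ht x)

lemma norm_fderiv_lt (hφ : IsAdmissible φ V W) {t : RSpace n} (ht : t ∈ W) (x : RSpace m) :
    ‖fderiv ℝ (fun y => φ y t) x‖ < 1 := by
  obtain ⟨K, hK, h⟩ := hφ.exists_lipschitz
  exact (norm_fderiv_le_of_lipschitz ℝ (h t ht)).trans_lt hK

lemma det_Zx_ne_zero (hφ : IsAdmissible φ V W) {t : RSpace n} (ht : t ∈ W) (x : RSpace m) :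
    (Zx φ x t).det ≠ 0 := by
  rw [hφ.Zx_eq ht]
  exact det_one_add_ne_zero (hφ.norm_fderiv_lt ht x)

/-- The covectors `p - i ᵗφ_x p` are in the fibre. -/
lemma mem_fibre (hφ : IsAdmissible φ V W) {t : RSpace n} (ht : t ∈ W) (x p : RSpace m) :
    covector φ t x (p + ContinuousLinearMap.adjoint (fderiv ℝ (fun y => φ y t) x)
      (ContinuousLinearMap.adjoint (fderiv ℝ (fun y => φ y t) x) p)) = toC p + Complex.I •
        toC (-ContinuousLinearMap.adjoint (fderiv ℝ (fun y => φ y t) x) p) := by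
  set A := ContinuousLinearMap.adjoint (fderiv ℝ (fun y => φ y t) x) with hA
  have hT : (Zx φ x t)ᵀ = 1 + Complex.I • matC A := by
    rw [hφ.Zx_eq ht, hA, matC_adjoint, Matrix.transpose_add, Matrix.transpose_smul,
      Matrix.transpose_one]
  have hu : IsUnit (Zx φ x t)ᵀ.det := by
    rw [Matrix.det_transpose]; exact (hφ.det_Zx_ne_zero ht x).isUnit
  -- (1 + iA)(p − iAp) = p + A²p is real, so p − iAp is the covector belonging to ξ = p + A²p.
  have h1 : (fun j => ((p + A (A p)) j : ℂ)) = (Zx φ x t)ᵀ *ᵥ (toC p + Complex.I • toC (-A p)).ofLp := by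
    funext j
    rw [hT, toLp_mulVec_add_I]
    simp
  rw [covector, h1, Matrix.mulVec_mulVec, Matrix.nonsing_inv_mul _ hu, Matrix.one_mulVec]

end IsAdmissible

end Geometry

end FBI
end

noncomputable section

namespace FBI

/-! ### Pairing compactly supported distributions with integrals of entire functions -/

section Exchange

/-- The bound makes l vanish on the kernel of ρ, so l descends to a bounded functional on the range
of ρ, which Hahn–Banach extends to X. -/
lemma exists_factor_of_norm_le {O X : Type*} [AddCommGroup O] [Module ℂ O] [NormedAddCommGroup X]
    [NormedSpace ℂ X] (ρ : O →ₗ[ℂ] X) (l : O →ₗ[ℂ] ℂ) (C : ℝ) (h : ∀ o, ‖l o‖ ≤ C * ‖ρ o‖) :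
    ∃ T : X →L[ℂ] ℂ, ∀ o, T (ρ o) = l o := by
  have hker : LinearMap.ker ρ.rangeRestrict ≤ LinearMap.ker l := by
    intro o ho
    rw [LinearMap.ker_rangeRestrict, LinearMap.mem_ker] at ho
    have := h o
    rw [ho, norm_zero, mul_zero] at this
    exact norm_le_zero_iff.1 this
  obtain ⟨σ, hσ⟩ := ρ.rangeRestrict.exists_rightInverse_of_surjective ρ.range_rangeRestrict
  have hl : ∀ o, l (σ (ρ.rangeRestrict o)) = l o := by
    intro o
    rw [← sub_eq_zero, ← map_sub]
    refine hker ?_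
    rw [LinearMap.mem_ker, map_sub, sub_eq_zero]
    exact LinearMap.congr_fun hσ _
  obtain ⟨T, hT, -⟩ := exists_extension_norm_eq (LinearMap.range ρ)
    ((l ∘ₗ σ).mkContinuous C fun x => by
      obtain ⟨o, rfl⟩ := ρ.surjective_rangeRestrict x
      rw [LinearMap.comp_apply, hl]
      exact h o)
  refine ⟨T, fun o => ?_⟩
  have := hT (ρ.rangeRestrict o)
  rw [LinearMap.mkContinuous_apply, LinearMap.comp_apply, hl] at this
  exact this

variable {m : ℕ} {V : Opens (RSpace m)}

lemma contDiff_comp_mul {Zt : RSpace m → CSpace m} (hZ : ContDiff ℝ ∞ Zt) {a : RSpace m → ℂ}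
    (ha : ContDiff ℝ ∞ a) {Φ : CSpace m → ℂ} (hΦ : Differentiable ℂ Φ) :
    ContDiff ℝ ∞ fun y => Φ (Zt y) * a y :=
  ((hΦ.contDiff_of_finiteDimensional.restrict_scalars ℝ).comp hZ).mul ha

/-- For entire Φ the sup norm on a large ball controls all derivatives on a smaller one, by Cauchy's
estimates. After composition with Zt and multiplication by a, the functional d is therefore
continuous for a mere sup norm. -/
lemma CompactDistribution.exists_norm_pair_comp_le (d : CompactDistribution V)
    {Zt : RSpace m → CSpace m} (hZ : ContDiff ℝ ∞ Zt) {a : RSpace m → ℂ} (ha : ContDiff ℝ ∞ a) :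
    ∃ R C : ℝ, 0 ≤ C ∧ ∀ Φ : CSpace m → ℂ, Differentiable ℂ Φ → ∀ M, 0 ≤ M →
      (∀ b ∈ Metric.closedBall (0 : CSpace m) R, ‖Φ b‖ ≤ M) →
        ‖d.pair (fun y => Φ (Zt y) * a y)‖ ≤ C * M := by
  obtain ⟨L, hL, hLV, q, C₀, hC₀⟩ := d.bound
  have hbZ : ∀ j : ℕ, ∃ D : ℝ, ∀ x ∈ L, ‖iteratedFDeriv ℝ j Zt x‖ ≤ D := fun j =>
    hL.exists_bound_of_continuousOn (hZ.continuous_iteratedFDeriv (by exact_mod_cast le_top)).continuousOn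
  have hba : ∀ j : ℕ, ∃ D : ℝ, ∀ x ∈ L, ‖iteratedFDeriv ℝ j a x‖ ≤ D := fun j =>
    hL.exists_bound_of_continuousOn (ha.continuous_iteratedFDeriv (by exact_mod_cast le_top)).continuousOn
  choose DZ hDZ using hbZ
  choose Da hDa using hba
  -- The summand 1 ensures D ≤ Dⁱ for i ≥ 1, the form in which the estimate for derivatives of a
  -- composition wants its hypothesis.
  set D : ℝ := 1 + ∑ j ∈ Finset.range (q + 1), |DZ j| with hD
  set A : ℝ := ∑ j ∈ Finset.range (q + 1), |Da j| with hA
  have hD1 : 1 ≤ D := by rw [hD]; linarith [Finset.sum_nonneg fun j (_ : j ∈ Finset.range (q + 1)) => abs_nonneg (DZ j)]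
  have hZD : ∀ j ≤ q, ∀ x ∈ L, ‖iteratedFDeriv ℝ j Zt x‖ ≤ D := fun j hj x hx => by
    have := Finset.single_le_sum (f := fun j => |DZ j|) (fun j _ => abs_nonneg (DZ j))
      (Finset.mem_range.2 (Nat.lt_succ_of_le hj))
    linarith [hDZ j x hx, le_abs_self (DZ j)]
  have haA : ∀ j ≤ q, ∀ x ∈ L, ‖iteratedFDeriv ℝ j a x‖ ≤ A := fun j hj x hx => by
    have := Finset.single_le_sum (f := fun j => |Da j|) (fun j _ => abs_nonneg (Da j))
      (Finset.mem_range.2 (Nat.lt_succ_of_le hj))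
    linarith [hDa j x hx, le_abs_self (Da j)]
  have hA0 : 0 ≤ A := Finset.sum_nonneg fun j _ => abs_nonneg _
  set B : ℝ := q.factorial * 2 ^ q * D ^ q with hB
  -- The radius D covers Zt(L), and Cauchy's estimates up to order q need the margin q + 1.
  refine ⟨D + (q + 1), |C₀| * (2 ^ q * B * A), by positivity, fun Φ hΦ M hM hb => ?_⟩
  have hΦr : ContDiff ℝ ∞ Φ := hΦ.contDiff_of_finiteDimensional.restrict_scalars ℝ
  have hsm := contDiff_comp_mul hZ ha hΦ
  rw [CompactDistribution.pair_of_smooth _ hsm.contDiffOn]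
  refine (hC₀ _ (2 ^ q * B * A * M) (by positivity) fun j hj x hx => ?_).trans ?_
  · have hZx : ‖Zt x‖ ≤ D := by simpa using hZD 0 (Nat.zero_le _) x hx
    have hΦj : ∀ i ≤ q, ‖iteratedFDeriv ℝ i Φ (Zt x)‖ ≤ 2 ^ q * M := by
      intro i hi
      refine (norm_iteratedFDeriv_le_of_norm_le i hΦ (M := M) fun b hb' => hb b ?_).trans ?_
      · rw [mem_closedBall_zero_iff]
        rw [Metric.mem_ball, dist_eq_norm] at hb'
        have h1 : ‖b‖ ≤ ‖b - Zt x‖ + ‖Zt x‖ := by simpa using norm_add_le (b - Zt x) (Zt x)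
        have : (i : ℝ) ≤ q := by exact_mod_cast hi
        linarith
      · gcongr; norm_num
    have hcomp : ∀ i ≤ q, ‖iteratedFDeriv ℝ i (Φ ∘ Zt) x‖ ≤ B * M := by
      intro i hi
      refine (norm_iteratedFDeriv_comp_le hΦr hZ (n := i) (by exact_mod_cast le_top) x
        (fun k hk => hΦj k (hk.trans hi)) (D := D) fun k hk1 hk2 => ?_).trans ?_
      · refine (hZD k (hk2.trans hi) x hx).trans ?_
        exact le_self_pow₀ hD1 (by omega)
      · have : (i.factorial : ℝ) ≤ q.factorial := by exact_mod_cast Nat.factorial_le hi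
        have : D ^ i ≤ D ^ q := pow_le_pow_right₀ hD1 hi
        calc i.factorial * (2 ^ q * M) * D ^ i ≤ q.factorial * (2 ^ q * M) * D ^ q := by gcongr
          _ = B * M := by rw [hB]; ring
    refine (norm_iteratedFDeriv_mul_le (hΦr.comp hZ) ha x (n := j) (by exact_mod_cast le_top)).trans ?_
    calc ∑ i ∈ Finset.range (j + 1), (j.choose i : ℝ) * ‖iteratedFDeriv ℝ i (Φ ∘ Zt) x‖ *
          ‖iteratedFDeriv ℝ (j - i) a x‖
        ≤ ∑ i ∈ Finset.range (j + 1), (j.choose i : ℝ) * (B * M) * A := by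
          refine Finset.sum_le_sum fun i hi => ?_
          have hi' := Finset.mem_range_succ_iff.1 hi
          gcongr
          · exact hcomp i (hi'.trans hj)
          · exact haA _ ((Nat.sub_le _ _).trans hj) x hx
      _ = 2 ^ j * (B * M * A) := by
          simp_rw [mul_assoc]
          rw [← Finset.sum_mul]
          congr 1
          exact_mod_cast Nat.sum_range_choose j
      _ ≤ 2 ^ q * (B * M * A) := by gcongr; norm_num
      _ = 2 ^ q * B * A * M := by ring
  · calc C₀ * (2 ^ q * B * A * M) ≤ |C₀| * (2 ^ q * B * A * M) := by gcongr; exact le_abs_self _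
      _ = _ := by ring

variable (m) in
/-- The space of entire functions on `ℂᵐ`. -/
def entireFunctions : Submodule ℂ (CSpace m → ℂ) where
  carrier := {f | Differentiable ℂ f}
  add_mem' hf hg := Differentiable.add hf hg
  zero_mem' := differentiable_const 0
  smul_mem' c _ hf := Differentiable.const_smul hf c

/-- The restriction of entire functions to a compact set. -/
def restrictEntire (N : Compacts (CSpace m)) : entireFunctions m →ₗ[ℂ] C(N, ℂ) where
  toFun f := ⟨fun b => f.1 b, (Differentiable.continuous (f.2 : Differentiable ℂ f.1)).comp continuous_subtype_val⟩
  map_add' f g := by ext; rfl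
  map_smul' c f := by ext; rfl

/-- On entire functions the bracket factors through restriction to a compact ball N, hence through
the Banach space C(N). There the family p ↦ Φ p is Bochner integrable, and continuous functionals
commute with Bochner integrals. No topology on C^∞(V) is involved. -/
theorem CompactDistribution.pair_integral (d : CompactDistribution V)
    {Zt : RSpace m → CSpace m} (hZ : ContDiff ℝ ∞ Zt) {a : RSpace m → ℂ} (ha : ContDiff ℝ ∞ a)
    {P : Type*} [TopologicalSpace P] [MeasurableSpace P] [OpensMeasurableSpace P] {μ : Measure P}
    {Φ : P → CSpace m → ℂ} (hΦ : ∀ p, Differentiable ℂ (Φ p)) {s : Set P} (hs : MeasurableSet s)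
    (hsμ : ∀ᵐ p ∂μ, p ∈ s) (hc : ContinuousOn (Function.uncurry Φ) (s ×ˢ univ))
    (hb : ∀ R : ℝ, ∃ bound : P → ℝ, Integrable bound μ ∧
      ∀ p ∈ s, ∀ b ∈ Metric.closedBall (0 : CSpace m) R, ‖Φ p b‖ ≤ bound p) :
    Differentiable ℂ (fun b => ∫ p, Φ p b ∂μ) ∧
    Integrable (fun p => d.pair (fun y => Φ p (Zt y) * a y)) μ ∧
    ∫ p, d.pair (fun y => Φ p (Zt y) * a y) ∂μ = d.pair (fun y => (∫ p, Φ p (Zt y) ∂μ) * a y) := by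
  have hrs : μ.restrict s = μ := Measure.restrict_eq_self_of_ae_mem hsμ
  have hmeas : ∀ b, AEStronglyMeasurable (fun p => Φ p b) μ := by
    intro b
    rw [← hrs]
    refine ContinuousOn.aestronglyMeasurable ?_ hs
    exact hc.comp (f := fun p => (p, b)) (by fun_prop) fun p hp => ⟨hp, mem_univ _⟩
  have hent : Differentiable ℂ (fun b => ∫ p, Φ p b ∂μ) := by
    refine differentiable_integral_of_dominated hmeas (Eventually.of_forall fun p => hΦ p) fun b => ?_
    obtain ⟨bound, hbi, hbd⟩ := hb (‖b‖ + 1)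
    refine ⟨_, Metric.ball_mem_nhds b one_pos, bound, hbi, ?_⟩
    filter_upwards [hsμ] with p hp y hy
    refine hbd p hp y ?_
    rw [mem_closedBall_zero_iff]
    rw [Metric.mem_ball, dist_eq_norm] at hy
    have : ‖y‖ ≤ ‖y - b‖ + ‖b‖ := by simpa using norm_add_le (y - b) b
    linarith
  obtain ⟨R, C, hC, hRC⟩ := d.exists_norm_pair_comp_le hZ ha
  let N : Compacts (CSpace m) := ⟨Metric.closedBall 0 R, isCompact_closedBall _ _⟩
  have hsm : ∀ f : entireFunctions m, ContDiffOn ℝ ∞ (fun y => f.1 (Zt y) * a y) V := fun f =>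
    (contDiff_comp_mul hZ ha f.2).contDiffOn
  let l : entireFunctions m →ₗ[ℂ] ℂ :=
    { toFun := fun f => d.pair (fun y => f.1 (Zt y) * a y)
      map_add' := fun f g => by
        rw [pair_of_smooth _ (hsm f), pair_of_smooth _ (hsm g), pair_of_smooth _ (hsm (f + g)), ← map_add]
        congr 1; ext y
        simp [add_mul]
      map_smul' := fun c f => by
        rw [pair_of_smooth _ (hsm f), pair_of_smooth _ (hsm (c • f)), RingHom.id_apply, ← map_smul]
        congr 1; ext y
        simp [mul_assoc] }
  obtain ⟨T, hT⟩ := exists_factor_of_norm_le (restrictEntire N) l C fun f =>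
    hRC f.1 f.2 _ (norm_nonneg _) fun b hb => (restrictEntire N f).norm_coe_le_norm ⟨b, hb⟩
  let Ψ : P → C(N, ℂ) := fun p => restrictEntire N ⟨Φ p, hΦ p⟩
  -- Joint continuity gives continuity in the sup norm, because N is compact; in Lean this is
  -- currying of continuous maps.
  have hΨc : ContinuousOn Ψ s := by
    rw [continuousOn_iff_continuous_domRestrict]
    let G : C(s × N, ℂ) := ⟨fun q => Φ q.1 q.2, by
      have := continuousOn_iff_continuous_domRestrict.1 hc
      exact this.comp (f := fun q : s × N => ⟨((q.1 : P), (q.2 : CSpace m)), q.1.2, mem_univ _⟩)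
        (by fun_prop)⟩
    exact G.curry.continuous
  obtain ⟨bound, hbi, hbd⟩ := hb R
  have hbd' : ∀ p ∈ s, ‖Ψ p‖ ≤ |bound p| := by
    intro p hp
    refine (ContinuousMap.norm_le _ (abs_nonneg _)).2 fun b => ?_
    exact (hbd p hp b b.2).trans (le_abs_self _)
  have hΨi : Integrable Ψ μ := by
    refine hbi.abs.mono' ?_ ?_
    · rw [← hrs]; exact hΨc.aestronglyMeasurable hs
    · filter_upwards [hsμ] with p hp using hbd' p hp
  have hint : ∫ p, Ψ p ∂μ = restrictEntire N ⟨_, hent⟩ := by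
    ext b
    rw [ContinuousMap.integral_apply hΨi]
    rfl
  have hpair : ∀ p, d.pair (fun y => Φ p (Zt y) * a y) = T (Ψ p) := fun p => (hT ⟨Φ p, hΦ p⟩).symm
  refine ⟨hent, ?_, ?_⟩
  · simp_rw [hpair]; exact T.integrable_comp hΨi
  · simp_rw [hpair]
    rw [T.integral_comp_comm hΨi, hint, hT]
    rfl

end Exchange

end FBI
end

noncomputable section

namespace FBI

/-! ### Some integrals -/

section Integrals

variable {m : ℕ}

/-- The linear term C‖ξ‖ is absorbed by half of the quadratic one, at the cost of a constant; polar
coordinates do the rest. -/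
lemma integrable_rpow_norm_mul_exp_sq (hm : 0 < m) {s c : ℝ} (hs : -(m : ℝ) < s) (hc : 0 < c) (C : ℝ) :
    Integrable fun ξ : RSpace m => ‖ξ‖ ^ s * Real.exp (C * ‖ξ‖ - c * ‖ξ‖ ^ 2) := by
  have : Nonempty (Fin m) := ⟨⟨0, hm⟩⟩
  have h1 : Integrable fun ξ : RSpace m => ‖ξ‖ ^ s * Real.exp (-(c / 2) * ‖ξ‖ ^ 2) := by
    rw [integrable_fun_norm_addHaar volume (f := fun r => r ^ s * Real.exp (-(c / 2) * r ^ 2))]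
    rw [finrank_euclideanSpace_fin]
    refine (integrableOn_rpow_mul_exp_neg_mul_sq (s := (m - 1 : ℝ) + s) (half_pos hc)
      (by linarith)).congr_fun (fun r hr => ?_) measurableSet_Ioi
    have hr0 : (0 : ℝ) < r := hr
    simp only [smul_eq_mul]
    rw [Real.rpow_add hr0, ← Nat.cast_pred hm, Real.rpow_natCast, mul_assoc]
  refine (h1.const_mul (Real.exp (C ^ 2 / (2 * c)))).mono' ?_ (Eventually.of_forall fun ξ => ?_)
  · exact Measurable.aestronglyMeasurable (by fun_prop)
  · rw [Real.norm_of_nonneg (by positivity)]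
    have h2 : C * ‖ξ‖ - c * ‖ξ‖ ^ 2 ≤ C ^ 2 / (2 * c) + -(c / 2) * ‖ξ‖ ^ 2 := by
      have : C ^ 2 / (2 * c) + -(c / 2) * ‖ξ‖ ^ 2 - (C * ‖ξ‖ - c * ‖ξ‖ ^ 2) =
          (C - c * ‖ξ‖) ^ 2 / (2 * c) := by field_simp; ring
      have h3 : 0 ≤ (C - c * ‖ξ‖) ^ 2 / (2 * c) := by positivity
      linarith
    calc ‖ξ‖ ^ s * Real.exp (C * ‖ξ‖ - c * ‖ξ‖ ^ 2)
        ≤ ‖ξ‖ ^ s * Real.exp (C ^ 2 / (2 * c) + -(c / 2) * ‖ξ‖ ^ 2) := by gcongr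
      _ = _ := by rw [Real.exp_add]; ring

lemma integrable_exp_sq (hm : 0 < m) {c : ℝ} (hc : 0 < c) (C : ℝ) :
    Integrable fun ξ : RSpace m => Real.exp (C * ‖ξ‖ - c * ‖ξ‖ ^ 2) := by
  simpa using integrable_rpow_norm_mul_exp_sq hm (s := 0) (by simpa using hm) hc C

lemma integrable_rpow_norm_mul_exp (hm : 0 < m) {s c : ℝ} (hs : -(m : ℝ) < s) (hc : 0 < c) :
    Integrable fun ξ : RSpace m => ‖ξ‖ ^ s * Real.exp (-c * ‖ξ‖) := by
  have : Nonempty (Fin m) := ⟨⟨0, hm⟩⟩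
  rw [integrable_fun_norm_addHaar volume (f := fun r => r ^ s * Real.exp (-c * r))]
  rw [finrank_euclideanSpace_fin]
  refine (integrableOn_rpow_mul_exp_neg_mul_rpow (s := (m - 1 : ℝ) + s) (p := 1)
    (by linarith) one_pos hc).congr_fun (fun r hr => ?_) measurableSet_Ioi
  have hr0 : (0 : ℝ) < r := hr
  simp only [smul_eq_mul, Real.rpow_one]
  rw [Real.rpow_add hr0, ← Nat.cast_pred hm, Real.rpow_natCast, mul_assoc]

lemma integral_rpow_norm_mul_exp {s c a : ℝ} (ha : 0 < a) :
    ∫ ξ : RSpace m, ‖ξ‖ ^ s * Real.exp (-(c * a) * ‖ξ‖) =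
      a ^ (-(m : ℝ) - s) * ∫ ξ : RSpace m, ‖ξ‖ ^ s * Real.exp (-c * ‖ξ‖) := by
  have h1 := Measure.integral_comp_smul (volume : Measure (RSpace m))
    (fun ξ => ‖ξ‖ ^ s * Real.exp (-c * ‖ξ‖)) a
  simp only [norm_smul, Real.norm_of_nonneg ha.le, smul_eq_mul, finrank_euclideanSpace_fin] at h1
  have h2 : ∀ ξ : RSpace m, (a * ‖ξ‖) ^ s * Real.exp (-c * (a * ‖ξ‖)) =
      a ^ s * (‖ξ‖ ^ s * Real.exp (-(c * a) * ‖ξ‖)) := by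
    intro ξ
    rw [Real.mul_rpow ha.le (norm_nonneg _)]
    ring_nf
  simp_rw [h2] at h1
  rw [integral_const_mul, abs_of_pos (by positivity)] at h1
  rw [Real.rpow_sub ha, Real.rpow_neg ha.le, Real.rpow_natCast]
  have : 0 < a ^ s := by positivity
  field_simp at h1 ⊢
  linarith

lemma pow_mul_exp_le (k : ℕ) {x : ℝ} (hx : 0 ≤ x) : x ^ k ≤ k.factorial * Real.exp x := by
  have := Real.pow_div_factorial_le_exp x hx k
  rwa [div_le_iff₀' (by positivity)] at this

/-- Mean value inequality on the half-plane Re ≤ ρ, which is convex and on which the derivative of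
exp is bounded by e^ρ. -/
lemma norm_exp_sub_exp_le {a b : ℂ} {ρ : ℝ} (ha : a.re ≤ ρ) (hb : b.re ≤ ρ) :
    ‖Complex.exp a - Complex.exp b‖ ≤ Real.exp ρ * ‖a - b‖ := by
  refine (convex_halfSpace_re_le ρ).norm_image_sub_le_of_norm_deriv_le
    (fun x _ => Complex.differentiableAt_exp) (fun x hx => ?_) hb ha
  rw [Complex.deriv_exp, Complex.norm_exp]
  exact Real.exp_le_exp.2 hx

/-- Integration of a derivative. -/
lemma integral_deriv_gaussian_eq_zero (hm : 0 < m) {ε : ℝ} (hε : 0 < ε) (l : ℂ) (w : CSpace m)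
    (v : RSpace m) :
    Integrable (fun ξ : RSpace m => (Complex.I * cdot (toC v) w - l * ((inner ℝ ξ v / ‖ξ‖ : ℝ) : ℂ)
      - 2 * ε * ((inner ℝ ξ v : ℝ) : ℂ)) *
        Complex.exp (Complex.I * cdot (toC ξ) w - l * ‖ξ‖ - ε * ‖ξ‖ ^ 2)) ∧
    ∫ ξ : RSpace m, (Complex.I * cdot (toC v) w - l * ((inner ℝ ξ v / ‖ξ‖ : ℝ) : ℂ)
      - 2 * ε * ((inner ℝ ξ v : ℝ) : ℂ)) *
        Complex.exp (Complex.I * cdot (toC ξ) w - l * ‖ξ‖ - ε * ‖ξ‖ ^ 2) = 0 := by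
  have : Nonempty (Fin m) := ⟨⟨0, hm⟩⟩
  let A : RSpace m → ℂ := fun ξ => Complex.I * cdot (toC ξ) w - l * ‖ξ‖ - ε * ‖ξ‖ ^ 2
  have hAc : Continuous A := by
    have : Continuous fun ξ : RSpace m => cdot (toC ξ) w := toC.continuous.cdot continuous_const
    fun_prop
  set c₁ : ℝ := ‖w‖ + ‖l‖ with hc₁
  have hAre : ∀ ξ, (A ξ).re ≤ c₁ * ‖ξ‖ - ε * ‖ξ‖ ^ 2 := by
    intro ξ
    have h1 : (A ξ).re = (Complex.I * cdot (toC ξ) w - l * ‖ξ‖).re - ε * ‖ξ‖ ^ 2 := by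
      simp only [A, Complex.sub_re]
      congr 1
      norm_cast
    have h2 : (Complex.I * cdot (toC ξ) w - l * ‖ξ‖).re ≤ ‖ξ‖ * ‖w‖ + ‖l‖ * ‖ξ‖ := by
      refine (Complex.re_le_norm _).trans ((norm_sub_le _ _).trans ?_)
      rw [norm_mul, norm_mul, Complex.norm_I, one_mul, Complex.norm_real, norm_norm]
      gcongr
      simpa using norm_cdot_le (toC ξ) w
    rw [h1, hc₁]; linarith
  have hAlip : ∀ ξ η, ‖A ξ - A η‖ ≤ (c₁ + ε * (‖ξ‖ + ‖η‖)) * ‖ξ - η‖ := by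
    intro ξ η
    have h1 : A ξ - A η = Complex.I * cdot (toC (ξ - η)) w - l * ((‖ξ‖ - ‖η‖ : ℝ) : ℂ)
        - ε * (((‖ξ‖ - ‖η‖) * (‖ξ‖ + ‖η‖) : ℝ) : ℂ) := by
      simp only [A, map_sub, cdot_sub_left]; push_cast; ring
    rw [h1]
    refine (norm_sub_le _ _).trans ((add_le_add_left (norm_sub_le _ _) _).trans ?_)
    simp only [norm_mul, Complex.norm_I, one_mul, Complex.norm_real, Real.norm_eq_abs,
      abs_of_pos hε]
    have h2 : ‖cdot (toC (ξ - η)) w‖ ≤ ‖ξ - η‖ * ‖w‖ := (norm_cdot_le _ _).trans_eq (by rw [toC.norm_map])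
    have h3 : |‖ξ‖ - ‖η‖| ≤ ‖ξ - η‖ := abs_norm_sub_norm_le ξ η
    have h4 : |‖ξ‖ + ‖η‖| = ‖ξ‖ + ‖η‖ := abs_of_nonneg (by positivity)
    rw [h4]
    calc _ ≤ ‖ξ - η‖ * ‖w‖ + ‖l‖ * ‖ξ - η‖ + ε * (‖ξ - η‖ * (‖ξ‖ + ‖η‖)) := by gcongr
      _ = _ := by rw [hc₁]; ring
  -- By translation invariance the integral of F s does not depend on s. Differentiating at s = 0
  -- under the integral sign gives the identity.
  let F : ℝ → RSpace m → ℂ := fun s ξ => Complex.exp (A (ξ + s • v))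
  set C₁ : ℝ := c₁ * ‖v‖ + ε * ‖v‖ ^ 2 with hC₁
  let bound : RSpace m → ℝ := fun ξ => (c₁ + 2 * ε * ‖v‖ + 2 * ε * ‖ξ‖) * ‖v‖ *
    Real.exp (C₁ + c₁ * ‖ξ‖ - ε / 2 * ‖ξ‖ ^ 2)
  have hbi : Integrable bound := by
    have h0 := (integrable_exp_sq (m := m) hm (half_pos hε) c₁).const_mul
      ((c₁ + 2 * ε * ‖v‖) * ‖v‖ * Real.exp C₁)
    have h1 := (integrable_rpow_norm_mul_exp_sq (m := m) hm (s := 1) (by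
      have : (0 : ℝ) < m := by exact_mod_cast hm
      linarith) (half_pos hε) c₁).const_mul (2 * ε * ‖v‖ * Real.exp C₁)
    refine (h0.add h1).congr (Eventually.of_forall fun ξ => ?_)
    simp only [bound, Pi.add_apply, Real.rpow_one]
    have he : Real.exp (C₁ + c₁ * ‖ξ‖ - ε / 2 * ‖ξ‖ ^ 2) =
        Real.exp C₁ * Real.exp (c₁ * ‖ξ‖ - ε / 2 * ‖ξ‖ ^ 2) := by
      rw [add_sub_assoc]; exact Real.exp_add _ _
    rw [he]
    ring
  have hFint : Integrable (F 0) := by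
    refine (integrable_exp_sq (m := m) hm hε c₁).mono' ?_ (Eventually.of_forall fun ξ => ?_)
    · exact (Complex.continuous_exp.comp (hAc.comp (by fun_prop))).aestronglyMeasurable
    · simp only [F, zero_smul, add_zero]
      rw [Complex.norm_exp]
      exact Real.exp_le_exp.2 (hAre ξ)
  have hc₁0 : 0 ≤ c₁ := by positivity
  -- The Lipschitz form of the theorem is used because ‖ξ + sv‖ is not differentiable when the line
  -- passes through 0; at s = 0 this excludes only ξ = 0.
  have key := hasDerivAt_integral_of_dominated_loc_of_lip (μ := volume) (F := F)
    (F' := fun ξ => (Complex.I * cdot (toC v) w - l * ((inner ℝ ξ v / ‖ξ‖ : ℝ) : ℂ)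
      - 2 * ε * ((inner ℝ ξ v : ℝ) : ℂ)) * Complex.exp (A ξ)) (x₀ := (0 : ℝ)) (bound := bound)
    (Metric.ball_mem_nhds (0 : ℝ) one_pos)
    (Eventually.of_forall fun s =>
      (Complex.continuous_exp.comp (hAc.comp (by fun_prop))).aestronglyMeasurable) hFint ?_ ?_ hbi ?_
  · refine ⟨key.1, key.2.unique ?_⟩
    have hconst : (fun s => ∫ ξ, F s ξ) = fun _ => ∫ ξ, F 0 ξ := by
      funext s
      simp only [F, zero_smul, add_zero]
      exact integral_add_right_eq_self (fun ξ => Complex.exp (A ξ)) (s • v)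
    rw [hconst]
    exact hasDerivAt_const _ _
  · refine Measurable.aestronglyMeasurable (Measurable.mul ?_ ?_)
    · have : Measurable fun ξ : RSpace m => (inner ℝ ξ v : ℝ) := by fun_prop
      fun_prop
    · exact (Complex.continuous_exp.comp hAc).measurable
  · refine Eventually.of_forall fun ξ => LipschitzOnWith.of_dist_le_mul fun s hs s' hs' => ?_
    have hbig : ∀ s ∈ Metric.ball (0 : ℝ) 1, ‖ξ + s • v‖ ≤ ‖ξ‖ + ‖v‖ ∧
        (A (ξ + s • v)).re ≤ C₁ + c₁ * ‖ξ‖ - ε / 2 * ‖ξ‖ ^ 2 := by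
      intro s hs
      rw [mem_ball_zero_iff, Real.norm_eq_abs] at hs
      have hsv : ‖s • v‖ ≤ ‖v‖ := by
        rw [norm_smul, Real.norm_eq_abs]
        nlinarith [norm_nonneg v]
      have h1 : ‖ξ + s • v‖ ≤ ‖ξ‖ + ‖v‖ := (norm_add_le _ _).trans (by gcongr)
      refine ⟨h1, (hAre _).trans ?_⟩
      have h2 : ‖ξ‖ ≤ ‖ξ + s • v‖ + ‖v‖ := by
        have := norm_sub_le (ξ + s • v) (s • v)
        rw [add_sub_cancel_right] at this
        linarith
      have h3 : ‖ξ‖ ^ 2 ≤ 2 * ‖ξ + s • v‖ ^ 2 + 2 * ‖v‖ ^ 2 := by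
        nlinarith [norm_nonneg ξ, sq_nonneg (‖ξ + s • v‖ - ‖v‖)]
      have h4 : c₁ * ‖ξ + s • v‖ ≤ c₁ * (‖ξ‖ + ‖v‖) := by gcongr
      have h5 : ε * ‖ξ‖ ^ 2 ≤ ε * (2 * ‖ξ + s • v‖ ^ 2 + 2 * ‖v‖ ^ 2) := by gcongr
      rw [hC₁]; linarith
    rw [dist_eq_norm, dist_eq_norm]
    refine (norm_exp_sub_exp_le (hbig s hs).2 (hbig s' hs').2).trans ?_
    have hb0 : 0 ≤ bound ξ := by positivity
    rw [Real.coe_nnabs, abs_of_nonneg hb0]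
    have h6 := hAlip (ξ + s • v) (ξ + s' • v)
    rw [add_sub_add_left_eq_sub, ← sub_smul, norm_smul] at h6
    calc _ ≤ Real.exp (C₁ + c₁ * ‖ξ‖ - ε / 2 * ‖ξ‖ ^ 2) *
          ((c₁ + ε * ((‖ξ‖ + ‖v‖) + (‖ξ‖ + ‖v‖))) * (‖s - s'‖ * ‖v‖)) := by
          refine mul_le_mul_of_nonneg_left (h6.trans ?_) (Real.exp_nonneg _)
          gcongr
          · exact (hbig s hs).1
          · exact (hbig s' hs').1
      _ = bound ξ * ‖s - s'‖ := by simp only [bound]; ring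
  · have h0 : ∀ᵐ ξ : RSpace m, ξ ≠ 0 := by
      simp [ae_iff, measure_singleton]
    filter_upwards [h0] with ξ hξ
    have hline : HasDerivAt (fun s : ℝ => ξ + s • v) v 0 := by
      simpa using ((hasDerivAt_id (0 : ℝ)).smul_const v).const_add ξ
    have hsq : HasDerivAt (fun s : ℝ => ‖ξ + s • v‖ ^ 2) (2 * inner ℝ ξ v) 0 := by
      simpa using hline.norm_sq
    have hn : HasDerivAt (fun s : ℝ => ‖ξ + s • v‖) (inner ℝ ξ v / ‖ξ‖) 0 := by
      have h1 := hsq.sqrt (by simpa using hξ)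
      simp only [Real.sqrt_sq (norm_nonneg _), zero_smul, add_zero] at h1
      convert h1 using 1
      field_simp
    have hcd : HasDerivAt (fun s : ℝ => cdot (toC (ξ + s • v)) w) (cdot (toC v) w) 0 := by
      have h2 : (fun s : ℝ => cdot (toC (ξ + s • v)) w) = fun s : ℝ =>
          cdot (toC ξ) w + (s : ℂ) * cdot (toC v) w := by
        funext s
        rw [map_add, map_smul, cdot_add_left, ← Complex.coe_smul, cdot_smul_left]
      rw [h2]
      simpa using ((hasDerivAt_id (0 : ℝ)).ofReal_comp.mul_const (cdot (toC v) w)).const_add (cdot (toC ξ) w)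
    have hA : HasDerivAt (fun s : ℝ => A (ξ + s • v)) (Complex.I * cdot (toC v) w
        - l * ((inner ℝ ξ v / ‖ξ‖ : ℝ) : ℂ) - 2 * ε * ((inner ℝ ξ v : ℝ) : ℂ)) 0 := by
      have h3 := ((hcd.const_mul Complex.I).sub (hn.ofReal_comp.const_mul l)).sub
        (hsq.ofReal_comp.const_mul (ε : ℂ))
      refine (h3.congr_deriv ?_).congr_of_eventuallyEq (Eventually.of_forall fun s => ?_)
      · push_cast; ring
      · simp [A]
    have h4 := hA.cexp
    simp only [zero_smul, add_zero] at h4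
    rw [mul_comm]
    exact h4

/-- Integration by parts in the direction of `w`. -/
lemma integral_deriv_gaussian_self (hm : 0 < m) {ε : ℝ} (hε : 0 < ε) (l : ℂ) (w : CSpace m) :
    ∫ ξ : RSpace m, (Complex.I * cdot w w - l * (cdot (toC ξ) w / ‖ξ‖) - 2 * ε * cdot (toC ξ) w) *
        Complex.exp (Complex.I * cdot (toC ξ) w - l * ‖ξ‖ - ε * ‖ξ‖ ^ 2) = 0 := by
  -- Translations exist only in real directions, so the identity is used for the real and imaginary
  -- parts of w and recombined.
  obtain ⟨p, q, hw⟩ := exists_eq_add_I w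
  obtain ⟨h1i, h1⟩ := integral_deriv_gaussian_eq_zero hm hε l w p
  obtain ⟨h2i, h2⟩ := integral_deriv_gaussian_eq_zero hm hε l w q
  have h3 := integral_add h1i (h2i.const_mul Complex.I)
  rw [integral_const_mul, h1, h2, mul_zero, add_zero] at h3
  rw [← h3]
  refine integral_congr_ae (Eventually.of_forall fun ξ => ?_)
  have e1 : cdot w w = cdot (toC p) w + Complex.I * cdot (toC q) w := by
    conv_lhs => rw [hw, cdot_add_left, cdot_smul_left, ← hw]
  have e2 : cdot (toC ξ) w = ((inner ℝ ξ p : ℝ) : ℂ) + Complex.I * ((inner ℝ ξ q : ℝ) : ℂ) := by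
    rw [← cdot_toC, ← cdot_toC]
    conv_lhs => rw [hw, cdot_add_right, cdot_smul_right]
  simp only
  rw [e1, show l * (cdot (toC ξ) w / ‖ξ‖) = l * ((inner ℝ ξ p / ‖ξ‖ : ℝ) : ℂ) +
      Complex.I * (l * ((inner ℝ ξ q / ‖ξ‖ : ℝ) : ℂ)) by rw [e2]; push_cast; ring,
    show 2 * ε * cdot (toC ξ) w = 2 * ε * ((inner ℝ ξ p : ℝ) : ℂ) +
      Complex.I * (2 * ε * ((inner ℝ ξ q : ℝ) : ℂ)) by rw [e2]; ring]
  ring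

end Integrals

end FBI
end

noncomputable section

namespace FBI

/-! ### The kernels of the inversion formula -/

section Kernel

variable {m : ℕ}

/-- The kernel `(2π)^{-m} ∫ e^{iξ·w - |ξ|⟨w⟩²/2 - ε|ξ|²} Δ(w/2, ξ) dξ`. -/
def kern (ε : ℝ) (w : CSpace m) : ℂ :=
  ((2 * Real.pi : ℂ) ^ m)⁻¹ * ∫ ξ : RSpace m,
    Complex.exp (Complex.I * cdot (toC ξ) w - cdot w w / 2 * ‖ξ‖ - ε * ‖ξ‖ ^ 2) *
      (1 + Complex.I * cdot (toC ξ) w / (2 * ‖ξ‖))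

/-- The Gaussian kernel `(2π)^{-m} ∫ e^{iξ·w - ε|ξ|²} dξ`. -/
def gauss (ε : ℝ) (w : CSpace m) : ℂ :=
  ((2 * Real.pi : ℂ) ^ m)⁻¹ * ∫ ξ : RSpace m,
    Complex.exp (Complex.I * cdot (toC ξ) w - ε * ‖ξ‖ ^ 2)

lemma norm_exp_le (l : ℂ) (ε : ℝ) (w : CSpace m) (ξ : RSpace m) :
    ‖Complex.exp (Complex.I * cdot (toC ξ) w - l * ‖ξ‖ - ε * ‖ξ‖ ^ 2)‖ ≤
      Real.exp ((‖w‖ + ‖l‖) * ‖ξ‖ - ε * ‖ξ‖ ^ 2) := by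
  rw [Complex.norm_exp]
  refine Real.exp_le_exp.2 ?_
  have h1 : (Complex.I * cdot (toC ξ) w - l * ‖ξ‖ - ε * ‖ξ‖ ^ 2 : ℂ).re =
      (Complex.I * cdot (toC ξ) w - l * ‖ξ‖).re - ε * ‖ξ‖ ^ 2 := by
    rw [Complex.sub_re]
    congr 1
    norm_cast
  have h2 : (Complex.I * cdot (toC ξ) w - l * ‖ξ‖).re ≤ ‖ξ‖ * ‖w‖ + ‖l‖ * ‖ξ‖ := by
    refine (Complex.re_le_norm _).trans ((norm_sub_le _ _).trans ?_)
    rw [norm_mul, norm_mul, Complex.norm_I, one_mul, Complex.norm_real, norm_norm]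
    gcongr
    exact (norm_cdot_le _ _).trans_eq (by rw [toC.norm_map])
  rw [h1]; linarith

lemma continuous_exp_kernel (l : ℂ) (ε : ℝ) (w : CSpace m) : Continuous fun ξ : RSpace m =>
    Complex.exp (Complex.I * cdot (toC ξ) w - l * ‖ξ‖ - ε * ‖ξ‖ ^ 2) := by
  have : Continuous fun ξ : RSpace m => cdot (toC ξ) w := toC.continuous.cdot continuous_const
  fun_prop

lemma integrable_exp_kernel (hm : 0 < m) {ε : ℝ} (hε : 0 < ε) (l : ℂ) (w : CSpace m) :
    Integrable fun ξ : RSpace m =>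
      Complex.exp (Complex.I * cdot (toC ξ) w - l * ‖ξ‖ - ε * ‖ξ‖ ^ 2) :=
  (integrable_exp_sq (m := m) hm hε _).mono' (continuous_exp_kernel l ε w).aestronglyMeasurable
    (Eventually.of_forall fun ξ => norm_exp_le l ε w ξ)

lemma integrable_cdot_mul_exp_kernel (hm : 0 < m) {ε : ℝ} (hε : 0 < ε) (l : ℂ) (w : CSpace m) :
    Integrable fun ξ : RSpace m => cdot (toC ξ) w *
      Complex.exp (Complex.I * cdot (toC ξ) w - l * ‖ξ‖ - ε * ‖ξ‖ ^ 2) := by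
  have h1 := (integrable_rpow_norm_mul_exp_sq (m := m) hm (s := 1) (by
      have : (0 : ℝ) < m := by exact_mod_cast hm
      linarith) hε (‖w‖ + ‖l‖)).const_mul ‖w‖
  refine h1.mono' ?_ (Eventually.of_forall fun ξ => ?_)
  · exact ((toC.continuous.cdot continuous_const).mul (continuous_exp_kernel l ε w)).aestronglyMeasurable
  · rw [norm_mul, Real.rpow_one]
    have := norm_cdot_le (toC ξ) w
    rw [toC.norm_map] at this
    calc _ ≤ (‖ξ‖ * ‖w‖) * Real.exp ((‖w‖ + ‖l‖) * ‖ξ‖ - ε * ‖ξ‖ ^ 2) := by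
          gcongr; exact norm_exp_le l ε w ξ
      _ = _ := by ring

lemma norm_cdot_div_le (ξ : RSpace m) (w : CSpace m) : ‖cdot (toC ξ) w / ‖ξ‖‖ ≤ ‖w‖ := by
  rw [norm_div, Complex.norm_real, norm_norm]
  refine div_le_of_le_mul₀ (norm_nonneg _) (norm_nonneg _) ?_
  refine (norm_cdot_le _ _).trans_eq ?_
  rw [toC.norm_map, mul_comm]

lemma integrable_cdot_div_mul_exp_kernel (hm : 0 < m) {ε : ℝ} (hε : 0 < ε) (l : ℂ) (w : CSpace m) :
    Integrable fun ξ : RSpace m => cdot (toC ξ) w / ‖ξ‖ *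
      Complex.exp (Complex.I * cdot (toC ξ) w - l * ‖ξ‖ - ε * ‖ξ‖ ^ 2) := by
  refine (integrable_exp_kernel hm hε l w).bdd_mul (c := ‖w‖) ?_
    (Eventually.of_forall fun ξ => norm_cdot_div_le ξ w)
  have : Continuous fun ξ : RSpace m => cdot (toC ξ) w := toC.continuous.cdot continuous_const
  exact Measurable.aestronglyMeasurable (by have := this.measurable; fun_prop)

/-- A weighted Gaussian integral, after integration by parts. -/
lemma integral_exp_kernel_eq (hm : 0 < m) {ε : ℝ} (hε : 0 < ε) (l : ℂ) {w : CSpace m}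
    (hw : cdot w w ≠ 0) :
    ∫ ξ : RSpace m, Complex.exp (Complex.I * cdot (toC ξ) w - l * ‖ξ‖ - ε * ‖ξ‖ ^ 2) *
      (1 + Complex.I * l / cdot w w * (cdot (toC ξ) w / ‖ξ‖)) =
    2 * ε / (Complex.I * cdot w w) * ∫ ξ : RSpace m, cdot (toC ξ) w *
      Complex.exp (Complex.I * cdot (toC ξ) w - l * ‖ξ‖ - ε * ‖ξ‖ ^ 2) := by
  have h0 := integral_deriv_gaussian_self hm hε l w
  have hi1 := integrable_exp_kernel hm hε l w
  have hi2 := integrable_cdot_mul_exp_kernel hm hε l w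
  have hi3 := integrable_cdot_div_mul_exp_kernel hm hε l w
  rw [← integral_const_mul, ← sub_eq_zero, ← integral_sub]
  · rw [← mul_zero (1 / (Complex.I * cdot w w)), ← h0, ← integral_const_mul]
    refine integral_congr_ae (Eventually.of_forall fun ξ => ?_)
    have hI : Complex.I ≠ 0 := Complex.I_ne_zero
    field_simp
    ring_nf
    rw [Complex.I_sq]
    ring
  · refine ((hi1).add (hi3.const_mul (Complex.I * l / cdot w w))).congr
      (Eventually.of_forall fun ξ => ?_)
    simp only [Pi.add_apply]; ring
  · exact hi2.const_mul _

/-- For l = w·w/2 the weight created by the integration by parts is exactly the factor 1 +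
iξ·w/(2|ξ|) of the kernel. This is what the determinant Δ is for: up to the regularization, the
integrand is a divergence, and a factor ε comes out. -/
lemma kern_eq (hm : 0 < m) {ε : ℝ} (hε : 0 < ε) {w : CSpace m} (hw : cdot w w ≠ 0) :
    kern ε w = ((2 * Real.pi : ℂ) ^ m)⁻¹ * (2 * ε / (Complex.I * cdot w w)) *
      ∫ ξ : RSpace m, cdot (toC ξ) w *
        Complex.exp (Complex.I * cdot (toC ξ) w - cdot w w / 2 * ‖ξ‖ - ε * ‖ξ‖ ^ 2) := by
  rw [kern, mul_assoc, ← integral_exp_kernel_eq hm hε _ hw]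
  congr 1
  refine integral_congr_ae (Eventually.of_forall fun ξ => ?_)
  simp only
  congr 2
  field_simp

/-- The case l = 0 of the same integration by parts. The prefactor agrees with that of `kern`, so
the two kernels differ only through the term w·w|ξ|/2 of the exponent. The term 0 * ‖ξ‖ is kept to
match. -/
lemma gauss_eq_integral (hm : 0 < m) {ε : ℝ} (hε : 0 < ε) {w : CSpace m} (hw : cdot w w ≠ 0) :
    gauss ε w = ((2 * Real.pi : ℂ) ^ m)⁻¹ * (2 * ε / (Complex.I * cdot w w)) *
      ∫ ξ : RSpace m, cdot (toC ξ) w *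
        Complex.exp (Complex.I * cdot (toC ξ) w - 0 * ‖ξ‖ - ε * ‖ξ‖ ^ 2) := by
  rw [gauss, mul_assoc, ← integral_exp_kernel_eq hm hε _ hw]
  simp

lemma gauss_eq {ε : ℝ} (hε : 0 < ε) (w : CSpace m) :
    gauss ε w = (((4 * Real.pi * ε) ^ (-(m / 2 : ℝ)) : ℝ) : ℂ) *
      Complex.exp (-(cdot w w / (4 * ε))) := by
  have h1 : ∫ ξ : RSpace m, Complex.exp (Complex.I * cdot (toC ξ) w - ε * ‖ξ‖ ^ 2) =
      (Real.pi / ε) ^ (m / 2 : ℂ) * Complex.exp (-(cdot w w / (4 * ε))) := by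
    have h2 := GaussianFourier.integral_cexp_neg_mul_sum_add (ι := Fin m) (b := ε) (by simpa using hε)
      (fun j => Complex.I * w j)
    have h4 : ∑ i, (Complex.I * w i) ^ 2 = -cdot w w := by
      rw [cdot, ← Finset.sum_neg_distrib]
      exact Finset.sum_congr rfl fun i _ => by linear_combination (w i) ^ 2 * Complex.I_sq
    rw [Fintype.card_fin, h4, neg_div] at h2
    rw [← h2, ← (EuclideanSpace.volume_preserving_symm_measurableEquiv_toLp (Fin m)).symm.integral_comp
      (MeasurableEquiv.measurableEmbedding _)]
    refine integral_congr_ae (Eventually.of_forall fun v => ?_)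
    have h5 : (‖(WithLp.toLp 2 v : RSpace m)‖ : ℂ) ^ 2 = ∑ i, (v i : ℂ) ^ 2 := by
      norm_cast
      rw [EuclideanSpace.real_norm_sq_eq]
    have h6 : cdot (toC (WithLp.toLp 2 v)) w = ∑ i, (v i : ℂ) * w i := by
      simp [cdot, toC_apply]
    change Complex.exp (Complex.I * cdot (toC (WithLp.toLp 2 v)) w -
      ε * (‖(WithLp.toLp 2 v : RSpace m)‖ : ℂ) ^ 2) = _
    rw [h5, h6, Finset.mul_sum]
    congr 1
    rw [neg_mul, sub_eq_neg_add]
    congr 1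
    exact Finset.sum_congr rfl fun i _ => by ring
  have hpos : (0 : ℝ) < 4 * Real.pi * ε := by positivity
  rw [gauss, h1, ← mul_assoc]
  congr 1
  have h3 : ((Real.pi : ℂ) / ε) ^ (m / 2 : ℂ) = (((Real.pi / ε) ^ (m / 2 : ℝ) : ℝ) : ℂ) := by
    rw [Complex.ofReal_cpow (by positivity)]; push_cast; rfl
  rw [h3]
  norm_cast
  rw [Real.rpow_neg hpos.le, inv_mul_eq_iff_eq_mul₀ (by positivity)]
  rw [← div_eq_mul_inv, eq_div_iff (by positivity), ← Real.mul_rpow (by positivity) hpos.le]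
  rw [show Real.pi / ε * (4 * Real.pi * ε) = (2 * Real.pi) ^ 2 by field_simp; ring,
    ← Real.rpow_natCast (2 * Real.pi) 2, ← Real.rpow_mul (by positivity)]
  rw [show ((2 : ℕ) : ℝ) * (m / 2) = m by push_cast; ring, Real.rpow_natCast]

end Kernel

end FBI
end

noncomputable section

namespace FBI

/-! ### Contours in the cone `|Im ζ| < |Re ζ|` -/

section ConeShift

variable {m : ℕ}

lemma convex_abs_re_add_abs_im_lt (ρ : ℝ) : Convex ℝ {τ : ℂ | |τ.re| + |τ.im| < ρ} := by
  intro x hx y hy a b ha hb hab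
  simp only [mem_ofPred_eq, Complex.add_re, Complex.add_im, Complex.real_smul, Complex.mul_re,
    Complex.ofReal_re, Complex.ofReal_im, zero_mul, sub_zero, Complex.mul_im, add_zero] at *
  have h1 := abs_add_le (a * x.re) (b * y.re)
  have h2 := abs_add_le (a * x.im) (b * y.im)
  simp only [abs_mul, abs_of_nonneg ha, abs_of_nonneg hb] at h1 h2
  have h3 : a * (|x.re| + |x.im|) + b * (|y.re| + |y.im|) < ρ := by
    rcases ha.eq_or_lt with rfl | ha'
    · have : b = 1 := by linarith
      subst this; linarith
    · have : a * (|x.re| + |x.im|) < a * ρ := by gcongr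
      have : b * (|y.re| + |y.im|) ≤ b * ρ := by gcongr
      have : a * ρ + b * ρ = ρ := by rw [← add_mul, hab, one_mul]
      linarith
  linarith

/-- Since g(0) = 0 and K < 1, all the intermediate contours p + τ g(p) stay in one closed cone |q| ≤
σ|p| with σ < 1, where F has uniform Gaussian decay. -/
theorem integral_cone_shift (hm : 0 < m) {g : RSpace m → RSpace m} {K : NNReal} (hK : K < 1)
    (hg : LipschitzWith K g) (hg0 : g 0 = 0) (hgd : ∀ p ≠ 0, DifferentiableAt ℝ g p)
    {F : CSpace m → ℂ} (hF : DifferentiableOn ℂ F (cone m))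
    (hFb : ∀ ρ : ℝ, 0 ≤ ρ → ρ < 1 → ∃ A C c : ℝ, 0 ≤ A ∧ 0 ≤ C ∧ 0 < c ∧ ∀ p q : RSpace m,
      ‖q‖ ≤ ρ * ‖p‖ → ‖F (toC p + Complex.I • toC q)‖ ≤ A * Real.exp (C * ‖p‖ - c * ‖p‖ ^ 2)) :
    ∫ p, F (toC p + Complex.I • toC (g p)) * (1 + Complex.I • jacC g p).det = ∫ p, F (toC p) := by
  have hK0 : (0 : ℝ) ≤ K := K.2
  have hK1 : (K : ℝ) < 1 := by exact_mod_cast hK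
  -- Chosen so that r > 1, which puts τ = i in the domain |Re τ| + |Im τ| < r, while σ = Kr is still
  -- less than 1. The ℓ¹ shape of the domain is adapted to σ: K|Im τ| ≤ σ − K|Re τ| ≤ σ(1 − K|Re
  -- τ|).
  set r : ℝ := 2 / (1 + K) with hr
  set σ : ℝ := 2 * K / (1 + K) with hσ
  have hσ0 : 0 ≤ σ := by positivity
  have hσ1 : σ < 1 := by rw [hσ, div_lt_one (by positivity)]; linarith
  have hr1 : 1 < r := by rw [hr, lt_div_iff₀ (by positivity)]; linarith
  have hrσ : K * r = σ := by rw [hr, hσ]; ring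
  have hr2 : r ≤ 2 := by rw [hr, div_le_iff₀ (by positivity)]; linarith
  obtain ⟨A, C, c, hA, hC, hc, hb⟩ := hFb σ hσ0 hσ1
  have hgp : ∀ p, ‖g p‖ ≤ K * ‖p‖ := fun p => by simpa [hg0] using hg.norm_sub_le p 0
  have key : ∀ τ : ℂ, |τ.re| + |τ.im| < r → ∀ p, ∃ p' q' : RSpace m,
      toC p + τ • toC (g p) = toC p' + Complex.I • toC q' ∧ ‖q'‖ ≤ σ * ‖p'‖ ∧
      (1 - σ) * ‖p‖ ≤ ‖p'‖ ∧ ‖p'‖ ≤ 2 * ‖p‖ := by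
    intro τ hτ p
    have h1 : K * (|τ.re| + |τ.im|) ≤ σ := by rw [← hrσ]; gcongr
    have h2 : ‖τ.re • g p‖ ≤ |τ.re| * K * ‖p‖ := by
      rw [norm_smul, Real.norm_eq_abs, mul_assoc]; gcongr; exact hgp p
    have h3 : ‖τ.im • g p‖ ≤ |τ.im| * K * ‖p‖ := by
      rw [norm_smul, Real.norm_eq_abs, mul_assoc]; gcongr; exact hgp p
    have h4 : ‖p‖ - ‖τ.re • g p‖ ≤ ‖p + τ.re • g p‖ := by
      have := norm_sub_norm_le p (-(τ.re • g p))
      rwa [norm_neg, sub_neg_eq_add] at this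
    have h5 := norm_add_le p (τ.re • g p)
    have hp := norm_nonneg p
    have h6 : K * |τ.re| * ‖p‖ + K * |τ.im| * ‖p‖ ≤ σ * ‖p‖ := by
      rw [← add_mul, ← mul_add]; gcongr
    have h7 : 0 ≤ K * |τ.re| * ‖p‖ := by positivity
    have h8 : 0 ≤ K * |τ.im| * ‖p‖ := by positivity
    refine ⟨p + τ.re • g p, τ.im • g p, ?_, ?_, ?_, ?_⟩
    · ext j
      simp only [PiLp.add_apply, PiLp.smul_apply, toC_apply, smul_eq_mul]
      push_cast
      linear_combination (-(g p j : ℂ)) * (Complex.re_add_im τ)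
    · have h9 : σ * (‖p‖ - K * |τ.re| * ‖p‖) ≤ σ * ‖p + τ.re • g p‖ := by
        gcongr; linarith
      nlinarith
    · linarith
    · nlinarith
  -- The vertex 0 is removed: it is not in the cone, and g need not be differentiable there.
  refine integral_contour_shift (s := {0}ᶜ) (U := cone m) (D := {τ : ℂ | |τ.re| + |τ.im| < r})
    (R := r) (bound := fun p => A * Real.exp ((2 * C) * ‖p‖ - (c * (1 - σ) ^ 2) * ‖p‖ ^ 2))
    hm hg (by simp) (fun p hp => hgd p hp) hF ?_ (convex_abs_re_add_abs_im_lt r).isPreconnected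
    ?_ ?_ ?_ ?_ ?_ ?_
  · exact isOpen_lt (by fun_prop) continuous_const
  · simp; positivity
  · simpa using hr1
  · intro τ hτ
    exact (Complex.norm_le_abs_re_add_abs_im τ).trans (le_of_lt hτ)
  · intro τ hτ p hp
    obtain ⟨p', q', h, h1, h2, h3⟩ := key τ hτ p
    rw [h]
    refine mem_cone_of_norm_le hσ0 hσ1 ?_ h1
    have : 0 < ‖p‖ := norm_pos_iff.2 hp
    rw [← norm_pos_iff]
    refine lt_of_lt_of_le ?_ h2
    have : 0 < 1 - σ := by linarith
    positivity
  · exact (integrable_exp_sq hm (by have : 0 < 1 - σ := by linarith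
                                    positivity) _).const_mul A
  · intro τ hτ p hp
    obtain ⟨p', q', h, h1, h2, h3⟩ := key τ hτ p
    rw [h]
    refine (hb p' q' h1).trans ?_
    gcongr A * Real.exp ?_
    have h4 : ((1 - σ) * ‖p‖) ^ 2 ≤ ‖p'‖ ^ 2 :=
      pow_le_pow_left₀ (by have : 0 < 1 - σ := by linarith
                           positivity) h2 2
    nlinarith [mul_le_mul_of_nonneg_left h3 hC, mul_le_mul_of_nonneg_left h4 hc.le]

/-- The integrand of the kernels after integration by parts. -/
def expInt (l : ℂ) (ε : ℝ) (w ζ : CSpace m) : ℂ :=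
  cdot ζ w * Complex.exp (Complex.I * cdot ζ w - l * bracket ζ - ε * cdot ζ ζ)

lemma expInt_toC (l : ℂ) (ε : ℝ) (w : CSpace m) (ξ : RSpace m) : expInt l ε w (toC ξ) =
    cdot (toC ξ) w * Complex.exp (Complex.I * cdot (toC ξ) w - l * ‖ξ‖ - ε * ‖ξ‖ ^ 2) := by
  rw [expInt, bracket_toC, cdot_toC ξ ξ, real_inner_self_eq_norm_sq]
  push_cast; rfl

lemma differentiableOn_expInt (l : ℂ) (ε : ℝ) (w : CSpace m) :
    DifferentiableOn ℂ (expInt l ε w) (cone m) := by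
  intro ζ hζ
  have h1 : DifferentiableAt ℂ (fun ζ => cdot ζ w) ζ :=
    differentiableAt_id.cdot (differentiableAt_const w)
  have h2 : DifferentiableAt ℂ (fun ζ : CSpace m => cdot ζ ζ) ζ :=
    differentiableAt_id.cdot differentiableAt_id
  have h3 : DifferentiableAt ℂ bracket ζ :=
    (differentiableOn_bracket ζ hζ).differentiableAt (isOpen_cone.mem_nhds hζ)
  refine DifferentiableAt.differentiableWithinAt ?_
  unfold expInt
  exact h1.mul (((h1.const_mul Complex.I).sub (h3.const_mul l)).sub (h2.const_mul (ε : ℂ))).cexp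

lemma re_exponent_le {ρ : ℝ} {ε : ℝ} (hε : 0 ≤ ε) {p q : RSpace m} (hq : ‖q‖ ≤ ρ * ‖p‖) :
    (-(ε * cdot (toC p + Complex.I • toC q) (toC p + Complex.I • toC q)) : ℂ).re ≤
      -(ε * (1 - ρ ^ 2) * ‖p‖ ^ 2) := by
  rw [Complex.neg_re, Complex.re_ofReal_mul]
  have := mul_le_mul_of_nonneg_left (re_cdot_self_ge hq) hε
  linarith

lemma norm_expInt_le {l : ℂ} {L : ℝ} (hl : ‖l‖ ≤ L) {ε : ℝ} (hε : 0 ≤ ε) (w : CSpace m) {ρ : ℝ}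
    (hρ1 : ρ < 1) {p q : RSpace m} (hq : ‖q‖ ≤ ρ * ‖p‖) :
    ‖expInt l ε w (toC p + Complex.I • toC q)‖ ≤
      ‖w‖ * Real.exp (2 * (1 + ‖w‖ + L) * ‖p‖ - ε * (1 - ρ ^ 2) * ‖p‖ ^ 2) := by
  have h1 := re_exponent_le hε hq
  have h2 := norm_add_I_le hq hρ1
  set ζ := toC p + Complex.I • toC q
  have hζ := norm_nonneg ζ
  have hL : 0 ≤ L := (norm_nonneg l).trans hl
  rw [expInt, norm_mul, Complex.norm_exp]
  have h3 : (Complex.I * cdot ζ w - l * bracket ζ - ε * cdot ζ ζ).re ≤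
      ‖ζ‖ * ‖w‖ + L * ‖ζ‖ - ε * (1 - ρ ^ 2) * ‖p‖ ^ 2 := by
    have e1 : (Complex.I * cdot ζ w - l * bracket ζ).re ≤ ‖ζ‖ * ‖w‖ + L * ‖ζ‖ := by
      refine (Complex.re_le_norm _).trans ((norm_sub_le _ _).trans ?_)
      rw [norm_mul, norm_mul, Complex.norm_I, one_mul]
      gcongr
      · exact norm_cdot_le _ _
      · exact norm_bracket_le _
    rw [Complex.sub_re]
    rw [Complex.neg_re] at h1
    linarith
  calc ‖cdot ζ w‖ * Real.exp (Complex.I * cdot ζ w - l * bracket ζ - ε * cdot ζ ζ).re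
      ≤ (‖w‖ * Real.exp ‖ζ‖) * Real.exp (‖ζ‖ * ‖w‖ + L * ‖ζ‖ - ε * (1 - ρ ^ 2) * ‖p‖ ^ 2) := by
        gcongr
        refine (norm_cdot_le _ _).trans ?_
        rw [mul_comm]
        gcongr
        linarith [Real.add_one_le_exp ‖ζ‖]
    _ = ‖w‖ * Real.exp (‖ζ‖ + (‖ζ‖ * ‖w‖ + L * ‖ζ‖ - ε * (1 - ρ ^ 2) * ‖p‖ ^ 2)) := by
        rw [mul_assoc, ← Real.exp_add]
    _ ≤ _ := by
        gcongr
        nlinarith [mul_le_mul_of_nonneg_left h2 (by positivity : 0 ≤ 1 + ‖w‖ + L)]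

lemma integral_expInt_shift (hm : 0 < m) {g : RSpace m → RSpace m} {K : NNReal} (hK : K < 1)
    (hg : LipschitzWith K g) (hg0 : g 0 = 0) (hgd : ∀ p ≠ 0, DifferentiableAt ℝ g p)
    {ε : ℝ} (hε : 0 < ε) (l : ℂ) (w : CSpace m) :
    ∫ p, expInt l ε w (toC p + Complex.I • toC (g p)) * (1 + Complex.I • jacC g p).det =
      ∫ p, expInt l ε w (toC p) := by
  refine integral_cone_shift hm hK hg hg0 hgd (differentiableOn_expInt l ε w) fun ρ hρ0 hρ1 => ?_
  exact ⟨‖w‖, 2 * (1 + ‖w‖ + ‖l‖), ε * (1 - ρ ^ 2), norm_nonneg _, by positivity, mul_pos hε (by nlinarith), fun p q hq =>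
    norm_expInt_le (le_refl ‖l‖) hε.le w hρ1 hq⟩

/-- The difference is moved as a single integrand, so that the two exponentials can be compared
pointwise on the new contour. -/
lemma integral_expInt_sub_shift (hm : 0 < m) {g : RSpace m → RSpace m} {K : NNReal} (hK : K < 1)
    (hg : LipschitzWith K g) (hg0 : g 0 = 0) (hgd : ∀ p ≠ 0, DifferentiableAt ℝ g p)
    {ε : ℝ} (hε : 0 < ε) (l l' : ℂ) (w : CSpace m) :
    ∫ p, (expInt l ε w (toC p + Complex.I • toC (g p)) - expInt l' ε w (toC p + Complex.I • toC (g p)))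
        * (1 + Complex.I • jacC g p).det =
      ∫ p, (expInt l ε w (toC p) - expInt l' ε w (toC p)) := by
  refine integral_cone_shift hm hK hg hg0 hgd (F := fun ζ => expInt l ε w ζ - expInt l' ε w ζ)
    ((differentiableOn_expInt l ε w).sub (differentiableOn_expInt l' ε w)) fun ρ hρ0 hρ1 => ?_
  refine ⟨‖w‖ + ‖w‖, 2 * (1 + ‖w‖ + (‖l‖ + ‖l'‖)), ε * (1 - ρ ^ 2), by positivity, by positivity,
    mul_pos hε (by nlinarith), fun p q hq => ?_⟩
  refine (norm_sub_le _ _).trans ?_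
  rw [add_mul]
  exact add_le_add (norm_expInt_le (by simp) hε.le w hρ1 hq)
    (norm_expInt_le (by simp) hε.le w hρ1 hq)

end ConeShift

end FBI
end

noncomputable section

namespace FBI

/-! ### Estimates of the kernels -/

section Estimates

variable {m : ℕ}

lemma cdot_self_ne_zero {r s : RSpace m} (hr : r ≠ 0) {K : ℝ} (hK0 : 0 ≤ K) (hK1 : K < 1)
    (hs : ‖s‖ ≤ K * ‖r‖) :
    cdot (toC r + Complex.I • toC s) (toC r + Complex.I • toC s) ≠ 0 := by
  have h := mem_cone_of_norm_le hK0 hK1 hr hs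
  intro h0
  have h1 : 0 < (cdot (toC r + Complex.I • toC s) (toC r + Complex.I • toC s)).re := h
  simp [h0] at h1

/-- From Re(w·w) ≥ (1 − K²)|r|² for w = r + is: the prefactor left by the integration by parts is of
size ε/|r|². -/
lemma norm_prefactor_le {r s : RSpace m} (hr : r ≠ 0) {K : ℝ} (hK0 : 0 ≤ K) (hK1 : K < 1)
    (hs : ‖s‖ ≤ K * ‖r‖) {ε : ℝ} (hε : 0 < ε) :
    ‖((2 * Real.pi : ℂ) ^ m)⁻¹ * (2 * ε / (Complex.I *
      cdot (toC r + Complex.I • toC s) (toC r + Complex.I • toC s)))‖ ≤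
      2 * ((2 * Real.pi) ^ m)⁻¹ / (1 - K ^ 2) * (ε / ‖r‖ ^ 2) := by
  have hr' : 0 < ‖r‖ := norm_pos_iff.2 hr
  have hK2 : 0 < 1 - K ^ 2 := by nlinarith
  have h1 : (1 - K ^ 2) * ‖r‖ ^ 2 ≤
      ‖cdot (toC r + Complex.I • toC s) (toC r + Complex.I • toC s)‖ :=
    (re_cdot_self_ge hs).trans (Complex.re_le_norm _)
  rw [norm_mul, norm_div, norm_mul Complex.I, Complex.norm_I, one_mul, norm_inv, norm_pow]
  have h2 : ‖(2 * Real.pi : ℂ)‖ = 2 * Real.pi := by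
    rw [norm_mul, Complex.norm_real]; simp [abs_of_pos Real.pi_pos]
  have h3 : ‖(2 * ε : ℂ)‖ = 2 * ε := by
    rw [norm_mul, Complex.norm_real]; simp [abs_of_pos hε]
  rw [h2, h3]
  calc _ ≤ ((2 * Real.pi) ^ m)⁻¹ * (2 * ε / ((1 - K ^ 2) * ‖r‖ ^ 2)) := by gcongr
    _ = _ := by field_simp

lemma integrable_expInt_toC (hm : 0 < m) {ε : ℝ} (hε : 0 < ε) (l : ℂ) (w : CSpace m) :
    Integrable fun ξ : RSpace m => expInt l ε w (toC ξ) := by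
  simp only [expInt_toC]
  exact integrable_cdot_mul_exp_kernel hm hε l w

lemma kern_eq_expInt (hm : 0 < m) {ε : ℝ} (hε : 0 < ε) {w : CSpace m} (hw : cdot w w ≠ 0) :
    kern ε w = ((2 * Real.pi : ℂ) ^ m)⁻¹ * (2 * ε / (Complex.I * cdot w w)) *
      ∫ ξ : RSpace m, expInt (cdot w w / 2) ε w (toC ξ) := by
  simp only [expInt_toC]
  exact kern_eq hm hε hw

lemma kern_sub_gauss_eq (hm : 0 < m) {ε : ℝ} (hε : 0 < ε) {w : CSpace m} (hw : cdot w w ≠ 0) :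
    kern ε w - gauss ε w = ((2 * Real.pi : ℂ) ^ m)⁻¹ * (2 * ε / (Complex.I * cdot w w)) *
      ∫ ξ : RSpace m, (expInt (cdot w w / 2) ε w (toC ξ) - expInt 0 ε w (toC ξ)) := by
  rw [integral_sub (integrable_expInt_toC hm hε _ w) (integrable_expInt_toC hm hε _ w), mul_sub,
    ← kern_eq_expInt hm hε hw, gauss_eq_integral hm hε hw]
  simp only [expInt_toC]

lemma exists_norm_det_jacC_le (m : ℕ) : ∃ C : ℝ, 0 ≤ C ∧ ∀ (g : RSpace m → RSpace m) (K : NNReal),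
    K < 1 → LipschitzWith K g → ∀ p, ‖(1 + Complex.I • jacC g p).det‖ ≤ C := by
  obtain ⟨C, hC, h⟩ := exists_norm_det_le m 1 1
  exact ⟨C, hC, fun g K hK hg p => h _ (by simp) _ fun j k =>
    (norm_jacC_le hg p j k).trans (by exact_mod_cast hK.le)⟩

lemma rpow_mul_exp_neg_le {a : ℝ} (ha0 : 0 ≤ a) (ha1 : a ≤ 1) {x : ℝ} (hx : 0 ≤ x) :
    x ^ a * Real.exp (-x) ≤ 1 := by
  rw [Real.exp_neg, ← div_eq_mul_inv, div_le_one (Real.exp_pos _)]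
  have h1 : x ^ a ≤ x + 1 := by
    rcases le_total x 1 with h | h
    · exact (Real.rpow_le_one hx h ha0).trans (by linarith)
    · refine (Real.rpow_le_rpow_of_exponent_le h ha1).trans ?_
      rw [Real.rpow_one]; linarith
  exact h1.trans (Real.add_one_le_exp x)

/-! ### A contour along which e^{iζ·w} decays, for given w = r + is -/

section Contour

variable (κ : ℝ) (r s : RSpace m)

/-- The contour `ζ = p + i g(p)` on which `Im (ζ · (r + i s)) = κ |p| |r|`. -/
def nearContour (p : RSpace m) : RSpace m := ((κ * ‖r‖ * ‖p‖ - inner ℝ p s) / ‖r‖ ^ 2) • r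

variable {κ r s}

lemma nearContour_zero : nearContour κ r s 0 = 0 := by simp [nearContour]

lemma differentiableAt_nearContour {p : RSpace m} (hp : p ≠ 0) :
    DifferentiableAt ℝ (nearContour κ r s) p := by
  have h1 : DifferentiableAt ℝ (fun p : RSpace m => ‖p‖) p := differentiableAt_id.norm ℝ hp
  have h2 : DifferentiableAt ℝ (fun p : RSpace m => inner ℝ p s) p :=
    differentiableAt_id.inner ℝ (differentiableAt_const s)
  unfold nearContour
  have h3 : DifferentiableAt ℝ (fun p : RSpace m => κ * ‖r‖ * ‖p‖ - inner ℝ p s) p :=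
    (h1.const_mul _).sub h2
  have h4 : DifferentiableAt ℝ (fun p : RSpace m => (κ * ‖r‖ * ‖p‖ - inner ℝ p s) / ‖r‖ ^ 2) p :=
    by simpa only [div_eq_mul_inv] using h3.mul_const (‖r‖ ^ 2)⁻¹
  exact h4.smul_const r

/-- The term with ‖p‖ contributes κ and the term with ⟨p, s⟩ contributes |s|/|r| ≤ K. For K < 1
there is room for some κ > 0 with κ + K < 1, as the deformation in the cone requires. -/
lemma lipschitzWith_nearContour (hκ : 0 ≤ κ) (hr : r ≠ 0) {K : ℝ} (hK : 0 ≤ K) (hs : ‖s‖ ≤ K * ‖r‖) :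
    LipschitzWith (κ + K).toNNReal (nearContour κ r s) := by
  have hr' : 0 < ‖r‖ := norm_pos_iff.2 hr
  refine LipschitzWith.of_dist_le_mul fun p p' => ?_
  rw [Real.coe_toNNReal _ (by positivity), dist_eq_norm, dist_eq_norm, nearContour, nearContour,
    ← sub_smul, norm_smul]
  have h1 : (κ * ‖r‖ * ‖p‖ - inner ℝ p s) / ‖r‖ ^ 2 - (κ * ‖r‖ * ‖p'‖ - inner ℝ p' s) / ‖r‖ ^ 2 =
      (κ * ‖r‖ * (‖p‖ - ‖p'‖) - inner ℝ (p - p') s) / ‖r‖ ^ 2 := by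
    rw [inner_sub_left]; ring
  have h2 : ‖κ * ‖r‖ * (‖p‖ - ‖p'‖) - inner ℝ (p - p') s‖ ≤ (κ + K) * ‖r‖ * ‖p - p'‖ := by
    refine (norm_sub_le _ _).trans ?_
    have h3 : ‖κ * ‖r‖ * (‖p‖ - ‖p'‖)‖ ≤ κ * ‖r‖ * ‖p - p'‖ := by
      rw [norm_mul, Real.norm_of_nonneg (by positivity : 0 ≤ κ * ‖r‖)]
      gcongr
      exact abs_norm_sub_norm_le p p'
    have h4 : ‖inner ℝ (p - p') s‖ ≤ ‖p - p'‖ * (K * ‖r‖) :=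
      (norm_inner_le_norm _ _).trans (by gcongr)
    linarith
  rw [h1, norm_div, Real.norm_of_nonneg (by positivity : 0 ≤ ‖r‖ ^ 2), div_mul_eq_mul_div,
    div_le_iff₀ (by positivity)]
  nlinarith

lemma im_cdot_nearContour (hr : r ≠ 0) (p : RSpace m) :
    (cdot (toC p + Complex.I • toC (nearContour κ r s p)) (toC r + Complex.I • toC s)).im =
      κ * ‖p‖ * ‖r‖ := by
  have hr' : ‖r‖ ≠ 0 := norm_ne_zero_iff.2 hr
  have h1 : cdot (toC p + Complex.I • toC (nearContour κ r s p)) (toC r + Complex.I • toC s) =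
      ((inner ℝ p r - inner ℝ (nearContour κ r s p) s : ℝ) : ℂ) +
        ((inner ℝ p s + inner ℝ (nearContour κ r s p) r : ℝ) : ℂ) * Complex.I := by
    simp only [cdot_add_left, cdot_add_right, cdot_smul_left, cdot_smul_right, cdot_toC]
    push_cast
    linear_combination (inner ℝ (nearContour κ r s p) s : ℂ) * Complex.I_mul_I
  rw [h1, Complex.add_im, Complex.ofReal_im, Complex.im_ofReal_mul, Complex.I_im, nearContour,
    inner_smul_left, real_inner_self_eq_norm_sq]
  simp only [conj_trivial]
  field_simp
  ring

end Contour

set_option maxHeartbeats 1000000 in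
/-- Near the diagonal, the kernel differs little from the Gaussian. -/
theorem exists_norm_kern_sub_gauss_le (hm : 0 < m) {K : ℝ} (hK0 : 0 ≤ K) (hK1 : K < 1) :
    ∃ δ : ℝ, 0 < δ ∧ ∃ C : ℝ, 0 ≤ C ∧ ∀ r s : RSpace m, r ≠ 0 → ‖s‖ ≤ K * ‖r‖ → ‖r‖ < δ →
      ∀ ε : ℝ, 0 < ε → ‖kern ε (toC r + Complex.I • toC s) - gauss ε (toC r + Complex.I • toC s)‖ ≤
        C * ε ^ (1 / 4 : ℝ) * ‖r‖ ^ (1 / 2 - m : ℝ) := by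
  -- Half of the available gap, so that the contour has Lipschitz constant ρ = κ + K = (1 + K)/2 <
  -- 1.
  set κ : ℝ := (1 - K) / 2 with hκ
  set ρ : ℝ := (1 + K) / 2 with hρ
  have hκ0 : 0 < κ := by rw [hκ]; linarith
  have hρ0 : 0 ≤ ρ := by rw [hρ]; linarith
  have hρ1 : ρ < 1 := by rw [hρ]; linarith
  have hκK : κ + K = ρ := by rw [hκ, hρ]; ring
  set c : ℝ := 1 - ρ ^ 2 with hc
  have hc0 : 0 < c := by rw [hc]; nlinarith
  have hK2 : 0 < 1 - K ^ 2 := by nlinarith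
  obtain ⟨D, hD, hdet⟩ := exists_norm_det_jacC_le m
  set J : ℝ := ∫ ξ : RSpace m, ‖ξ‖ ^ (1 / 2 : ℝ) * Real.exp (-(κ / 2) * ‖ξ‖) with hJ
  have hJ0 : 0 ≤ J := integral_nonneg fun ξ => by positivity
  -- For |r| < κ/8 the term (w·w/2)⟨ζ⟩, of size at most 4|r|²|p|, costs at most half of the decay
  -- κ|p||r|, so both exponentials decay like e^{−κ|p||r|/2}.
  refine ⟨κ / 8, by positivity, 2 * ((2 * Real.pi) ^ m)⁻¹ / (1 - K ^ 2) * (16 * D * c ^ (-(3 / 4) : ℝ) * J),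
    by positivity, fun r s hr hs hrδ ε hε => ?_⟩
  have hr' : 0 < ‖r‖ := norm_pos_iff.2 hr
  have hQ := cdot_self_ne_zero hr hK0 hK1 hs
  have hw2 : ‖toC r + Complex.I • toC s‖ ≤ 2 * ‖r‖ := norm_add_I_le hs hK1
  have hpre := norm_prefactor_le hr hK0 hK1 hs hε
  set w := toC r + Complex.I • toC s with hw
  have hQ4 : ‖cdot w w‖ ≤ 4 * ‖r‖ ^ 2 := by
    refine (norm_cdot_le w w).trans ?_
    nlinarith [norm_nonneg w]
  have hlip := lipschitzWith_nearContour hκ0.le hr hK0 hs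
  rw [hκK] at hlip
  have hρ' : ρ.toNNReal < 1 := by simpa using hρ1
  rw [kern_sub_gauss_eq hm hε hQ, ← integral_expInt_sub_shift hm hρ' hlip nearContour_zero
    (fun p hp => differentiableAt_nearContour hp) hε, norm_mul]
  have hpt : ∀ p, ‖(expInt (cdot w w / 2) ε w (toC p + Complex.I • toC (nearContour κ r s p)) -
      expInt 0 ε w (toC p + Complex.I • toC (nearContour κ r s p))) *
        (1 + Complex.I • jacC (nearContour κ r s) p).det‖ ≤
      16 * D * ‖r‖ ^ 3 * (ε * c) ^ (-(3 / 4) : ℝ) *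
        (‖p‖ ^ (1 / 2 : ℝ) * Real.exp (-(κ / 2 * ‖r‖) * ‖p‖)) := by
    intro p
    have hq : ‖nearContour κ r s p‖ ≤ ρ * ‖p‖ := by
      have := hlip.norm_sub_le p 0
      rwa [nearContour_zero, sub_zero, sub_zero, Real.coe_toNNReal _ hρ0] at this
    have him := im_cdot_nearContour (κ := κ) (s := s) hr p
    rw [← hw] at him
    have hre := re_exponent_le hε.le hq
    have hζ := norm_add_I_le hq hρ1
    have hd := hdet _ _ hρ' hlip p
    set ζ := toC p + Complex.I • toC (nearContour κ r s p) with hζd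
    set X : ℝ := -(κ / 2 * ‖r‖) * ‖p‖ - ε * c * ‖p‖ ^ 2 with hX
    have hbr : ‖cdot w w / 2 * bracket ζ‖ ≤ 4 * ‖r‖ ^ 2 * ‖p‖ := by
      rw [norm_mul, norm_div, Complex.norm_two]
      calc ‖cdot w w‖ / 2 * ‖bracket ζ‖ ≤ 4 * ‖r‖ ^ 2 / 2 * (2 * ‖p‖) := by
            gcongr; exact (norm_bracket_le ζ).trans hζ
        _ = _ := by ring
    have hre0 : (Complex.I * cdot ζ w - ε * cdot ζ ζ).re ≤ -(κ * ‖p‖ * ‖r‖) - ε * c * ‖p‖ ^ 2 := by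
      rw [Complex.sub_re, Complex.I_mul_re, him]
      rw [Complex.neg_re] at hre
      linarith
    have hprod : 4 * ‖r‖ ^ 2 * ‖p‖ ≤ κ / 2 * ‖r‖ * ‖p‖ := by
      have : 0 ≤ ‖r‖ * ‖p‖ := by positivity
      nlinarith
    have ha : (Complex.I * cdot ζ w - cdot w w / 2 * bracket ζ - ε * cdot ζ ζ).re ≤ X := by
      have h1 : (Complex.I * cdot ζ w - cdot w w / 2 * bracket ζ - ε * cdot ζ ζ) =
        (Complex.I * cdot ζ w - ε * cdot ζ ζ) - cdot w w / 2 * bracket ζ := by ring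
      rw [h1, Complex.sub_re]
      have h2 := (neg_le_abs _).trans ((Complex.abs_re_le_norm (cdot w w / 2 * bracket ζ)).trans hbr)
      rw [hX]; linarith
    have hb : (Complex.I * cdot ζ w - 0 * bracket ζ - ε * cdot ζ ζ).re ≤ X := by
      rw [zero_mul, sub_zero]
      have : 0 ≤ ‖r‖ * ‖p‖ := by positivity
      rw [hX]; nlinarith
    have hexp := norm_exp_sub_exp_le ha hb
    have hdiff : Complex.I * cdot ζ w - cdot w w / 2 * bracket ζ - ε * cdot ζ ζ -
        (Complex.I * cdot ζ w - 0 * bracket ζ - ε * cdot ζ ζ) = -(cdot w w / 2 * bracket ζ) := by ring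
    rw [hdiff, norm_neg] at hexp
    have hcw : ‖cdot ζ w‖ ≤ 4 * ‖p‖ * ‖r‖ := by
      refine (norm_cdot_le _ _).trans ?_
      calc ‖ζ‖ * ‖w‖ ≤ (2 * ‖p‖) * (2 * ‖r‖) := by gcongr
        _ = _ := by ring
    -- Of |p|², the part |p|^{3/2} is absorbed by e^{−εc|p|²} at the price ε^{−3/4}; with the ε of
    -- the prefactor this leaves ε^{1/4}. The remaining |p|^{1/2} is integrated against
    -- e^{−κ|r||p|/2}, giving |r|^{−m−1/2}. Together with |r|³ and the |r|^{−2} of the prefactor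
    -- this makes |r|^{1/2−m}, which is locally integrable.
    have hgau : ‖p‖ ^ 2 * Real.exp X ≤ (ε * c) ^ (-(3 / 4) : ℝ) *
        (‖p‖ ^ (1 / 2 : ℝ) * Real.exp (-(κ / 2 * ‖r‖) * ‖p‖)) := by
      have hx := rpow_mul_exp_neg_le (a := 3 / 4) (by norm_num) (by norm_num)
        (x := ε * c * ‖p‖ ^ 2) (by positivity)
      rw [Real.mul_rpow (by positivity) (by positivity), ← Real.rpow_natCast ‖p‖ 2,
        ← Real.rpow_mul (norm_nonneg _)] at hx
      have hec : 0 < (ε * c) ^ (3 / 4 : ℝ) := by positivity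
      have h2 : ‖p‖ ^ 2 = ‖p‖ ^ (1 / 2 : ℝ) * ‖p‖ ^ (((2 : ℕ) : ℝ) * (3 / 4)) := by
        rw [← Real.rpow_natCast, ← Real.rpow_add_of_nonneg (norm_nonneg _) (by norm_num) (by norm_num)]
        norm_num
      rw [Real.rpow_natCast] at hx
      rw [hX, sub_eq_add_neg, Real.exp_add]
      generalize Real.exp (-(ε * c * ‖p‖ ^ 2)) = Y at hx
      rw [h2, Real.rpow_neg (by positivity), ← div_eq_inv_mul, le_div_iff₀ hec]
      calc _ = ‖p‖ ^ (1 / 2 : ℝ) * Real.exp (-(κ / 2 * ‖r‖) * ‖p‖) * ((ε * c) ^ (3 / 4 : ℝ) *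
            ‖p‖ ^ (((2 : ℕ) : ℝ) * (3 / 4)) * Y) := by ring
        _ ≤ _ := mul_le_of_le_one_right (by positivity) hx
    rw [expInt, expInt, ← mul_sub, norm_mul, norm_mul]
    calc ‖cdot ζ w‖ * _ * _ ≤ (4 * ‖p‖ * ‖r‖) * (Real.exp X * (4 * ‖r‖ ^ 2 * ‖p‖)) * D := by
          gcongr
          exact hexp.trans (by gcongr)
      _ = 16 * D * ‖r‖ ^ 3 * (‖p‖ ^ 2 * Real.exp X) := by ring
      _ ≤ 16 * D * ‖r‖ ^ 3 * ((ε * c) ^ (-(3 / 4) : ℝ) *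
            (‖p‖ ^ (1 / 2 : ℝ) * Real.exp (-(κ / 2 * ‖r‖) * ‖p‖))) :=
          mul_le_mul_of_nonneg_left hgau (by positivity)
      _ = _ := by ring
  have hint : Integrable fun p : RSpace m => 16 * D * ‖r‖ ^ 3 * (ε * c) ^ (-(3 / 4) : ℝ) *
        (‖p‖ ^ (1 / 2 : ℝ) * Real.exp (-(κ / 2 * ‖r‖) * ‖p‖)) :=
    (integrable_rpow_norm_mul_exp hm (by have : (0 : ℝ) < m := by exact_mod_cast hm
                                         linarith) (by positivity)).const_mul _
  have hI := norm_integral_le_of_norm_le hint (Eventually.of_forall hpt)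
  rw [integral_const_mul, integral_rpow_norm_mul_exp hr', ← hJ] at hI
  refine (mul_le_mul hpre hI (norm_nonneg _) (by positivity)).trans (le_of_eq ?_)
  rw [Real.mul_rpow hε.le hc0.le]
  have e1 : ε ^ (1 / 4 : ℝ) = ε * ε ^ (-(3 / 4) : ℝ) := by
    rw [← Real.rpow_one_add' hε.le (by norm_num)]; norm_num
  have e2 : ‖r‖ ^ (1 / 2 - m : ℝ) = ‖r‖ * ‖r‖ ^ (-(m : ℝ) - 1 / 2) := by
    conv_rhs => rw [← Real.rpow_one ‖r‖, Real.rpow_one, mul_comm]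
    nth_rewrite 3 [← Real.rpow_one ‖r‖]
    rw [← Real.rpow_add hr']
    congr 1; ring
  rw [e1, e2]
  field_simp

set_option maxHeartbeats 1000000 in
/-- Away from the diagonal, the kernel tends to zero. -/
theorem IsAdmissible.exists_norm_kern_le {n : ℕ} {φ : RSpace m → RSpace n → RSpace m}
    {V : Opens (RSpace m)} {W : Opens (RSpace n)} (hφ : IsAdmissible φ V W) (hm : 0 < m)
    {δ : ℝ} (hδ : 0 < δ) :
    ∃ C : ℝ, 0 ≤ C ∧ ∀ t ∈ W, ∀ x ∈ V, ∀ y ∈ V, δ ≤ ‖x - y‖ → ∀ ε : ℝ, 0 < ε →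
      ‖kern ε (Z φ x t - Z φ y t)‖ ≤ C * ε := by
  obtain ⟨K, hK, hlip⟩ := hφ.exists_lipschitz
  obtain ⟨c, hc, hwp⟩ := hφ.well_positioned
  obtain ⟨D, hD, hdet⟩ := exists_norm_det_jacC_le m
  have hK0 : (0 : ℝ) ≤ K := K.2
  have hK1 : (K : ℝ) < 1 := by exact_mod_cast hK
  have hK2 : 0 < 1 - (K : ℝ) ^ 2 := by nlinarith
  set J : ℝ := ∫ ξ : RSpace m, ‖ξ‖ ^ (1 : ℝ) * Real.exp (-(c * δ ^ 2) * ‖ξ‖) with hJ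
  have hJ0 : 0 ≤ J := integral_nonneg fun ξ => by positivity
  refine ⟨2 * ((2 * Real.pi) ^ m)⁻¹ / (1 - (K : ℝ) ^ 2) * (4 * D / δ) * J, by positivity,
    fun t ht x hx y hy hxy ε hε => ?_⟩
  set r := x - y with hr
  have hr' : 0 < ‖r‖ := hδ.trans_le hxy
  have hr0 : r ≠ 0 := norm_pos_iff.1 hr'
  have hs : ‖φ x t - φ y t‖ ≤ K * ‖r‖ := (hlip t ht).norm_sub_le x y
  have hQ := cdot_self_ne_zero hr0 hK0 hK1 hs
  have hw2 : ‖toC r + Complex.I • toC (φ x t - φ y t)‖ ≤ 2 * ‖r‖ := norm_add_I_le hs hK1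
  have hw1 : ‖r‖ ≤ ‖toC r + Complex.I • toC (φ x t - φ y t)‖ := norm_le_norm_add_I _ _
  have hpre := norm_prefactor_le hr0 hK0 hK1 hs hε
  have hwp' := hwp t ht x hx y hy
  rw [Z_sub, ← hr] at hwp' ⊢
  set w := toC r + Complex.I • toC (φ x t - φ y t) with hw
  -- The contour p − iAp runs in the fibre over Z(y,t), where the positivity hypothesis is
  -- available.
  set A := ContinuousLinearMap.adjoint (fderiv ℝ (fun y => φ y t) y) with hA
  have hAK : ‖-A‖ ≤ K := by
    rw [norm_neg, hA, LinearIsometryEquiv.norm_map]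
    exact norm_fderiv_le_of_lipschitz ℝ (hlip t ht)
  have hglip : LipschitzWith K (fun p => (-A) p) := by
    refine (-A).lipschitz.weaken ?_
    exact_mod_cast hAK
  rw [kern_eq_expInt hm hε hQ, ← integral_expInt_shift hm hK hglip (by simp)
    (fun p _ => (-A).differentiableAt) hε, norm_mul]
  have hpt : ∀ p, ‖expInt (cdot w w / 2) ε w (toC p + Complex.I • toC ((-A) p)) *
      (1 + Complex.I • jacC (fun p => (-A) p) p).det‖ ≤
      4 * D * ‖r‖ * (‖p‖ ^ (1 : ℝ) * Real.exp (-(c * δ ^ 2) * ‖p‖)) := by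
    intro p
    have hq : ‖(-A) p‖ ≤ K * ‖p‖ := ((-A).le_opNorm p).trans (by gcongr)
    have hmem : toC p + Complex.I • toC ((-A) p) ∈ fibre φ t y :=
      ⟨_, hφ.mem_fibre ht y p⟩
    have hwq := hwp' _ (Or.inr hmem)
    have hre := re_exponent_le hε.le hq
    have hζ := norm_add_I_le hq hK1
    have hζ1 := norm_le_norm_add_I p ((-A) p)
    have hd := hdet _ _ hK hglip p
    set ζ := toC p + Complex.I • toC ((-A) p) with hζd
    have hX : (Complex.I * cdot ζ w - cdot w w / 2 * bracket ζ - ε * cdot ζ ζ).re ≤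
        -(c * δ ^ 2) * ‖p‖ := by
      -- Apart from the ε-term, the exponent is i times the phase of the hypothesis, with the same
      -- coefficient 1/2; its real part is thus at most −c|ζ||w|².
      have h1 : Complex.I * cdot ζ w - cdot w w / 2 * bracket ζ - ε * cdot ζ ζ =
        Complex.I * (cdot ζ w + Complex.I * (1 / 2) * bracket ζ * cdot w w) + -(ε * cdot ζ ζ) := by
        linear_combination (-(1 / 2 : ℂ) * bracket ζ * cdot w w) * Complex.I_mul_I
      rw [h1, Complex.add_re, Complex.I_mul_re]
      have h2 : c * ‖p‖ * δ ^ 2 ≤ c * ‖ζ‖ * ‖w‖ ^ 2 := by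
        gcongr
        exact hxy.trans hw1
      have h3 : 0 ≤ ε * (1 - (K : ℝ) ^ 2) * ‖p‖ ^ 2 := by positivity
      linarith
    rw [expInt, norm_mul, norm_mul, Complex.norm_exp, Real.rpow_one]
    calc ‖cdot ζ w‖ * _ * _ ≤ ((2 * ‖p‖) * (2 * ‖r‖)) * Real.exp (-(c * δ ^ 2) * ‖p‖) * D := by
          gcongr
          exact (norm_cdot_le _ _).trans (by gcongr)
      _ = _ := by ring
  have hint : Integrable fun p : RSpace m =>
      4 * D * ‖r‖ * (‖p‖ ^ (1 : ℝ) * Real.exp (-(c * δ ^ 2) * ‖p‖)) :=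
    (integrable_rpow_norm_mul_exp hm (by have : (0 : ℝ) < m := by exact_mod_cast hm
                                         linarith) (by positivity)).const_mul _
  have hI := norm_integral_le_of_norm_le hint (Eventually.of_forall hpt)
  rw [integral_const_mul, ← hJ] at hI
  have hP : 0 ≤ 2 * ((2 * Real.pi) ^ m)⁻¹ / (1 - (K : ℝ) ^ 2) := by positivity
  generalize 2 * ((2 * Real.pi) ^ m)⁻¹ / (1 - (K : ℝ) ^ 2) = P at hpre hP ⊢
  clear_value J
  refine (mul_le_mul hpre hI (norm_nonneg _) (by positivity)).trans ?_
  calc P * (ε / ‖r‖ ^ 2) * (4 * D * ‖r‖ * J) = P * (4 * D * J * ε) / ‖r‖ := by field_simp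
    _ ≤ P * (4 * D * J * ε) / δ := div_le_div_of_nonneg_left (by positivity) hδ hxy
    _ = P * (4 * D / δ) * J * ε := by ring

/-- The size of the Gaussian kernel. -/
lemma norm_gauss_le {K : ℝ} {r s : RSpace m} (hs : ‖s‖ ≤ K * ‖r‖) {ε : ℝ} (hε : 0 < ε) :
    ‖gauss ε (toC r + Complex.I • toC s)‖ ≤
      (4 * Real.pi * ε) ^ (-(m / 2 : ℝ)) * Real.exp (-((1 - K ^ 2) / (4 * ε)) * ‖r‖ ^ 2) := by
  have hpos : (0 : ℝ) < 4 * Real.pi * ε := by positivity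
  rw [gauss_eq hε, norm_mul, Complex.norm_real, Real.norm_of_nonneg (by positivity),
    Complex.norm_exp]
  gcongr
  have h1 : cdot (toC r + Complex.I • toC s) (toC r + Complex.I • toC s) / (4 * ε) =
    ((1 / (4 * ε) : ℝ) : ℂ) * cdot (toC r + Complex.I • toC s) (toC r + Complex.I • toC s) := by
      push_cast; ring
  rw [h1, Complex.neg_re, Complex.re_ofReal_mul]
  have := mul_le_mul_of_nonneg_left (re_cdot_self_ge hs) (by positivity : 0 ≤ 1 / (4 * ε))
  calc _ ≤ _ := neg_le_neg this
    _ = _ := by ring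

end Estimates

end FBI
end

noncomputable section

namespace FBI

/-! ### Gaussian integrals over the manifolds `{x + i g(x)}` -/

section GaussianShift

variable {m : ℕ}

/-- For bounded g no smallness of the Lipschitz constant is needed: the contours with |τ| < 2 stay
in a tube of bounded imaginary part, where an entire F with Gaussian decay is integrable. -/
theorem integral_bounded_shift (hm : 0 < m) {g : RSpace m → RSpace m} {K : NNReal}
    (hg : LipschitzWith K g) (hgd : ∀ p, DifferentiableAt ℝ g p) {B : ℝ} (hB : ∀ p, ‖g p‖ ≤ B)
    {F : CSpace m → ℂ} (hF : Differentiable ℂ F)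
    (hFb : ∀ R : ℝ, ∃ A C c : ℝ, 0 ≤ A ∧ 0 ≤ C ∧ 0 < c ∧ ∀ p q : RSpace m,
      ‖q‖ ≤ R → ‖F (toC p + Complex.I • toC q)‖ ≤ A * Real.exp (C * ‖p‖ - c * ‖p‖ ^ 2)) :
    ∫ p, F (toC p + Complex.I • toC (g p)) * (1 + Complex.I • jacC g p).det = ∫ p, F (toC p) := by
  have hB0 : 0 ≤ B := (norm_nonneg _).trans (hB 0)
  obtain ⟨A, C, c, hA, hC, hc, hb⟩ := hFb (2 * B)
  refine integral_contour_shift (s := univ) (U := univ) (D := Metric.ball 0 2) (R := 2)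
    (bound := fun p => A * Real.exp (2 * C * B + 4 * c * B ^ 2) *
      Real.exp (C * ‖p‖ - c / 2 * ‖p‖ ^ 2))
    hm hg (by simp) (fun p _ => hgd p) hF.differentiableOn Metric.isOpen_ball
    (convex_ball 0 2).isPreconnected (by simp) (by simp) ?_ (fun _ _ _ _ => mem_univ _)
    ((integrable_exp_sq hm (half_pos hc) C).const_mul _) ?_
  · intro τ hτ
    exact (mem_ball_zero_iff.1 hτ).le
  · intro τ hτ p _
    have hτ2 : ‖τ‖ ≤ 2 := (mem_ball_zero_iff.1 hτ).le
    have e1 : toC p + τ • toC (g p) = toC (p + τ.re • g p) + Complex.I • toC (τ.im • g p) := by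
      ext j
      simp only [PiLp.add_apply, PiLp.smul_apply, toC_apply, smul_eq_mul]
      push_cast
      linear_combination (-(g p j : ℂ)) * (Complex.re_add_im τ)
    have h1 : ‖τ.re • g p‖ ≤ 2 * B := by
      rw [norm_smul]
      exact mul_le_mul ((Complex.abs_re_le_norm τ).trans hτ2) (hB p) (norm_nonneg _) (by norm_num)
    have h2 : ‖τ.im • g p‖ ≤ 2 * B := by
      rw [norm_smul]
      exact mul_le_mul ((Complex.abs_im_le_norm τ).trans hτ2) (hB p) (norm_nonneg _) (by norm_num)
    rw [e1]
    refine (hb _ _ h2).trans ?_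
    rw [mul_assoc, ← Real.exp_add]
    gcongr A * Real.exp ?_
    have h3 := norm_add_le p (τ.re • g p)
    have h4 : ‖p‖ ≤ ‖p + τ.re • g p‖ + 2 * B := by
      have := norm_sub_le (p + τ.re • g p) (τ.re • g p)
      rw [add_sub_cancel_right] at this
      linarith
    have h5 : ‖p‖ ^ 2 ≤ 2 * ‖p + τ.re • g p‖ ^ 2 + 8 * B ^ 2 := by
      have := pow_le_pow_left₀ (norm_nonneg p) h4 2
      nlinarith [sq_nonneg (‖p + τ.re • g p‖ - 2 * B)]
    nlinarith [mul_le_mul_of_nonneg_left h5 hc.le]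

lemma integrable_gaussian_affine (hm : 0 < m) {l : ℝ} (hl : 0 < l) (v : CSpace m) (α : ℂ) :
    Integrable fun x : RSpace m => Complex.exp (-(l * cdot (toC x) (toC x))) * (α + cdot v (toC x)) := by
  have hc : Continuous fun x : RSpace m => cdot v (toC x) := continuous_const.cdot toC.continuous
  have hc' : Continuous fun x : RSpace m => cdot (toC x) (toC x) := toC.continuous.cdot toC.continuous
  refine ((integrable_exp_sq hm hl 1).const_mul (‖α‖ + ‖v‖)).mono'
    (Continuous.aestronglyMeasurable (by fun_prop)) (Eventually.of_forall fun x => ?_)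
  rw [norm_mul, Complex.norm_exp, cdot_toC, real_inner_self_eq_norm_sq]
  have h1 : (-(l * ((‖x‖ ^ 2 : ℝ) : ℂ))).re = -(l * ‖x‖ ^ 2) := by norm_cast
  have h2 : ‖α + cdot v (toC x)‖ ≤ (‖α‖ + ‖v‖) * Real.exp ‖x‖ := by
    refine (norm_add_le _ _).trans ?_
    have := norm_cdot_le v (toC x)
    rw [toC.norm_map] at this
    have h3 : 1 ≤ Real.exp ‖x‖ := Real.one_le_exp (norm_nonneg _)
    have h4 : ‖x‖ ≤ Real.exp ‖x‖ := by linarith [Real.add_one_le_exp ‖x‖]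
    nlinarith [norm_nonneg α, norm_nonneg v]
  rw [h1]
  calc _ ≤ Real.exp (-(l * ‖x‖ ^ 2)) * ((‖α‖ + ‖v‖) * Real.exp ‖x‖) := by gcongr
    _ = (‖α‖ + ‖v‖) * (Real.exp ‖x‖ * Real.exp (-(l * ‖x‖ ^ 2))) := by ring
    _ = _ := by rw [← Real.exp_add]; ring_nf

/-- The linear term is odd and does not contribute. -/
lemma integral_gaussian_affine (hm : 0 < m) {l : ℝ} (hl : 0 < l) (v : CSpace m) (α : ℂ) :
    ∫ x : RSpace m, Complex.exp (-(l * cdot (toC x) (toC x))) * (α + cdot v (toC x)) =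
      (((Real.pi / l) ^ (m / 2 : ℝ) : ℝ) : ℂ) * α := by
  have i1 := integrable_gaussian_affine hm hl 0 α
  have i2 := integrable_gaussian_affine hm hl v 0
  have e0 : ∀ x : RSpace m, cdot 0 (toC x) = 0 := fun x => by simp [cdot]
  simp only [e0, add_zero, zero_add] at i1 i2
  simp only [mul_add]
  rw [integral_add i1 i2, integral_mul_const]
  have h1 : ∫ x : RSpace m, Complex.exp (-(l * cdot (toC x) (toC x))) * cdot v (toC x) = 0 := by
    have h2 := integral_neg_eq_self
      (fun x : RSpace m => Complex.exp (-(l * cdot (toC x) (toC x))) * cdot v (toC x)) volume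
    simp only [map_neg, cdot_neg_left, cdot_neg_right, neg_neg, mul_neg, integral_neg] at h2
    exact self_eq_neg.1 h2.symm
  have h3 := GaussianFourier.integral_cexp_neg_mul_sq_norm (V := RSpace m) (b := l) (by simpa using hl)
  rw [h1, add_zero]
  congr 1
  simp only [cdot_toC, real_inner_self_eq_norm_sq]
  push_cast
  simp only [neg_mul] at h3
  rw [h3, finrank_euclideanSpace_fin, Complex.ofReal_cpow (by positivity)]
  push_cast; rfl

/-- The imaginary part of the centre c is absorbed in g, which stays bounded and Lipschitz, and the
real part is removed by a translation after the contour has been moved to ℝᵐ. So the integral does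
not see the manifold or the centre. -/
theorem integral_gaussian_shift (hm : 0 < m) {g : RSpace m → RSpace m} {K : NNReal}
    (hg : LipschitzWith K g) (hgd : ∀ p, DifferentiableAt ℝ g p) {B : ℝ} (hB : ∀ p, ‖g p‖ ≤ B)
    {l : ℝ} (hl : 0 < l) (c v : CSpace m) (α : ℂ) :
    ∫ x, Complex.exp (-(l * cdot (toC x + Complex.I • toC (g x) - c) (toC x + Complex.I • toC (g x) - c)))
      * (α + cdot v (toC x + Complex.I • toC (g x) - c)) * (1 + Complex.I • jacC g x).det =
      (((Real.pi / l) ^ (m / 2 : ℝ) : ℝ) : ℂ) * α := by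
  obtain ⟨c₁, c₂, rfl⟩ := exists_eq_add_I c
  have hlip : LipschitzWith K fun x => g x - c₂ :=
    LipschitzWith.of_dist_le_mul fun x y => by
      rw [dist_sub_right]; exact hg.dist_le_mul x y
  have e1 : ∀ x, toC x + Complex.I • toC (g x) - (toC c₁ + Complex.I • toC c₂) =
      toC x + Complex.I • toC (g x - c₂) - toC c₁ := fun x => by
    rw [map_sub, smul_sub]; abel
  have e2 : ∀ x, jacC g x = jacC (fun x => g x - c₂) x := fun x => by
    rw [jacC_eq, jacC_eq, fderiv_sub_const]
  simp only [e1, e2]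
  rw [integral_bounded_shift hm hlip (fun p => (hgd p).sub_const c₂) (B := B + ‖c₂‖)
    (fun p => (norm_sub_le _ _).trans (by gcongr; exact hB p))
    (F := fun z => Complex.exp (-(l * cdot (z - toC c₁) (z - toC c₁))) * (α + cdot v (z - toC c₁)))]
  · have h3 := integral_sub_right_eq_self (μ := volume)
      (fun x : RSpace m => Complex.exp (-(l * cdot (toC x) (toC x))) * (α + cdot v (toC x))) c₁
    simp only [map_sub] at h3
    rw [h3, integral_gaussian_affine hm hl]
  · intro z
    have h1 : DifferentiableAt ℂ (fun z : CSpace m => z - toC c₁) z := by fun_prop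
    exact ((h1.cdot h1).const_mul (l : ℂ)).neg.cexp.mul
      (((differentiableAt_const v).cdot h1).const_add α)
  · intro R
    refine ⟨Real.exp (l * (‖c₁‖ ^ 2 + R ^ 2)) * (‖α‖ + ‖v‖ * (1 + |R| + ‖c₁‖)), 1, l / 2, by positivity,
      zero_le_one, by positivity, fun p q hq => ?_⟩
    have hR : 0 ≤ R := (norm_nonneg q).trans hq
    have e3 : toC p + Complex.I • toC q - toC c₁ = toC (p - c₁) + Complex.I • toC q := by
      rw [map_sub]; abel
    rw [e3, norm_mul, Complex.norm_exp, abs_of_nonneg hR]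
    have h1 : (-(l * cdot (toC (p - c₁) + Complex.I • toC q) (toC (p - c₁) + Complex.I • toC q)) : ℂ).re
        ≤ l * (‖c₁‖ ^ 2 + R ^ 2) - l / 2 * ‖p‖ ^ 2 := by
      rw [Complex.neg_re, Complex.re_ofReal_mul, re_cdot_self_add_I]
      have h2 : ‖q‖ ^ 2 ≤ R ^ 2 := by gcongr
      have h3 : ‖p‖ ≤ ‖p - c₁‖ + ‖c₁‖ := by
        have := norm_add_le (p - c₁) c₁
        rwa [sub_add_cancel] at this
      have h4 : ‖p‖ ^ 2 ≤ 2 * ‖p - c₁‖ ^ 2 + 2 * ‖c₁‖ ^ 2 := by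
        have := pow_le_pow_left₀ (norm_nonneg p) h3 2
        nlinarith [sq_nonneg (‖p - c₁‖ - ‖c₁‖)]
      nlinarith [mul_le_mul_of_nonneg_left h4 hl.le, mul_le_mul_of_nonneg_left h2 hl.le]
    have h5 : ‖α + cdot v (toC (p - c₁) + Complex.I • toC q)‖ ≤
        (‖α‖ + ‖v‖ * (1 + R + ‖c₁‖)) * Real.exp ‖p‖ := by
      have h6 : ‖toC (p - c₁) + Complex.I • toC q‖ ≤ ‖p‖ + ‖c₁‖ + R := by
        refine (norm_add_le _ _).trans ?_
        rw [norm_smul, Complex.norm_I, one_mul, toC.norm_map, toC.norm_map]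
        have := norm_sub_le p c₁
        linarith
      have h7 : 1 ≤ Real.exp ‖p‖ := Real.one_le_exp (norm_nonneg _)
      have h8 : ‖p‖ ≤ Real.exp ‖p‖ := by linarith [Real.add_one_le_exp ‖p‖]
      refine (norm_add_le _ _).trans ?_
      calc ‖α‖ + ‖cdot v (toC (p - c₁) + Complex.I • toC q)‖
          ≤ ‖α‖ * Real.exp ‖p‖ + ‖v‖ * (Real.exp ‖p‖ + (‖c₁‖ + R) * Real.exp ‖p‖) := by
            gcongr
            · exact le_mul_of_one_le_right (norm_nonneg _) h7
            · refine (norm_cdot_le _ _).trans ?_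
              gcongr
              have : ‖c₁‖ + R ≤ (‖c₁‖ + R) * Real.exp ‖p‖ :=
                le_mul_of_one_le_right (by positivity) h7
              linarith
        _ = _ := by ring
    calc _ ≤ Real.exp (l * (‖c₁‖ ^ 2 + R ^ 2) - l / 2 * ‖p‖ ^ 2) *
          ((‖α‖ + ‖v‖ * (1 + R + ‖c₁‖)) * Real.exp ‖p‖) := by
          gcongr
      _ = _ := by
          rw [sub_eq_add_neg, Real.exp_add, sub_eq_add_neg, Real.exp_add, one_mul]; ring

/-- Total mass one with respect to dZ, for any centre in ℂᵐ. This normalizes the approximate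
identity. -/
theorem integral_gauss_mul_det (hm : 0 < m) {g : RSpace m → RSpace m} {K : NNReal}
    (hg : LipschitzWith K g) (hgd : ∀ p, DifferentiableAt ℝ g p) {B : ℝ} (hB : ∀ p, ‖g p‖ ≤ B)
    {ε : ℝ} (hε : 0 < ε) (b : CSpace m) :
    ∫ x, gauss ε (toC x + Complex.I • toC (g x) - b) * (1 + Complex.I • jacC g x).det = 1 := by
  have h := integral_gaussian_shift hm hg hgd hB (l := 1 / (4 * ε)) (by positivity) b 0 1
  have e0 : ∀ z : CSpace m, cdot 0 z = 0 := fun z => by simp [cdot]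
  simp only [e0, add_zero, mul_one] at h
  have e1 : ∀ z : CSpace m, -(((1 / (4 * ε) : ℝ) : ℂ) * cdot z z) = -(cdot z z / (4 * ε)) := fun z => by
    push_cast; ring
  simp only [e1] at h
  simp only [gauss_eq hε, mul_assoc]
  rw [integral_const_mul, h]
  norm_cast
  rw [show Real.pi / (1 / (4 * ε)) = 4 * (Real.pi * ε) by field_simp, Real.rpow_neg (by positivity),
    inv_mul_cancel₀ (by positivity)]

end GaussianShift

end FBI
end

noncomputable section

namespace FBI

/-! ### The integrand of the inversion formula -/

section Integrand

variable {m : ℕ}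

/-- The argument of a principal square root lies in [−π/2, π/2], so the powers compose. Holomorphy
of the left side on the cone is then that of a power of ζ·ζ, which stays in the slit plane. -/
lemma bracket_cpow (ζ : CSpace m) (s : ℂ) : bracket ζ ^ s = cdot ζ ζ ^ (1 / 2 * s) := by
  have h1 : (Complex.log (cdot ζ ζ) * (1 / 2)).im = Complex.arg (cdot ζ ζ) / 2 := by
    have : (1 / 2 : ℂ) = ((1 / 2 : ℝ) : ℂ) := by push_cast; rfl
    rw [this, Complex.im_mul_ofReal, Complex.log_im]; ring
  have h2 := Complex.neg_pi_lt_arg (cdot ζ ζ)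
  have h3 := Complex.arg_le_pi (cdot ζ ζ)
  rw [bracket, Complex.cpow_mul] <;> rw [h1] <;> linarith [Real.pi_pos]

/-- The integrand, with the second point `b` as a complex variable. -/
def invKernel (ε : ℝ) (a z b ζ : CSpace m) : ℂ :=
  Complex.exp (Complex.I * cdot ζ (a - b)
      - bracket ζ * (cdot (a - z) (a - z) + cdot (z - b) (z - b)) - ε * cdot ζ ζ) *
    (1 + Complex.I / bracket ζ * cdot (z - b) ζ) * bracket ζ ^ ((m : ℂ) / 2)

lemma differentiable_invKernel (ε : ℝ) (a z ζ : CSpace m) :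
    Differentiable ℂ fun b => invKernel ε a z b ζ := by
  intro b
  have h1 : DifferentiableAt ℂ (fun b : CSpace m => z - b) b := by fun_prop
  have h2 : DifferentiableAt ℂ (fun b : CSpace m => cdot ζ (a - b)) b :=
    (differentiableAt_const ζ).cdot (by fun_prop)
  have h3 := h1.cdot h1
  have h4 := h1.cdot (differentiableAt_const ζ)
  unfold invKernel
  fun_prop

lemma differentiableOn_invKernel (ε : ℝ) (a z b : CSpace m) :
    DifferentiableOn ℂ (invKernel ε a z b) (cone m) := by
  intro ζ hζ
  have h1 : DifferentiableAt ℂ (fun ζ => cdot ζ (a - b)) ζ :=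
    differentiableAt_id.cdot (differentiableAt_const _)
  have h2 : DifferentiableAt ℂ (fun ζ : CSpace m => cdot ζ ζ) ζ :=
    differentiableAt_id.cdot differentiableAt_id
  have h3 : DifferentiableAt ℂ bracket ζ :=
    (differentiableOn_bracket ζ hζ).differentiableAt (isOpen_cone.mem_nhds hζ)
  have h4 : DifferentiableAt ℂ (fun ζ => cdot (z - b) ζ) ζ :=
    (differentiableAt_const _).cdot differentiableAt_id
  have h5 : DifferentiableAt ℂ (fun ζ : CSpace m => bracket ζ ^ ((m : ℂ) / 2)) ζ := by
    simp only [bracket_cpow]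
    exact h2.cpow_const (slitPlane_of_mem_cone hζ)
  have h6 : DifferentiableAt ℂ (fun ζ => Complex.I / bracket ζ) ζ := by
    simp only [div_eq_mul_inv]
    exact (h3.fun_inv (bracket_ne_zero hζ)).const_mul _
  refine DifferentiableAt.differentiableWithinAt ?_
  unfold invKernel
  exact ((((h1.const_mul Complex.I).sub (h3.mul_const _)).sub (h2.const_mul (ε : ℂ))).cexp.mul
    ((h6.mul h4).const_add 1)).mul h5

lemma continuousAt_invKernel {X : Type*} [TopologicalSpace X] (ε : ℝ) (a : CSpace m)
    {z b ζ : X → CSpace m} {x : X} (hz : ContinuousAt z x) (hb : ContinuousAt b x)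
    (hζ : ContinuousAt ζ x) (hx : ζ x ∈ cone m) :
    ContinuousAt (fun x => invKernel ε a (z x) (b x) (ζ x)) x := by
  have h1 : ContinuousAt (fun x => cdot (ζ x) (a - b x)) x := hζ.cdot (continuousAt_const.sub hb)
  have h2 := hζ.cdot hζ
  have h3 : ContinuousAt (fun x => bracket (ζ x)) x :=
    ContinuousAt.comp (f := ζ) (continuousOn_bracket.continuousAt (isOpen_cone.mem_nhds hx)) hζ
  have h4 := (hz.sub hb).cdot hζ
  have h5 : ContinuousAt (fun x => bracket (ζ x) ^ ((m : ℂ) / 2)) x := by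
    simp only [bracket_cpow]
    exact h2.cpow continuousAt_const (slitPlane_of_mem_cone hx)
  have h6 := bracket_ne_zero hx
  have h7 : ContinuousAt (fun x => cdot (a - z x) (a - z x)) x :=
    (continuousAt_const.sub hz).cdot (continuousAt_const.sub hz)
  have h8 := (hz.sub hb).cdot (hz.sub hb)
  unfold invKernel
  exact ((((h1.const_mul Complex.I).sub (h3.mul (h7.add h8))).sub (h2.const_mul (ε : ℂ))).cexp.mul
    (((continuousAt_const.div h3 h6).mul h4).const_add 1)).mul h5

/-- In a proper subcone |⟨ζ⟩| ≥ (1 − ρ)|p| and |ζ| ≤ 2|p|, so the quotient is homogeneous of degree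
zero and bounded. At p = 0 it vanishes, since ζ = 0. -/
lemma norm_factor_le {ρ : ℝ} (hρ0 : 0 ≤ ρ) (hρ1 : ρ < 1) {p q : RSpace m} (hq : ‖q‖ ≤ ρ * ‖p‖)
    (v : CSpace m) :
    ‖1 + Complex.I / bracket (toC p + Complex.I • toC q) * cdot v (toC p + Complex.I • toC q)‖ ≤
      1 + 2 / (1 - ρ) * ‖v‖ := by
  have hζ := norm_add_I_le hq hρ1
  have h1 : (1 - ρ) * ‖p‖ ≤ ‖bracket (toC p + Complex.I • toC q)‖ := by
    have : 0 ≤ 1 - ρ := by linarith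
    refine norm_bracket_ge (by positivity) (le_trans ?_ (re_cdot_self_ge hq))
    rw [mul_pow]
    gcongr
    nlinarith
  set ζ := toC p + Complex.I • toC q
  refine (norm_add_le _ _).trans ?_
  rw [norm_one, norm_mul, norm_div, Complex.norm_I]
  gcongr 1 + ?_
  have h2 : 0 < 1 - ρ := by linarith
  rcases (norm_nonneg p).eq_or_lt with hp | hp
  · have : ‖ζ‖ = 0 := le_antisymm (by rw [← hp] at hζ; simpa using hζ) (norm_nonneg _)
    rw [norm_eq_zero.1 this]
    have : cdot v 0 = 0 := by simp [cdot]
    rw [this, norm_zero, mul_zero]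
    positivity
  · calc 1 / ‖bracket ζ‖ * ‖cdot v ζ‖ ≤ 1 / ((1 - ρ) * ‖p‖) * (‖v‖ * (2 * ‖p‖)) := by
          gcongr
          exact (norm_cdot_le _ _).trans (by gcongr)
      _ = _ := by field_simp

lemma norm_bracket_cpow_le {ρ : ℝ} (hρ1 : ρ < 1) {p q : RSpace m} (hq : ‖q‖ ≤ ρ * ‖p‖) :
    ‖bracket (toC p + Complex.I • toC q) ^ ((m : ℂ) / 2)‖ ≤ (2 * ‖p‖) ^ (m / 2 : ℝ) := by
  have : ((m : ℂ) / 2) = ((m / 2 : ℝ) : ℂ) := by push_cast; rfl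
  rw [this, Complex.norm_cpow_real]
  gcongr
  exact (norm_bracket_le _).trans (norm_add_I_le hq hρ1)

lemma rpow_le_exp {x s : ℝ} (hx : 0 ≤ x) (hs : 0 ≤ s) : x ^ s ≤ Real.exp (s * x) := by
  calc x ^ s ≤ Real.exp x ^ s :=
        Real.rpow_le_rpow hx (by linarith [Real.add_one_le_exp x]) hs
    _ = _ := by rw [← Real.exp_mul, mul_comm]

lemma exists_norm_invKernel_le {ε : ℝ} (hε : 0 < ε) (a z b : CSpace m) {ρ : ℝ} (hρ0 : 0 ≤ ρ)
    (hρ1 : ρ < 1) : ∃ A C c : ℝ, 0 ≤ A ∧ 0 ≤ C ∧ 0 < c ∧ ∀ p q : RSpace m, ‖q‖ ≤ ρ * ‖p‖ →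
      ‖invKernel ε a z b (toC p + Complex.I • toC q)‖ ≤ A * Real.exp (C * ‖p‖ - c * ‖p‖ ^ 2) := by
  have h0 : 0 < 1 - ρ := by linarith
  refine ⟨1 + 2 / (1 - ρ) * ‖z - b‖,
    2 * (‖a - b‖ + (‖a - z‖ * ‖a - z‖ + ‖z - b‖ * ‖z - b‖)) + m, ε * (1 - ρ ^ 2), by positivity,
    by positivity, mul_pos hε (by nlinarith), fun p q hq => ?_⟩
  have h1 := norm_factor_le hρ0 hρ1 hq (z - b)
  have h2 := norm_bracket_cpow_le hρ1 hq
  have h3 := re_exponent_le hε.le hq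
  have hζ := norm_add_I_le hq hρ1
  set ζ := toC p + Complex.I • toC q
  rw [invKernel, norm_mul, norm_mul, Complex.norm_exp]
  have h4 : (Complex.I * cdot ζ (a - b) - bracket ζ * (cdot (a - z) (a - z) + cdot (z - b) (z - b))
      - ε * cdot ζ ζ).re ≤ 2 * (‖a - b‖ + (‖a - z‖ * ‖a - z‖ + ‖z - b‖ * ‖z - b‖)) * ‖p‖
        - ε * (1 - ρ ^ 2) * ‖p‖ ^ 2 := by
    have h5 : (Complex.I * cdot ζ (a - b) -
        bracket ζ * (cdot (a - z) (a - z) + cdot (z - b) (z - b))).re ≤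
        2 * ‖p‖ * ‖a - b‖ + 2 * ‖p‖ * (‖a - z‖ * ‖a - z‖ + ‖z - b‖ * ‖z - b‖) := by
      refine (Complex.re_le_norm _).trans ((norm_sub_le _ _).trans ?_)
      rw [norm_mul, norm_mul, Complex.norm_I, one_mul]
      gcongr
      · exact (norm_cdot_le _ _).trans (by gcongr)
      · exact (norm_bracket_le _).trans hζ
      · exact (norm_add_le _ _).trans (add_le_add (norm_cdot_le _ _) (norm_cdot_le _ _))
    rw [Complex.sub_re]
    rw [Complex.neg_re] at h3
    linarith
  have h6 : (2 * ‖p‖) ^ (m / 2 : ℝ) ≤ Real.exp (m * ‖p‖) := by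
    refine (rpow_le_exp (by positivity) (by positivity)).trans_eq ?_
    congr 1; ring
  calc _ ≤ Real.exp (2 * (‖a - b‖ + (‖a - z‖ * ‖a - z‖ + ‖z - b‖ * ‖z - b‖)) * ‖p‖
        - ε * (1 - ρ ^ 2) * ‖p‖ ^ 2) * (1 + 2 / (1 - ρ) * ‖z - b‖) * Real.exp (m * ‖p‖) := by
        gcongr
        exact h2.trans h6
    _ = (1 + 2 / (1 - ρ) * ‖z - b‖) * (Real.exp (2 * (‖a - b‖ + (‖a - z‖ * ‖a - z‖ + ‖z - b‖ * ‖z - b‖)) * ‖p‖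
        - ε * (1 - ρ ^ 2) * ‖p‖ ^ 2) * Real.exp (m * ‖p‖)) := by ring
    _ = _ := by rw [← Real.exp_add]; ring_nf

/-- The majorant used for the integrals over the real structure bundle. -/
def bundleMajorant (m : ℕ) (A C c : ℝ) (p : RSpace m × RSpace m) : ℝ :=
  A * ((1 + ‖p.1‖) ^ (-(m + 1 / 2) : ℝ) * (‖p.2‖ ^ (-(3 / 4) : ℝ) * Real.exp (C * ‖p.2‖ - c * ‖p.2‖ ^ 2)))

/-- Both powers are on the convergent side: m + 1/2 > m at infinity in x, and 3/4 < 1 ≤ m at the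
origin in ξ. -/
lemma integrable_bundleMajorant (hm : 0 < m) (A C : ℝ) {c : ℝ} (hc : 0 < c) :
    Integrable (bundleMajorant m A C c) := by
  have h1 : Integrable fun x : RSpace m => (1 + ‖x‖) ^ (-(m + 1 / 2) : ℝ) :=
    integrable_one_add_norm (by rw [finrank_euclideanSpace_fin]; linarith)
  have h2 := integrable_rpow_norm_mul_exp_sq (m := m) hm (s := -(3 / 4)) (by
    have : (1 : ℝ) ≤ m := by exact_mod_cast hm
    linarith) hc C
  exact (h1.mul_prod h2).const_mul A

lemma exists_rpow_le_mul_exp {s : ℝ} (hs : 0 ≤ s) : ∃ C : ℝ, 0 ≤ C ∧ ∀ x : ℝ, 0 ≤ x →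
    x ^ s ≤ C * Real.exp x := by
  refine ⟨1 + (⌈s⌉₊).factorial, by positivity, fun x hx => ?_⟩
  have h1 : x ^ s ≤ 1 + x ^ ⌈s⌉₊ := by
    rcases le_total x 1 with h | h
    · exact (Real.rpow_le_one hx h hs).trans (by linarith [pow_nonneg hx ⌈s⌉₊])
    · have := Real.rpow_le_rpow_of_exponent_le h (Nat.le_ceil s)
      rw [Real.rpow_natCast] at this
      linarith
  have h2 := pow_mul_exp_le ⌈s⌉₊ hx
  have h3 := Real.one_le_exp hx
  linarith

/-- The decay e^{−rX²} in X degenerates as r → 0. Since e^{−s} ≤ D s^{−(m/2+3/4)} for s = r(1 + X²),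
it can be exchanged for the power (1 + X)^{−(m+3/2)} at the price r^{−(m/2+3/4)}. The factors 1 + X
and r^{m/2} leave the exponents −(m+1/2) and −3/4. The 1 in C + 1 pays for replacing X² by 1 + X².
-/
lemma exists_bundle_le (m : ℕ) : ∃ A : ℝ, 0 ≤ A ∧ ∀ (r X C c : ℝ), 0 < r → 0 ≤ X →
    (1 + X) * r ^ (m / 2 : ℝ) * Real.exp (C * r - r * X ^ 2 - c * r ^ 2) ≤
      A * ((1 + X) ^ (-(m + 1 / 2) : ℝ) * (r ^ (-(3 / 4) : ℝ) * Real.exp ((C + 1) * r - c * r ^ 2))) := by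
  obtain ⟨D, hD, h⟩ := exists_rpow_le_mul_exp (s := m / 2 + 3 / 4) (by positivity)
  refine ⟨D * 2 ^ (m / 2 + 3 / 4 : ℝ), by positivity, fun r X C c hr hX => ?_⟩
  have h1 := h (r * (1 + X ^ 2)) (by positivity)
  have h2 : (1 + X) ^ 2 ≤ 2 * (1 + X ^ 2) := by nlinarith [sq_nonneg (X - 1)]
  have h3 : (1 + X) ^ (m + 3 / 2 : ℝ) ≤ 2 ^ (m / 2 + 3 / 4 : ℝ) * (1 + X ^ 2) ^ (m / 2 + 3 / 4 : ℝ) := by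
    rw [← Real.mul_rpow (by norm_num) (by positivity)]
    calc (1 + X) ^ (m + 3 / 2 : ℝ) = ((1 + X) ^ 2) ^ (m / 2 + 3 / 4 : ℝ) := by
          rw [← Real.rpow_natCast, ← Real.rpow_mul (by positivity)]
          congr 1; push_cast; ring
      _ ≤ _ := by gcongr
  rw [Real.mul_rpow hr.le (by positivity)] at h1
  have h4 : r ^ (m / 2 + 3 / 4 : ℝ) * (1 + X) ^ (m + 3 / 2 : ℝ) * Real.exp (-(r * (1 + X ^ 2))) ≤
      D * 2 ^ (m / 2 + 3 / 4 : ℝ) := by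
    rw [Real.exp_neg, ← div_eq_mul_inv, div_le_iff₀ (Real.exp_pos _)]
    calc r ^ (m / 2 + 3 / 4 : ℝ) * (1 + X) ^ (m + 3 / 2 : ℝ) ≤ r ^ (m / 2 + 3 / 4 : ℝ) *
          (2 ^ (m / 2 + 3 / 4 : ℝ) * (1 + X ^ 2) ^ (m / 2 + 3 / 4 : ℝ)) := by gcongr
      _ = 2 ^ (m / 2 + 3 / 4 : ℝ) * (r ^ (m / 2 + 3 / 4 : ℝ) * (1 + X ^ 2) ^ (m / 2 + 3 / 4 : ℝ)) := by ring
      _ ≤ 2 ^ (m / 2 + 3 / 4 : ℝ) * (D * Real.exp (r * (1 + X ^ 2))) := by gcongr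
      _ = _ := by ring
  have e1 : 1 + X = (1 + X) ^ (m + 3 / 2 : ℝ) * (1 + X) ^ (-(m + 1 / 2) : ℝ) := by
    rw [← Real.rpow_add (by positivity)]
    conv_lhs => rw [← Real.rpow_one (1 + X)]
    congr 1; ring
  have e2 : r ^ (m / 2 : ℝ) = r ^ (m / 2 + 3 / 4 : ℝ) * r ^ (-(3 / 4) : ℝ) := by
    rw [← Real.rpow_add hr]; congr 1; ring
  have e3 : Real.exp (C * r - r * X ^ 2 - c * r ^ 2) =
      Real.exp (-(r * (1 + X ^ 2))) * Real.exp ((C + 1) * r - c * r ^ 2) := by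
    rw [← Real.exp_add]; ring_nf
  rw [e3, e2]
  nth_rewrite 1 [e1]
  calc _ = (r ^ (m / 2 + 3 / 4 : ℝ) * (1 + X) ^ (m + 3 / 2 : ℝ) * Real.exp (-(r * (1 + X ^ 2)))) *
        ((1 + X) ^ (-(m + 1 / 2) : ℝ) * (r ^ (-(3 / 4) : ℝ) * Real.exp ((C + 1) * r - c * r ^ 2))) := by ring
    _ ≤ _ := by gcongr

/-- Domination of the integrand on the real structure bundle. -/
lemma exists_norm_invKernel_le_bundle {ε : ℝ} (hε : 0 < ε) {K : ℝ} (hK0 : 0 ≤ K) (hK1 : K < 1)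
    {B ρ R : ℝ} (hB : 0 ≤ B) (hR : 0 ≤ R) : ∃ A C c : ℝ, 0 ≤ A ∧ 0 ≤ C ∧ 0 < c ∧
    ∀ (a b : CSpace m) (x h p q : RSpace m), ‖a‖ ≤ R → ‖b‖ ≤ R → ‖h‖ ≤ B → p ≠ 0 →
      ‖q‖ ≤ K * ‖p‖ → (q = 0 ∨ ‖x‖ ≤ ρ) →
      ‖invKernel ε a (toC x + Complex.I • toC h) b (toC p + Complex.I • toC q)‖ ≤
        A * ((1 + ‖x‖) ^ (-(m + 1 / 2) : ℝ) *
          (‖p‖ ^ (-(3 / 4) : ℝ) * Real.exp (C * ‖p‖ - c * ‖p‖ ^ 2))) := by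
  obtain ⟨A₀, hA₀, hA⟩ := exists_bundle_le m
  have hK2 : 0 < 1 - K ^ 2 := by nlinarith
  have hK3 : 0 < 1 - K := by linarith
  set C₁ : ℝ := 4 * R + 4 * (R + ρ + B) ^ 2 + ρ ^ 2 + 2 * R ^ 2 + 2 * (R + B) ^ 2 with hC₁
  set D : ℝ := 1 + 2 / (1 - K) * (1 + B + R) with hD
  refine ⟨D * 2 ^ (m / 2 : ℝ) * A₀, C₁ + 1, ε * (1 - K ^ 2), by positivity, by positivity,
    by positivity, fun a b x h p q ha hb hh hp hq hqx => ?_⟩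
  have hp' : 0 < ‖p‖ := norm_pos_iff.2 hp
  have hZ : ‖toC x + Complex.I • toC h‖ ≤ ‖x‖ + B := by
    refine (norm_add_le _ _).trans ?_
    rw [norm_smul, Complex.norm_I, one_mul, toC.norm_map, toC.norm_map]
    linarith
  have h1 := norm_factor_le hK0 hK1 hq (toC x + Complex.I • toC h - b)
  have h2 := norm_bracket_cpow_le hK1 hq
  have h3 := re_exponent_le hε.le hq
  have hζ := norm_add_I_le hq hK1
  set z := toC x + Complex.I • toC h with hz
  have h5 : (-(bracket (toC p + Complex.I • toC q) *
      (cdot (a - z) (a - z) + cdot (z - b) (z - b)))).re ≤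
      (C₁ - 4 * R) * ‖p‖ - ‖p‖ * ‖x‖ ^ 2 := by
    -- For a real covector ⟨ζ⟩ = |p| > 0, and each of the two squares has real part at least |x|²/2
    -- minus a constant, which yields the decay −|p||x|². Otherwise x is bounded, so everything is
    -- O(|p|) and |p||x|² ≤ ρ²|p| can be added to both sides.
    rcases hqx with hq0 | hx
    · have e1 : ∀ w : CSpace m, ‖w‖ ≤ R → ‖x‖ ^ 2 / 2 - R ^ 2 - (R + B) ^ 2 ≤ (cdot (w - z) (w - z)).re := by
        intro w hw
        obtain ⟨w₁, w₂, rfl⟩ := exists_eq_add_I w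
        have e2 : toC w₁ + Complex.I • toC w₂ - z = toC (w₁ - x) + Complex.I • toC (w₂ - h) := by
          rw [hz, map_sub, map_sub, smul_sub]; abel
        have hw₁ : ‖w₁‖ ≤ R := (norm_le_norm_add_I w₁ w₂).trans hw
        have hw₂ : ‖w₂‖ ≤ R := by
          refine le_trans ?_ hw
          have := norm_sq_add_I w₁ w₂
          nlinarith [norm_nonneg w₁, norm_nonneg w₂, norm_nonneg (toC w₁ + Complex.I • toC w₂)]
        rw [e2, re_cdot_self_add_I]
        have e3 : ‖x‖ ≤ ‖w₁ - x‖ + R := by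
          have := norm_sub_norm_le x w₁
          rw [norm_sub_rev x w₁] at this
          linarith
        have e4 : ‖x‖ ^ 2 ≤ 2 * ‖w₁ - x‖ ^ 2 + 2 * R ^ 2 := by
          have := pow_le_pow_left₀ (norm_nonneg x) e3 2
          nlinarith [sq_nonneg (‖w₁ - x‖ - R)]
        have e5 : ‖w₂ - h‖ ≤ R + B := (norm_sub_le _ _).trans (by gcongr)
        have e6 := pow_le_pow_left₀ (norm_nonneg _) e5 2
        linarith
      have e7 := e1 a ha
      have e8 := e1 b hb
      have e9 : cdot (b - z) (b - z) = cdot (z - b) (z - b) := by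
        rw [← neg_sub z b, cdot_neg_left, cdot_neg_right, neg_neg]
      rw [e9] at e8
      have e10 : bracket (toC p + Complex.I • toC q) = (‖p‖ : ℂ) := by
        rw [hq0, map_zero, smul_zero, add_zero, bracket_toC]
      rw [e10, Complex.neg_re, Complex.re_ofReal_mul, Complex.add_re]
      have e11 : ‖p‖ * (‖x‖ ^ 2 - 2 * R ^ 2 - 2 * (R + B) ^ 2) ≤
          ‖p‖ * ((cdot (a - z) (a - z)).re + (cdot (z - b) (z - b)).re) := by
        gcongr; linarith
      have : 0 ≤ ‖p‖ * (4 * (R + ρ + B) ^ 2 + ρ ^ 2) := by positivity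
      rw [hC₁]; linarith
    · have e1 : ∀ w : CSpace m, ‖w‖ ≤ R + ρ + B → ‖cdot w w‖ ≤ (R + ρ + B) ^ 2 := fun w hw =>
        (norm_cdot_le w w).trans (by rw [← sq]; gcongr)
      have e2 : ‖a - z‖ ≤ R + ρ + B := (norm_sub_le _ _).trans (by linarith)
      have e3 : ‖z - b‖ ≤ R + ρ + B := (norm_sub_le _ _).trans (by linarith)
      have e4 : (-(bracket (toC p + Complex.I • toC q) *
          (cdot (a - z) (a - z) + cdot (z - b) (z - b)))).re ≤
          2 * ‖p‖ * ((R + ρ + B) ^ 2 + (R + ρ + B) ^ 2) := by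
        refine (Complex.re_le_norm _).trans ?_
        rw [norm_neg, norm_mul]
        gcongr
        · exact (norm_bracket_le _).trans hζ
        · exact (norm_add_le _ _).trans (add_le_add (e1 _ e2) (e1 _ e3))
      have e5 : ‖p‖ * ‖x‖ ^ 2 ≤ ‖p‖ * ρ ^ 2 := by gcongr
      have : 0 ≤ ‖p‖ * (2 * R ^ 2 + 2 * (R + B) ^ 2) := by positivity
      rw [hC₁]; linarith
  set ζ := toC p + Complex.I • toC q with hζdef
  have hexp : (Complex.I * cdot ζ (a - b) - bracket ζ * (cdot (a - z) (a - z) + cdot (z - b) (z - b))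
      - ε * cdot ζ ζ).re ≤ C₁ * ‖p‖ - ‖p‖ * ‖x‖ ^ 2 - ε * (1 - K ^ 2) * ‖p‖ ^ 2 := by
    have e1 : (Complex.I * cdot ζ (a - b)).re ≤ 4 * R * ‖p‖ := by
      refine (Complex.re_le_norm _).trans ?_
      rw [norm_mul, Complex.norm_I, one_mul]
      refine (norm_cdot_le _ _).trans ?_
      calc ‖ζ‖ * ‖a - b‖ ≤ (2 * ‖p‖) * (R + R) := by
            gcongr
            exact (norm_sub_le _ _).trans (by gcongr)
        _ = _ := by ring
    rw [Complex.sub_re, Complex.sub_re]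
    rw [Complex.neg_re] at h3 h5
    linarith
  have hfac : ‖1 + Complex.I / bracket ζ * cdot (z - b) ζ‖ ≤ D * (1 + ‖x‖) := by
    refine h1.trans ?_
    have e1 : ‖z - b‖ ≤ (1 + B + R) * (1 + ‖x‖) := by
      refine (norm_sub_le _ _).trans ?_
      nlinarith [norm_nonneg x]
    calc 1 + 2 / (1 - K) * ‖z - b‖ ≤ 1 + 2 / (1 - K) * ((1 + B + R) * (1 + ‖x‖)) := by gcongr
      _ ≤ 1 * (1 + ‖x‖) + 2 / (1 - K) * ((1 + B + R) * (1 + ‖x‖)) := by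
          gcongr
          linarith [norm_nonneg x]
      _ = _ := by rw [hD]; ring
  rw [invKernel, norm_mul, norm_mul, Complex.norm_exp]
  calc _ ≤ Real.exp (C₁ * ‖p‖ - ‖p‖ * ‖x‖ ^ 2 - ε * (1 - K ^ 2) * ‖p‖ ^ 2) * (D * (1 + ‖x‖)) *
        (2 * ‖p‖) ^ (m / 2 : ℝ) := by gcongr
    _ = D * 2 ^ (m / 2 : ℝ) * ((1 + ‖x‖) * ‖p‖ ^ (m / 2 : ℝ) *
        Real.exp (C₁ * ‖p‖ - ‖p‖ * ‖x‖ ^ 2 - ε * (1 - K ^ 2) * ‖p‖ ^ 2)) := by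
        rw [Real.mul_rpow (by norm_num) hp'.le]; ring
    _ ≤ D * 2 ^ (m / 2 : ℝ) * _ :=
        mul_le_mul_of_nonneg_left (hA ‖p‖ ‖x‖ C₁ _ hp' (norm_nonneg x)) (by positivity)
    _ = _ := by ring

end Integrand

end FBI
end

noncomputable section

namespace FBI

/-! ### The real structure bundle -/

section Bundle

variable {m n : ℕ}

lemma _root_.ContDiffOn.matrix_det {E : Type*} [NormedAddCommGroup E] [NormedSpace ℝ E] {s : Set E}
    {k : WithTop ℕ∞} {M : E → Matrix (Fin m) (Fin m) ℂ} (h : ∀ i j, ContDiffOn ℝ k (fun x => M x i j) s) :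
    ContDiffOn ℝ k (fun x => (M x).det) s := by
  simp only [Matrix.det_apply]
  exact ContDiffOn.sum fun σ _ => (contDiffOn_prod fun i _ => h _ _).const_smul _

lemma matC_comp (L L' : RSpace m →L[ℝ] RSpace m) : matC (L ∘L L') = matC L * matC L' := by
  ext j k
  have h := matC_mulVec L (L' (EuclideanSpace.single k 1)) j
  rw [matC, Matrix.of_apply, ContinuousLinearMap.comp_apply, ← h]
  rfl

lemma det_one_sub_eq_conj (L : RSpace m →L[ℝ] RSpace m) :
    (1 + Complex.I • matC (-L)).det = (starRingEnd ℂ) (1 + Complex.I • matC L).det := by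
  rw [RingHom.map_det]
  congr 1
  ext j k
  simp [matC, Matrix.one_apply, apply_ite]

/-- `det (1 + L²) = det (1 + iL) det (1 - iL)`. -/
lemma det_id_add_comp_self (L : RSpace m →L[ℝ] RSpace m) :
    (((ContinuousLinearMap.id ℝ (RSpace m) + L ∘L L).det : ℝ) : ℂ) =
      (1 + Complex.I • matC L).det * (1 + Complex.I • matC (-L)).det ∧
    0 ≤ (ContinuousLinearMap.id ℝ (RSpace m) + L ∘L L).det := by
  have h1 : (((ContinuousLinearMap.id ℝ (RSpace m) + L ∘L L).det : ℝ) : ℂ) =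
      (1 + Complex.I • matC L).det * (1 + Complex.I • matC (-L)).det := by
    have h := det_id_add_smul (L ∘L L) 1
    rw [one_smul] at h
    rw [h, ← Matrix.det_mul]
    congr 1
    have h2 : (Matrix.of fun j k => (((L ∘L L) (EuclideanSpace.single k 1) j : ℝ) : ℂ)) =
        matC L * matC L := matC_comp L L
    have h3 : (Complex.I • matC L) * (Complex.I • matC L) = -(matC L * matC L) := by
      rw [smul_mul_smul_comm, Complex.I_mul_I, neg_one_smul]
    rw [h2, matC_neg, smul_neg, ← sub_eq_add_neg, mul_sub, mul_one, add_mul, one_mul, h3]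
    simp only [Complex.ofReal_one, one_smul]
    abel
  refine ⟨h1, ?_⟩
  rw [det_one_sub_eq_conj, Complex.mul_conj] at h1
  have h2 : (ContinuousLinearMap.id ℝ (RSpace m) + L ∘L L).det =
      Complex.normSq (1 + Complex.I • matC L).det := by exact_mod_cast h1
  rw [h2]
  exact Complex.normSq_nonneg _

namespace IsAdmissible

variable {φ : RSpace m → RSpace n → RSpace m} {V : Opens (RSpace m)} {W : Opens (RSpace n)}

lemma isOpen_domain (W : Opens (RSpace n)) : IsOpen ((univ : Set (RSpace m)) ×ˢ (W : Set (RSpace n))) :=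
  isOpen_univ.prod W.isOpen

lemma contDiffOn_fderiv_apply (hφ : IsAdmissible φ V W) (v : RSpace m) :
    ContDiffOn ℝ ∞ (fun p : RSpace m × RSpace n => fderiv ℝ (fun y => φ y p.2) p.1 v)
      (univ ×ˢ (W : Set (RSpace n))) := by
  have h1 := (hφ.smooth.fderiv_of_isOpen (isOpen_domain W) (m := ∞) (by simp)).clm_apply
    (contDiffOn_const (c := ((v, 0) : RSpace m × RSpace n)))
  refine h1.congr fun p hp => ?_
  have h2 : DifferentiableAt ℝ (fun p : RSpace m × RSpace n => φ p.1 p.2) p :=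
    (hφ.smooth.contDiffAt ((isOpen_domain W).mem_nhds hp)).differentiableAt (by simp)
  have h3 := h2.hasFDerivAt.comp (f := fun y : RSpace m => (y, p.2)) p.1 (hasFDerivAt_prodMk_left p.1 p.2)
  have h4 : HasFDerivAt (fun y => φ y p.2) _ p.1 := h3
  rw [h4.fderiv]
  simp

lemma contDiffOn_Z (hφ : IsAdmissible φ V W) :
    ContDiffOn ℝ ∞ (fun p : RSpace m × RSpace n => Z φ p.1 p.2) (univ ×ˢ (W : Set (RSpace n))) := by
  simp only [Z_eq]
  exact (toC.contDiff.comp contDiff_fst).contDiffOn.add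
    ((toC.contDiff.comp_contDiffOn hφ.smooth).const_smul Complex.I)

lemma contDiffOn_Zx (hφ : IsAdmissible φ V W) (i j : Fin m) :
    ContDiffOn ℝ ∞ (fun p : RSpace m × RSpace n => Zx φ p.1 p.2 i j) (univ ×ˢ (W : Set (RSpace n))) := by
  have h1 : ContDiffOn ℝ ∞ (fun p : RSpace m × RSpace n =>
      (1 : Matrix (Fin m) (Fin m) ℂ) i j + Complex.I *
        ((fderiv ℝ (fun y => φ y p.2) p.1 (EuclideanSpace.single j 1) i : ℝ) : ℂ))
      (univ ×ˢ (W : Set (RSpace n))) := by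
    refine contDiffOn_const.add (contDiffOn_const.mul ?_)
    exact Complex.ofRealCLM.contDiff.comp_contDiffOn
      ((EuclideanSpace.proj i : RSpace m →L[ℝ] ℝ).contDiff.comp_contDiffOn
        (hφ.contDiffOn_fderiv_apply (EuclideanSpace.single j 1)))
  refine h1.congr fun p hp => ?_
  rw [hφ.Zx_eq hp.2]
  rfl

lemma contDiffOn_det (hφ : IsAdmissible φ V W) :
    ContDiffOn ℝ ∞ (fun p : RSpace m × RSpace n => (Zx φ p.1 p.2).det) (univ ×ˢ (W : Set (RSpace n))) :=
  ContDiffOn.matrix_det hφ.contDiffOn_Zx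

lemma contDiff_slice {F : Type*} [NormedAddCommGroup F] [NormedSpace ℝ F]
    {f : RSpace m × RSpace n → F} (hf : ContDiffOn ℝ ∞ f (univ ×ˢ (W : Set (RSpace n)))) {t : RSpace n}
    (ht : t ∈ W) : ContDiff ℝ ∞ fun x => f (x, t) := by
  rw [← contDiffOn_univ]
  exact hf.comp (f := fun x : RSpace m => (x, t)) (by fun_prop) fun x _ => ⟨mem_univ _, ht⟩

lemma contDiff_Z (hφ : IsAdmissible φ V W) {t : RSpace n} (ht : t ∈ W) : ContDiff ℝ ∞ fun x => Z φ x t :=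
  contDiff_slice hφ.contDiffOn_Z ht

lemma contDiff_det (hφ : IsAdmissible φ V W) {t : RSpace n} (ht : t ∈ W) :
    ContDiff ℝ ∞ fun x => (Zx φ x t).det :=
  contDiff_slice hφ.contDiffOn_det ht

/-- W is not compact, so uniformity in t cannot come from continuity. It comes from the Lipschitz
bound, comparing x with a point of norm R + 1 at which φ vanishes for every t. -/
lemma exists_norm_le (hφ : IsAdmissible φ V W) (hm : 0 < m) : ∃ B ρ : ℝ, 0 ≤ B ∧ 0 ≤ ρ ∧
    ∀ t ∈ W, ∀ x, ‖φ x t‖ ≤ B ∧ (ρ < ‖x‖ → φ x t = 0 ∧ fderiv ℝ (fun y => φ y t) x = 0) := by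
  obtain ⟨K₀, hK₀, h0⟩ := hφ.compact_support
  obtain ⟨K, hK, hlip⟩ := hφ.exists_lipschitz
  obtain ⟨R, hR0, hR⟩ := hK₀.isBounded.exists_pos_norm_le
  have hout : ∀ t ∈ W, ∀ x, R < ‖x‖ → φ x t = 0 := fun t ht x hx =>
    h0 x (fun hx' => (hR x hx').not_gt hx) t ht
  have hK1 : (K : ℝ) ≤ 1 := by exact_mod_cast hK.le
  refine ⟨2 * R + 1, R, by positivity, hR0.le, fun t ht x => ⟨?_, fun hx => ⟨hout t ht x hx, ?_⟩⟩⟩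
  · by_cases hx : R < ‖x‖
    · rw [hout t ht x hx, norm_zero]; positivity
    · set y : RSpace m := EuclideanSpace.single ⟨0, hm⟩ (R + 1) with hy
      have hyn : ‖y‖ = R + 1 := by
        rw [hy, PiLp.norm_single, Real.norm_of_nonneg (by positivity)]
      have h1 := (hlip t ht).norm_sub_le x y
      rw [hout t ht y (by rw [hyn]; linarith), sub_zero] at h1
      have h2 := norm_sub_le x y
      rw [hyn] at h2
      push Not at hx
      have h3 : (K : ℝ) * ‖x - y‖ ≤ 1 * ‖x - y‖ := by gcongr
      linarith
  · have h1 : (fun y => φ y t) =ᶠ[𝓝 x] fun _ => 0 := by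
      filter_upwards [(isOpen_lt continuous_const continuous_norm).mem_nhds hx] with y hy
      exact hout t ht y hy
    rw [h1.fderiv_eq]
    simp

/-- With A = ᵗφ_x and ‖A‖ ≤ K < 1, the map 1 + A² is invertible. Solving ξ = p + A²p makes the
covector p − iAp, so |p| and |ξ| are comparable and the covector lies in a fixed subcone. Where φ_x
= 0 it is real. -/
lemma exists_covector_eq (hφ : IsAdmissible φ V W) {K : NNReal} (hK : K < 1)
    (hlip : ∀ t ∈ W, LipschitzWith K (fun x => φ x t)) {t : RSpace n} (ht : t ∈ W) (x ξ : RSpace m) :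
    ∃ p q : RSpace m, covector φ t x ξ = toC p + Complex.I • toC q ∧ ‖q‖ ≤ K * ‖p‖ ∧
      ‖ξ‖ ≤ 2 * ‖p‖ ∧ (1 - (K : ℝ) ^ 2) * ‖p‖ ≤ ‖ξ‖ ∧ (fderiv ℝ (fun y => φ y t) x = 0 → q = 0) := by
  set A := ContinuousLinearMap.adjoint (fderiv ℝ (fun y => φ y t) x) with hA
  have hK1 : (K : ℝ) < 1 := by exact_mod_cast hK
  have hK0 : (0 : ℝ) ≤ K := K.2
  have hAK : ∀ p, ‖A p‖ ≤ K * ‖p‖ := fun p => by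
    refine A.le_of_opNorm_le ?_ p
    rw [hA, LinearIsometryEquiv.norm_map]
    exact norm_fderiv_le_of_lipschitz ℝ (hlip t ht)
  have hAA : ∀ p, ‖A (A p)‖ ≤ (K : ℝ) ^ 2 * ‖p‖ := fun p =>
    (hAK _).trans (by rw [sq, mul_assoc]; gcongr; exact hAK p)
  have hlow : ∀ p, (1 - (K : ℝ) ^ 2) * ‖p‖ ≤ ‖p + A (A p)‖ := fun p => by
    have h1 := norm_sub_norm_le p (-(A (A p)))
    rw [norm_neg, sub_neg_eq_add] at h1
    linarith [hAA p]
  let T : RSpace m →ₗ[ℝ] RSpace m := LinearMap.id + ((A ∘L A : RSpace m →L[ℝ] RSpace m) : RSpace m →ₗ[ℝ] RSpace m)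
  have hinj : Function.Injective T := by
    rw [← LinearMap.ker_eq_bot, LinearMap.ker_eq_bot']
    intro p hp
    have h1 := hlow p
    have h2 : p + A (A p) = 0 := hp
    rw [h2, norm_zero] at h1
    have : 0 < 1 - (K : ℝ) ^ 2 := by nlinarith
    exact norm_eq_zero.1 (le_antisymm (by nlinarith) (norm_nonneg p))
  obtain ⟨p, hp⟩ := (LinearMap.injective_iff_surjective.1 hinj) ξ
  have hp' : ξ = p + A (A p) := hp.symm
  refine ⟨p, -A p, ?_, ?_, ?_, ?_, ?_⟩
  · rw [hp', hA, hφ.mem_fibre ht]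
  · rw [norm_neg]; exact hAK p
  · rw [hp']
    refine (norm_add_le _ _).trans ?_
    have h1 : (K : ℝ) ^ 2 ≤ 1 := by nlinarith
    nlinarith [hAA p, norm_nonneg p]
  · rw [hp']; exact hlow p
  · intro h
    rw [hA, h]; simp

lemma covector_mem_cone (hφ : IsAdmissible φ V W) {t : RSpace n} (ht : t ∈ W) (x : RSpace m)
    {ξ : RSpace m} (hξ : ξ ≠ 0) : covector φ t x ξ ∈ cone m := by
  obtain ⟨K, hK, hlip⟩ := hφ.exists_lipschitz
  obtain ⟨p, q, h, hq, hp, -⟩ := hφ.exists_covector_eq hK hlip ht x ξ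
  rw [h]
  refine mem_cone_of_norm_le K.2 (by exact_mod_cast hK) ?_ hq
  rintro rfl
  exact hξ (norm_le_zero_iff.1 (by simpa using hp))

lemma continuous_covector (hφ : IsAdmissible φ V W) {t : RSpace n} (ht : t ∈ W) :
    Continuous fun p : RSpace m × RSpace m => covector φ t p.1 p.2 := by
  have h1 : Continuous fun x => (Zx φ x t)ᵀ :=
    (continuous_matrix fun i j => (contDiff_slice (hφ.contDiffOn_Zx i j) ht).continuous).matrix_transpose
  have h2 : Continuous fun x => ((Zx φ x t)ᵀ)⁻¹ := by
    simp only [Matrix.inv_def, Ring.inverse_eq_inv']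
    refine (h1.matrix_det.inv₀ fun x => ?_).smul h1.matrix_adjugate
    rw [Matrix.det_transpose]
    exact hφ.det_Zx_ne_zero ht x
  have h3 : Continuous fun p : RSpace m × RSpace m =>
      (((Zx φ p.1 t)ᵀ)⁻¹ *ᵥ fun j => (p.2 j : ℂ)) := by
    refine (h2.comp continuous_fst).matrix_mulVec (continuous_pi fun j => ?_)
    fun_prop
  unfold covector
  exact (PiLp.continuous_toLp 2 _).comp h3

/-- Integration over a fibre of the real structure bundle. -/
theorem integral_covector (hφ : IsAdmissible φ V W) (hm : 0 < m) {t : RSpace n} (ht : t ∈ W)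
    (x : RSpace m) {H : CSpace m → ℂ} (hH : DifferentiableOn ℂ H (cone m))
    (hHb : ∀ ρ : ℝ, 0 ≤ ρ → ρ < 1 → ∃ A C c : ℝ, 0 ≤ A ∧ 0 ≤ C ∧ 0 < c ∧ ∀ p q : RSpace m,
      ‖q‖ ≤ ρ * ‖p‖ → ‖H (toC p + Complex.I • toC q)‖ ≤ A * Real.exp (C * ‖p‖ - c * ‖p‖ ^ 2)) :
    ∫ ξ, H (covector φ t x ξ) = (Zx φ x t).det * ∫ p, H (toC p) := by
  obtain ⟨K, hK, hlip⟩ := hφ.exists_lipschitz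
  set A := ContinuousLinearMap.adjoint (fderiv ℝ (fun y => φ y t) x) with hA
  have hAK : ‖-A‖ ≤ K := by
    rw [norm_neg, hA, LinearIsometryEquiv.norm_map]
    exact norm_fderiv_le_of_lipschitz ℝ (hlip t ht)
  have hglip : LipschitzWith K (fun p => (-A) p) := by
    refine (-A).lipschitz.weaken ?_
    exact_mod_cast hAK
  have hK1 : (K : ℝ) < 1 := by exact_mod_cast hK
  -- Substituting ξ = Tp parametrizes the fibre as {p − iAp}. The Jacobian factors as det(1 + iA)
  -- det(1 − iA): the first factor is det Z_x, the second is the Jacobian of the contour p − iAp,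
  -- which the deformation to ℝᵐ consumes.
  set T : RSpace m →L[ℝ] RSpace m := ContinuousLinearMap.id ℝ (RSpace m) + A ∘L A with hT
  have hZ : (Zx φ x t).det = (1 + Complex.I • matC A).det := by
    rw [hφ.Zx_eq ht, ← Matrix.det_transpose, hA, matC_adjoint, Matrix.transpose_add,
      Matrix.transpose_smul, Matrix.transpose_one]
  obtain ⟨hd1, hd2⟩ := det_id_add_comp_self A
  have hinj : Function.Injective T := by
    intro p p' h
    have h1 := (hφ.mem_fibre ht x p).symm.trans ((congrArg (covector φ t x) h).trans (hφ.mem_fibre ht x p'))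
    have h2 : p - p' = 0 := by
      have h3 := norm_le_norm_add_I (p - p') (-A p - -A p')
      rw [map_sub, map_sub, smul_sub, sub_add_sub_comm, h1, sub_self, norm_zero] at h3
      exact norm_le_zero_iff.1 h3
    exact sub_eq_zero.1 h2
  have hsurj : Function.Surjective T :=
    (LinearMap.injective_iff_surjective (f := (T : RSpace m →ₗ[ℝ] RSpace m))).1 hinj
  have hcv := integral_image_eq_integral_abs_det_fderiv_smul volume MeasurableSet.univ
    (f' := fun _ => T) (fun p _ => T.hasFDerivAt.hasFDerivWithinAt) hinj.injOn
    (fun ξ => H (covector φ t x ξ))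
  rw [image_univ, hsurj.range_eq, Measure.restrict_univ] at hcv
  have hshift := integral_cone_shift hm hK hglip (by simp) (fun p _ => (-A).differentiableAt) hH hHb
  rw [hcv, ← hshift, ← integral_const_mul]
  refine integral_congr_ae (Eventually.of_forall fun p => ?_)
  have h1 : covector φ t x (T p) = toC p + Complex.I • toC ((-A) p) := hφ.mem_fibre ht x p
  have h2 : jacC (fun p => (-A) p) p = matC (-A) := by
    rw [jacC_eq]
    congr 1
    exact (-A).fderiv
  simp only
  rw [h1, h2, abs_of_nonneg hd2, Complex.real_smul, hd1, hZ]
  ring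

end IsAdmissible

end Bundle

end FBI
end

noncomputable section

namespace FBI

/-! ### Evaluation of the inversion integral -/

section Inversion

variable {m n : ℕ}

/-- Completing the square about the midpoint: with w = z − (a+b)/2 and d = (a−b)/2, the sum of
squares is 2w·w + 2d·d. The Gaussian in w has parameter 2|ξ|, and the affine factor is split into
its value at the midpoint and a part linear in w. -/
lemma invKernel_toC (ε : ℝ) (a z b : CSpace m) (ξ : RSpace m) :
    invKernel ε a z b (toC ξ) =
      (Complex.exp (Complex.I * cdot (toC ξ) (a - b) - cdot (a - b) (a - b) / 2 * ‖ξ‖ - ε * ‖ξ‖ ^ 2) *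
        (‖ξ‖ : ℂ) ^ ((m : ℂ) / 2)) *
      (Complex.exp (-((2 * ‖ξ‖ : ℝ) * cdot (z - (1 / 2 : ℂ) • (a + b)) (z - (1 / 2 : ℂ) • (a + b)))) *
        ((1 + Complex.I * cdot (toC ξ) (a - b) / (2 * ‖ξ‖)) +
          cdot ((Complex.I / ‖ξ‖) • toC ξ) (z - (1 / 2 : ℂ) • (a + b)))) := by
  set w := z - (1 / 2 : ℂ) • (a + b) with hw
  set d := (1 / 2 : ℂ) • (a - b) with hd
  have e1 : a - z = d - w := by rw [hw, hd]; module
  have e2 : z - b = w + d := by rw [hw, hd]; module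
  have e3 : a - b = (2 : ℂ) • d := by rw [hd]; module
  rw [invKernel, bracket_toC, cdot_toC ξ ξ, real_inner_self_eq_norm_sq, e1, e2, e3]
  simp only [cdot_sub_left, cdot_sub_right, cdot_add_left, cdot_add_right, cdot_smul_left,
    cdot_smul_right, cdot_comm d w, cdot_comm d (toC ξ), cdot_comm w (toC ξ)]
  have e4 : Complex.exp (Complex.I * (2 * cdot (toC ξ) d) - ‖ξ‖ * (cdot d d - cdot w d - (cdot w d - cdot w w) +
      (cdot w w + cdot w d + (cdot w d + cdot d d))) - ε * ((‖ξ‖ ^ 2 : ℝ) : ℂ)) =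
      Complex.exp (Complex.I * (2 * cdot (toC ξ) d) - 2 * (2 * cdot d d) / 2 * ‖ξ‖ - ε * ‖ξ‖ ^ 2) *
        Complex.exp (-((2 * ‖ξ‖ : ℝ) * cdot w w)) := by
    rw [← Complex.exp_add]
    congr 1
    push_cast
    ring
  have e5 : 1 + Complex.I / ‖ξ‖ * (cdot (toC ξ) w + cdot (toC ξ) d) =
      1 + Complex.I * (2 * cdot (toC ξ) d) / (2 * ‖ξ‖) + Complex.I / ‖ξ‖ * cdot (toC ξ) w := by
    rcases eq_or_ne (‖ξ‖ : ℂ) 0 with h0 | h0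
    · rw [h0]; simp
    · field_simp; ring
  rw [e4, e5]
  ring

namespace IsAdmissible

variable {φ : RSpace m → RSpace n → RSpace m} {V : Opens (RSpace m)} {W : Opens (RSpace n)}

lemma measurableSet_snd_ne : MeasurableSet {p : RSpace m × RSpace m | p.2 ≠ 0} :=
  (measurableSet_eq_fun measurable_snd measurable_const).compl

lemma ae_snd_ne (hm : 0 < m) : ∀ᵐ p : RSpace m × RSpace m, p.2 ≠ 0 := by
  have : Nonempty (Fin m) := ⟨⟨0, hm⟩⟩
  have h : {p : RSpace m × RSpace m | ¬ p.2 ≠ 0} = univ ×ˢ {0} := by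
    ext p; simp
  rw [ae_iff, h, Measure.volume_eq_prod, Measure.prod_prod]
  simp

lemma continuousOn_invKernel (hφ : IsAdmissible φ V W) {t : RSpace n} (ht : t ∈ W) (ε : ℝ) (a : CSpace m) :
    ContinuousOn (fun q : (RSpace m × RSpace m) × CSpace m =>
      invKernel ε a (Z φ q.1.1 t) q.2 (covector φ t q.1.1 q.1.2))
      ({p : RSpace m × RSpace m | p.2 ≠ 0} ×ˢ univ) := fun _ hq =>
  (continuousAt_invKernel ε a
    ((hφ.contDiff_Z ht).continuous.comp (continuous_fst.comp continuous_fst)).continuousAt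
    continuous_snd.continuousAt
    ((hφ.continuous_covector ht).comp continuous_fst).continuousAt
    (hφ.covector_mem_cone ht _ hq.1)).continuousWithinAt

/-- Integrable majorants of the integrand over the real structure bundle, in the given and in the
straightened fibres. -/
lemma exists_norm_invKernel_le (hφ : IsAdmissible φ V W) (hm : 0 < m) {ε : ℝ} (hε : 0 < ε) {R : ℝ} (hR : 0 ≤ R) :
    ∃ A C c : ℝ, 0 < c ∧ ∀ t ∈ W, ∀ a b : CSpace m, ‖a‖ ≤ R → ‖b‖ ≤ R → ∀ p : RSpace m × RSpace m, p.2 ≠ 0 →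
      ‖invKernel ε a (Z φ p.1 t) b (covector φ t p.1 p.2)‖ ≤ bundleMajorant m A C c p ∧
      ‖invKernel ε a (Z φ p.1 t) b (toC p.2)‖ ≤ bundleMajorant m A C c p := by
  obtain ⟨K, hK, hlip⟩ := hφ.exists_lipschitz
  obtain ⟨B, ρ, hB, hρ, hφB⟩ := hφ.exists_norm_le hm
  have hK1 : (K : ℝ) < 1 := by exact_mod_cast hK
  have hK0 : (0 : ℝ) ≤ K := K.2
  have hK2 : 0 < 1 - (K : ℝ) ^ 2 := by nlinarith
  obtain ⟨A, C, c, hA, hC, hc, h⟩ := exists_norm_invKernel_le_bundle (m := m) hε hK0 hK1 (ρ := ρ) hB hR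
  set k : ℝ := (1 - (K : ℝ) ^ 2)⁻¹ with hk
  have hk1 : 1 ≤ k := by
    rw [hk, one_le_inv₀ hK2]; nlinarith
  -- The covector p' + iq' satisfies |ξ|/2 ≤ |p'| ≤ k|ξ|. The lower bound accounts for the first and
  -- last constants, the upper bound for Ck.
  refine ⟨A * (1 / 2 : ℝ) ^ (-(3 / 4) : ℝ), C * k, c / 4, by positivity, fun t ht a b ha hb p hp => ?_⟩
  have hξ : 0 < ‖p.2‖ := norm_pos_iff.2 hp
  have key : ∀ p' q' : RSpace m, ‖q'‖ ≤ K * ‖p'‖ → ‖p.2‖ ≤ 2 * ‖p'‖ → ‖p'‖ ≤ k * ‖p.2‖ →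
      (q' = 0 ∨ ‖p.1‖ ≤ ρ) → ‖invKernel ε a (Z φ p.1 t) b (toC p' + Complex.I • toC q')‖ ≤
        bundleMajorant m (A * (1 / 2 : ℝ) ^ (-(3 / 4) : ℝ)) (C * k) (c / 4) p := by
    intro p' q' hq' h1 h2 h3
    have hp' : 0 < ‖p'‖ := by linarith
    refine (h a b p.1 (φ p.1 t) p' q' ha hb (hφB t ht p.1).1 (norm_pos_iff.1 hp') hq' h3).trans ?_
    rw [bundleMajorant, mul_assoc A, mul_left_comm ((1 / 2 : ℝ) ^ (-(3 / 4) : ℝ))]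
    have e1 : ‖p'‖ ^ (-(3 / 4) : ℝ) ≤ (1 / 2 : ℝ) ^ (-(3 / 4) : ℝ) * ‖p.2‖ ^ (-(3 / 4) : ℝ) := by
      rw [← Real.mul_rpow (by norm_num) hξ.le]
      exact Real.rpow_le_rpow_of_nonpos (by positivity) (by linarith) (by norm_num)
    have e2 : C * ‖p'‖ - c * ‖p'‖ ^ 2 ≤ C * k * ‖p.2‖ - c / 4 * ‖p.2‖ ^ 2 := by
      have e3 : C * ‖p'‖ ≤ C * (k * ‖p.2‖) := by gcongr
      have e4 := pow_le_pow_left₀ hξ.le h1 2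
      nlinarith [mul_le_mul_of_nonneg_left e4 hc.le]
    rw [← mul_assoc ((1 / 2 : ℝ) ^ (-(3 / 4) : ℝ))]
    gcongr
  refine ⟨?_, ?_⟩
  · obtain ⟨p', q', hcov, h1, h2, h3, h4⟩ := hφ.exists_covector_eq hK hlip ht p.1 p.2
    rw [hcov]
    refine key p' q' h1 h2 ?_ ?_
    · rw [hk, ← div_eq_inv_mul, le_div_iff₀ hK2]; linarith
    · by_cases hx : ρ < ‖p.1‖
      · exact Or.inl (h4 ((hφB t ht p.1).2 hx).2)
      · exact Or.inr (not_lt.1 hx)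
  · have := key p.2 0 (by rw [norm_zero]; positivity) (by linarith) (by nlinarith) (Or.inl rfl)
    simpa using this

/-- The integral of the inversion kernel over the real structure bundle. -/
theorem integral_invKernel (hφ : IsAdmissible φ V W) (hm : 0 < m) {t : RSpace n} (ht : t ∈ W) {ε : ℝ}
    (hε : 0 < ε) (a b : CSpace m) :
    ∫ p : RSpace m × RSpace m, invKernel ε a (Z φ p.1 t) b (covector φ t p.1 p.2) =
      ((((2 * Real.pi ^ 3) ^ ((m : ℝ) / 2) : ℝ)) : ℂ) * kern ε (a - b) := by
  have : Nonempty (Fin m) := ⟨⟨0, hm⟩⟩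
  obtain ⟨K, hK, hlip⟩ := hφ.exists_lipschitz
  obtain ⟨B, ρ, hB, hρ, hφB⟩ := hφ.exists_norm_le hm
  obtain ⟨A, C, c, hc, hmaj⟩ := hφ.exists_norm_invKernel_le hm hε (R := max ‖a‖ ‖b‖) (by positivity)
  obtain ⟨D, hD, hdet⟩ := exists_norm_det_jacC_le m
  have hmi := integrable_bundleMajorant hm A C hc
  have hjac : ∀ x, (Zx φ x t).det = (1 + Complex.I • jacC (fun y => φ y t) x).det := fun x => by
    rw [hφ.Zx_eq ht, jacC_eq]
  have hi1 : Integrable fun p : RSpace m × RSpace m =>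
      invKernel ε a (Z φ p.1 t) b (covector φ t p.1 p.2) := by
    refine hmi.mono' ?_ ?_
    · have h1 := ((hφ.continuousOn_invKernel ht ε a).comp (f := fun p => (p, b))
        (by fun_prop) fun p hp => ⟨hp, mem_univ _⟩).aestronglyMeasurable measurableSet_snd_ne (μ := volume)
      rwa [Measure.restrict_eq_self_of_ae_mem (s := {p : RSpace m × RSpace m | p.2 ≠ 0}) (ae_snd_ne hm)] at h1
    · filter_upwards [ae_snd_ne hm] with p hp
      exact (hmaj t ht a b (le_max_left _ _) (le_max_right _ _) p hp).1
  have hi2 : Integrable fun p : RSpace m × RSpace m =>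
      (Zx φ p.1 t).det * invKernel ε a (Z φ p.1 t) b (toC p.2) := by
    refine (hmi.const_mul D).mono' ?_ ?_
    · have h1 : ContinuousOn (fun p : RSpace m × RSpace m =>
          (Zx φ p.1 t).det * invKernel ε a (Z φ p.1 t) b (toC p.2)) {p | p.2 ≠ 0} := fun p hp =>
        (((hφ.contDiff_det ht).continuous.comp continuous_fst).continuousAt.mul
          (continuousAt_invKernel ε a
            ((hφ.contDiff_Z ht).continuous.comp continuous_fst).continuousAt continuousAt_const
            (toC.continuous.comp continuous_snd).continuousAt (toC_mem_cone hp))).continuousWithinAt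
      have h2 := h1.aestronglyMeasurable measurableSet_snd_ne (μ := volume)
      rwa [Measure.restrict_eq_self_of_ae_mem (s := {p : RSpace m × RSpace m | p.2 ≠ 0}) (ae_snd_ne hm)] at h2
    · filter_upwards [ae_snd_ne hm] with p hp
      rw [norm_mul, hjac]
      exact mul_le_mul (hdet _ K hK (hlip t ht) _)
        (hmaj t ht a b (le_max_left _ _) (le_max_right _ _) p hp).2 (norm_nonneg _) hD
  rw [Measure.volume_eq_prod] at hi1 hi2 ⊢
  rw [integral_prod _ hi1]
  -- Straightening the fibre yields det Z_x(x,t), which is the Jacobian needed to read the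
  -- x-integral as one over the manifold {Z(x,t)}. After that ξ no longer depends on x, and the
  -- order of integration can be exchanged.
  have h1 : ∀ x, ∫ ξ, invKernel ε a (Z φ x t) b (covector φ t x ξ) =
      ∫ ξ, (Zx φ x t).det * invKernel ε a (Z φ x t) b (toC ξ) := fun x => by
    rw [integral_const_mul]
    exact hφ.integral_covector hm ht x (differentiableOn_invKernel ε a _ b) fun ρ h0 h1 =>
      FBI.exists_norm_invKernel_le hε a _ b h0 h1
  simp only [h1]
  rw [integral_integral_swap hi2, kern, ← mul_assoc]
  -- (π/2)^{m/2} is what remains of the Gaussian integral (π/(2|ξ|))^{m/2} after multiplication by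
  -- |ξ|^{m/2}; this explains the normalization (2π³)^{−m/2}.
  have hpi : ((((2 * Real.pi ^ 3) ^ ((m : ℝ) / 2) : ℝ)) : ℂ) * ((2 * Real.pi : ℂ) ^ m)⁻¹ =
      (((Real.pi / 2) ^ (m / 2 : ℝ) : ℝ) : ℂ) := by
    have e1 : ((2 * Real.pi : ℂ) ^ m) = (((2 * Real.pi) ^ m : ℝ) : ℂ) := by push_cast; rfl
    rw [e1, ← Complex.ofReal_inv, ← Complex.ofReal_mul]
    congr 1
    rw [← div_eq_mul_inv, div_eq_iff (by positivity)]
    have e2 : (2 * Real.pi) ^ m = ((2 * Real.pi) ^ 2) ^ (m / 2 : ℝ) := by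
      rw [← Real.rpow_natCast (2 * Real.pi) 2, ← Real.rpow_mul (by positivity), ← Real.rpow_natCast]
      congr 1; push_cast; ring
    rw [e2, ← Real.mul_rpow (by positivity) (by positivity)]
    congr 1; ring
  rw [hpi, ← integral_const_mul]
  have hae : ∀ᵐ ξ : RSpace m, ξ ≠ 0 := by simp [ae_iff]
  refine integral_congr_ae (hae.mono fun ξ hξ => ?_)
  have hξ' : 0 < ‖ξ‖ := norm_pos_iff.2 hξ
  have h2 := integral_gaussian_shift hm (hlip t ht) (hφ.differentiableAt ht) (fun p => (hφB t ht p).1)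
    (l := 2 * ‖ξ‖) (by positivity) ((1 / 2 : ℂ) • (a + b)) ((Complex.I / ‖ξ‖) • toC ξ)
    (1 + Complex.I * cdot (toC ξ) (a - b) / (2 * ‖ξ‖))
  have h3 : ∀ x, (Zx φ x t).det * invKernel ε a (Z φ x t) b (toC ξ) =
      (Complex.exp (Complex.I * cdot (toC ξ) (a - b) - cdot (a - b) (a - b) / 2 * ‖ξ‖ - ε * ‖ξ‖ ^ 2) *
        (‖ξ‖ : ℂ) ^ ((m : ℂ) / 2)) *
      (Complex.exp (-((2 * ‖ξ‖ : ℝ) * cdot (toC x + Complex.I • toC (φ x t) - (1 / 2 : ℂ) • (a + b))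
          (toC x + Complex.I • toC (φ x t) - (1 / 2 : ℂ) • (a + b)))) *
        ((1 + Complex.I * cdot (toC ξ) (a - b) / (2 * ‖ξ‖)) +
          cdot ((Complex.I / ‖ξ‖) • toC ξ) (toC x + Complex.I • toC (φ x t) - (1 / 2 : ℂ) • (a + b))) *
        (1 + Complex.I • jacC (fun y => φ y t) x).det) := fun x => by
    rw [hjac, invKernel_toC, ← Z_eq]; ring
  simp only [h3]
  rw [integral_const_mul, h2]
  have h4 : (‖ξ‖ : ℂ) ^ ((m : ℂ) / 2) * (((Real.pi / (2 * ‖ξ‖)) ^ (m / 2 : ℝ) : ℝ) : ℂ) =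
      (((Real.pi / 2) ^ (m / 2 : ℝ) : ℝ) : ℂ) := by
    have e1 : (‖ξ‖ : ℂ) ^ ((m : ℂ) / 2) = ((‖ξ‖ ^ (m / 2 : ℝ) : ℝ) : ℂ) := by
      rw [Complex.ofReal_cpow hξ'.le]; push_cast; rfl
    rw [e1, ← Complex.ofReal_mul, ← Real.mul_rpow hξ'.le (by positivity)]
    congr 2
    field_simp
  rw [← h4]
  ring

lemma _root_.FBI.CompactDistribution.pair_const_mul (d : CompactDistribution V) (c : ℂ)
    {f : RSpace m → ℂ} (hf : ContDiffOn ℝ ∞ f V) : d.pair (fun y => c * f y) = c * d.pair f := by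
  rw [CompactDistribution.pair_of_smooth d hf,
    CompactDistribution.pair_of_smooth d (f := fun y => c * f y) (contDiffOn_const.mul hf),
    ← smul_eq_mul c (d.toLinearMap _), ← map_smul]
  rfl

/-- The outer factors do not depend on y and may enter the bracket, the phases add up because ζ·(a −
z) + ζ·(z − b) = ζ·(a − b), and the two Jacobians of the form dz' ∧ dζ cancel. -/
lemma inversionIntegrand_eq (hφ : IsAdmissible φ V W) (u : RSpace n → CompactDistribution V)
    {t : RSpace n} (ht : t ∈ W) (ε : ℝ) (x : RSpace m) (p : RSpace m × RSpace m) :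
    inversionIntegrand φ u ε x t p = (u t).pair fun y =>
      invKernel ε (Z φ x t) (Z φ p.1 t) (Z φ y t) (covector φ t p.1 p.2) * (Zx φ y t).det := by
  have h0 : (Zx φ p.1 t).det * (((Zx φ p.1 t)ᵀ)⁻¹).det = 1 := by
    rw [Matrix.det_nonsing_inv, Matrix.det_transpose]
    exact Ring.mul_inverse_cancel _ (hφ.det_Zx_ne_zero ht p.1).isUnit
  rw [inversionIntegrand, h0, mul_one, inversionKernel, fbi]
  set ζ := covector φ t p.1 p.2
  set z := Z φ p.1 t
  set a := Z φ x t
  have hE : Differentiable ℂ fun b : CSpace m => Complex.exp (Complex.I * cdot ζ (z - b)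
      - bracket ζ * cdot (z - b) (z - b)) * fbiDelta (z - b) ζ := by
    intro b
    have h1 : DifferentiableAt ℂ (fun b : CSpace m => z - b) b := by fun_prop
    have h2 := (differentiableAt_const ζ).cdot h1
    have h3 := h1.cdot h1
    have h4 := h1.cdot (differentiableAt_const ζ)
    simp only [fbiDelta_eq]
    fun_prop
  have hsm := (contDiff_comp_mul (hφ.contDiff_Z ht) (hφ.contDiff_det ht) hE).contDiffOn (s := (V : Set (RSpace m)))
  rw [mul_right_comm, ← (u t).pair_const_mul _ hsm]
  congr 1
  funext y
  rw [invKernel, fbiDelta_eq]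
  have h5 : Complex.exp (Complex.I * cdot ζ (a - Z φ y t) -
      bracket ζ * (cdot (a - z) (a - z) + cdot (z - Z φ y t) (z - Z φ y t)) - ε * cdot ζ ζ) =
      Complex.exp (Complex.I * cdot ζ (a - z) - bracket ζ * cdot (a - z) (a - z) - ε * cdot ζ ζ) *
      Complex.exp (Complex.I * cdot ζ (z - Z φ y t) - bracket ζ * cdot (z - Z φ y t) (z - Z φ y t)) := by
    rw [← Complex.exp_add]
    congr 1
    rw [← sub_add_sub_cancel a z (Z φ y t), cdot_add_right]
    ring
  rw [h5]
  ring

/-- The integrand is entire in b and dominated uniformly for bounded b, so bracket and integral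
commute, and the bundle integral is the kernel up to the normalizing constant. -/
theorem inversionIntegral_eq (hφ : IsAdmissible φ V W) (hm : 0 < m) (u : RSpace n → CompactDistribution V)
    {t : RSpace n} (ht : t ∈ W) {ε : ℝ} (hε : 0 < ε) (x : RSpace m) :
    Integrable (inversionIntegrand φ u ε x t) ∧
    inversionIntegral φ u ε x t =
      (u t).pair fun y => kern ε (Z φ x t - Z φ y t) * (Zx φ y t).det := by
  obtain ⟨h1, h2, h3⟩ := (u t).pair_integral (μ := volume) (hφ.contDiff_Z ht) (hφ.contDiff_det ht)
    (Φ := fun (p : RSpace m × RSpace m) b =>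
      invKernel ε (Z φ x t) (Z φ p.1 t) b (covector φ t p.1 p.2))
    (fun p => differentiable_invKernel _ _ _ _) measurableSet_snd_ne (ae_snd_ne hm)
    (hφ.continuousOn_invKernel ht ε _) (fun R => by
      obtain ⟨A, C, c, hc, hmaj⟩ := hφ.exists_norm_invKernel_le hm hε (R := max ‖Z φ x t‖ R) (by positivity)
      exact ⟨bundleMajorant m A C c, integrable_bundleMajorant hm A C hc, fun p hp b hb =>
        (hmaj t ht _ b (le_max_left _ _) ((mem_closedBall_zero_iff.1 hb).trans (le_max_right _ _)) p hp).1⟩)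
  have hc : ((((2 * Real.pi ^ 3) ^ ((m : ℝ) / 2) : ℝ)) : ℂ) ≠ 0 := by
    norm_cast
    positivity
  have h0 : inversionIntegrand φ u ε x t = fun p => (u t).pair fun y =>
      invKernel ε (Z φ x t) (Z φ p.1 t) (Z φ y t) (covector φ t p.1 p.2) * (Zx φ y t).det :=
    funext fun p => hφ.inversionIntegrand_eq u ht ε x p
  simp only [hφ.integral_invKernel hm ht hε] at h1 h3
  refine ⟨by rw [h0]; exact h2, ?_⟩
  rw [inversionIntegral, h0, h3]
  have hkd : Differentiable ℂ fun b => kern ε (Z φ x t - b) := by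
    have := h1.const_mul ((((2 * Real.pi ^ 3) ^ ((m : ℝ) / 2) : ℝ)) : ℂ)⁻¹
    simpa only [inv_mul_cancel_left₀ hc] using this
  have hsm := (contDiff_comp_mul (hφ.contDiff_Z ht) (hφ.contDiff_det ht) hkd).contDiffOn (s := (V : Set (RSpace m)))
  have h4 := (u t).pair_const_mul ((((2 * Real.pi ^ 3) ^ ((m : ℝ) / 2) : ℝ)) : ℂ) hsm
  simp only [← mul_assoc] at h4
  rw [h4, inv_mul_cancel_left₀ hc]

end IsAdmissible

end Inversion

end FBI
end

noncomputable section

namespace FBI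

/-! ### Convergence of derivatives in a class of families closed under differentiation -/

section Abstract

variable {X Y F : Type} [NormedAddCommGroup X] [NormedSpace ℝ X] [NormedAddCommGroup Y]
  [NormedSpace ℝ Y] [NormedAddCommGroup F] [NormedSpace ℝ F]

lemma norm_iteratedFDeriv_sum_le {ι : Type*} (s : Finset ι) {f : ι → X → F} {x : X} {j : ℕ}
    (hf : ∀ i ∈ s, ContDiffAt ℝ j (f i) x) :
    ‖iteratedFDeriv ℝ j (fun y => ∑ i ∈ s, f i y) x‖ ≤ ∑ i ∈ s, ‖iteratedFDeriv ℝ j (f i) x‖ := by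
  classical
  induction s using Finset.induction_on with
  | empty =>
    simp only [Finset.sum_empty]
    rw [iteratedFDeriv_fun_zero]
    simp
  | insert a s ha ih =>
    simp only [Finset.sum_insert ha]
    rw [fun_iteratedFDeriv_add_apply (hf a (Finset.mem_insert_self a s))
      (ContDiffAt.sum fun i hi => hf i (Finset.mem_insert_of_mem hi))]
    exact (norm_add_le _ _).trans (by gcongr; exact ih fun i hi => hf i (Finset.mem_insert_of_mem hi))

variable [FiniteDimensional ℝ X]

/-- The coordinates of a basis of a finite-dimensional space. -/
def coordCLM (X : Type) [NormedAddCommGroup X] [NormedSpace ℝ X] [FiniteDimensional ℝ X]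
    (i : Fin (Module.finrank ℝ X)) : X →L[ℝ] ℝ :=
  LinearMap.toContinuousLinearMap ((Module.finBasis ℝ X).coord i)

/-- The linear maps `X → F` determined by the value at a basis vector. -/
def coordSMul (X F : Type) [NormedAddCommGroup X] [NormedSpace ℝ X] [FiniteDimensional ℝ X]
    [NormedAddCommGroup F] [NormedSpace ℝ F] (i : Fin (Module.finrank ℝ X)) : F →L[ℝ] (X →L[ℝ] F) :=
  ContinuousLinearMap.smulRightL ℝ X F (coordCLM X i)

lemma eq_sum_coordSMul (T : X →L[ℝ] F) :
    T = ∑ i, coordSMul X F i (T (Module.finBasis ℝ X i)) := by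
  ext v
  conv_lhs => rw [← (Module.finBasis ℝ X).sum_repr v, map_sum]
  simp only [map_smul, FunLike.coe_sum, Finset.sum_apply]
  rfl

lemma contDiffOn_succ_of_fderiv_apply {Ω : Set X} (hΩ : IsOpen Ω) {f : X → F} {j : ℕ}
    (hf : DifferentiableOn ℝ f Ω)
    (h : ∀ i, ContDiffOn ℝ j (fun x => fderiv ℝ f x (Module.finBasis ℝ X i)) Ω) :
    ContDiffOn ℝ (j + 1 : ℕ) f Ω := by
  have h1 : ContDiffOn ℝ ((j : WithTop ℕ∞) + 1) f Ω := by
    rw [contDiffOn_succ_iff_fderiv_of_isOpen hΩ]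
    refine ⟨hf, fun h => by simp at h, ?_⟩
    have h2 : ContDiffOn ℝ j (fun x => ∑ i, coordSMul X F i (fderiv ℝ f x (Module.finBasis ℝ X i))) Ω :=
      ContDiffOn.sum fun i _ => (coordSMul X F i).contDiff.comp_contDiffOn (h i)
    exact h2.congr fun x _ => eq_sum_coordSMul _
  exact_mod_cast h1

lemma norm_iteratedFDeriv_succ_le {Ω : Set X} (hΩ : IsOpen Ω) {f : X → F} {j : ℕ}
    {k : Fin (Module.finrank ℝ X) → X → F} (hk : ∀ i, ContDiffOn ℝ j (k i) Ω)
    (h : ∀ x ∈ Ω, ∀ i, fderiv ℝ f x (Module.finBasis ℝ X i) = k i x) {x : X} (hx : x ∈ Ω) :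
    ‖iteratedFDeriv ℝ (j + 1) f x‖ ≤ ∑ i, ‖coordSMul X F i‖ * ‖iteratedFDeriv ℝ j (k i) x‖ := by
  have h1 : fderiv ℝ f =ᶠ[𝓝 x] fun x => ∑ i, (coordSMul X F i ∘ k i) x := by
    filter_upwards [hΩ.mem_nhds hx] with y hy
    rw [eq_sum_coordSMul (fderiv ℝ f y)]
    simp only [h y hy, Function.comp_apply]
  have hk' : ∀ i, ContDiffAt ℝ j (k i) x := fun i => (hk i).contDiffAt (hΩ.mem_nhds hx)
  rw [← norm_iteratedFDeriv_fderiv, (h1.iteratedFDeriv ℝ j).eq_of_nhds]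
  refine (norm_iteratedFDeriv_sum_le _ fun i _ =>
    (coordSMul X F i).contDiff.contDiffAt.comp x (hk' i)).trans ?_
  gcongr with i
  exact (coordSMul X F i).norm_iteratedFDeriv_comp_left (hk' i) le_rfl

variable {S : Type*}

/-- If a class of families of functions is closed under differentiation and all its members converge
locally uniformly, then all derivatives converge locally uniformly. -/
theorem tendstoUniformlyOn_iteratedFDeriv_of_class {Ω : Set X} (hΩ : IsOpen Ω) {l : Filter ℝ} [l.NeBot]
    {E₀ : Set ℝ} (hE₀ : E₀ ∈ l) (𝒞 : Set ((ℝ → S → X → F) × (S → X → F)))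
    (hconv : ∀ f ∈ 𝒞, ∀ K ⊆ Ω, IsCompact K → TendstoUniformlyOn
      (fun ε (q : S × X) => f.1 ε q.1 q.2) (fun q => f.2 q.1 q.2) l (univ ×ˢ K))
    (hdiff : ∀ f ∈ 𝒞, ∀ ε ∈ E₀, ∀ s, DifferentiableOn ℝ (f.1 ε s) Ω)
    (hder : ∀ f ∈ 𝒞, ∀ v, ∃ g ∈ 𝒞, ∃ h ∈ 𝒞, ∀ ε ∈ E₀, ∀ s, ∀ x ∈ Ω,
      fderiv ℝ (f.1 ε s) x v = g.1 ε s x + h.1 ε s x) :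
    ∀ f ∈ 𝒞, (∀ ε ∈ E₀, ∀ s, ContDiffOn ℝ ∞ (f.1 ε s) Ω) ∧ (∀ s, ContDiffOn ℝ ∞ (f.2 s) Ω) ∧
      ∀ j : ℕ, ∀ K ⊆ Ω, IsCompact K → TendstoUniformlyOn
        (fun ε (q : S × X) => iteratedFDeriv ℝ j (f.1 ε q.1) q.2)
        (fun q => iteratedFDeriv ℝ j (f.2 q.1) q.2) l (univ ×ˢ K) := by
  -- Two members are allowed for a derivative so that a product rule fits the hypothesis.
  choose! G hG H hH hGH using hder
  -- The first derivatives are again sums of members of the class, so they converge locally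
  -- uniformly; hence the limit is differentiable, with the limit of the derivatives as derivative.
  have hlim : ∀ f ∈ 𝒞, ∀ s, ∀ x ∈ Ω, HasFDerivAt (f.2 s) (∑ i, coordSMul X F i
      ((G f (Module.finBasis ℝ X i)).2 s x + (H f (Module.finBasis ℝ X i)).2 s x)) x := by
    intro f hf s x hx
    obtain ⟨K, hK, hxK, hKΩ⟩ := exists_compact_subset hΩ hx
    refine hasFDerivAt_of_tendstoUniformlyOnFilter (l := l) (f := fun ε => f.1 ε s)
      (f' := fun ε x => fderiv ℝ (f.1 ε s) x) (g' := fun x => ∑ i, coordSMul X F i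
      ((G f (Module.finBasis ℝ X i)).2 s x + (H f (Module.finBasis ℝ X i)).2 s x)) ?_ ?_ ?_
    · have h1 : TendstoUniformlyOn (fun ε x => fderiv ℝ (f.1 ε s) x) (fun x => ∑ i, coordSMul X F i
          ((G f (Module.finBasis ℝ X i)).2 s x + (H f (Module.finBasis ℝ X i)).2 s x)) l K := by
        have h2 : TendstoUniformlyOn (fun ε x => ∑ i, coordSMul X F i
            ((G f (Module.finBasis ℝ X i)).1 ε s x + (H f (Module.finBasis ℝ X i)).1 ε s x))
            (fun x => ∑ i, coordSMul X F i
            ((G f (Module.finBasis ℝ X i)).2 s x + (H f (Module.finBasis ℝ X i)).2 s x)) l K := by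
          have h3 : ∀ i, TendstoUniformlyOn (fun ε x => coordSMul X F i
            ((G f (Module.finBasis ℝ X i)).1 ε s x + (H f (Module.finBasis ℝ X i)).1 ε s x))
            (fun x => coordSMul X F i
            ((G f (Module.finBasis ℝ X i)).2 s x + (H f (Module.finBasis ℝ X i)).2 s x)) l K := by
            intro i
            have h4 := (hconv _ (hG f hf (Module.finBasis ℝ X i)) K hKΩ hK).comp (fun x => (s, x))
            have h5 := (hconv _ (hH f hf (Module.finBasis ℝ X i)) K hKΩ hK).comp (fun x => (s, x))
            have hpre : (fun x => (s, x)) ⁻¹' (univ ×ˢ K) = K := by ext; simp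
            rw [hpre] at h4 h5
            exact (coordSMul X F i).uniformContinuous.comp_tendstoUniformlyOn (h4.add h5)
          rw [Metric.tendstoUniformlyOn_iff]
          intro δ hδ
          have hδ' : 0 < δ / (Module.finrank ℝ X + 1) := by positivity
          have h6 := (eventually_all (ι := Fin (Module.finrank ℝ X))).2 fun i =>
            Metric.tendstoUniformlyOn_iff.1 (h3 i) _ hδ'
          filter_upwards [h6] with ε hε y hy
          refine (dist_sum_sum_le _ _ _).trans_lt ?_
          refine (Finset.sum_le_sum fun i _ => (hε i y hy).le).trans_lt ?_
          rw [Finset.sum_const, Finset.card_univ, Fintype.card_fin, nsmul_eq_mul, mul_div_assoc',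
            div_lt_iff₀ (by positivity)]
          nlinarith
        refine h2.congr ?_
        filter_upwards [hE₀] with ε hε y hy
        simp only
        rw [eq_sum_coordSMul (fderiv ℝ (f.1 ε s) y)]
        exact Finset.sum_congr rfl fun i _ => by rw [hGH f hf _ ε hε s y (hKΩ hy)]
      exact (tendstoUniformlyOn_iff_tendstoUniformlyOnFilter.1 h1).mono_right
        (le_principal_iff.2 (mem_interior_iff_mem_nhds.1 hxK))
    · filter_upwards [prod_mem_prod hE₀ (hΩ.mem_nhds hx)] with p hp
      exact ((hdiff f hf p.1 hp.1 s).differentiableAt (hΩ.mem_nhds hp.2)).hasFDerivAt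
    · filter_upwards [mem_interior_iff_mem_nhds.1 hxK] with y hy
      exact (hconv f hf K hKΩ hK).tendsto_at (x := (s, y)) ⟨mem_univ _, hy⟩
  have hlim' : ∀ f ∈ 𝒞, ∀ s, ∀ x ∈ Ω, ∀ i, fderiv ℝ (f.2 s) x (Module.finBasis ℝ X i) =
      (G f (Module.finBasis ℝ X i)).2 s x + (H f (Module.finBasis ℝ X i)).2 s x := by
    intro f hf s x hx i
    rw [(hlim f hf s x hx).fderiv]
    simp only [FunLike.coe_sum, Finset.sum_apply]
    rw [Finset.sum_eq_single i]
    · simp [coordSMul, coordCLM]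
    · intro b _ hb
      simp [coordSMul, coordCLM, hb.symm]
    · simp
  -- The induction on the order is over all members at once: order j + 1 for f is order j for the
  -- members representing its first derivatives.
  have hmain : ∀ j : ℕ, ∀ f ∈ 𝒞, (∀ ε ∈ E₀, ∀ s, ContDiffOn ℝ j (f.1 ε s) Ω) ∧
      (∀ s, ContDiffOn ℝ j (f.2 s) Ω) ∧ ∀ K ⊆ Ω, IsCompact K → TendstoUniformlyOn
        (fun ε (q : S × X) => iteratedFDeriv ℝ j (f.1 ε q.1) q.2)
        (fun q => iteratedFDeriv ℝ j (f.2 q.1) q.2) l (univ ×ˢ K) := by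
    intro j
    induction j with
    | zero =>
      intro f hf
      refine ⟨fun ε hε s => ?_, fun s => ?_, fun K hKΩ hK => ?_⟩
      · exact contDiffOn_zero.2 (hdiff f hf ε hε s).continuousOn
      · exact contDiffOn_zero.2 fun x hx => (hlim f hf s x hx).continuousAt.continuousWithinAt
      · have h1 := hconv f hf K hKΩ hK
        rw [Metric.tendstoUniformlyOn_iff] at h1 ⊢
        refine fun δ hδ => (h1 δ hδ).mono fun ε h q hq => ?_
        have h2 := h q hq
        simp only [iteratedFDeriv_zero_eq_comp, Function.comp_apply, LinearIsometryEquiv.dist_map]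
        exact h2
    | succ j ih =>
      intro f hf
      have hsm : ∀ ε ∈ E₀, ∀ s i, ContDiffOn ℝ j (fun x => (G f (Module.finBasis ℝ X i)).1 ε s x +
          (H f (Module.finBasis ℝ X i)).1 ε s x) Ω := fun ε hε s i =>
        ((ih _ (hG f hf (Module.finBasis ℝ X i))).1 ε hε s).add
          ((ih _ (hH f hf (Module.finBasis ℝ X i))).1 ε hε s)
      have hsm0 : ∀ s i, ContDiffOn ℝ j (fun x => (G f (Module.finBasis ℝ X i)).2 s x +
          (H f (Module.finBasis ℝ X i)).2 s x) Ω := fun s i =>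
        ((ih _ (hG f hf (Module.finBasis ℝ X i))).2.1 s).add
          ((ih _ (hH f hf (Module.finBasis ℝ X i))).2.1 s)
      have hc1 : ∀ ε ∈ E₀, ∀ s, ContDiffOn ℝ (j + 1 : ℕ) (f.1 ε s) Ω := fun ε hε s =>
        contDiffOn_succ_of_fderiv_apply hΩ (hdiff f hf ε hε s) fun i =>
          (hsm ε hε s i).congr fun x hx => hGH f hf _ ε hε s x hx
      have hc2 : ∀ s, ContDiffOn ℝ (j + 1 : ℕ) (f.2 s) Ω := fun s =>
        contDiffOn_succ_of_fderiv_apply hΩ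
          (fun x hx => (hlim f hf s x hx).differentiableAt.differentiableWithinAt) fun i =>
          (hsm0 s i).congr fun x hx => hlim' f hf s x hx i
      refine ⟨hc1, hc2, fun K hKΩ hK => ?_⟩
      rw [Metric.tendstoUniformlyOn_iff]
      intro δ hδ
      set N : ℝ := ∑ i, 2 * ‖coordSMul X F i‖ + 1 with hN
      have hN0 : 0 < N := by positivity
      have e1 := (eventually_all (ι := Fin (Module.finrank ℝ X))).2 fun i =>
        Metric.tendstoUniformlyOn_iff.1 ((ih _ (hG f hf (Module.finBasis ℝ X i))).2.2 K hKΩ hK)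
          (δ / N) (by positivity)
      have e2 := (eventually_all (ι := Fin (Module.finrank ℝ X))).2 fun i =>
        Metric.tendstoUniformlyOn_iff.1 ((ih _ (hH f hf (Module.finBasis ℝ X i))).2.2 K hKΩ hK)
          (δ / N) (by positivity)
      filter_upwards [e1, e2, hE₀] with ε h1 h2 hε q hq
      have hqΩ : q.2 ∈ Ω := hKΩ hq.2
      have hnh := hΩ.mem_nhds hqΩ
      have hsub : iteratedFDeriv ℝ (j + 1) (f.2 q.1) q.2 - iteratedFDeriv ℝ (j + 1) (f.1 ε q.1) q.2 =
          iteratedFDeriv ℝ (j + 1) (f.2 q.1 - f.1 ε q.1) q.2 :=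
        (iteratedFDeriv_sub_apply ((hc2 q.1).contDiffAt hnh) ((hc1 ε hε q.1).contDiffAt hnh)).symm
      rw [dist_eq_norm, hsub]
      have hb := norm_iteratedFDeriv_succ_le hΩ (f := f.2 q.1 - f.1 ε q.1) (j := j)
        (k := fun i x => ((G f (Module.finBasis ℝ X i)).2 q.1 x + (H f (Module.finBasis ℝ X i)).2 q.1 x) -
          ((G f (Module.finBasis ℝ X i)).1 ε q.1 x + (H f (Module.finBasis ℝ X i)).1 ε q.1 x))
        (fun i => (hsm0 q.1 i).sub (hsm ε hε q.1 i)) (fun x hx i => by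
          rw [fderiv_sub (hlim f hf q.1 x hx).differentiableAt
            ((hdiff f hf ε hε q.1).differentiableAt (hΩ.mem_nhds hx)), sub_apply,
            hlim' f hf q.1 x hx i, hGH f hf _ ε hε q.1 x hx]) hqΩ
      refine hb.trans_lt ?_
      have hterm : ∀ i, ‖iteratedFDeriv ℝ j (fun x => ((G f (Module.finBasis ℝ X i)).2 q.1 x +
          (H f (Module.finBasis ℝ X i)).2 q.1 x) - ((G f (Module.finBasis ℝ X i)).1 ε q.1 x +
          (H f (Module.finBasis ℝ X i)).1 ε q.1 x)) q.2‖ ≤ 2 * (δ / N) := by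
        intro i
        have c1 := ((ih _ (hG f hf (Module.finBasis ℝ X i))).2.1 q.1).contDiffAt hnh
        have c2 := ((ih _ (hH f hf (Module.finBasis ℝ X i))).2.1 q.1).contDiffAt hnh
        have c3 := ((ih _ (hG f hf (Module.finBasis ℝ X i))).1 ε hε q.1).contDiffAt hnh
        have c4 := ((ih _ (hH f hf (Module.finBasis ℝ X i))).1 ε hε q.1).contDiffAt hnh
        rw [fun_iteratedFDeriv_sub_apply (c1.add c2) (c3.add c4), fun_iteratedFDeriv_add_apply c1 c2,
          fun_iteratedFDeriv_add_apply c3 c4, add_sub_add_comm]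
        refine (norm_add_le _ _).trans ?_
        have d1 := (h1 i q hq).le
        have d2 := (h2 i q hq).le
        rw [dist_eq_norm] at d1 d2
        linarith
      calc ∑ i, ‖coordSMul X F i‖ * _ ≤ ∑ i, ‖coordSMul X F i‖ * (2 * (δ / N)) :=
            Finset.sum_le_sum fun i _ => mul_le_mul_of_nonneg_left (hterm i) (norm_nonneg (coordSMul X F i))
        _ = (∑ i, 2 * ‖coordSMul X F i‖) * (δ / N) := by
            rw [Finset.sum_mul]
            exact Finset.sum_congr rfl fun i _ => by ring
        _ < δ := by
            rw [mul_div_assoc', div_lt_iff₀ hN0, hN]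
            linarith
  intro f hf
  exact ⟨fun ε hε s => contDiffOn_infty.2 fun j => (hmain j f hf).1 ε hε s,
    fun s => contDiffOn_infty.2 fun j => (hmain j f hf).2.1 s, fun j => (hmain j f hf).2.2⟩

end Abstract

end FBI
end

noncomputable section

namespace FBI

/-! ### Bounded families of smooth functions -/

section BddFamily

variable {X : Type} [NormedAddCommGroup X] [NormedSpace ℝ X] {S : Type*}

/-- Families of smooth functions on `D` all of whose derivatives are bounded on compact sets,
uniformly in the family. -/
structure IsBddFamily (D : Set X) (g : S → X → ℂ) : Prop where
  contDiffOn : ∀ s, ContDiffOn ℝ ∞ (g s) D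
  bdd : ∀ (j : ℕ), ∀ K ⊆ D, IsCompact K → ∃ M : ℝ, 0 ≤ M ∧ ∀ s, ∀ x ∈ K, ‖iteratedFDeriv ℝ j (g s) x‖ ≤ M

namespace IsBddFamily

variable {D : Set X} {f g : S → X → ℂ}

lemma of_const (hD : IsOpen D) {a : X → ℂ} (ha : ContDiffOn ℝ ∞ a D) :
    IsBddFamily D (fun _ : S => a) := by
  refine ⟨fun _ => ha, fun j K hKD hK => ?_⟩
  have h1 : ContinuousOn (iteratedFDeriv ℝ j a) K :=
    ((ha.continuousOn_iteratedFDerivWithin (m := j) (by exact_mod_cast le_top) hD.uniqueDiffOn).congr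
      fun x hx => (iteratedFDerivWithin_of_isOpen j hD hx).symm).mono hKD
  obtain ⟨M, hM⟩ := hK.exists_bound_of_continuousOn h1
  exact ⟨max M 0, le_max_right _ _, fun _ x hx => (hM x hx).trans (le_max_left _ _)⟩

lemma add (hD : IsOpen D) (hf : IsBddFamily D f) (hg : IsBddFamily D g) :
    IsBddFamily D (fun s x => f s x + g s x) := by
  refine ⟨fun s => (hf.contDiffOn s).add (hg.contDiffOn s), fun j K hKD hK => ?_⟩
  obtain ⟨M, hM0, hM⟩ := hf.bdd j K hKD hK
  obtain ⟨N, hN0, hN⟩ := hg.bdd j K hKD hK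
  refine ⟨M + N, by positivity, fun s x hx => ?_⟩
  have hn := hD.mem_nhds (hKD hx)
  rw [fun_iteratedFDeriv_add_apply (((hf.contDiffOn s).contDiffAt hn).of_le (by exact_mod_cast le_top))
    (((hg.contDiffOn s).contDiffAt hn).of_le (by exact_mod_cast le_top))]
  exact (norm_add_le _ _).trans (add_le_add (hM s x hx) (hN s x hx))

lemma mul (hD : IsOpen D) (hf : IsBddFamily D f) (hg : IsBddFamily D g) :
    IsBddFamily D (fun s x => f s x * g s x) := by
  refine ⟨fun s => (hf.contDiffOn s).mul (hg.contDiffOn s), fun j K hKD hK => ?_⟩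
  choose M hM0 hM using fun i => hf.bdd i K hKD hK
  choose N hN0 hN using fun i => hg.bdd i K hKD hK
  refine ⟨∑ i ∈ Finset.range (j + 1), (j.choose i : ℝ) * M i * N (j - i),
    Finset.sum_nonneg fun i _ => mul_nonneg (mul_nonneg (by positivity) (hM0 i)) (hN0 _),
    fun s x hx => ?_⟩
  have h1 := norm_iteratedFDerivWithin_mul_le (hf.contDiffOn s) (hg.contDiffOn s) hD.uniqueDiffOn
    (hKD hx) (n := j) (by exact_mod_cast le_top)
  rw [iteratedFDerivWithin_of_isOpen j hD (hKD hx)] at h1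
  refine h1.trans (Finset.sum_le_sum fun i _ => ?_)
  rw [iteratedFDerivWithin_of_isOpen i hD (hKD hx), iteratedFDerivWithin_of_isOpen (j - i) hD (hKD hx)]
  exact mul_le_mul (mul_le_mul_of_nonneg_left (hM i s x hx) (by positivity)) (hN _ s x hx)
    (norm_nonneg _) (mul_nonneg (by positivity) (hM0 i))

lemma sum (hD : IsOpen D) {ι : Type*} {G : ι → S → X → ℂ} (T : Finset ι)
    (h : ∀ i ∈ T, IsBddFamily D (G i)) : IsBddFamily D (fun s x => ∑ i ∈ T, G i s x) := by
  classical
  induction T using Finset.induction_on with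
  | empty => simpa using of_const hD contDiffOn_const
  | insert a T ha ih =>
    simp only [Finset.sum_insert ha]
    exact add hD (h a (Finset.mem_insert_self a T)) (ih fun i hi => h i (Finset.mem_insert_of_mem hi))

lemma contDiffOn_fderiv (hD : IsOpen D) (hf : IsBddFamily D f) (s : S) :
    ContDiffOn ℝ ∞ (fderiv ℝ (f s)) D :=
  (hf.contDiffOn s).fderiv_of_isOpen hD (m := ∞) (by simp)

lemma fderiv_apply (hD : IsOpen D) (hf : IsBddFamily D f) (v : X) :
    IsBddFamily D (fun s x => fderiv ℝ (f s) x v) := by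
  have h1 := fun s => hf.contDiffOn_fderiv hD s
  refine ⟨fun s => (h1 s).clm_apply contDiffOn_const, fun j K hKD hK => ?_⟩
  obtain ⟨M, hM0, hM⟩ := hf.bdd (j + 1) K hKD hK
  refine ⟨‖v‖ * M, by positivity, fun s x hx => ?_⟩
  refine (norm_iteratedFDeriv_clm_apply_const ((h1 s).contDiffAt (hD.mem_nhds (hKD hx)))
    (by exact_mod_cast le_top)).trans ?_
  rw [norm_iteratedFDeriv_fderiv]
  gcongr
  exact hM s x hx

end IsBddFamily

end BddFamily

/-! ### Smoothness of the kernel -/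

section Kern

variable {m : ℕ}

/-- For w in a ball the integrand grows at most exponentially in |ξ|, which the weight e^{−ε|ξ|²}
dominates. Holomorphy lets derivatives be moved from y and t to x. -/
lemma differentiable_kern (hm : 0 < m) {ε : ℝ} (hε : 0 < ε) :
    Differentiable ℂ (kern ε : CSpace m → ℂ) := by
  refine Differentiable.const_mul ?_ _
  have hc : ∀ w : CSpace m, Continuous fun ξ : RSpace m => cdot (toC ξ) w := fun w =>
    toC.continuous.cdot continuous_const
  refine differentiable_integral_of_dominated (fun w => ?_) (Eventually.of_forall fun ξ => ?_)
    fun w => ⟨Metric.ball w 1, Metric.ball_mem_nhds w one_pos, fun ξ =>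
      Real.exp (((‖w‖ + 1) + (‖w‖ + 1) ^ 2 / 2) * ‖ξ‖ - ε * ‖ξ‖ ^ 2) * (1 + (‖w‖ + 1) / 2),
      (integrable_exp_sq hm hε _).mul_const _, Eventually.of_forall fun ξ w' hw' => ?_⟩
  · refine AEStronglyMeasurable.mul (continuous_exp_kernel _ ε w).aestronglyMeasurable ?_
    have h1 := hc w
    have h2 : Measurable fun ξ : RSpace m => (1 + Complex.I * cdot (toC ξ) w / (2 * ‖ξ‖) : ℂ) := by
      have := h1.measurable
      fun_prop
    exact h2.aestronglyMeasurable
  · intro w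
    have h1 : DifferentiableAt ℂ (fun w : CSpace m => cdot (toC ξ) w) w :=
      (differentiableAt_const _).cdot differentiableAt_id
    have h2 : DifferentiableAt ℂ (fun w : CSpace m => cdot w w) w :=
      differentiableAt_id.cdot differentiableAt_id
    simp only [div_eq_mul_inv]
    fun_prop
  · have hw1 : ‖w'‖ ≤ ‖w‖ + 1 := by
      have := norm_le_norm_add_norm_sub' w' w
      rw [mem_ball_iff_norm] at hw'
      linarith
    rw [norm_mul]
    refine mul_le_mul ?_ ?_ (norm_nonneg _) (Real.exp_nonneg _)
    · refine (norm_exp_le _ ε w' ξ).trans (Real.exp_le_exp.2 ?_)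
      gcongr
      rw [norm_div]
      refine div_le_div₀ (by positivity) ((norm_cdot_le _ _).trans ?_) (by norm_num) (by simp)
      rw [pow_two]
      gcongr
    · refine (norm_add_le _ _).trans ?_
      rw [norm_one]
      have h3 := norm_cdot_div_le ξ w'
      have : Complex.I * cdot (toC ξ) w' / (2 * ‖ξ‖) = Complex.I / 2 * (cdot (toC ξ) w' / ‖ξ‖) := by
        rw [mul_div_mul_comm]
      rw [this, norm_mul]
      have h4 : ‖Complex.I / 2‖ = 1 / 2 := by simp
      rw [h4]
      linarith

end Kern

/-! ### Integrals depending on parameters -/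

section Param

variable {m : ℕ} {P : Type} [NormedAddCommGroup P] [NormedSpace ℝ P] [FiniteDimensional ℝ P]

lemma hasFDerivAt_integral_of_support {Ω : Set P} (hΩ : IsOpen Ω) {L : Set (RSpace m)} (hL : IsCompact L)
    {F : RSpace m × P → ℂ} (hF : ContDiffOn ℝ 1 F (univ ×ˢ Ω)) (h0 : ∀ x ∉ L, ∀ p, F (x, p) = 0)
    {p : P} (hp : p ∈ Ω) :
    Integrable (fun x => fderiv ℝ F (x, p) ∘L ContinuousLinearMap.inr ℝ (RSpace m) P) ∧
    HasFDerivAt (fun p => ∫ x, F (x, p))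
      (∫ x, fderiv ℝ F (x, p) ∘L ContinuousLinearMap.inr ℝ (RSpace m) P) p := by
  have hD : IsOpen ((univ : Set (RSpace m)) ×ˢ Ω) := isOpen_univ.prod hΩ
  have hdc : ContinuousOn (fderiv ℝ F) (univ ×ˢ Ω) := hF.continuousOn_fderiv_of_isOpen hD le_rfl
  have hda : ∀ x, ∀ q ∈ Ω, HasFDerivAt (fun q => F (x, q))
      (fderiv ℝ F (x, q) ∘L ContinuousLinearMap.inr ℝ (RSpace m) P) q := fun x q hq =>
    ((hF.contDiffAt (hD.mem_nhds ⟨mem_univ x, hq⟩)).differentiableAt one_ne_zero).hasFDerivAt.comp q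
      (hasFDerivAt_prodMk_right x q)
  have hd0 : ∀ x ∉ L, ∀ q ∈ Ω, fderiv ℝ F (x, q) ∘L ContinuousLinearMap.inr ℝ (RSpace m) P = 0 :=
    fun x hx q hq => by
      rw [← (hda x q hq).fderiv]
      simp only [h0 x hx]
      simp
  obtain ⟨K, hK, hpK, hKΩ⟩ := exists_compact_subset hΩ hp
  obtain ⟨M, hM⟩ := (hL.prod hK).exists_bound_of_continuousOn
    (f := fun q => fderiv ℝ F q ∘L ContinuousLinearMap.inr ℝ (RSpace m) P)
    ((hdc.mono (prod_mono (subset_univ L) hKΩ)).clm_comp continuousOn_const)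
  have hslice : ∀ q ∈ Ω, Continuous fun x => F (x, q) := fun q hq => by
    rw [← continuousOn_univ]
    exact hF.continuousOn.comp (f := fun x : RSpace m => (x, q)) (by fun_prop) fun x _ => ⟨mem_univ _, hq⟩
  have hslice' : Continuous fun x => fderiv ℝ F (x, p) ∘L ContinuousLinearMap.inr ℝ (RSpace m) P := by
    rw [← continuousOn_univ]
    exact (hdc.comp (f := fun x : RSpace m => (x, p)) (by fun_prop)
      fun x _ => ⟨mem_univ _, hp⟩).clm_comp continuousOn_const
  have hsup : ∀ {E : Type _} [NormedAddCommGroup E] {G : RSpace m → E}, (∀ x ∉ L, G x = 0) → HasCompactSupport G :=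
    fun h => HasCompactSupport.intro hL fun x hx => h x hx
  refine ⟨hslice'.integrable_of_hasCompactSupport (hsup fun x hx => hd0 x hx p hp), ?_⟩
  refine hasFDerivAt_integral_of_dominated_of_fderiv_le (s := K) (bound := L.indicator fun _ => M)
    (mem_interior_iff_mem_nhds.1 hpK)
    ?_ ?_ hslice'.aestronglyMeasurable (Eventually.of_forall fun x q hq => ?_) ?_
    (Eventually.of_forall fun x q hq => hda x q (hKΩ hq))
  · filter_upwards [hΩ.mem_nhds hp] with q hq
    exact (hslice q hq).aestronglyMeasurable
  · exact (hslice p hp).integrable_of_hasCompactSupport (hsup fun x hx => h0 x hx p)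
  · by_cases hx : x ∈ L
    · rw [indicator_of_mem hx]
      exact hM (x, q) ⟨hx, hq⟩
    · rw [indicator_of_notMem hx, hd0 x hx q (hKΩ hq), norm_zero]
  · rw [integrable_indicator_iff hL.measurableSet]
    exact integrableOn_const hL.measure_lt_top.ne

lemma integral_fderiv_eq_zero_of_support {L : Set (RSpace m)} (hL : IsCompact L) {G : RSpace m → ℂ}
    (hG : ContDiff ℝ 1 G) (h0 : ∀ x ∉ L, G x = 0) (v : RSpace m) :
    Integrable (fun x => fderiv ℝ G x v) ∧ ∫ x, fderiv ℝ G x v = 0 := by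
  have hs : HasCompactSupport G := HasCompactSupport.intro hL h0
  have h1 : Integrable fun x => fderiv ℝ G x v :=
    ((hG.continuous_fderiv one_ne_zero).clm_apply continuous_const).integrable_of_hasCompactSupport
      (hs.fderiv_apply ℝ v)
  refine ⟨h1, ?_⟩
  have h := integral_mul_fderiv_eq_neg_fderiv_mul_of_integrable (μ := volume) (f := fun _ : RSpace m => (1 : ℂ))
    (g := G) (v := v) (by simp) (by simpa using h1)
    (by simpa using hG.continuous.integrable_of_hasCompactSupport hs)
    (fun x _ => differentiableAt_const _) fun x _ => hG.differentiable one_ne_zero x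
  simpa using h

end Param

end FBI
end

noncomputable section

namespace FBI

/-! ### Derivatives of the regularized pairing with a test function -/

section KernInt

variable {m n : ℕ} {V : Opens (RSpace m)} {W : Opens (RSpace n)} {φ : RSpace m → RSpace n → RSpace m}

/-- The set of triples `(x, (y, t))` with `t ∈ W`. -/
abbrev triples (m : ℕ) (W : Opens (RSpace n)) : Set (RSpace m × RSpace m × RSpace n) :=
  univ ×ˢ (univ ×ˢ (W : Set (RSpace n)))

lemma isOpen_triples : IsOpen (triples m W) := isOpen_univ.prod (isOpen_univ.prod W.isOpen)

/-- `Z(x,t) - Z(y,t)` as a function of `(x, (y, t))`. -/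
def diffZ (φ : RSpace m → RSpace n → RSpace m) (q : RSpace m × RSpace m × RSpace n) : CSpace m :=
  Z φ q.1 q.2.2 - Z φ q.2.1 q.2.2

/-- `∫ g(x,y,t) k_ε(Z(x,t) - Z(y,t)) dx`. -/
def kernInt (φ : RSpace m → RSpace n → RSpace m) (ε : ℝ) (g : RSpace m × RSpace m × RSpace n → ℂ)
    (p : RSpace m × RSpace n) : ℂ :=
  ∫ x, g (x, p) * kern ε (diffZ φ (x, p))

/-- The components of `Z_x(x,t)⁻¹ ∂_v (Z(x,t) - Z(y,t))`, for a direction `v` of the `(y,t)` space. -/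
def shiftField (φ : RSpace m → RSpace n → RSpace m) (v : RSpace m × RSpace n) (j : Fin m)
    (q : RSpace m × RSpace m × RSpace n) : ℂ :=
  ((Zx φ q.1 q.2.2)⁻¹ *ᵥ (fderiv ℝ (diffZ φ) q (0, v)).ofLp) j

/-- The coefficient of the derivative of `kernInt`. -/
def derivCoeff (φ : RSpace m → RSpace n → RSpace m) (v : RSpace m × RSpace n)
    (g : RSpace m × RSpace m × RSpace n → ℂ) (q : RSpace m × RSpace m × RSpace n) : ℂ :=
  fderiv ℝ g q (0, v) +
    (-1) * ∑ j, fderiv ℝ (fun q => g q * shiftField φ v j q) q (EuclideanSpace.single j 1, 0)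

namespace IsAdmissible

lemma contDiffOn_diffZ (hφ : IsAdmissible φ V W) : ContDiffOn ℝ ∞ (diffZ φ) (triples m W) :=
  (hφ.contDiffOn_Z.comp (f := fun q : RSpace m × RSpace m × RSpace n => (q.1, q.2.2))
    (by fun_prop) fun q hq => ⟨mem_univ _, hq.2.2⟩).sub
  (hφ.contDiffOn_Z.comp (f := fun q : RSpace m × RSpace m × RSpace n => q.2)
    (by fun_prop) fun q hq => hq.2)

lemma fderiv_diffZ_single (hφ : IsAdmissible φ V W) {q : RSpace m × RSpace m × RSpace n}
    (hq : q ∈ triples m W) (i j : Fin m) :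
    fderiv ℝ (diffZ φ) q (EuclideanSpace.single j 1, 0) i = Zx φ q.1 q.2.2 i j := by
  have h1 : HasFDerivAt (diffZ φ) (fderiv ℝ (diffZ φ) q) q :=
    ((hφ.contDiffOn_diffZ.contDiffAt (isOpen_triples.mem_nhds hq)).differentiableAt (by simp)).hasFDerivAt
  have h2 := h1.comp (f := fun e : RSpace m => (e, q.2)) q.1 (hasFDerivAt_prodMk_left q.1 q.2)
  have h3 := (((EuclideanSpace.proj i : CSpace m →L[ℂ] ℂ).restrictScalars ℝ).hasFDerivAt.comp q.1 h2).add_const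
    (Z φ q.2.1 q.2.2 i)
  have h4 : (fun x => (⇑((EuclideanSpace.proj i : CSpace m →L[ℂ] ℂ).restrictScalars ℝ) ∘ diffZ φ ∘
      fun e => (e, q.2)) x + Z φ q.2.1 q.2.2 i) = fun y => Z φ y q.2.2 i := by
    funext x
    simp [diffZ]
  rw [h4] at h3
  rw [Zx, Matrix.of_apply, h3.fderiv]
  rfl

lemma contDiffOn_Zx_inv (hφ : IsAdmissible φ V W) (i j : Fin m) :
    ContDiffOn ℝ ∞ (fun p : RSpace m × RSpace n => (Zx φ p.1 p.2)⁻¹ i j) (univ ×ˢ (W : Set (RSpace n))) := by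
  simp only [Matrix.inv_def, Ring.inverse_eq_inv', Matrix.smul_apply, smul_eq_mul, Matrix.adjugate_apply]
  refine (hφ.contDiffOn_det.inv fun p hp => hφ.det_Zx_ne_zero hp.2 p.1).mul
    (ContDiffOn.matrix_det fun a b => ?_)
  simp only [Matrix.updateRow_apply]
  split_ifs
  · exact contDiffOn_const
  · exact hφ.contDiffOn_Zx a b

lemma contDiffOn_shiftField (hφ : IsAdmissible φ V W) (v : RSpace m × RSpace n) (j : Fin m) :
    ContDiffOn ℝ ∞ (shiftField φ v j) (triples m W) := by
  have h1 : ContDiffOn ℝ ∞ (fun q => fderiv ℝ (diffZ φ) q (0, v)) (triples m W) :=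
    (hφ.contDiffOn_diffZ.fderiv_of_isOpen isOpen_triples (m := ∞) (by simp)).clm_apply contDiffOn_const
  change ContDiffOn ℝ ∞ (fun q => ∑ k, (Zx φ q.1 q.2.2)⁻¹ j k * fderiv ℝ (diffZ φ) q (0, v) k) _
  refine ContDiffOn.sum fun k _ => ContDiffOn.mul ?_ ?_
  · exact (hφ.contDiffOn_Zx_inv j k).comp (f := fun q : RSpace m × RSpace m × RSpace n => (q.1, q.2.2))
      (by fun_prop) fun q hq => ⟨mem_univ _, hq.2.2⟩
  · exact ((EuclideanSpace.proj k : CSpace m →L[ℂ] ℂ).restrictScalars ℝ).contDiff.comp_contDiffOn h1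

lemma isBddFamily_derivCoeff (hφ : IsAdmissible φ V W) {S : Type*}
    {g : S → RSpace m × RSpace m × RSpace n → ℂ} (hg : IsBddFamily (triples m W) g)
    (v : RSpace m × RSpace n) : IsBddFamily (triples m W) (fun s => derivCoeff φ v (g s)) := by
  have hD := isOpen_triples (m := m) (W := W)
  exact (hg.fderiv_apply hD (0, v)).add hD ((IsBddFamily.of_const hD contDiffOn_const).mul hD
    (IsBddFamily.sum hD _ fun j _ => (hg.mul hD (IsBddFamily.of_const hD
      (hφ.contDiffOn_shiftField v j))).fderiv_apply hD _))

lemma derivCoeff_eq_zero {L : Set (RSpace m)} (hL : IsClosed L)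
    {g : RSpace m × RSpace m × RSpace n → ℂ} (h0 : ∀ x ∉ L, ∀ p, g (x, p) = 0)
    (v : RSpace m × RSpace n) : ∀ x ∉ L, ∀ p, derivCoeff φ v g (x, p) = 0 := by
  intro x hx p
  have h1 : g =ᶠ[𝓝 (x, p)] fun _ => 0 := by
    have : (Lᶜ ×ˢ (univ : Set (RSpace m × RSpace n))) ∈ 𝓝 (x, p) :=
      (hL.isOpen_compl.prod isOpen_univ).mem_nhds ⟨hx, mem_univ _⟩
    filter_upwards [this] with q hq using h0 q.1 hq.1 q.2
  have h2 : ∀ j, (fun q => g q * shiftField φ v j q) =ᶠ[𝓝 (x, p)] fun _ => 0 := fun j => by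
    filter_upwards [h1] with q hq
    rw [hq, zero_mul]
  rw [derivCoeff, h1.fderiv_eq, Finset.sum_eq_zero fun j _ => by rw [(h2 j).fderiv_eq]; simp]
  simp

/-- Since k_ε is holomorphic, ∂_v of k_ε(Z(x,t) − Z(y,t)) equals Σ s_j ∂_{x_j} of it, where s solves
Z_x s = ∂_v(Z(x,t) − Z(y,t)). Integrating by parts in x leaves an integral of the same kind, with no
derivative on the kernel and coefficients independent of ε. -/
theorem hasFDerivAt_kernInt (hφ : IsAdmissible φ V W) (hm : 0 < m) {ε : ℝ} (hε : 0 < ε)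
    {L : Set (RSpace m)} (hL : IsCompact L) {g : RSpace m × RSpace m × RSpace n → ℂ}
    (hg : ContDiffOn ℝ ∞ g (triples m W)) (h0 : ∀ x ∉ L, ∀ p, g (x, p) = 0)
    {p : RSpace m × RSpace n} (hp : p.2 ∈ W) :
    DifferentiableAt ℝ (kernInt φ ε g) p ∧
      ∀ v, fderiv ℝ (kernInt φ ε g) p v = kernInt φ ε (derivCoeff φ v g) p := by
  have hD := isOpen_triples (m := m) (W := W)
  set k : RSpace m × RSpace m × RSpace n → ℂ := fun q => kern ε (diffZ φ q) with hk
  have hkd := differentiable_kern (m := m) hm hε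
  have hks : ContDiffOn ℝ ∞ k (triples m W) :=
    (hkd.contDiff_of_finiteDimensional.restrict_scalars ℝ).comp_contDiffOn hφ.contDiffOn_diffZ
  have hgk : ContDiffOn ℝ ∞ (fun q => g q * k q) (triples m W) := hg.mul hks
  have hpΩ : p ∈ (univ : Set (RSpace m)) ×ˢ (W : Set (RSpace n)) := ⟨mem_univ _, hp⟩
  obtain ⟨hint, hder⟩ := hasFDerivAt_integral_of_support (isOpen_domain W) hL (F := fun q => g q * k q)
    (hgk.of_le (by simp)) (fun x hx p => by simp only [h0 x hx p, zero_mul]) hpΩ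
  refine ⟨hder.differentiableAt, fun v => ?_⟩
  have hder' := hder.fderiv
  change fderiv ℝ (kernInt φ ε g) p = _ at hder'
  rw [hder', ContinuousLinearMap.integral_apply hint]
  simp only [ContinuousLinearMap.comp_apply, ContinuousLinearMap.inr_apply]
  set G : Fin m → RSpace m × RSpace m × RSpace n → ℂ := fun j q => g q * shiftField φ v j q with hG
  have hGs : ∀ j, ContDiffOn ℝ ∞ (G j) (triples m W) := fun j => hg.mul (hφ.contDiffOn_shiftField v j)
  have hda : ∀ {f : RSpace m × RSpace m × RSpace n → ℂ}, ContDiffOn ℝ ∞ f (triples m W) →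
      ∀ x, HasFDerivAt f (fderiv ℝ f (x, p)) (x, p) := fun hf x =>
    ((hf.contDiffAt (hD.mem_nhds ⟨mem_univ _, hpΩ⟩)).differentiableAt (by simp)).hasFDerivAt
  -- The (y,t)-derivative of the integrand is the new integrand plus an x-divergence of compactly
  -- supported functions.
  have hpt : ∀ x, fderiv ℝ (fun q => g q * k q) (x, p) (0, v) =
      derivCoeff φ v g (x, p) * k (x, p) +
        ∑ j, fderiv ℝ (fun x => G j (x, p) * k (x, p)) x (EuclideanSpace.single j 1) := by
    intro x
    have hx : (x, p) ∈ triples m W := ⟨mem_univ _, hpΩ⟩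
    have hw : HasFDerivAt (diffZ φ) (fderiv ℝ (diffZ φ) (x, p)) (x, p) :=
      ((hφ.contDiffOn_diffZ.contDiffAt (hD.mem_nhds hx)).differentiableAt (by simp)).hasFDerivAt
    have hk' : ∀ u, fderiv ℝ k (x, p) u =
        fderiv ℂ (kern ε) (diffZ φ (x, p)) (fderiv ℝ (diffZ φ) (x, p) u) := fun u => by
      have := ((hkd (diffZ φ (x, p))).hasFDerivAt.restrictScalars ℝ).comp (x, p) hw
      rw [hk, show (fun q => kern ε (diffZ φ q)) = kern ε ∘ diffZ φ from rfl, this.fderiv]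
      rfl
    -- The vectors ∂Z/∂x_j form a complex basis of ℂᵐ. The coefficients are complex, which is
    -- harmless because the derivative of the kernel is ℂ-linear.
    have hvec : fderiv ℝ (diffZ φ) (x, p) (0, v) = ∑ j, shiftField φ v j (x, p) •
        fderiv ℝ (diffZ φ) (x, p) (EuclideanSpace.single j 1, 0) := by
      ext i
      have hu : IsUnit (Zx φ x p.2).det := (hφ.det_Zx_ne_zero hp x).isUnit
      have h1 : (Zx φ x p.2) *ᵥ ((Zx φ x p.2)⁻¹ *ᵥ (fderiv ℝ (diffZ φ) (x, p) (0, v)).ofLp) =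
          (fderiv ℝ (diffZ φ) (x, p) (0, v)).ofLp := by
        rw [Matrix.mulVec_mulVec, Matrix.mul_nonsing_inv _ hu, Matrix.one_mulVec]
      rw [← h1]
      simp only [Matrix.mulVec, WithLp.ofLp_sum, WithLp.ofLp_smul, Finset.sum_apply, Pi.smul_apply,
        smul_eq_mul, hφ.fderiv_diffZ_single hx]
      simp only [dotProduct]
      exact Finset.sum_congr rfl fun j _ => mul_comm _ _
    have hslice : ∀ j, fderiv ℝ (fun x => G j (x, p) * k (x, p)) x (EuclideanSpace.single j 1) =
        G j (x, p) * fderiv ℝ k (x, p) (EuclideanSpace.single j 1, 0) +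
          k (x, p) * fderiv ℝ (G j) (x, p) (EuclideanSpace.single j 1, 0) := fun j => by
      have h2 := ((hda (hGs j) x).mul (hda hks x)).comp (f := fun e => (e, p)) x (hasFDerivAt_prodMk_left x p)
      rw [show (fun x => G j (x, p) * k (x, p)) = ((fun q => G j q * k q) ∘ fun e => (e, p)) from rfl]
      erw [h2.fderiv]
      simp [smul_eq_mul]
    have h3 : fderiv ℝ (fun q => g q * k q) (x, p) (0, v) =
        g (x, p) * fderiv ℝ k (x, p) (0, v) + k (x, p) * fderiv ℝ g (x, p) (0, v) := by
      erw [((hda hg x).mul (hda hks x)).fderiv]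
      simp [smul_eq_mul]
    have h4 : fderiv ℝ k (x, p) (0, v) = ∑ j, shiftField φ v j (x, p) *
        fderiv ℝ k (x, p) (EuclideanSpace.single j 1, 0) := by
      simp only [hk', hvec, map_sum, map_smul, smul_eq_mul]
    simp only [hslice, Finset.sum_add_distrib, ← Finset.mul_sum, derivCoeff]
    rw [h3, h4, Finset.mul_sum]
    simp only [hG, mul_assoc]
    ring
  have hGk : ∀ j, Integrable (fun x => fderiv ℝ (fun x => G j (x, p) * k (x, p)) x (EuclideanSpace.single j 1)) ∧
      ∫ x, fderiv ℝ (fun x => G j (x, p) * k (x, p)) x (EuclideanSpace.single j 1) = 0 := fun j => by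
    refine integral_fderiv_eq_zero_of_support hL ?_ (fun x hx => by simp only [hG, h0 x hx p, zero_mul]) _
    rw [← contDiffOn_univ]
    exact (((hGs j).mul hks).of_le (by simp)).comp (f := fun x : RSpace m => (x, p)) (by fun_prop)
      fun x _ => ⟨mem_univ _, hpΩ⟩
  have hsum : Integrable fun x => ∑ j, fderiv ℝ (fun x => G j (x, p) * k (x, p)) x (EuclideanSpace.single j 1) :=
    integrable_finsetSum _ fun j _ => (hGk j).1
  have hmain : Integrable fun x => derivCoeff φ v g (x, p) * k (x, p) := by
    have h5 := (hint.apply_continuousLinearMap v).sub hsum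
    refine h5.congr (Eventually.of_forall fun x => ?_)
    have := hpt x
    simp only [Pi.sub_apply, ContinuousLinearMap.comp_apply, ContinuousLinearMap.inr_apply]
    rw [this, add_sub_cancel_right]
  simp only [hpt]
  rw [integral_add hmain hsum, integral_finsetSum _ fun j _ => (hGk j).1,
    Finset.sum_eq_zero fun j _ => (hGk j).2, add_zero]
  rfl

end IsAdmissible

end KernInt

end FBI
end

noncomputable section

namespace FBI

/-! ### The regularized pairing converges -/

section KernConv

variable {m n : ℕ} {V : Opens (RSpace m)} {W : Opens (RSpace n)} {φ : RSpace m → RSpace n → RSpace m}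

/-- Scaling r by √ε: the normalization cancels the Jacobian, and the first moment contributes √ε. -/
lemma exists_integral_norm_mul_gaussian_le (hm : 0 < m) {c : ℝ} (hc : 0 < c) : ∃ C : ℝ, 0 ≤ C ∧ ∀ ε : ℝ, 0 < ε →
    Integrable (fun r : RSpace m => ‖r‖ * ((4 * Real.pi * ε) ^ (-(m / 2 : ℝ)) *
      Real.exp (-(c / (4 * ε)) * ‖r‖ ^ 2))) ∧
    ∫ r : RSpace m, ‖r‖ * ((4 * Real.pi * ε) ^ (-(m / 2 : ℝ)) *
      Real.exp (-(c / (4 * ε)) * ‖r‖ ^ 2)) ≤ C * Real.sqrt ε := by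
  have hm' : (0 : ℝ) < m := by exact_mod_cast hm
  set f : RSpace m → ℝ := fun r => (4 * Real.pi) ^ (-(m / 2 : ℝ)) * (‖r‖ * Real.exp (-(c / 4) * ‖r‖ ^ 2)) with hf
  have hfi : Integrable f := by
    have h := (integrable_rpow_norm_mul_exp_sq (m := m) hm (s := 1) (by linarith)
      (show 0 < c / 4 by positivity) 0).const_mul ((4 * Real.pi) ^ (-(m / 2 : ℝ)))
    refine h.congr (Eventually.of_forall fun r => ?_)
    simp [hf]
  refine ⟨∫ r, f r, integral_nonneg fun r => by positivity, fun ε hε => ?_⟩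
  have hs : 0 < Real.sqrt ε := Real.sqrt_pos.2 hε
  have hss : Real.sqrt ε ^ 2 = ε := Real.sq_sqrt hε.le
  have hpt : ∀ r : RSpace m, ‖r‖ * ((4 * Real.pi * ε) ^ (-(m / 2 : ℝ)) *
      Real.exp (-(c / (4 * ε)) * ‖r‖ ^ 2)) =
      (Real.sqrt ε * (Real.sqrt ε ^ m)⁻¹) * f ((Real.sqrt ε)⁻¹ • r) := fun r => by
    have h1 : ε ^ (-(m / 2 : ℝ)) = (Real.sqrt ε ^ m)⁻¹ := by
      rw [Real.sqrt_eq_rpow, ← Real.rpow_natCast, ← Real.rpow_mul hε.le, ← Real.rpow_neg hε.le]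
      ring_nf
    have h2 : -(c / 4) * ((Real.sqrt ε)⁻¹ * ‖r‖) ^ 2 = -(c / (4 * ε)) * ‖r‖ ^ 2 := by
      rw [mul_pow, inv_pow, hss]
      field_simp
    simp only [hf]
    rw [norm_smul, norm_inv, Real.norm_of_nonneg hs.le, h2, Real.mul_rpow (by positivity) hε.le, h1]
    field_simp
  have hi := hfi.comp_smul (R := (Real.sqrt ε)⁻¹) (by positivity)
  simp only [hpt]
  refine ⟨hi.const_mul _, le_of_eq ?_⟩
  rw [integral_const_mul, Measure.integral_comp_smul, finrank_euclideanSpace_fin, inv_pow, inv_inv,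
    abs_of_pos (by positivity), smul_eq_mul]
  field_simp

namespace IsAdmissible

/-- With h = a/det Z_x and γ the Gaussian kernel of mass one, the error is the integral of a(k_ε −
γ) + (h(x) − h(y)) γ det Z_x. The first term is controlled by the estimates near and away from the
diagonal, the second by the Lipschitz bound on h and the first moment of γ. The constant depends
only on φ, V, W and L, so the estimate is uniform in the coefficient. -/
theorem exists_norm_integral_kern_sub_le (hφ : IsAdmissible φ V W) (hm : 0 < m) {L : Set (RSpace m)}
    (hL : IsCompact L) (hLV : L ⊆ V) : ∃ C : ℝ, 0 ≤ C ∧ ∀ ε : ℝ, 0 < ε → ε ≤ 1 → ∀ t ∈ W, ∀ y ∈ V,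
      ∀ a : RSpace m → ℂ, Continuous a → (∀ x ∉ L, a x = 0) → ∀ M M₁ : ℝ, 0 ≤ M → 0 ≤ M₁ →
      (∀ x, ‖a x‖ ≤ M) →
      (∀ x, ‖a x / (Zx φ x t).det - a y / (Zx φ y t).det‖ ≤ M₁ * ‖x - y‖) →
      ‖(∫ x, a x * kern ε (Z φ x t - Z φ y t)) - a y / (Zx φ y t).det‖ ≤ C * (M + M₁) * ε ^ (1 / 4 : ℝ) := by
  obtain ⟨K, hK, hlip⟩ := hφ.exists_lipschitz
  have hK0 : (0 : ℝ) ≤ K := K.2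
  have hK1 : (K : ℝ) < 1 := by exact_mod_cast hK
  have hK2 : 0 < 1 - (K : ℝ) ^ 2 := by nlinarith
  have hm' : (0 : ℝ) < m := by exact_mod_cast hm
  obtain ⟨B, ρ, hB0, -, hB⟩ := hφ.exists_norm_le hm
  obtain ⟨δ, hδ, C₁, hC₁, hnear⟩ := exists_norm_kern_sub_gauss_le hm hK0 hK1
  obtain ⟨C₂, hC₂, hfar⟩ := hφ.exists_norm_kern_le hm hδ
  obtain ⟨D, hD, hdet⟩ := exists_norm_det_jacC_le m
  obtain ⟨C₀, hC₀, hgb⟩ := exists_integral_norm_mul_gaussian_le hm hK2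
  have hI1 := integrable_rpow_norm_mul_exp (m := m) hm (s := 1 / 2 - m) (c := 1) (by linarith) one_pos
  set I₁ : ℝ := ∫ ξ : RSpace m, ‖ξ‖ ^ (1 / 2 - m : ℝ) * Real.exp (-1 * ‖ξ‖) with hI₁
  have hI₁0 : 0 ≤ I₁ := integral_nonneg fun ξ => by positivity
  set v : ℝ := volume.real L with hv
  have hv0 : 0 ≤ v := measureReal_nonneg
  refine ⟨C₁ * Real.exp δ * I₁ + C₂ * v + δ⁻¹ * C₀ + D * C₀, by positivity,
    fun ε hε hε1 t ht y hy a ha ha0 M M₁ hM hM₁ haM hh => ?_⟩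
  have hgd : ∀ x, ‖φ x t - φ y t‖ ≤ K * ‖x - y‖ := fun x => by
    have := (hlip t ht).dist_le_mul x y
    rwa [dist_eq_norm, dist_eq_norm] at this
  have hdetx : ∀ x, ‖(Zx φ x t).det‖ ≤ D := fun x => by
    rw [hφ.Zx_eq ht, ← jacC_eq (fun y => φ y t)]
    exact hdet _ K hK (hlip t ht) x
  set G : RSpace m → ℝ := fun r => (4 * Real.pi * ε) ^ (-(m / 2 : ℝ)) *
    Real.exp (-((1 - (K : ℝ) ^ 2) / (4 * ε)) * ‖r‖ ^ 2) with hG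
  have hG0 : ∀ r, 0 ≤ G r := fun r => by simp only [hG]; positivity
  have hgG : ∀ x, ‖gauss ε (Z φ x t - Z φ y t)‖ ≤ G (x - y) := fun x => by
    rw [Z_sub]
    exact norm_gauss_le (hgd x) hε
  obtain ⟨hGi, hGI⟩ := hgb ε hε
  change Integrable (fun r => ‖r‖ * G r) at hGi
  change ∫ r, ‖r‖ * G r ≤ _ at hGI
  have hone : ∫ x, gauss ε (Z φ x t - Z φ y t) * (Zx φ x t).det = 1 := by
    rw [← integral_gauss_mul_det hm (hlip t ht) (fun p => hφ.differentiableAt ht p)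
      (fun p => (hB t ht p).1) hε (Z φ y t)]
    refine integral_congr_ae (Eventually.of_forall fun x => ?_)
    simp only [hφ.Zx_eq ht, jacC_eq, Z_eq φ x]
  -- The integral of a non-integrable function is 0 by convention, so the value 1 already implies
  -- integrability.
  have hgi : Integrable fun x => gauss ε (Z φ x t - Z φ y t) * (Zx φ x t).det :=
    Integrable.of_integral_ne_zero (by rw [hone]; exact one_ne_zero)
  have hki : Integrable fun x => a x * kern ε (Z φ x t - Z φ y t) := by
    refine Continuous.integrable_of_hasCompactSupport ?_
      (HasCompactSupport.intro hL fun x hx => by rw [ha0 x hx, zero_mul])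
    exact ha.mul ((differentiable_kern hm hε).continuous.comp
      ((hφ.contDiff_Z ht).continuous.sub continuous_const))
  set h₀ : ℂ := a y / (Zx φ y t).det with hh₀
  have e2 : (∫ x, a x * kern ε (Z φ x t - Z φ y t)) - h₀ =
      ∫ x, (a x * kern ε (Z φ x t - Z φ y t) - h₀ * (gauss ε (Z φ x t - Z φ y t) * (Zx φ x t).det)) := by
    rw [integral_sub hki (hgi.const_mul _), integral_const_mul, hone, mul_one]
  -- Three majorants: b₁ for the difference of kernels near the diagonal, where the exponential
  -- factor only secures integrability at infinity; b₂ for the kernel away from it, over L; b₃ for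
  -- the terms controlled by the first moment of the Gaussian.
  set b₁ : RSpace m → ℝ := fun x => ‖x - y‖ ^ (1 / 2 - m : ℝ) * Real.exp (-1 * ‖x - y‖) with hb₁
  set b₂ : RSpace m → ℝ := L.indicator fun _ => 1 with hb₂
  set b₃ : RSpace m → ℝ := fun x => ‖x - y‖ * G (x - y) with hb₃
  have hb₁0 : ∀ x, 0 ≤ b₁ x := fun x => by simp only [hb₁]; positivity
  have hb₂0 : ∀ x, 0 ≤ b₂ x := fun x => indicator_nonneg (fun _ _ => zero_le_one) x
  have hb₃0 : ∀ x, 0 ≤ b₃ x := fun x => mul_nonneg (norm_nonneg _) (hG0 _)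
  have hb₁i : Integrable b₁ := hI1.comp_sub_right y
  have hb₁I : ∫ x, b₁ x = I₁ := integral_sub_right_eq_self (fun ξ : RSpace m =>
    ‖ξ‖ ^ (1 / 2 - m : ℝ) * Real.exp (-1 * ‖ξ‖)) y
  have hb₂i : Integrable b₂ := by
    rw [hb₂, integrable_indicator_iff hL.measurableSet]
    exact integrableOn_const hL.measure_lt_top.ne
  have hb₂I : ∫ x, b₂ x = v := by
    rw [hb₂, integral_indicator hL.measurableSet]
    simp [hv]
  have hb₃i : Integrable b₃ := hGi.comp_sub_right y
  have hb₃I : ∫ x, b₃ x ≤ C₀ * Real.sqrt ε :=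
    (integral_sub_right_eq_self (fun r : RSpace m => ‖r‖ * G r) y).trans_le hGI
  have hE4 : 0 ≤ ε ^ (1 / 4 : ℝ) := by positivity
  have hbi : Integrable fun x => M * (C₁ * Real.exp δ * ε ^ (1 / 4 : ℝ)) * b₁ x + M * (C₂ * ε) * b₂ x +
      (M * δ⁻¹ + M₁ * D) * b₃ x :=
    ((hb₁i.const_mul _).add (hb₂i.const_mul _)).add (hb₃i.const_mul _)
  have hbound : ∀ᵐ x : RSpace m, ‖a x * kern ε (Z φ x t - Z φ y t) -
      h₀ * (gauss ε (Z φ x t - Z φ y t) * (Zx φ x t).det)‖ ≤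
      M * (C₁ * Real.exp δ * ε ^ (1 / 4 : ℝ)) * b₁ x + M * (C₂ * ε) * b₂ x +
      (M * δ⁻¹ + M₁ * D) * b₃ x := by
    have : Nonempty (Fin m) := ⟨⟨0, hm⟩⟩
    have hne : ∀ᵐ x : RSpace m, x ≠ y := by
      simp [ae_iff]
    filter_upwards [hne] with x hxy
    have hr0 : x - y ≠ 0 := sub_ne_zero.2 hxy
    have hdx := hφ.det_Zx_ne_zero ht x
    have h1 : a x * kern ε (Z φ x t - Z φ y t) - h₀ * (gauss ε (Z φ x t - Z φ y t) * (Zx φ x t).det) =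
        a x * (kern ε (Z φ x t - Z φ y t) - gauss ε (Z φ x t - Z φ y t)) +
        (a x / (Zx φ x t).det - h₀) * (gauss ε (Z φ x t - Z φ y t) * (Zx φ x t).det) := by
      field_simp
      ring
    have h2 : ‖(a x / (Zx φ x t).det - h₀) * (gauss ε (Z φ x t - Z φ y t) * (Zx φ x t).det)‖ ≤
        M₁ * D * b₃ x := by
      rw [norm_mul, norm_mul]
      calc _ ≤ (M₁ * ‖x - y‖) * (G (x - y) * D) :=
            mul_le_mul (hh x) (mul_le_mul (hgG x) (hdetx x) (norm_nonneg _) (hG0 _)) (by positivity)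
              (by positivity)
        _ = M₁ * D * b₃ x := by simp only [hb₃]; ring
    have h3 : ‖a x * (kern ε (Z φ x t - Z φ y t) - gauss ε (Z φ x t - Z φ y t))‖ ≤
        M * (C₁ * Real.exp δ * ε ^ (1 / 4 : ℝ)) * b₁ x + M * (C₂ * ε) * b₂ x + M * δ⁻¹ * b₃ x := by
      have p1 : 0 ≤ M * (C₁ * Real.exp δ * ε ^ (1 / 4 : ℝ)) * b₁ x :=
        mul_nonneg (by positivity) (hb₁0 x)
      have p2 : 0 ≤ M * (C₂ * ε) * b₂ x := mul_nonneg (by positivity) (hb₂0 x)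
      have p3 : 0 ≤ M * δ⁻¹ * b₃ x := mul_nonneg (by positivity) (hb₃0 x)
      by_cases hx : x ∈ L
      · by_cases hlt : ‖x - y‖ < δ
        · have h4 := hnear (x - y) (φ x t - φ y t) hr0 (hgd x) hlt ε hε
          rw [← Z_sub] at h4
          have h5 : ‖x - y‖ ^ (1 / 2 - m : ℝ) ≤ Real.exp δ * b₁ x := by
            simp only [hb₁]
            have : 1 ≤ Real.exp δ * Real.exp (-1 * ‖x - y‖) := by
              rw [← Real.exp_add]
              exact Real.one_le_exp (by linarith)
            have h6 : 0 ≤ ‖x - y‖ ^ (1 / 2 - m : ℝ) := by positivity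
            nlinarith
          rw [norm_mul]
          have h6 : ‖a x‖ * ‖kern ε (Z φ x t - Z φ y t) - gauss ε (Z φ x t - Z φ y t)‖ ≤
              M * (C₁ * ε ^ (1 / 4 : ℝ) * (Real.exp δ * b₁ x)) :=
            mul_le_mul (haM x) (h4.trans (mul_le_mul_of_nonneg_left h5 (by positivity)))
              (norm_nonneg _) hM
          have h7 : M * (C₁ * ε ^ (1 / 4 : ℝ) * (Real.exp δ * b₁ x)) =
            M * (C₁ * Real.exp δ * ε ^ (1 / 4 : ℝ)) * b₁ x := by ring
          linarith
        · have hge : δ ≤ ‖x - y‖ := not_lt.1 hlt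
          have h4 := hfar t ht x (hLV hx) y hy hge ε hε
          -- Where |x − y| ≥ δ, the Gaussian itself is bounded by its first-moment density.
          have h5 : G (x - y) ≤ δ⁻¹ * b₃ x := by
            simp only [hb₃]
            rw [← mul_assoc]
            refine le_mul_of_one_le_left (hG0 _) ?_
            rw [← div_eq_inv_mul, one_le_div hδ]
            exact hge
          have h6 : b₂ x = 1 := indicator_of_mem hx _
          rw [norm_mul]
          have h7 : ‖a x‖ * ‖kern ε (Z φ x t - Z φ y t) - gauss ε (Z φ x t - Z φ y t)‖ ≤
              M * (C₂ * ε + δ⁻¹ * b₃ x) :=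
            mul_le_mul (haM x) ((norm_sub_le _ _).trans (add_le_add h4 ((hgG x).trans h5)))
              (norm_nonneg _) hM
          rw [h6]
          rw [h6] at p2
          have h8 : M * (C₂ * ε + δ⁻¹ * b₃ x) = M * (C₂ * ε) * 1 + M * δ⁻¹ * b₃ x := by ring
          linarith
      · rw [ha0 x hx, zero_mul, norm_zero]
        linarith
    rw [h1]
    refine (norm_add_le _ _).trans ((add_le_add h3 h2).trans_eq ?_)
    ring
  rw [e2]
  refine (norm_integral_le_of_norm_le hbi hbound).trans ?_
  have hbi' : Integrable fun x => M * (C₁ * Real.exp δ * ε ^ (1 / 4 : ℝ)) * b₁ x + M * (C₂ * ε) * b₂ x :=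
    (hb₁i.const_mul _).add (hb₂i.const_mul _)
  rw [integral_add hbi' (hb₃i.const_mul _),
    integral_add (hb₁i.const_mul _) (hb₂i.const_mul _), integral_const_mul, integral_const_mul,
    integral_const_mul, hb₁I, hb₂I]
  have he1 : ε ≤ ε ^ (1 / 4 : ℝ) := by
    conv_lhs => rw [← Real.rpow_one ε]
    exact Real.rpow_le_rpow_of_exponent_ge hε hε1 (by norm_num)
  have he2 : Real.sqrt ε ≤ ε ^ (1 / 4 : ℝ) := by
    rw [Real.sqrt_eq_rpow]
    exact Real.rpow_le_rpow_of_exponent_ge hε hε1 (by norm_num)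
  have hb₃I' : ∫ x, b₃ x ≤ C₀ * ε ^ (1 / 4 : ℝ) := hb₃I.trans (mul_le_mul_of_nonneg_left he2 hC₀)
  have hed : 0 ≤ Real.exp δ := Real.exp_nonneg δ
  generalize ε ^ (1 / 4 : ℝ) = e at *
  generalize Real.exp δ = d at *
  have hδi : 0 ≤ δ⁻¹ := by positivity
  generalize δ⁻¹ = d' at *
  clear_value I₁ v b₃
  calc M * (C₁ * d * e) * I₁ + M * (C₂ * ε) * v + (M * d' + M₁ * D) * ∫ x, b₃ x
      ≤ M * (C₁ * d * e) * I₁ + M * (C₂ * e) * v + (M * d' + M₁ * D) * (C₀ * e) := by gcongr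
    _ ≤ (C₁ * d * I₁ + C₂ * v + d' * C₀ + D * C₀) * (M + M₁) * e := by
        have : 0 ≤ M₁ * e * (C₁ * d * I₁ + C₂ * v + d' * C₀) + M * e * D * C₀ := by positivity
        linarith

/-- Boundedness of the family on the compact set L × K supplies the constants M and M₁ for all
members at once. The Lipschitz bound holds on all of ℝᵐ, since the coefficients vanish off L. -/
theorem tendstoUniformlyOn_kernInt (hφ : IsAdmissible φ V W) (hm : 0 < m) {L : Set (RSpace m)}
    (hL : IsCompact L) (hLV : L ⊆ V) {S : Type*} {g : S → RSpace m × RSpace m × RSpace n → ℂ}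
    (hg : IsBddFamily (triples m W) g) (h0 : ∀ s, ∀ x ∉ L, ∀ p, g s (x, p) = 0)
    {K : Set (RSpace m × RSpace n)} (hK : IsCompact K) (hKΩ : K ⊆ (V : Set (RSpace m)) ×ˢ (W : Set (RSpace n))) :
    TendstoUniformlyOn (fun ε (q : S × (RSpace m × RSpace n)) => kernInt φ ε (g q.1) q.2)
      (fun q => g q.1 (q.2.1, q.2) / (Zx φ q.2.1 q.2.2).det) (𝓝[>] 0) (univ ×ˢ K) := by
  have hD := isOpen_triples (m := m) (W := W)
  obtain ⟨C, hC, hmain⟩ := hφ.exists_norm_integral_kern_sub_le hm hL hLV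
  have hLK : L ×ˢ K ⊆ triples m W := fun q hq => ⟨mem_univ _, mem_univ _, (hKΩ hq.2).2⟩
  obtain ⟨M, hM0, hM⟩ := hg.bdd 0 (L ×ˢ K) hLK (hL.prod hK)
  set h : S → RSpace m × RSpace m × RSpace n → ℂ := fun s q => g s q * ((Zx φ q.1 q.2.2).det)⁻¹ with hh
  have hhb : IsBddFamily (triples m W) h := hg.mul hD (IsBddFamily.of_const hD
    ((hφ.contDiffOn_det.inv fun p hp => hφ.det_Zx_ne_zero hp.2 p.1).comp
      (f := fun q : RSpace m × RSpace m × RSpace n => (q.1, q.2.2)) (by fun_prop)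
      fun q hq => ⟨mem_univ _, hq.2.2⟩))
  obtain ⟨M₁, hM₁0, hM₁⟩ := hhb.bdd 1 (L ×ˢ K) hLK (hL.prod hK)
  have hlim : Tendsto (fun ε : ℝ => C * (M + M₁) * ε ^ (1 / 4 : ℝ)) (𝓝[>] 0) (𝓝 0) := by
    have h1 : Tendsto (fun ε : ℝ => ε ^ (1 / 4 : ℝ)) (𝓝[>] 0) (𝓝 0) := by
      have := (Real.continuousAt_rpow_const 0 (1 / 4) (Or.inr (by norm_num))).tendsto
      rw [Real.zero_rpow (by norm_num)] at this
      exact this.mono_left nhdsWithin_le_nhds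
    simpa using h1.const_mul (C * (M + M₁))
  rw [Metric.tendstoUniformlyOn_iff]
  intro η hη
  filter_upwards [hlim.eventually_lt_const hη, self_mem_nhdsWithin,
    mem_nhdsWithin_of_mem_nhds (Iic_mem_nhds one_pos)] with ε h1 hε hε1 q hq
  obtain ⟨s, y, t⟩ := q
  have hyt : (y, t) ∈ K := hq.2
  obtain ⟨hy, ht⟩ := hKΩ hyt
  have hgs : ContDiff ℝ ∞ fun x => g s (x, (y, t)) := by
    rw [← contDiffOn_univ]
    exact (hg.contDiffOn s).comp (f := fun x : RSpace m => (x, (y, t))) (by fun_prop)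
      fun x _ => ⟨mem_univ _, mem_univ _, ht⟩
  rw [dist_comm, dist_eq_norm]
  refine lt_of_le_of_lt ?_ h1
  refine hmain ε hε hε1 t ht y hy (fun x => g s (x, (y, t))) hgs.continuous (fun x hx => h0 s x hx _)
    M M₁ hM0 hM₁0 (fun x => ?_) fun x => ?_
  · by_cases hx : x ∈ L
    · have := hM s (x, (y, t)) ⟨hx, hyt⟩
      rwa [norm_iteratedFDeriv_zero] at this
    · rw [h0 s x hx, norm_zero]
      exact hM0
  · have hder : ∀ x, HasFDerivAt (fun x => h s (x, (y, t)))
        (fderiv ℝ (h s) (x, (y, t)) ∘L ContinuousLinearMap.inl ℝ (RSpace m) (RSpace m × RSpace n)) x := fun x =>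
      (((hhb.contDiffOn s).contDiffAt (hD.mem_nhds ⟨mem_univ _, mem_univ _, ht⟩)).differentiableAt
        (by simp)).hasFDerivAt.comp (f := fun x : RSpace m => (x, (y, t))) x
        (hasFDerivAt_prodMk_left x (y, t))
    have h2 := Convex.norm_image_sub_le_of_norm_fderiv_le (𝕜 := ℝ) (f := fun x => h s (x, (y, t)))
      (s := univ) (C := M₁) (x := y) (y := x) (fun x _ => (hder x).differentiableAt) (fun x _ => ?_)
      convex_univ (mem_univ _) (mem_univ _)
    · simpa [hh, div_eq_mul_inv] using h2
    · by_cases hx : x ∈ L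
      · rw [(hder x).fderiv]
        refine (ContinuousLinearMap.opNorm_comp_le _ _).trans ?_
        have h3 := hM₁ s (x, (y, t)) ⟨hx, hyt⟩
        rw [norm_iteratedFDeriv_one] at h3
        exact (mul_le_of_le_one_right (norm_nonneg _) (ContinuousLinearMap.norm_inl_le_one ℝ _ _)).trans h3
      · have h4 : (fun x => h s (x, (y, t))) =ᶠ[𝓝 x] fun _ => 0 := by
          filter_upwards [hL.isClosed.isOpen_compl.mem_nhds hx] with x' hx'
          simp only [hh, h0 s x' hx', zero_mul]
        rw [h4.fderiv_eq]
        simpa using hM₁0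

/-- All derivatives of the regularized pairing converge. -/
theorem tendstoUniformlyOn_iteratedFDeriv_kernInt (hφ : IsAdmissible φ V W) (hm : 0 < m) {L : Set (RSpace m)}
    (hL : IsCompact L) (hLV : L ⊆ V) {S : Type} {g : S → RSpace m × RSpace m × RSpace n → ℂ}
    (hg : IsBddFamily (triples m W) g) (h0 : ∀ s, ∀ x ∉ L, ∀ p, g s (x, p) = 0) :
    (∀ ε : ℝ, 0 < ε → ∀ s, ContDiffOn ℝ ∞ (kernInt φ ε (g s)) ((V : Set (RSpace m)) ×ˢ (W : Set (RSpace n)))) ∧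
    ∀ j : ℕ, ∀ K ⊆ (V : Set (RSpace m)) ×ˢ (W : Set (RSpace n)), IsCompact K → TendstoUniformlyOn
      (fun ε (q : S × (RSpace m × RSpace n)) => iteratedFDeriv ℝ j (kernInt φ ε (g q.1)) q.2)
      (fun q => iteratedFDeriv ℝ j (fun p => g q.1 (p.1, p) / (Zx φ p.1 p.2).det) q.2) (𝓝[>] 0) (univ ×ˢ K) := by
  have hΩ : IsOpen ((V : Set (RSpace m)) ×ˢ (W : Set (RSpace n))) := V.isOpen.prod W.isOpen
  -- All regularized integrals with bounded coefficient families supported in L. Differentiation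
  -- replaces the coefficient by `derivCoeff`; the second summand of the abstract theorem is taken
  -- to be zero.
  set 𝒞 : Set ((ℝ → S → RSpace m × RSpace n → ℂ) × (S → RSpace m × RSpace n → ℂ)) :=
    {f | ∃ g : S → RSpace m × RSpace m × RSpace n → ℂ, IsBddFamily (triples m W) g ∧
      (∀ s, ∀ x ∉ L, ∀ p, g s (x, p) = 0) ∧
      f = (fun ε s => kernInt φ ε (g s), fun s p => g s (p.1, p) / (Zx φ p.1 p.2).det)} with h𝒞
  have h := tendstoUniformlyOn_iteratedFDeriv_of_class hΩ (l := 𝓝[>] 0) (E₀ := Ioi 0) self_mem_nhdsWithin 𝒞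
    (by
      rintro _ ⟨g, hg, h0, rfl⟩ K hKΩ hK
      exact hφ.tendstoUniformlyOn_kernInt hm hL hLV hg h0 hK hKΩ)
    (by
      rintro _ ⟨g, hg, h0, rfl⟩ ε hε s p hp
      exact (hφ.hasFDerivAt_kernInt hm hε hL (hg.contDiffOn s) (h0 s) hp.2).1.differentiableWithinAt)
    (by
      rintro _ ⟨g, hg, h0, rfl⟩ v
      refine ⟨_, ⟨_, hφ.isBddFamily_derivCoeff hg v, fun s => derivCoeff_eq_zero hL.isClosed (h0 s) v, rfl⟩,
        _, ⟨fun _ _ => 0, IsBddFamily.of_const isOpen_triples contDiffOn_const, fun _ _ _ _ => rfl, rfl⟩,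
        fun ε hε s p hp => ?_⟩
      rw [(hφ.hasFDerivAt_kernInt hm hε hL (hg.contDiffOn s) (h0 s) hp.2).2 v]
      simp [kernInt])
    _ ⟨g, hg, h0, rfl⟩
  exact ⟨fun ε hε s => h.1 ε hε s, h.2.2⟩

end IsAdmissible

end KernConv

end FBI
end

noncomputable section

namespace FBI

/-! ### Absolutely convergent series of smooth functions -/

section Series

variable {m : ℕ} {V : Opens (RSpace m)}

lemma exists_bump {x : RSpace m} (hx : x ∈ V) : ∃ χ : RSpace m → ℂ, ContDiff ℝ ∞ χ ∧
    HasCompactSupport χ ∧ tsupport χ ⊆ V ∧ χ =ᶠ[𝓝 x] 1 := by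
  obtain ⟨r, hr, hrV⟩ := Metric.isOpen_iff.1 V.isOpen x hx
  let b : ContDiffBump x := ⟨r / 4, r / 2, by positivity, by linarith⟩
  have hts : tsupport (fun y => (b y : ℂ)) ⊆ tsupport b :=
    closure_mono fun y hy => by
      simp only [Function.mem_support, ne_eq, Complex.ofReal_eq_zero] at hy
      exact hy
  refine ⟨fun y => (b y : ℂ), Complex.ofRealCLM.contDiff.comp b.contDiff, ?_, ?_, ?_⟩
  · exact b.hasCompactSupport.of_isClosed_subset (isClosed_tsupport _) hts
  · refine hts.trans ?_
    rw [b.tsupport_eq]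
    exact (Metric.closedBall_subset_ball (by change r / 2 < r; linarith)).trans hrV
  · filter_upwards [b.eventuallyEq_one] with y hy
    simp [hy]

/-- Termwise differentiation is a theorem about globally bounded derivatives, whereas here the
bounds hold on compact subsets of V. Multiplication by a cutoff equal to 1 near the given point
makes them global without changing the germ. -/
lemma IsBddFamily.tsum {f : ℕ → RSpace m → ℂ} (hf : IsBddFamily (V : Set (RSpace m)) f) {c : ℕ → ℂ}
    (hc : Summable fun N => ‖c N‖) :
    ContDiffOn ℝ ∞ (fun x => ∑' N, c N * f N x) V ∧ (∀ x ∈ V, Summable fun N => c N * f N x) ∧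
    ∀ j, ∀ x ∈ V, ∀ M, (∀ N, ‖iteratedFDeriv ℝ j (f N) x‖ ≤ M) →
      ‖iteratedFDeriv ℝ j (fun x => ∑' N, c N * f N x) x‖ ≤ (∑' N, ‖c N‖) * M := by
  have hsum : ∀ x ∈ V, Summable fun N => c N * f N x := fun x hx => by
    obtain ⟨M, hM0, hM⟩ := hf.bdd 0 {x} (by simpa using hx) isCompact_singleton
    refine Summable.of_norm_bounded (hc.mul_right M) fun N => ?_
    rw [norm_mul]
    have := hM N x rfl
    rw [norm_iteratedFDeriv_zero] at this
    gcongr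
  have hloc : ∀ x ∈ V, ContDiffAt ℝ ∞ (fun x => ∑' N, c N * f N x) x ∧
      ∀ j, iteratedFDeriv ℝ j (fun x => ∑' N, c N * f N x) x = ∑' N, c N • iteratedFDeriv ℝ j (f N) x := by
    intro x hx
    obtain ⟨χ, hχ, hχc, hχV, hχ1⟩ := exists_bump hx
    set g : ℕ → RSpace m → ℂ := fun N x => c N * (χ x * f N x) with hg
    have hb : IsBddFamily (V : Set (RSpace m)) fun N x => χ x * f N x :=
      (IsBddFamily.of_const V.isOpen hχ.contDiffOn).mul V.isOpen hf
    have hzero : ∀ N, ∀ y ∉ tsupport χ, (fun x => χ x * f N x) =ᶠ[𝓝 y] fun _ => 0 := fun N y hy => by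
      filter_upwards [(isClosed_tsupport χ).isOpen_compl.mem_nhds hy] with z hz
      rw [image_eq_zero_of_notMem_tsupport hz, zero_mul]
    have hs : ∀ N, ContDiff ℝ ∞ fun x => χ x * f N x := fun N => by
      rw [contDiff_iff_contDiffAt]
      intro y
      by_cases hy : y ∈ tsupport χ
      · exact (hb.contDiffOn N).contDiffAt (V.isOpen.mem_nhds (hχV hy))
      · exact contDiffAt_const.congr_of_eventuallyEq (hzero N y hy)
    choose M hM0 hM using fun j => hb.bdd j (tsupport χ) hχV hχc
    have hM' : ∀ j N y, ‖iteratedFDeriv ℝ j (fun x => χ x * f N x) y‖ ≤ M j := fun j N y => by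
      by_cases hy : y ∈ tsupport χ
      · exact hM j N y hy
      · rw [((hzero N y hy).iteratedFDeriv ℝ j).eq_of_nhds, iteratedFDeriv_fun_zero]
        simpa using hM0 j
    have hgs : ∀ N, ContDiff ℝ ∞ (g N) := fun N => contDiff_const.mul (hs N)
    have hgd : ∀ j N y, iteratedFDeriv ℝ j (g N) y = c N • iteratedFDeriv ℝ j (fun x => χ x * f N x) y :=
      fun j N y => iteratedFDeriv_const_smul_apply (a := c N) (((hs N).contDiffAt).of_le (by exact_mod_cast le_top))
    have hgM : ∀ (j : ℕ) (N : ℕ) (y : RSpace m), (j : ℕ∞) ≤ (⊤ : ℕ∞) → ‖iteratedFDeriv ℝ j (g N) y‖ ≤ ‖c N‖ * M j :=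
      fun j N y _ => by
        rw [hgd, norm_smul]
        exact mul_le_mul_of_nonneg_left (hM' j N y) (norm_nonneg _)
    have heq : (fun x => ∑' N, c N * f N x) =ᶠ[𝓝 x] fun x => ∑' N, g N x := by
      filter_upwards [hχ1] with y hy
      simp [hg, hy]
    refine ⟨(contDiff_tsum (N := ⊤) hgs (fun j _ => hc.mul_right (M j)) hgM).contDiffAt.congr_of_eventuallyEq heq,
      fun j => ?_⟩
    rw [(heq.iteratedFDeriv ℝ j).eq_of_nhds,
      iteratedFDeriv_tsum_apply (N := ⊤) hgs (fun j _ => hc.mul_right (M j)) hgM le_top]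
    refine tsum_congr fun N => ?_
    rw [hgd]
    congr 1
    refine (Filter.EventuallyEq.iteratedFDeriv ℝ ?_ j).eq_of_nhds
    filter_upwards [hχ1] with y hy
    simp [hy]
  refine ⟨fun x hx => (hloc x hx).1.contDiffWithinAt, hsum, fun j x hx M hM => ?_⟩
  rw [(hloc x hx).2 j, ← tsum_mul_right]
  have hs : Summable fun N => ‖c N‖ * M := hc.mul_right M
  refine tsum_of_norm_bounded hs.hasSum fun N => ?_
  rw [norm_smul]
  exact mul_le_mul_of_nonneg_left (hM N) (norm_nonneg _)

end Series

/-! ### The uniform boundedness principle for compactly supported distributions -/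

section BanachSteinhaus

variable {m : ℕ} {V : Opens (RSpace m)}

/-- Continuity of a linear functional on `C^∞(V)`. -/
def IsCompactlyBounded (Λ : smoothFunctions V →ₗ[ℂ] ℂ) : Prop :=
  ∃ K : Set (RSpace m), IsCompact K ∧ K ⊆ V ∧ ∃ (q : ℕ) (C : ℝ),
    ∀ (f : smoothFunctions V) (M : ℝ), 0 ≤ M →
      (∀ j ≤ q, ∀ x ∈ K, ‖iteratedFDeriv ℝ j (f : RSpace m → ℂ) x‖ ≤ M) → ‖Λ f‖ ≤ C * M

lemma exists_exhaustion (V : Opens (RSpace m)) : ∃ E : ℕ → Set (RSpace m), (∀ N, IsCompact (E N)) ∧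
    (∀ N, E N ⊆ V) ∧ Monotone E ∧ ∀ K ⊆ (V : Set (RSpace m)), IsCompact K → ∃ N, K ⊆ E N := by
  have : LocallyCompactSpace V := V.isOpen.locallyCompactSpace
  let E := CompactExhaustion.choice V
  refine ⟨fun N => (Subtype.val : V → RSpace m) '' E N, fun N => (E.isCompact N).image continuous_subtype_val,
    fun N => ?_, fun a b hab => image_mono (E.subset hab), fun K hKV hK => ?_⟩
  · rintro _ ⟨x, -, rfl⟩
    exact x.2
  · have h1 : IsCompact ((Subtype.val : V → RSpace m) ⁻¹' K) := by
      have h2 : (Subtype.val : V → RSpace m) '' ((Subtype.val : V → RSpace m) ⁻¹' K) = K := by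
        ext x
        simpa using fun hx => hKV hx
      rwa [Subtype.isCompact_iff, h2]
    obtain ⟨N, hN⟩ := E.exists_superset_of_isCompact h1
    exact ⟨N, fun x hx => ⟨⟨x, hKV hx⟩, hN hx, rfl⟩⟩

/-- The bound applied with M = 0 to the difference: the values of the functions outside V play no
role. -/
lemma IsCompactlyBounded.congr {Λ : smoothFunctions V →ₗ[ℂ] ℂ} (h : IsCompactlyBounded Λ)
    {f g : smoothFunctions V} (hfg : EqOn f.1 g.1 V) : Λ f = Λ g := by
  obtain ⟨K, hK, hKV, q, C, hC⟩ := h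
  have h1 := hC (f - g) 0 le_rfl fun j _ x hx => by
    have : ((f - g : smoothFunctions V) : RSpace m → ℂ) =ᶠ[𝓝 x] fun _ => 0 := by
      filter_upwards [V.isOpen.mem_nhds (hKV hx)] with y hy
      have := hfg hy
      simp [this]
    rw [(this.iteratedFDeriv ℝ j).eq_of_nhds, iteratedFDeriv_fun_zero]
    simp
  rw [mul_zero, norm_le_zero_iff, map_sub, sub_eq_zero] at h1
  exact h1

/-- Otherwise there are functionals Λ_{i_N} and functions g_N whose derivatives of order at most N
are at most 1 on the N-th set of an exhaustion, with |Λ_{i_N} g_N| ≥ N. The map T : ℓ¹ → C^∞(V), c ↦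
Σ c_N g_N, is then continuous, and the functionals Λ_{i_N} ∘ T on the Banach space ℓ¹ are pointwise
bounded. Banach–Steinhaus bounds their norms, against their values on the unit vectors. -/
theorem exists_common_bound {ι : Type*} (Λ : ι → smoothFunctions V →ₗ[ℂ] ℂ)
    (hΛ : ∀ i, IsCompactlyBounded (Λ i)) (hb : ∀ f, ∃ B : ℝ, ∀ i, ‖Λ i f‖ ≤ B) :
    ∃ K : Set (RSpace m), IsCompact K ∧ K ⊆ V ∧ ∃ (q : ℕ) (C : ℝ), 0 ≤ C ∧ ∀ i,
      ∀ (f : smoothFunctions V) (M : ℝ), 0 ≤ M →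
        (∀ j ≤ q, ∀ x ∈ K, ‖iteratedFDeriv ℝ j (f : RSpace m → ℂ) x‖ ≤ M) → ‖Λ i f‖ ≤ C * M := by
  obtain ⟨E, hE, hEV, hEm, hEK⟩ := exists_exhaustion V
  by_contra hcon
  have key : ∀ N : ℕ, ∃ i, ∃ g : smoothFunctions V,
      (∀ j ≤ N, ∀ x ∈ E N, ‖iteratedFDeriv ℝ j (g : RSpace m → ℂ) x‖ ≤ 1) ∧ N ≤ ‖Λ i g‖ := by
    intro N
    by_contra hN
    refine hcon ⟨E N, hE N, hEV N, N, N, by positivity, fun i f M hM hf => ?_⟩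
    by_contra hlt
    rw [not_le] at hlt
    have hpos : 0 < ‖Λ i f‖ := lt_of_le_of_lt (by positivity) hlt
    refine hN ⟨i, ((N / ‖Λ i f‖ : ℝ) : ℂ) • f, fun j hj x hx => ?_, ?_⟩
    · have h1 : iteratedFDeriv ℝ j ((((N / ‖Λ i f‖ : ℝ) : ℂ) • f : smoothFunctions V) : RSpace m → ℂ) x =
          ((N / ‖Λ i f‖ : ℝ) : ℂ) • iteratedFDeriv ℝ j (f : RSpace m → ℂ) x :=
        iteratedFDeriv_const_smul_apply ((ContDiffOn.contDiffAt f.2 (V.isOpen.mem_nhds (hEV N hx))).of_le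
          (by exact_mod_cast le_top))
      rw [h1, norm_smul, Complex.norm_real, Real.norm_of_nonneg (by positivity), div_mul_eq_mul_div,
        div_le_one hpos]
      exact (mul_le_mul_of_nonneg_left (hf j hj x hx) (by positivity)).trans hlt.le
    · rw [map_smul, norm_smul, Complex.norm_real, Real.norm_of_nonneg (by positivity),
        div_mul_cancel₀ _ hpos.ne']
  choose i g hg1 hgN using key
  have hbdd : IsBddFamily (V : Set (RSpace m)) fun N => (g N : RSpace m → ℂ) := by
    refine ⟨fun N => (g N).2, fun j K hKV hK => ?_⟩
    obtain ⟨N₀, hN₀⟩ := hEK K hKV hK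
    have hone : ∀ N, ∃ M : ℝ, 0 ≤ M ∧ ∀ x ∈ K, ‖iteratedFDeriv ℝ j (g N : RSpace m → ℂ) x‖ ≤ M := fun N => by
      obtain ⟨M, hM0, hM⟩ := (IsBddFamily.of_const (S := Unit) V.isOpen (g N).2).bdd j K hKV hK
      exact ⟨M, hM0, hM ()⟩
    choose M hM0 hM using hone
    -- For N ≥ N₀ + j the order j is allowed and K lies in the N-th set, so the bound is 1; the
    -- finitely many other functions are bounded one by one.
    refine ⟨1 + ∑ N ∈ Finset.range (N₀ + j), M N, ?_, fun N x hx => ?_⟩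
    · have := Finset.sum_nonneg fun N (_ : N ∈ Finset.range (N₀ + j)) => hM0 N
      linarith
    · by_cases h : N < N₀ + j
      · have h2 := Finset.single_le_sum (fun N _ => hM0 N) (Finset.mem_range.2 h)
        linarith [hM N x hx]
      · have h3 := Finset.sum_nonneg fun N (_ : N ∈ Finset.range (N₀ + j)) => hM0 N
        linarith [hg1 N j (by omega) x (hEm (by omega) (hN₀ hx))]
  have hsumm : ∀ c : lp (fun _ : ℕ => ℂ) 1, Summable fun N => ‖c N‖ := fun c => by
    simpa using (lp.memℓp c).summable (by simp)
  have hnorm : ∀ c : lp (fun _ : ℕ => ℂ) 1, ∑' N, ‖c N‖ = ‖c‖ := fun c => by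
    rw [lp.norm_eq_tsum_rpow (by simp)]
    simp
  classical
  -- Outside V the series may diverge, and the default value 0 of the sum would then break
  -- additivity; cutting off by the indicator of V makes T linear.
  let T : lp (fun _ : ℕ => ℂ) 1 →ₗ[ℂ] smoothFunctions V :=
    { toFun := fun c => ⟨(V : Set (RSpace m)).indicator fun x => ∑' N, c N * (g N : RSpace m → ℂ) x,
        ((hbdd.tsum (hsumm c)).1).congr fun x hx => indicator_of_mem hx _⟩
      map_add' := fun c d => by
        ext x
        by_cases hx : x ∈ (V : Set (RSpace m))
        · have h1 := (hbdd.tsum (hsumm c)).2.1 x hx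
          have h2 := (hbdd.tsum (hsumm d)).2.1 x hx
          simp [indicator_of_mem hx, add_mul, h1.tsum_add h2]
        · simp [indicator_of_notMem hx]
      map_smul' := fun a c => by
        ext x
        by_cases hx : x ∈ (V : Set (RSpace m))
        · simp [indicator_of_mem hx, mul_assoc, tsum_mul_left]
        · simp [indicator_of_notMem hx] }
  have hTv : ∀ c, ∀ x ∈ V, (T c : RSpace m → ℂ) =ᶠ[𝓝 x] fun x => ∑' N, c N * (g N : RSpace m → ℂ) x :=
    fun c x hx => by
      filter_upwards [V.isOpen.mem_nhds hx] with y hy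
      exact indicator_of_mem hy fun x => ∑' N, c N * (g N : RSpace m → ℂ) x
  have hcont : ∀ N, ∃ B : ℝ, ∀ c, ‖(Λ (i N) ∘ₗ T) c‖ ≤ B * ‖c‖ := fun N => by
    obtain ⟨K, hK, hKV, q, C, hC⟩ := hΛ (i N)
    choose M hM0 hM using fun j => hbdd.bdd j K hKV hK
    refine ⟨C * ∑ j ∈ Finset.range (q + 1), M j, fun c => ?_⟩
    have hS := Finset.sum_nonneg fun j (_ : j ∈ Finset.range (q + 1)) => hM0 j
    refine (hC (T c) (‖c‖ * ∑ j ∈ Finset.range (q + 1), M j) (by positivity) fun j hj x hx => ?_).trans_eq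
      (by ring)
    rw [((hTv c x (hKV hx)).iteratedFDeriv ℝ j).eq_of_nhds]
    refine ((hbdd.tsum (hsumm c)).2.2 j x (hKV hx) (M j) fun N => hM j N x hx).trans ?_
    rw [hnorm]
    gcongr
    exact Finset.single_le_sum (fun j _ => hM0 j) (Finset.mem_range.2 (Nat.lt_succ_of_le hj))
  choose B hB using hcont
  obtain ⟨C, hC⟩ := banach_steinhaus (𝕜 := ℂ) (𝕜₂ := ℂ) (σ₁₂ := RingHom.id ℂ)
    (g := fun N => (Λ (i N) ∘ₗ T).mkContinuous (B N) (hB N)) fun c => by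
      obtain ⟨b, hb⟩ := hb (T c)
      exact ⟨b, fun N => hb (i N)⟩
  obtain ⟨N, hN⟩ := exists_nat_gt C
  have h1 := ((Λ (i N) ∘ₗ T).mkContinuous (B N) (hB N)).le_of_opNorm_le (hC N)
    (lp.single 1 N (1 : ℂ))
  rw [lp.norm_single (by simp), norm_one, mul_one] at h1
  have h2 : Λ (i N) (T (lp.single 1 N (1 : ℂ))) = Λ (i N) (g N) := by
    refine (hΛ (i N)).congr fun x hx => ?_
    refine (hTv _ x hx).eq_of_nhds.trans ?_
    simp only
    rw [tsum_eq_single N fun k hk => by rw [lp.single_apply_ne _ _ _ hk, zero_mul], lp.single_apply_self, one_mul]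
  have h3 : ‖Λ (i N) (g N)‖ ≤ C := by
    rw [← h2]
    exact h1
  linarith [hgN N]

end BanachSteinhaus

end FBI
end

noncomputable section

namespace FBI

/-! ### Linearity of the duality bracket -/

namespace CompactDistribution

variable {m : ℕ} {V : Opens (RSpace m)} (u : CompactDistribution V)

lemma pair_add {f g : RSpace m → ℂ} (hf : ContDiffOn ℝ ∞ f V) (hg : ContDiffOn ℝ ∞ g V) :
    u.pair (fun y => f y + g y) = u.pair f + u.pair g := by
  rw [pair_of_smooth u hf, pair_of_smooth u hg, pair_of_smooth u (hf.add hg), ← map_add]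
  rfl

lemma pair_sub {f g : RSpace m → ℂ} (hf : ContDiffOn ℝ ∞ f V) (hg : ContDiffOn ℝ ∞ g V) :
    u.pair (fun y => f y - g y) = u.pair f - u.pair g := by
  rw [pair_of_smooth u hf, pair_of_smooth u hg, pair_of_smooth u (hf.sub hg), ← map_sub]
  rfl

lemma pair_zero : u.pair (fun _ => 0) = 0 := by
  rw [pair_of_smooth u contDiffOn_const]
  exact map_zero u.toLinearMap

lemma pair_sum {ι : Type*} (T : Finset ι) {f : ι → RSpace m → ℂ} (hf : ∀ i, ContDiffOn ℝ ∞ (f i) V) :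
    u.pair (fun y => ∑ i ∈ T, f i y) = ∑ i ∈ T, u.pair (f i) := by
  classical
  induction T using Finset.induction_on with
  | empty => simpa using u.pair_zero
  | insert a T ha ih =>
    simp only [Finset.sum_insert ha]
    rw [u.pair_add (hf a) (ContDiffOn.sum fun i _ => hf i), ih]

end CompactDistribution

/-! ### Iterated derivatives of slices and directional derivatives -/

section Slices

variable {X Y F : Type} [NormedAddCommGroup X] [NormedSpace ℝ X] [NormedAddCommGroup Y]
  [NormedSpace ℝ Y] [NormedAddCommGroup F] [NormedSpace ℝ F]

lemma norm_iteratedFDeriv_slice_le {A : Set X} {Ω : Set Y} (hA : IsOpen A) (hΩ : IsOpen Ω) {f : X × Y → F}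
    (hf : ContDiffOn ℝ ∞ f (A ×ˢ Ω)) {x : X} (hx : x ∈ A) {t : Y} (ht : t ∈ Ω) (j : ℕ) :
    ‖iteratedFDeriv ℝ j (fun x => f (x, t)) x‖ ≤ ‖iteratedFDeriv ℝ j f (x, t)‖ := by
  set s : Set (X × Y) := (fun z => z + (0, t)) ⁻¹' (A ×ˢ Ω) with hs
  have hso : IsOpen s := (hA.prod hΩ).preimage (by fun_prop)
  have hg : ContDiffOn ℝ ∞ (fun z => f (z + (0, t))) s :=
    hf.comp (by fun_prop) fun z hz => hz
  have hpre : ContinuousLinearMap.inl ℝ X Y ⁻¹' s = A := by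
    ext y
    simp [hs, ht]
  have hxs : ContinuousLinearMap.inl ℝ X Y x ∈ s := by
    simp [hs, ht, hx]
  have h1 := (ContinuousLinearMap.inl ℝ X Y).iteratedFDerivWithin_comp_right hg hso.uniqueDiffOn
    (by rw [hpre]; exact hA.uniqueDiffOn) hxs (i := j) (by exact_mod_cast le_top)
  rw [hpre, iteratedFDerivWithin_of_isOpen j hA hx, iteratedFDerivWithin_of_isOpen j hso hxs] at h1
  have h2 : ((fun z : X × Y => f (z + (0, t))) ∘ ContinuousLinearMap.inl ℝ X Y) = fun x => f (x, t) := by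
    funext y
    simp
  rw [h2, iteratedFDeriv_comp_add_right] at h1
  rw [h1]
  refine (ContinuousMultilinearMap.norm_compContinuousLinearMap_le _ _).trans ?_
  simp only [ContinuousLinearMap.inl_apply, Prod.mk_add_mk, add_zero, zero_add, Finset.prod_const]
  exact mul_le_of_le_one_right (norm_nonneg _)
    (pow_le_one₀ (norm_nonneg _) (ContinuousLinearMap.norm_inl_le_one ℝ X Y))

lemma contDiffOn_slice {A : Set X} {Ω : Set Y} {f : X × Y → F}
    (hf : ContDiffOn ℝ ∞ f (A ×ˢ Ω)) {t : Y} (ht : t ∈ Ω) : ContDiffOn ℝ ∞ (fun x => f (x, t)) A :=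
  hf.comp (f := fun x : X => (x, t)) (by fun_prop) fun _ hx => ⟨hx, ht⟩

lemma contDiffOn_iteratedFDeriv {D : Set X} (hD : IsOpen D) {f : X → F} (hf : ContDiffOn ℝ ∞ f D) (j : ℕ) :
    ContDiffOn ℝ ∞ (iteratedFDeriv ℝ j f) D := by
  exact fun x hx => ((hf.contDiffAt (hD.mem_nhds hx)).iteratedFDeriv_right (m := ∞)
    (by exact_mod_cast le_top)).contDiffWithinAt

/-- Directional derivatives commute with iterated derivatives. -/
lemma iteratedFDeriv_fderiv_apply {D : Set X} (hD : IsOpen D) {f : X → F} (hf : ContDiffOn ℝ ∞ f D) (k : X)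
    (j : ℕ) : ∀ x ∈ D, iteratedFDeriv ℝ j (fun q => fderiv ℝ f q k) x = fderiv ℝ (iteratedFDeriv ℝ j f) x k := by
  induction j with
  | zero =>
    intro x hx
    have h1 : DifferentiableAt ℝ f x := (hf.contDiffAt (hD.mem_nhds hx)).differentiableAt (by simp)
    have h2 := ((continuousMultilinearCurryFin0 ℝ X F).symm.toContinuousLinearEquiv.hasFDerivAt.comp x
      h1.hasFDerivAt).fderiv
    exact (DFunLike.congr_fun h2 k).symm
  | succ j ih =>
    intro x hx
    have hG := contDiffOn_iteratedFDeriv hD hf j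
    have hGx := hG.contDiffAt (hD.mem_nhds hx)
    have hG' : DifferentiableAt ℝ (fderiv ℝ (iteratedFDeriv ℝ j f)) x :=
      ((hG.fderiv_of_isOpen hD (m := ∞) (by simp)).contDiffAt (hD.mem_nhds hx)).differentiableAt (by simp)
    -- The directional derivative moves past one more differentiation by symmetry of the second
    -- derivative of D^j f.
    have hsym := hGx.isSymmSndFDerivAt (by
      rw [minSmoothness_of_isRCLikeNormedField]; exact WithTop.coe_le_coe.2 (le_top : (2 : ℕ∞) ≤ ⊤))
    have h1 : iteratedFDeriv ℝ j (fun q => fderiv ℝ f q k) =ᶠ[𝓝 x]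
        fun q => fderiv ℝ (iteratedFDeriv ℝ j f) q k := by
      filter_upwards [hD.mem_nhds hx] with q hq using ih q hq
    have h2 : fderiv ℝ (fun q => fderiv ℝ (iteratedFDeriv ℝ j f) q k) x =
        fderiv ℝ (fderiv ℝ (iteratedFDeriv ℝ j f)) x k := by
      ext1 v
      rw [(hG'.hasFDerivAt.clm_apply (hasFDerivAt_const k x)).fderiv]
      simp only [add_apply, ContinuousLinearMap.comp_apply, zero_apply, map_zero,
        ContinuousLinearMap.flip_apply, zero_add]
      exact hsym v k
    have hG1 : DifferentiableAt ℝ (iteratedFDeriv ℝ (j + 1) f) x :=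
      ((contDiffOn_iteratedFDeriv hD hf (j + 1)).contDiffAt (hD.mem_nhds hx)).differentiableAt (by simp)
    have hG2 : ∀ w, DifferentiableAt ℝ (fun q => fderiv ℝ (iteratedFDeriv ℝ j f) q w) x := fun w =>
      hG'.clm_apply (differentiableAt_const w)
    have h3 : ∀ w, fderiv ℝ (fun q => fderiv ℝ (iteratedFDeriv ℝ j f) q w) x k =
        fderiv ℝ (fderiv ℝ (iteratedFDeriv ℝ j f)) x k w := fun w => by
      rw [(hG'.hasFDerivAt.clm_apply (hasFDerivAt_const w x)).fderiv]
      simp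
    ext v
    rw [iteratedFDeriv_succ_apply_left, h1.fderiv_eq, h2, ← h3,
      ← fderiv_continuousMultilinear_apply_const_apply hG1,
      ← fderiv_continuousMultilinear_apply_const_apply (hG2 _)]
    rfl

end Slices

/-! ### Smooth families of compactly supported distributions -/

section Families

variable {m : ℕ} {V : Opens (RSpace m)} {Y : Type} [NormedAddCommGroup Y] [NormedSpace ℝ Y]
  {Ω : Set Y} {u : Y → CompactDistribution V}

/-- Smoothness of a family of compactly supported distributions, with parameters in an open subset of
a normed space. -/
def IsSmoothCompactFamilyOn (Ω : Set Y) (u : Y → CompactDistribution V) : Prop :=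
  ∀ f : smoothFunctions V, ContDiffOn ℝ ∞ (fun t => (u t).toLinearMap f) Ω

lemma IsCompactlyBounded.smul_sub {Λ Λ' : smoothFunctions V →ₗ[ℂ] ℂ} (h : IsCompactlyBounded Λ)
    (h' : IsCompactlyBounded Λ') (c : ℂ) : IsCompactlyBounded (c • (Λ - Λ')) := by
  obtain ⟨K, hK, hKV, q, C, hC⟩ := h
  obtain ⟨K', hK', hKV', q', C', hC'⟩ := h'
  refine ⟨K ∪ K', hK.union hK', union_subset hKV hKV', max q q', ‖c‖ * (C + C'), fun f M hM hf => ?_⟩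
  have h1 := hC f M hM fun j hj x hx => hf j (hj.trans (le_max_left _ _)) x (Or.inl hx)
  have h2 := hC' f M hM fun j hj x hx => hf j (hj.trans (le_max_right _ _)) x (Or.inr hx)
  rw [LinearMap.smul_apply, LinearMap.sub_apply, norm_smul, mul_assoc, add_mul]
  exact mul_le_mul_of_nonneg_left ((norm_sub_le _ _).trans (add_le_add h1 h2)) (norm_nonneg _)

namespace IsSmoothCompactFamilyOn

lemma contDiffOn_pair (hu : IsSmoothCompactFamilyOn Ω u) {f : RSpace m → ℂ} (hf : ContDiffOn ℝ ∞ f V) :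
    ContDiffOn ℝ ∞ (fun t => (u t).pair f) Ω := by
  simp only [CompactDistribution.pair_of_smooth _ hf]
  exact hu ⟨f, hf⟩

/-- For each f the brackets are continuous in t, hence bounded on K, and uniform boundedness
applies. Local uniformity of order and support is thus a consequence of the weak notion of
smoothness. -/
lemma exists_common_bound (hu : IsSmoothCompactFamilyOn Ω u) {K : Set Y} (hK : IsCompact K) (hKΩ : K ⊆ Ω) :
    ∃ L : Set (RSpace m), IsCompact L ∧ L ⊆ V ∧ ∃ (q : ℕ) (C : ℝ), 0 ≤ C ∧ ∀ t ∈ K,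
      ∀ f : RSpace m → ℂ, ContDiffOn ℝ ∞ f V → ∀ M : ℝ, 0 ≤ M →
        (∀ j ≤ q, ∀ x ∈ L, ‖iteratedFDeriv ℝ j f x‖ ≤ M) → ‖(u t).pair f‖ ≤ C * M := by
  obtain ⟨L, hL, hLV, q, C, hC, h⟩ := FBI.exists_common_bound (fun t : K => (u t).toLinearMap)
    (fun t => (u t).bound) fun f => by
      obtain ⟨B, hB⟩ := hK.exists_bound_of_continuousOn ((hu f).continuousOn.mono hKΩ)
      exact ⟨B, fun t => hB t t.2⟩
  refine ⟨L, hL, hLV, q, C, hC, fun t ht f hf M hM hfM => ?_⟩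
  rw [CompactDistribution.pair_of_smooth _ hf]
  exact h ⟨t, ht⟩ ⟨f, hf⟩ M hM hfM

/-- The derivative of a smooth family in a fixed direction is a smooth family. -/
lemma exists_fderiv (hΩ : IsOpen Ω) (hu : IsSmoothCompactFamilyOn Ω u) (v : Y) :
    ∃ u' : Y → CompactDistribution V, IsSmoothCompactFamilyOn Ω u' ∧ ∀ t ∈ Ω, ∀ f : RSpace m → ℂ,
      ContDiffOn ℝ ∞ f V → (u' t).pair f = fderiv ℝ (fun t => (u t).pair f) t v := by
  have hd : ∀ t ∈ Ω, ∀ f : smoothFunctions V, DifferentiableAt ℝ (fun t => (u t).toLinearMap f) t :=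
    fun t ht f => ((hu f).contDiffAt (hΩ.mem_nhds ht)).differentiableAt (by simp)
  have hex : ∀ t ∈ Ω, ∃ d : CompactDistribution V, ∀ f : smoothFunctions V,
      d.toLinearMap f = fderiv ℝ (fun t => (u t).toLinearMap f) t v := by
    intro t ht
    let Λ : smoothFunctions V →ₗ[ℂ] ℂ :=
      { toFun := fun f => fderiv ℝ (fun t => (u t).toLinearMap f) t v
        map_add' := fun f g => by
          simp only [map_add]
          rw [fderiv_fun_add (hd t ht f) (hd t ht g)]
          rfl
        map_smul' := fun c f => by
          simp only [map_smul]
          rw [fderiv_fun_const_smul (hd t ht f)]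
          rfl }
    refine ⟨⟨Λ, ?_⟩, fun f => rfl⟩
    -- Difference quotients with step 1/k. They converge on every f, so they are pointwise bounded;
    -- their common bound passes to the limit, which is therefore a compactly supported
    -- distribution.
    let Λs : ℕ → smoothFunctions V →ₗ[ℂ] ℂ := fun k =>
      (((k : ℝ) : ℂ)) • ((u (t + (k : ℝ)⁻¹ • v)).toLinearMap - (u t).toLinearMap)
    have hlim : ∀ f, Tendsto (fun k => Λs k f) atTop (𝓝 (Λ f)) := fun f => by
      have h := (hd t ht f).hasFDerivAt.lim v (c := fun k : ℕ => (k : ℝ)) (l := atTop)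
        (by simpa using tendsto_natCast_atTop_atTop (R := ℝ))
      refine h.congr fun k => ?_
      simp [Λs]
    obtain ⟨K, hK, hKV, q, C, hC, hb⟩ := FBI.exists_common_bound Λs
      (fun k => IsCompactlyBounded.smul_sub (u _).bound (u _).bound _) fun f => by
        obtain ⟨B, hB⟩ := (hlim f).norm.bddAbove_range
        exact ⟨B, fun i => hB ⟨i, rfl⟩⟩
    exact ⟨K, hK, hKV, q, C, fun f M hM hf =>
      le_of_tendsto (hlim f).norm (Eventually.of_forall fun k => hb k f M hM hf)⟩
  classical
  choose d hd' using hex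
  refine ⟨fun t => if h : t ∈ Ω then d t h else u t, fun f => ?_, fun t ht f hf => ?_⟩
  · refine (((hu f).fderiv_of_isOpen hΩ (m := ∞) (by simp)).clm_apply (contDiffOn_const (c := v))).congr
      fun t ht => ?_
    simp only [dif_pos ht]
    exact hd' t ht f
  · simp only [dif_pos ht, CompactDistribution.pair_of_smooth _ hf]
    exact hd' t ht ⟨f, hf⟩

end IsSmoothCompactFamilyOn

end Families

end FBI
end

noncomputable section

namespace FBI

/-! ### The product rule for brackets of a smooth family with functions depending on the parameter
-/

section Pairing

variable {m : ℕ} {V : Opens (RSpace m)} {Y : Type} [NormedAddCommGroup Y] [NormedSpace ℝ Y]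
  {Ω : Set Y} {u : Y → CompactDistribution V}

/-- First order Taylor expansion in one variable, uniformly in the other one. -/
lemma eventually_norm_sub_fderiv_le {F : Type} [NormedAddCommGroup F] [NormedSpace ℝ F]
    [FiniteDimensional ℝ Y] (hΩ : IsOpen Ω) {G : RSpace m × Y → F}
    (hGs : ContDiffOn ℝ ∞ G ((V : Set (RSpace m)) ×ˢ Ω)) {t : Y} (ht : t ∈ Ω)
    {L : Set (RSpace m)} (hL : IsCompact L) (hLV : L ⊆ V) {c : ℝ} (hc : 0 < c) :
    ∀ᶠ τ in 𝓝 t, ∀ y ∈ L, ‖G (y, τ) - G (y, t) - fderiv ℝ G (y, t) (0, τ - t)‖ ≤ c * ‖τ - t‖ := by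
  have : ProperSpace Y := FiniteDimensional.proper ℝ Y
  have hD : IsOpen ((V : Set (RSpace m)) ×ˢ Ω) := V.isOpen.prod hΩ
  have hG' : ContinuousOn (fderiv ℝ G) ((V : Set (RSpace m)) ×ˢ Ω) :=
    hGs.continuousOn_fderiv_of_isOpen hD (by simp)
  obtain ⟨r, hr, hrΩ⟩ := Metric.nhds_basis_closedBall.mem_iff.1 (hΩ.mem_nhds ht)
  have hLB : L ×ˢ Metric.closedBall t r ⊆ (V : Set (RSpace m)) ×ˢ Ω := prod_mono hLV hrΩ
  obtain ⟨δ, hδ, hδc⟩ := Metric.uniformContinuousOn_iff.1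
    ((hL.prod (isCompact_closedBall t r)).uniformContinuousOn_of_continuous (hG'.mono hLB)) c hc
  filter_upwards [Metric.ball_mem_nhds t (lt_min hδ hr)] with τ hτ y hy
  have hyV : y ∈ (V : Set (RSpace m)) := hLV hy
  have hball : ∀ s ∈ Metric.ball t (min δ r), s ∈ Metric.closedBall t r := fun s hs =>
    Metric.ball_subset_closedBall (Metric.ball_subset_ball (min_le_right _ _) hs)
  have hder : ∀ s ∈ Metric.ball t (min δ r), HasFDerivWithinAt (fun s => G (y, s))
      (fderiv ℝ G (y, s) ∘L ContinuousLinearMap.inr ℝ (RSpace m) Y) (Metric.ball t (min δ r)) s :=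
    fun s hs => (((hGs.contDiffAt (hD.mem_nhds ⟨hyV, hrΩ (hball s hs)⟩)).differentiableAt
      (by simp)).hasFDerivAt.comp s (f := fun s => (y, s)) (hasFDerivAt_prodMk_right y s)).hasFDerivWithinAt
  have hmv := (convex_ball t (min δ r)).norm_image_sub_le_of_norm_hasFDerivWithin_le'
    (φ := fderiv ℝ G (y, t) ∘L ContinuousLinearMap.inr ℝ (RSpace m) Y) (C := c) hder (fun s hs => ?_)
    (Metric.mem_ball_self (lt_min hδ hr)) hτ
  · simpa using hmv
  · rw [← ContinuousLinearMap.sub_comp]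
    refine (ContinuousLinearMap.opNorm_comp_le _ _).trans ?_
    refine (mul_le_of_le_one_right (norm_nonneg _) (ContinuousLinearMap.norm_inr_le_one ℝ _ _)).trans ?_
    rw [← dist_eq_norm]
    exact (hδc (y, s) ⟨hy, hball s hs⟩ (y, t) ⟨hy, Metric.mem_closedBall_self hr.le⟩ (by
      rw [dist_prod_same_left]
      exact lt_of_lt_of_le hs (min_le_left _ _))).le

/-- First order Taylor expansion in the parameter, uniformly in the other variable together with its
derivatives. -/
lemma exists_norm_iteratedFDeriv_taylor_le (hΩ : IsOpen Ω) {f : RSpace m × Y → ℂ}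
    [FiniteDimensional ℝ Y] (hf : ContDiffOn ℝ ∞ f ((V : Set (RSpace m)) ×ˢ Ω)) {t : Y} (ht : t ∈ Ω)
    {L : Set (RSpace m)} (hL : IsCompact L) (hLV : L ⊆ V) {c : ℝ} (hc : 0 < c) (j : ℕ) :
    ∀ᶠ τ in 𝓝 t, ∀ y ∈ L,
      ‖iteratedFDeriv ℝ j (fun y => f (y, τ) - f (y, t) - fderiv ℝ f (y, t) (0, τ - t)) y‖ ≤ c * ‖τ - t‖ := by
  have hD : IsOpen ((V : Set (RSpace m)) ×ˢ Ω) := V.isOpen.prod hΩ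
  -- The j-th derivative of the Taylor remainder of f is the Taylor remainder of D^j f, because
  -- directional and iterated derivatives commute; slicing in y only decreases norms.
  set G := iteratedFDeriv ℝ j f with hG
  have hGs : ContDiffOn ℝ ∞ G ((V : Set (RSpace m)) ×ˢ Ω) := contDiffOn_iteratedFDeriv hD hf j
  filter_upwards [eventually_norm_sub_fderiv_le hΩ hGs ht hL hLV hc, hΩ.mem_nhds ht] with τ hτ hτΩ y hy
  set h := τ - t with hh
  -- The parameters for which both f and its translate by h are smooth.
  set Ω' : Set Y := Ω ∩ (fun s => s + h) ⁻¹' Ω with hΩ'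
  have hΩ'o : IsOpen Ω' := hΩ.inter (hΩ.preimage (by fun_prop))
  have htΩ' : t ∈ Ω' := ⟨ht, by simpa [hh] using hτΩ⟩
  have hyV : y ∈ (V : Set (RSpace m)) := hLV hy
  have hyt : (y, t) ∈ (V : Set (RSpace m)) ×ˢ Ω := ⟨hyV, ht⟩
  have hyτ : (y, t) + (0, h) = (y, τ) := by simp [hh]
  have hs1 : ContDiffOn ℝ ∞ (fun q : RSpace m × Y => f (q + (0, h))) ((V : Set (RSpace m)) ×ˢ Ω') :=
    hf.comp (by fun_prop) fun q hq => ⟨by simpa using hq.1, hq.2.2⟩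
  have hs2 : ContDiffOn ℝ ∞ f ((V : Set (RSpace m)) ×ˢ Ω') := hf.mono (prod_mono le_rfl inter_subset_left)
  have hs3 : ContDiffOn ℝ ∞ (fun q => fderiv ℝ f q (0, h)) ((V : Set (RSpace m)) ×ˢ Ω) :=
    (hf.fderiv_of_isOpen hD (m := ∞) (by simp)).clm_apply contDiffOn_const
  have hs3' := hs3.mono (prod_mono le_rfl inter_subset_left : (V : Set (RSpace m)) ×ˢ Ω' ⊆ _)
  have hle := norm_iteratedFDeriv_slice_le V.isOpen hΩ'o
    (f := fun q => f (q + (0, h)) - f q - fderiv ℝ f q (0, h)) ((hs1.sub hs2).sub hs3') hyV htΩ' j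
  have hfun : (fun y => f ((y, t) + (0, h)) - f (y, t) - fderiv ℝ f (y, t) (0, h)) =
      fun y => f (y, τ) - f (y, t) - fderiv ℝ f (y, t) (0, h) := by
    funext y
    simp [hh]
  rw [hfun] at hle
  refine hle.trans ?_
  have hn : (V : Set (RSpace m)) ×ˢ Ω' ∈ 𝓝 (y, t) := (V.isOpen.prod hΩ'o).mem_nhds ⟨hyV, htΩ'⟩
  have hlt : ((j : ℕ) : WithTop ℕ∞) ≤ ∞ := by exact_mod_cast le_top
  have e1 := (hs1.contDiffAt hn).of_le hlt
  have e2 := (hs2.contDiffAt hn).of_le hlt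
  have e3 := (hs3'.contDiffAt hn).of_le hlt
  rw [fun_iteratedFDeriv_sub_apply (e1.sub e2) e3, fun_iteratedFDeriv_sub_apply e1 e2,
    iteratedFDeriv_comp_add_right, iteratedFDeriv_fderiv_apply hD hf _ j _ hyt, hyτ, ← hG]
  exact hτ y hy

/-- The bracket `⟨u(t), f(·,t)⟩`. -/
def pairing (u : Y → CompactDistribution V) (f : RSpace m × Y → ℂ) (t : Y) : ℂ :=
  (u t).pair fun y => f (y, t)

variable [FiniteDimensional ℝ Y]

/-- Expand f(·,τ) to first order at t inside the bracket: ⟨u(τ), f(·,t)⟩, plus the sum of (τ − t)_i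
⟨u(τ), ∂_i f(·,t)⟩, plus a remainder. In the first two terms the test function is fixed, so
smoothness of u applies directly. The remainder is o(|τ − t|), since the Taylor remainder is small
with finitely many derivatives on a compact set and u(τ) satisfies a common bound for τ near t. -/
theorem IsSmoothCompactFamilyOn.hasFDerivAt_pairing (hΩ : IsOpen Ω) (hu : IsSmoothCompactFamilyOn Ω u)
    {f : RSpace m × Y → ℂ} (hf : ContDiffOn ℝ ∞ f ((V : Set (RSpace m)) ×ˢ Ω)) {t : Y} (ht : t ∈ Ω) :
    DifferentiableAt ℝ (pairing u f) t ∧ ∀ v, fderiv ℝ (pairing u f) t v =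
      fderiv ℝ (fun τ => (u τ).pair fun y => f (y, t)) t v + pairing u (fun q => fderiv ℝ f q (0, v)) t := by
  have hD : IsOpen ((V : Set (RSpace m)) ×ˢ Ω) := V.isOpen.prod hΩ
  set b := Module.finBasis ℝ Y with hb
  have hft : ∀ τ ∈ Ω, ContDiffOn ℝ ∞ (fun y => f (y, τ)) V := fun τ hτ => contDiffOn_slice hf hτ
  have hdf : ∀ v : Y, ContDiffOn ℝ ∞ (fun y => fderiv ℝ f (y, t) (0, v)) V := fun v =>
    contDiffOn_slice ((hf.fderiv_of_isOpen hD (m := ∞) (by simp)).clm_apply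
      (contDiffOn_const (c := ((0, v) : RSpace m × Y)))) ht
  have hexp : ∀ (v : Y) y, fderiv ℝ f (y, t) (0, v) =
      ∑ i, ((coordCLM Y i v : ℝ) : ℂ) * fderiv ℝ f (y, t) (0, b i) := fun v y => by
    have h1 : ((0, v) : RSpace m × Y) = ∑ i, coordCLM Y i v • ((0, b i) : RSpace m × Y) := by
      have h2 : v = ∑ i, coordCLM Y i v • b i := (b.sum_repr v).symm
      ext1
      · simp [Prod.fst_sum]
      · simpa [Prod.snd_sum] using h2
    rw [h1]
    simp only [map_sum, map_smul, Complex.real_smul]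
  have hpexp : ∀ (v τ : Y), (u τ).pair (fun y => fderiv ℝ f (y, t) (0, v)) =
      ∑ i, ((coordCLM Y i v : ℝ) : ℂ) * (u τ).pair (fun y => fderiv ℝ f (y, t) (0, b i)) := fun v τ => by
    simp only [hexp v]
    rw [(u τ).pair_sum _ fun i => contDiffOn_const.mul (hdf (b i))]
    exact Finset.sum_congr rfl fun i _ => (u τ).pair_const_mul _ (hdf (b i))
  set A : Y → ℂ := fun τ => (u τ).pair fun y => f (y, t) with hA
  set B : Fin (Module.finrank ℝ Y) → Y → ℂ := fun i τ => (u τ).pair (fun y => fderiv ℝ f (y, t) (0, b i)) with hB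
  set ρ : Y → ℂ := fun τ => (u τ).pair (fun y => f (y, τ) - f (y, t) - fderiv ℝ f (y, t) (0, τ - t)) with hρ
  have hdA : HasFDerivAt A (fderiv ℝ A t) t :=
    (((hu.contDiffOn_pair (hft t ht)).contDiffAt (hΩ.mem_nhds ht)).differentiableAt (by simp)).hasFDerivAt
  have hdB : ∀ i, HasFDerivAt (B i) (fderiv ℝ (B i) t) t := fun i =>
    (((hu.contDiffOn_pair (hdf (b i))).contDiffAt (hΩ.mem_nhds ht)).differentiableAt (by simp)).hasFDerivAt
  have hdρ : HasFDerivAt ρ (0 : Y →L[ℝ] ℂ) t := by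
    rw [hasFDerivAt_iff_isLittleO]
    have hρt : ρ t = 0 := by
      have h1 : (fun y => f (y, t) - f (y, t) - fderiv ℝ f (y, t) (0, t - t)) = fun _ : RSpace m => (0 : ℂ) := by
        funext y
        simp [show ((0 : RSpace m), (0 : Y)) = 0 from rfl]
      simp only [hρ]
      rw [h1, (u t).pair_zero]
    rw [Asymptotics.isLittleO_iff]
    intro c hc
    obtain ⟨K, hK, htK, hKΩ⟩ := exists_compact_subset hΩ ht
    obtain ⟨L, hL, hLV, q, C, hC, hbd⟩ := hu.exists_common_bound hK hKΩ
    have hc' : 0 < c / (C + 1) := by positivity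
    have hev : ∀ᶠ τ in 𝓝 t, ∀ j ∈ Finset.range (q + 1), ∀ y ∈ L,
        ‖iteratedFDeriv ℝ j (fun y => f (y, τ) - f (y, t) - fderiv ℝ f (y, t) (0, τ - t)) y‖ ≤
          c / (C + 1) * ‖τ - t‖ :=
      (Finset.eventually_all _).2 fun j _ => exists_norm_iteratedFDeriv_taylor_le hΩ hf ht hL hLV hc' j
    filter_upwards [hev, mem_interior_iff_mem_nhds.1 htK] with τ hτ hτK
    rw [hρt]
    simp only [zero_apply, sub_zero]
    have h1 := hbd τ hτK _ (((hft τ (hKΩ hτK)).sub (hft t ht)).sub (hdf (τ - t))) (c / (C + 1) * ‖τ - t‖)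
      (by positivity) fun j hj x hx => hτ j (Finset.mem_range.2 (Nat.lt_succ_of_le hj)) x hx
    refine h1.trans ?_
    rw [← mul_assoc]
    refine mul_le_mul_of_nonneg_right ?_ (norm_nonneg _)
    rw [mul_div_assoc', div_le_iff₀ (by positivity)]
    nlinarith
  have hterm : ∀ i, HasFDerivAt (fun τ => ((coordCLM Y i (τ - t) : ℝ) : ℂ) * B i τ)
      (B i t • (Complex.ofRealCLM ∘L coordCLM Y i)) t := fun i => by
    have h1 : HasFDerivAt (fun τ => ((coordCLM Y i (τ - t) : ℝ) : ℂ)) (Complex.ofRealCLM ∘L coordCLM Y i) t := by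
      have := ((Complex.ofRealCLM ∘L coordCLM Y i).hasFDerivAt (x := t - t)).comp (f := fun τ => τ - t) t
        ((hasFDerivAt_id t).sub_const t)
      exact this
    have h2 := h1.mul (hdB i)
    refine h2.congr_fderiv ?_
    ext v
    simp
  have hsum := (hdA.add (HasFDerivAt.fun_sum fun i (_ : i ∈ Finset.univ) => hterm i)).add hdρ
  have heq : pairing u f =ᶠ[𝓝 t] fun τ => (A τ + ∑ i, ((coordCLM Y i (τ - t) : ℝ) : ℂ) * B i τ) + ρ τ := by
    filter_upwards [hΩ.mem_nhds ht] with τ hτ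
    simp only [hA, hB, hρ, pairing]
    rw [← hpexp (τ - t) τ, (u τ).pair_sub ((hft τ hτ).sub (hft t ht)) (hdf (τ - t)),
      (u τ).pair_sub (hft τ hτ) (hft t ht)]
    ring
  have hfin := hsum.congr_of_eventuallyEq heq
  refine ⟨hfin.differentiableAt, fun v => ?_⟩
  rw [hfin.fderiv, pairing, hpexp v t]
  simp only [add_zero, add_apply, FunLike.coe_sum, Finset.sum_apply, smul_apply, smul_eq_mul,
    ContinuousLinearMap.comp_apply, Complex.ofRealCLM_apply]
  congr 1
  exact Finset.sum_congr rfl fun i _ => mul_comm _ _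

/-- Families of smooth functions converging, with all their derivatives, uniformly on compact sets. -/
structure ConvFamily {X S : Type} [NormedAddCommGroup X] [NormedSpace ℝ X] (D : Set X)
    (F : ℝ → S → X → ℂ) (F₀ : S → X → ℂ) : Prop where
  contDiffOn : ∀ ε : ℝ, 0 < ε → ∀ s, ContDiffOn ℝ ∞ (F ε s) D
  contDiffOn_lim : ∀ s, ContDiffOn ℝ ∞ (F₀ s) D
  conv : ∀ j : ℕ, ∀ K ⊆ D, IsCompact K → TendstoUniformlyOn
      (fun ε (q : S × X) => iteratedFDeriv ℝ j (F ε q.1) q.2)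
      (fun q => iteratedFDeriv ℝ j (F₀ q.1) q.2) (𝓝[>] 0) (univ ×ˢ K)

lemma ConvFamily.fderiv_apply {X S : Type} [NormedAddCommGroup X] [NormedSpace ℝ X] {D : Set X}
    (hD : IsOpen D) {F : ℝ → S → X → ℂ} {F₀ : S → X → ℂ} (h : ConvFamily D F F₀) (v : X) :
    ConvFamily D (fun ε s x => fderiv ℝ (F ε s) x v) (fun s x => fderiv ℝ (F₀ s) x v) := by
  have h1 : ∀ {f : X → ℂ}, ContDiffOn ℝ ∞ f D → ContDiffOn ℝ ∞ (fderiv ℝ f) D := fun hf =>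
    hf.fderiv_of_isOpen hD (m := ∞) (by simp)
  refine ⟨fun ε hε s => (h1 (h.contDiffOn ε hε s)).clm_apply contDiffOn_const,
    fun s => (h1 (h.contDiffOn_lim s)).clm_apply contDiffOn_const, fun j K hKD hK => ?_⟩
  have h2 := Metric.tendstoUniformlyOn_iff.1 (h.conv (j + 1) K hKD hK)
  rw [Metric.tendstoUniformlyOn_iff]
  intro η hη
  filter_upwards [h2 (η / (‖v‖ + 1)) (by positivity), self_mem_nhdsWithin] with ε hε hε0 q hq
  have h3 := hε q hq
  have hn := hD.mem_nhds (hKD hq.2)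
  have hlt : ∀ i : ℕ, ((i : ℕ) : WithTop ℕ∞) ≤ ∞ := fun i => by exact_mod_cast le_top
  have a0 := (h.contDiffOn_lim q.1).contDiffAt hn
  have a1 := (h.contDiffOn ε hε0 q.1).contDiffAt hn
  have b0 := ((h1 (h.contDiffOn_lim q.1)).contDiffAt hn)
  have b1 := ((h1 (h.contDiffOn ε hε0 q.1)).contDiffAt hn)
  rw [dist_eq_norm, ← iteratedFDeriv_sub_apply (a0.of_le (hlt _)) (a1.of_le (hlt _))] at h3
  rw [dist_eq_norm, ← fun_iteratedFDeriv_sub_apply ((b0.clm_apply contDiffAt_const).of_le (hlt _))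
    ((b1.clm_apply contDiffAt_const).of_le (hlt _))]
  have h4 : (fun x => fderiv ℝ (F₀ q.1) x v - fderiv ℝ (F ε q.1) x v) =ᶠ[𝓝 q.2]
      fun x => fderiv ℝ (F₀ q.1 - F ε q.1) x v := by
    filter_upwards [hn] with x hx
    rw [fderiv_sub (((h.contDiffOn_lim q.1).contDiffAt (hD.mem_nhds hx)).differentiableAt (by simp))
      (((h.contDiffOn ε hε0 q.1).contDiffAt (hD.mem_nhds hx)).differentiableAt (by simp)), sub_apply]
  rw [(h4.iteratedFDeriv ℝ j).eq_of_nhds]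
  have h5 := norm_iteratedFDeriv_clm_apply_const (c := v) (n := j) (f := fderiv ℝ (F₀ q.1 - F ε q.1)) (x := q.2)
    ((h1 ((h.contDiffOn_lim q.1).sub (h.contDiffOn ε hε0 q.1))).contDiffAt hn) (hlt j)
  rw [norm_iteratedFDeriv_fderiv] at h5
  refine h5.trans_lt ?_
  rw [lt_div_iff₀ (by positivity)] at h3
  have : 0 ≤ ‖iteratedFDeriv ℝ (j + 1) (F₀ q.1 - F ε q.1) q.2‖ := norm_nonneg _
  nlinarith

/-- The class consists of the brackets of all smooth families u with all convergent families F. It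
is closed under differentiation by the product rule, whose two terms pair u' with F and u with F'.
Uniform convergence of each member comes from the common bound for u on compact sets. -/
theorem ConvFamily.pairing {S : Type} (hΩ : IsOpen Ω) (hu : IsSmoothCompactFamilyOn Ω u)
    {F : ℝ → S → RSpace m × Y → ℂ} {F₀ : S → RSpace m × Y → ℂ}
    (h : ConvFamily ((V : Set (RSpace m)) ×ˢ Ω) F F₀) :
    ConvFamily Ω (fun ε s => pairing u (F ε s)) (fun s => pairing u (F₀ s)) := by
  have hD : IsOpen ((V : Set (RSpace m)) ×ˢ Ω) := V.isOpen.prod hΩ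
  set 𝒞 : Set ((ℝ → S → Y → ℂ) × (S → Y → ℂ)) :=
    {p | ∃ u : Y → CompactDistribution V, IsSmoothCompactFamilyOn Ω u ∧ ∃ F F₀,
      ConvFamily ((V : Set (RSpace m)) ×ˢ Ω) F F₀ ∧
      p = (fun ε s => FBI.pairing u (F ε s), fun s => FBI.pairing u (F₀ s))} with h𝒞
  have hmain := tendstoUniformlyOn_iteratedFDeriv_of_class hΩ (l := 𝓝[>] 0) (E₀ := Ioi 0) self_mem_nhdsWithin 𝒞
    (by
      rintro _ ⟨u, hu, F, F₀, h, rfl⟩ K hKΩ hK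
      obtain ⟨L, hL, hLV, q, C, hC, hbd⟩ := hu.exists_common_bound hK hKΩ
      rw [Metric.tendstoUniformlyOn_iff]
      intro η hη
      have hη' : 0 < η / (C + 1) := by positivity
      have hev := (Finset.eventually_all (l := 𝓝[>] (0 : ℝ)) (Finset.range (q + 1))).2 fun j _ =>
        Metric.tendstoUniformlyOn_iff.1 (h.conv j (L ×ˢ K) (prod_mono hLV hKΩ) (hL.prod hK)) _ hη'
      filter_upwards [hev, self_mem_nhdsWithin] with ε hε hε0 p hp
      obtain ⟨s, t⟩ := p
      have ht : t ∈ K := hp.2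
      have a0 := h.contDiffOn_lim s
      have a1 := h.contDiffOn ε hε0 s
      have c0 := contDiffOn_slice a0 (hKΩ ht)
      have c1 := contDiffOn_slice a1 (hKΩ ht)
      simp only [FBI.pairing]
      rw [dist_eq_norm, ← (u t).pair_sub c0 c1]
      refine (hbd t ht _ (c0.sub c1) _ hη'.le fun j hj x hx => ?_).trans_lt ?_
      · have h3 := hε j (Finset.mem_range.2 (Nat.lt_succ_of_le hj)) (s, (x, t)) ⟨mem_univ _, hx, ht⟩
        have hn := hD.mem_nhds (show (x, t) ∈ (V : Set (RSpace m)) ×ˢ Ω from ⟨hLV hx, hKΩ ht⟩)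
        have hlt : ((j : ℕ) : WithTop ℕ∞) ≤ ∞ := by exact_mod_cast le_top
        rw [dist_eq_norm, ← fun_iteratedFDeriv_sub_apply ((a0.contDiffAt hn).of_le hlt)
          ((a1.contDiffAt hn).of_le hlt)] at h3
        exact (norm_iteratedFDeriv_slice_le V.isOpen hΩ (f := fun q => F₀ s q - F ε s q)
          (a0.sub a1) (hLV hx) (hKΩ ht) j).trans h3.le
      · rw [mul_div_assoc', div_lt_iff₀ (by positivity)]
        nlinarith)
    (by
      rintro _ ⟨u, hu, F, F₀, h, rfl⟩ ε hε s t ht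
      exact (hu.hasFDerivAt_pairing hΩ (h.contDiffOn ε hε s) ht).1.differentiableWithinAt)
    (by
      rintro _ ⟨u, hu, F, F₀, h, rfl⟩ v
      obtain ⟨u', hu', hd⟩ := hu.exists_fderiv hΩ v
      refine ⟨_, ⟨u', hu', F, F₀, h, rfl⟩, _, ⟨u, hu, _, _, h.fderiv_apply hD (0, v), rfl⟩,
        fun ε hε s t ht => ?_⟩
      rw [(hu.hasFDerivAt_pairing hΩ (h.contDiffOn ε hε s) ht).2 v,
        ← hd t ht _ (contDiffOn_slice (h.contDiffOn ε hε s) ht)]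
      rfl)
    _ ⟨u, hu, F, F₀, h, rfl⟩
  exact ⟨hmain.1, hmain.2.1, hmain.2.2⟩

end Pairing

end FBI
end

noncomputable section

namespace FBI

/-! ### Compact sets of test functions -/

section TestFunctions

variable {m : ℕ} {V : Opens (RSpace m)}

/-- Order zero is continuity of the map into bounded functions. The derivative is a continuous map
of test function spaces, hence sends compact sets to compact sets; as it changes the target, F is
quantified inside the induction. -/
lemma exists_norm_iteratedFDeriv_le_of_isCompact (j : ℕ) : ∀ {F : Type} [NormedAddCommGroup F]
    [NormedSpace ℝ F] {B : Set 𝓓(V, F)}, IsCompact B →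
    ∃ M : ℝ, 0 ≤ M ∧ ∀ χ ∈ B, ∀ x, ‖iteratedFDeriv ℝ j χ x‖ ≤ M := by
  induction j with
  | zero =>
    intro F _ _ B hB
    obtain ⟨M, hM⟩ := hB.exists_bound_of_continuousOn
      (TestFunction.toBoundedContinuousFunctionCLM ℝ (Ω := V) (F := F) (n := ⊤)).continuous.continuousOn
    refine ⟨max M 0, le_max_right _ _, fun χ hχ x => ?_⟩
    rw [norm_iteratedFDeriv_zero]
    exact (BoundedContinuousFunction.norm_coe_le_norm (TestFunction.toBoundedContinuousFunctionCLM ℝ χ) x).trans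
      ((hM χ hχ).trans (le_max_left _ _))
  | succ j ih =>
    intro F _ _ B hB
    obtain ⟨M, hM0, hM⟩ := ih (hB.image (TestFunction.fderivCLM ℝ (Ω := V) (F := F) ⊤ ⊤).continuous)
    refine ⟨M, hM0, fun χ hχ x => ?_⟩
    have h := hM _ ⟨χ, hχ, rfl⟩ x
    rw [TestFunction.fderivCLM_apply_of_le χ (by simp)] at h
    rwa [norm_iteratedFDeriv_fderiv] at h

/-- Otherwise there are χ_N in B and points x_N leaving every compact subset of V with χ_N(x_N) ≠ 0.
The map f ↦ (N f(x_N)/|χ_N(x_N)|)_N into bounded sequences is continuous, because a given compact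
set contains only finitely many of the points. It is thus bounded on B, yet its N-th entry at χ_N
has absolute value N. -/
lemma exists_common_support_of_isCompact {B : Set 𝓓(V, ℝ)} (hB : IsCompact B) :
    ∃ L : Set (RSpace m), IsCompact L ∧ L ⊆ V ∧ ∀ χ ∈ B, ∀ x ∉ L, χ x = 0 := by
  obtain ⟨E, hE, hEV, hEm, hEK⟩ := exists_exhaustion V
  by_contra hcon
  have key : ∀ N : ℕ, ∃ χ ∈ B, ∃ x ∉ E N, χ x ≠ 0 := by
    intro N
    by_contra h
    refine hcon ⟨E N, hE N, hEV N, fun χ hχ x hx => ?_⟩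
    by_contra h0
    exact h ⟨χ, hχ, x, hx, h0⟩
  choose χ hχB x hx hχx using key
  set a : ℕ → ℝ := fun N => N / ‖χ N (x N)‖ with ha
  have ha0 : ∀ N, 0 ≤ a N := fun N => by positivity
  have hbd : ∀ K ⊆ (V : Set (RSpace m)), IsCompact K → ∃ C : ℝ, 0 ≤ C ∧ ∀ (f : RSpace m → ℝ) (M : ℝ),
      (∀ y ∉ K, f y = 0) → (∀ y, ‖f y‖ ≤ M) → ∀ N, ‖a N * f (x N)‖ ≤ C * M := by
    intro K hKV hK
    obtain ⟨N₀, hN₀⟩ := hEK K hKV hK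
    refine ⟨∑ N ∈ Finset.range N₀, a N, Finset.sum_nonneg fun N _ => ha0 N, fun f M hf hM N => ?_⟩
    have hM0 : 0 ≤ M := (norm_nonneg _).trans (hM (x N))
    by_cases hN : N < N₀
    · rw [norm_mul, Real.norm_of_nonneg (ha0 N)]
      exact mul_le_mul (Finset.single_le_sum (fun N _ => ha0 N) (Finset.mem_range.2 hN)) (hM _)
        (norm_nonneg _) (Finset.sum_nonneg fun N _ => ha0 N)
    · rw [hf _ fun h => hx N (hEm (not_lt.1 hN) (hN₀ h)), mul_zero, norm_zero]
      exact mul_nonneg (Finset.sum_nonneg fun N _ => ha0 N) hM0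
  have hfin : ∀ f : 𝓓(V, ℝ), ∃ C : ℝ, ∀ N, ‖a N * f (x N)‖ ≤ C := fun f => by
    obtain ⟨C, -, h⟩ := hbd (tsupport f) f.tsupport_subset f.hasCompactSupport
    obtain ⟨M, hM⟩ := f.hasCompactSupport.exists_bound_of_continuous f.continuous
    exact ⟨C * M, h f M (fun y hy => image_eq_zero_of_notMem_tsupport hy) hM⟩
  choose Cf hCf using hfin
  let ev : 𝓓(V, ℝ) → BoundedContinuousFunction ℕ ℝ := fun f =>
    BoundedContinuousFunction.ofNormedAddCommGroupDiscrete (fun N => a N * f (x N)) (Cf f) (hCf f)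
  let T : 𝓓(V, ℝ) →L[ℝ] BoundedContinuousFunction ℕ ℝ := TestFunction.mkCLM ℝ ev
    (fun f g => by ext N; simp [ev, mul_add]) (fun c f => by ext N; simp [ev, mul_left_comm])
    (fun K hK => by
      refine (ContDiffMapSupportedIn.mkCLMtoNormedSpace (𝕜 := ℝ) (K := K) (n := ⊤)
        (fun f => ev (TestFunction.ofSupportedIn hK f)) ?_ ?_ ?_).continuous
      · intro f g
        ext N
        simp [ev, mul_add]
      · intro c f
        ext N
        simp [ev, mul_left_comm]
      · obtain ⟨C, hC, h⟩ := hbd K hK K.isCompact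
        refine ⟨{0}, C, hC, fun f => ?_⟩
        rw [Finset.sup_singleton]
        refine (BoundedContinuousFunction.norm_le (mul_nonneg hC (apply_nonneg _ f))).2 fun N => ?_
        exact h f _ (fun y hy => f.zero_on_compl hy)
          (fun y => ContDiffMapSupportedIn.norm_apply_le_seminorm ℝ) N)
  obtain ⟨C, hC⟩ := hB.exists_bound_of_continuousOn T.continuous.continuousOn
  obtain ⟨N, hN⟩ := exists_nat_gt C
  have h1 := ((T (χ N)).norm_coe_le_norm N).trans (hC _ (hχB N))
  have h2 : (T (χ N)) N = a N * χ N (x N) := rfl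
  rw [h2, norm_mul, Real.norm_of_nonneg (ha0 N), ha, div_mul_cancel₀ _ (norm_ne_zero_iff.2 (hχx N))] at h1
  linarith

end TestFunctions

end FBI
end

noncomputable section

namespace FBI

/-! ### The inversion integral as a family of distributions -/

section Inversion

variable {m n : ℕ} {V : Opens (RSpace m)} {W : Opens (RSpace n)} {φ : RSpace m → RSpace n → RSpace m}
  {u : RSpace n → CompactDistribution V}

/-- The coefficient `χ(x) det Z_x(y,t)`. -/
def testCoeff (φ : RSpace m → RSpace n → RSpace m) (χ : RSpace m → ℝ)
    (q : RSpace m × RSpace m × RSpace n) : ℂ :=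
  (χ q.1 : ℂ) * (Zx φ q.2.1 q.2.2).det

namespace IsAdmissible

/-- The point x is treated as a further parameter besides t: the integral is the bracket of a smooth
family over ℝᵐ × W with a smooth kernel, which is differentiable in (x,t). -/
lemma continuousOn_inversionIntegral (hφ : IsAdmissible φ V W) (hm : 0 < m)
    (hu : IsSmoothCompactFamily W u) {ε : ℝ} (hε : 0 < ε) :
    ContinuousOn (fun p : RSpace m × RSpace n => inversionIntegral φ u ε p.1 p.2)
      ((univ : Set (RSpace m)) ×ˢ (W : Set (RSpace n))) := by
  have hΩ := isOpen_domain (m := m) W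
  have hu' : IsSmoothCompactFamilyOn ((univ : Set (RSpace m)) ×ˢ (W : Set (RSpace n)))
      (fun p : RSpace m × RSpace n => u p.2) := fun f =>
    (hu f).comp (f := fun p : RSpace m × RSpace n => p.2) (by fun_prop) fun p hp => hp.2
  have hf : ContDiffOn ℝ ∞ (fun q : RSpace m × RSpace m × RSpace n =>
      kern ε (Z φ q.2.1 q.2.2 - Z φ q.1 q.2.2) * (Zx φ q.1 q.2.2).det)
      ((V : Set (RSpace m)) ×ˢ ((univ : Set (RSpace m)) ×ˢ (W : Set (RSpace n)))) := by
    have h1 : ContDiffOn ℝ ∞ (fun q : RSpace m × RSpace m × RSpace n => Z φ q.2.1 q.2.2 - Z φ q.1 q.2.2)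
        ((V : Set (RSpace m)) ×ˢ ((univ : Set (RSpace m)) ×ˢ (W : Set (RSpace n)))) :=
      (hφ.contDiffOn_Z.comp (f := fun q : RSpace m × RSpace m × RSpace n => q.2) (by fun_prop)
        fun q hq => hq.2).sub
      (hφ.contDiffOn_Z.comp (f := fun q : RSpace m × RSpace m × RSpace n => (q.1, q.2.2)) (by fun_prop)
        fun q hq => ⟨mem_univ _, hq.2.2⟩)
    exact (((differentiable_kern hm hε).contDiff_of_finiteDimensional.restrict_scalars ℝ).comp_contDiffOn h1).mul
      (hφ.contDiffOn_det.comp (f := fun q : RSpace m × RSpace m × RSpace n => (q.1, q.2.2)) (by fun_prop)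
        fun q hq => ⟨mem_univ _, hq.2.2⟩)
  have h2 : ContinuousOn (pairing (fun p : RSpace m × RSpace n => u p.2)
      (fun q : RSpace m × RSpace m × RSpace n =>
        kern ε (Z φ q.2.1 q.2.2 - Z φ q.1 q.2.2) * (Zx φ q.1 q.2.2).det))
      ((univ : Set (RSpace m)) ×ˢ (W : Set (RSpace n))) := fun p hp =>
    (hu'.hasFDerivAt_pairing hΩ hf hp).1.continuousAt.continuousWithinAt
  exact h2.congr fun p hp => (hφ.inversionIntegral_eq hm u hp.2 hε p.1).2

/-- Fubini for the bracket in y and the integral in x, again because the kernel is entire in the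
second point. This moves the test function to the side of the kernel. -/
lemma integral_mul_inversionIntegral (hφ : IsAdmissible φ V W) (hm : 0 < m) {χ : RSpace m → ℝ}
    (hχ : Continuous χ) (hχc : HasCompactSupport χ) {t : RSpace n} (ht : t ∈ W) {ε : ℝ} (hε : 0 < ε) :
    ∫ x, (χ x : ℂ) * inversionIntegral φ u ε x t = pairing u (kernInt φ ε (testCoeff φ χ)) t := by
  have hk := differentiable_kern (m := m) hm hε
  have hZc := (hφ.contDiff_Z ht).continuous
  have hkt : ∀ x, Differentiable ℂ fun b => kern ε (Z φ x t - b) := fun x =>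
    hk.comp ((differentiable_const _).sub differentiable_id)
  obtain ⟨-, -, h⟩ := (u t).pair_integral (μ := volume) (hφ.contDiff_Z ht) (hφ.contDiff_det ht)
    (Φ := fun x b => (χ x : ℂ) * kern ε (Z φ x t - b)) (s := univ)
    (fun x => (hkt x).const_mul _) MeasurableSet.univ (Eventually.of_forall fun _ => mem_univ _)
    (by
      refine Continuous.continuousOn ?_
      have h1 : Continuous fun p : RSpace m × CSpace m => Z φ p.1 t - p.2 :=
        (hZc.comp continuous_fst).sub continuous_snd
      exact (Complex.continuous_ofReal.comp (hχ.comp continuous_fst)).mul (hk.continuous.comp h1))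
    (fun R => by
      obtain ⟨M₁, hM₁⟩ := hχc.isCompact.exists_bound_of_continuousOn hZc.continuousOn
      obtain ⟨M₂, hM₂⟩ := (isCompact_closedBall (0 : CSpace m) (M₁ + R)).exists_bound_of_continuousOn
        hk.continuous.continuousOn
      refine ⟨fun x => ‖χ x‖ * M₂, (hχ.norm.integrable_of_hasCompactSupport hχc.norm).mul_const _,
        fun x _ b hb => ?_⟩
      rw [norm_mul, Complex.norm_real]
      by_cases hx : x ∈ tsupport χ
      · refine mul_le_mul_of_nonneg_left (hM₂ _ ?_) (norm_nonneg _)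
        rw [mem_closedBall_zero_iff] at hb ⊢
        exact (norm_sub_le _ _).trans (add_le_add (hM₁ x hx) hb)
      · simp [image_eq_zero_of_notMem_tsupport hx])
  have e1 : ∀ x, (χ x : ℂ) * inversionIntegral φ u ε x t =
      (u t).pair fun y => (χ x : ℂ) * kern ε (Z φ x t - Z φ y t) * (Zx φ y t).det := fun x => by
    have hsm : ContDiffOn ℝ ∞ (fun y => kern ε (Z φ x t - Z φ y t) * (Zx φ y t).det) V :=
      (contDiff_comp_mul (hφ.contDiff_Z ht) (hφ.contDiff_det ht) (hkt x)).contDiffOn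
    rw [(hφ.inversionIntegral_eq hm u ht hε x).2, ← (u t).pair_const_mul _ hsm]
    simp only [mul_assoc]
  simp only [e1]
  rw [h, pairing]
  congr 1
  funext y
  rw [kernInt, ← integral_mul_const]
  refine integral_congr_ae (Eventually.of_forall fun x => ?_)
  simp only [testCoeff, diffZ]
  ring

lemma isBddFamily_testCoeff (hφ : IsAdmissible φ V W) {B : Set 𝓓(V, ℝ)} (hB : IsCompact B) :
    IsBddFamily (triples m W) (fun χ : B => testCoeff φ χ.1) := by
  have h1 : IsBddFamily (triples m W) (fun (χ : B) (q : RSpace m × RSpace m × RSpace n) => (χ.1 q.1 : ℂ)) := by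
    have hs : ∀ χ : B, ContDiff ℝ ∞ fun x => (χ.1 x : ℂ) := fun χ =>
      CompactDistribution.contDiff_ofReal_test χ.1
    refine ⟨fun χ => ((hs χ).comp contDiff_fst).contDiffOn, fun j K _ _ => ?_⟩
    obtain ⟨M, hM0, hM⟩ := exists_norm_iteratedFDeriv_le_of_isCompact j hB
    refine ⟨M, hM0, fun χ q _ => ?_⟩
    have h2 := (ContinuousLinearMap.fst ℝ (RSpace m) (RSpace m × RSpace n)).iteratedFDeriv_comp_right
      (hs χ) q (i := j) (by exact_mod_cast le_top)
    have h3 : ((fun x => (χ.1 x : ℂ)) ∘ ContinuousLinearMap.fst ℝ (RSpace m) (RSpace m × RSpace n)) =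
      fun q : RSpace m × RSpace m × RSpace n => (χ.1 q.1 : ℂ) := rfl
    rw [h3] at h2
    rw [h2]
    refine (ContinuousMultilinearMap.norm_compContinuousLinearMap_le _ _).trans ?_
    rw [Finset.prod_const]
    refine (mul_le_of_le_one_right (norm_nonneg _)
      (pow_le_one₀ (norm_nonneg _) (ContinuousLinearMap.norm_fst_le ℝ _ _))).trans ?_
    have h4 : ‖iteratedFDeriv ℝ j (fun x => (χ.1 x : ℂ)) q.1‖ = ‖iteratedFDeriv ℝ j χ.1 q.1‖ :=
      Complex.ofRealLI.norm_iteratedFDeriv_comp_left (n := ∞) (i := j)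
        χ.1.contDiff.contDiffAt (by exact_mod_cast le_top)
    exact h4.le.trans (hM χ.1 χ.2 q.1)
  exact h1.mul isOpen_triples (IsBddFamily.of_const isOpen_triples
    (hφ.contDiffOn_det.comp (f := fun q : RSpace m × RSpace m × RSpace n => q.2) (by fun_prop)
      fun q hq => hq.2))

theorem convFamily_pairing_kernInt (hφ : IsAdmissible φ V W) (hm : 0 < m)
    (hu : IsSmoothCompactFamily W u) {B : Set 𝓓(V, ℝ)} (hB : IsCompact B) :
    ConvFamily (W : Set (RSpace n)) (fun ε (χ : B) => pairing u (kernInt φ ε (testCoeff φ χ.1)))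
      (fun χ => pairing u fun p => testCoeff φ χ.1 (p.1, p) / (Zx φ p.1 p.2).det) := by
  obtain ⟨L, hL, hLV, h0⟩ := exists_common_support_of_isCompact hB
  have hg := hφ.isBddFamily_testCoeff hB
  obtain ⟨h1, h2⟩ := hφ.tendstoUniformlyOn_iteratedFDeriv_kernInt hm hL hLV hg
    (fun χ x hx p => by simp [testCoeff, h0 χ.1 χ.2 x hx])
  refine ConvFamily.pairing (V := V) W.isOpen hu ⟨h1, fun χ => ?_, h2⟩
  have hsub : (V : Set (RSpace m)) ×ˢ (W : Set (RSpace n)) ⊆ univ ×ˢ (W : Set (RSpace n)) :=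
    prod_mono (subset_univ _) le_rfl
  have hnum : ContDiffOn ℝ ∞ (fun p : RSpace m × RSpace n => testCoeff φ χ.1 (p.1, p))
      ((V : Set (RSpace m)) ×ˢ (W : Set (RSpace n))) :=
    (hg.contDiffOn χ).comp (f := fun p : RSpace m × RSpace n => (p.1, p)) (by fun_prop)
      fun p hp => ⟨mem_univ _, mem_univ _, hp.2⟩
  have hinv : ContDiffOn ℝ ∞ (fun p : RSpace m × RSpace n => ((Zx φ p.1 p.2).det)⁻¹)
      ((V : Set (RSpace m)) ×ˢ (W : Set (RSpace n))) :=
    (hφ.contDiffOn_det.mono hsub).inv fun p hp => hφ.det_Zx_ne_zero hp.2 p.1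
  simpa only [div_eq_mul_inv] using hnum.mul hinv

lemma regularDistribution_apply (hφ : IsAdmissible φ V W) (hm : 0 < m)
    (hu : IsSmoothCompactFamily W u) {ε : ℝ} (hε : 0 < ε) {t : RSpace n} (ht : t ∈ W) (χ : 𝓓(V, ℝ)) :
    regularDistribution V (fun x => inversionIntegral φ u ε x t) χ =
      pairing u (kernInt φ ε (testCoeff φ χ)) t := by
  have hc : ContinuousOn (fun x => inversionIntegral φ u ε x t) V :=
    (hφ.continuousOn_inversionIntegral hm hu hε).comp (f := fun x : RSpace m => (x, t)) (by fun_prop)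
      fun x _ => ⟨mem_univ _, ht⟩
  have hloc : LocallyIntegrableOn (fun x => inversionIntegral φ u ε x t) (V : Set (RSpace m)) :=
    hc.locallyIntegrableOn V.isOpen.measurableSet
  rw [← hφ.integral_mul_inversionIntegral hm χ.continuous χ.hasCompactSupport ht hε]
  refine (TestFunction.integralAgainstBilinCLM_eq_integral hloc).trans ?_
  refine integral_congr_ae (Eventually.of_forall fun x => ?_)
  simp

/-- On the diagonal the factor det Z_x of the coefficient cancels the determinant in the limit of
the regularized integrals, leaving χ. -/
lemma toDistribution_apply (hφ : IsAdmissible φ V W) {t : RSpace n} (ht : t ∈ W) (χ : 𝓓(V, ℝ)) :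
    (u t).toDistribution χ = pairing u (fun p => testCoeff φ χ (p.1, p) / (Zx φ p.1 p.2).det) t := by
  have h : (fun y => testCoeff φ χ (y, (y, t)) / (Zx φ y t).det) = fun y => (χ y : ℂ) := by
    funext y
    exact mul_div_cancel_right₀ _ (hφ.det_Zx_ne_zero ht y)
  rw [pairing, h]
  rfl

end IsAdmissible

end Inversion

end FBI
end

theorem mainTheorem3 {m n : ℕ} (hm : 0 < m)
    (V : TopologicalSpace.Opens (FBI.RSpace m)) (W : TopologicalSpace.Opens (FBI.RSpace n))
    (φ : FBI.RSpace m → FBI.RSpace n → FBI.RSpace m) (hφ : FBI.IsAdmissible φ V W)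
    (u : FBI.RSpace n → FBI.CompactDistribution V) (hu : FBI.IsSmoothCompactFamily W u) :
    (∀ ε : ℝ, 0 < ε →
      (∀ x ∈ V, ∀ t ∈ W, MeasureTheory.Integrable (FBI.inversionIntegrand φ u ε x t)) ∧
      ContinuousOn (fun p : FBI.RSpace m × FBI.RSpace n => FBI.inversionIntegral φ u ε p.1 p.2)
        ((V : Set (FBI.RSpace m)) ×ˢ (W : Set (FBI.RSpace n))) ∧
      FBI.IsSmoothFamily W
        (fun t => FBI.regularDistribution V (fun x => FBI.inversionIntegral φ u ε x t))) ∧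
    FBI.TendstoInSmoothFamilies W
      (fun ε t => FBI.regularDistribution V (fun x => FBI.inversionIntegral φ u ε x t))
      (nhdsWithin 0 (Set.Ioi 0)) (fun t => (u t).toDistribution) := by
  refine ⟨fun ε hε => ⟨fun x _ t ht => (hφ.inversionIntegral_eq hm u ht hε x).1,
    (hφ.continuousOn_inversionIntegral hm hu hε).mono (Set.prod_mono (Set.subset_univ _) le_rfl),
    fun χ => ?_⟩, fun k K hK hKW B hB => ?_⟩
  -- Smoothness for a single test function is the case of the compact set {χ}.
  · exact ((hφ.convFamily_pairing_kernInt hm hu (isCompact_singleton (x := χ))).contDiffOn ε hε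
      ⟨χ, rfl⟩).congr fun t ht => hφ.regularDistribution_apply hm hu hε ht χ
  · have h := Metric.tendstoUniformlyOn_iff.1 ((hφ.convFamily_pairing_kernInt hm hu hB).conv k K hKW hK)
    rw [Metric.tendstoUniformlyOn_iff]
    intro η hη
    filter_upwards [h η hη, self_mem_nhdsWithin] with ε hε hε0 p hp
    have hp1 : (W : Set (FBI.RSpace n)) ∈ nhds p.1 := W.isOpen.mem_nhds (hKW hp.1)
    -- The identification with brackets holds only for t in W, which is open, so it passes to the
    -- iterated derivatives through germs.
    have e1 := Filter.EventuallyEq.iteratedFDeriv ℝ (Filter.eventuallyEq_of_mem hp1 fun t ht =>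
      hφ.regularDistribution_apply hm hu hε0 ht p.2) k
    have e2 := Filter.EventuallyEq.iteratedFDeriv ℝ (Filter.eventuallyEq_of_mem hp1 fun t ht =>
      hφ.toDistribution_apply (u := u) ht p.2) k
    rw [e1.eq_of_nhds, e2.eq_of_nhds]
    exact hε (⟨p.2, hp.2⟩, p.1) ⟨Set.mem_univ _, hp.1⟩
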